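/- Let $S$ be a scheme, let $\mathrm{Sch}_S$ be the big fppf site of $S$-schemes, let $\mathbf{G}$ be a sheaf of groups on $\mathrm{Sch}_S$, and let $d\ge 0$ be an integer. Torsors are sheaf torsors for the fppf topology, with $\mathbf{G}$ acting on the right, and for an $S$-scheme $X$ the set $H^1(X,\mathbf{G}|_X)$ is the set of isomorphism classes of $\mathbf{G}|_X$-torsors on $\mathrm{Sch}_X$. A finite étale cover of degree $d$ is a finite étale morphism of constant rank $d$. Let $\mathbb{S}_d$ be the constant group sheaf of the symmetric group on $d$ letters, and let $\mathbf{G}^d\rtimes\mathbb{S}_d$ be the semidirect product in which $\sigma$ acts on $\mathbf{G}^d$ by $(\sigma\cdot n)_i=n_{\sigma^{-1}(i)}$, i.e. $(g_1,\dots,g_d)\,\sigma=\sigma\,(g_{\sigma(1)},\dots,g_{\sigma(d)})$. Let $\mathfrak{F}(\mathbf{G})^{d\text{-ét}}$ be the category over $\mathrm{Sch}_S$ whose objects are pairs $(T\to X,\mathcal{P})$, with $X\in\mathrm{Sch}_S$, $T\to X$ a finite étale cover of degree $d$ and $\mathcal{P}$ a $\mathbf{G}|_T$-torsor, and whose morphisms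 $(T'\to X',\mathcal{P}')\to(T\to X,\mathcal{P})$ are triples $(f,g,\varphi)$ where $f\colon X'\to X$ and $g\colon T'\to T$ are $S$-morphisms forming a pullback square with the structure morphisms $T'\to X'$, $T\to X$, and $\varphi\colon\mathcal{P}'\cong g^*\mathcal{P}$ is an isomorphism of torsors; composition is $(f,g,\varphi)\circ(h,j,\psi)=(f\circ h,\,g\circ j,\,j^*(\varphi)\circ\psi)$, and the structure functor is $(T\to X,\mathcal{P})\mapsto X$. Let $\mathfrak{Tors}(\mathbf{G}^d\rtimes\mathbb{S}_d)$ be the category of pairs $(X,\mathcal{Q})$, with $X\in\mathrm{Sch}_S$ and $\mathcal{Q}$ a $(\mathbf{G}^d\rtimes\mathbb{S}_d)|_X$-torsor, whose morphisms $(X',\mathcal{Q}')\to(X,\mathcal{Q})$ are pairs of an $S$-morphism $f\colon X'\to X$ and an isomorphism of torsors $\mathcal{Q}'\cong f^*\mathcal{Q}$. Then the following hold. 1. $\mathfrak{F}(\mathbf{G})^{d\text{-ét}}$ and $\mathfrak{Tors}(\mathbf{G}^d\rtimes\mathbb{S}_d)$ are gerbes over $\mathrm{Sch}_S$: stacks fibered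 in groupoids, locally non-empty, any two objects of a fiber being locally isomorphic. 2. For $Z\in\mathrm{Sch}_S$, let $s_Z=(Z^{\sqcup d}\to Z,\mathbf{G}|_{Z^{\sqcup d}})$ be the split object. There are group isomorphisms $(\mathbf{G}^d\rtimes\mathbb{S}_d)(Z)\cong\operatorname{Aut}(s_Z)$, compatible with base change in $Z$, sending $(n,\sigma)$ to $(\mathrm{id},g,\varphi)$ with $g$ mapping the $i$-th copy of $Z$ to the $\sigma(i)$-th copy and $\varphi(1)$ equal to $n_{\sigma(i)}$ on the $i$-th copy (locally on $Z$, where $\sigma$ is constant). Through these, for $x=(T\to X,\mathcal{P})$ the sheaf $\mathcal{I}som(s_X,x)\colon Y\mapsto\operatorname{Isom}(s_Y,x|_Y)$ on $\mathrm{Sch}_X$ is a $(\mathbf{G}^d\rtimes\mathbb{S}_d)|_X$-torsor, acted on by composition, and the functor $$\mathfrak{F}(\mathbf{G})^{d\text{-ét}}\to\mathfrak{Tors}(\mathbf{G}^d\rtimes\mathbb{S}_d),\qquad x\mapsto \mathcal{I}som(s_X,x),$$ which acts on morphisms by composition, is an equivalence of gerbes: it commutes with the structure functors to $\mathrm{Sch}_S$,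 preserves cartesian morphisms, and is an equivalence on every fiber. 3. Sending a finite étale cover $T\to S$ of degree $d$ to the class $[T]$ of the $\mathbb{S}_d$-torsor $Y\mapsto\operatorname{Isom}_Y(Y^{\sqcup d},T\times_S Y)$ induces a bijection from the set of $S$-isomorphism classes of finite étale covers of $S$ of degree $d$ to $H^1(S,\mathbb{S}_d)$. For every choice of a representative $T$ of each class $[T]\in H^1(S,\mathbb{S}_d)$ there is a bijection $$H^1(S,\mathbf{G}^d\rtimes\mathbb{S}_d)\;\xrightarrow{\ \sim\ }\;\bigsqcup_{[T]\in H^1(S,\mathbb{S}_d)}H^1(T,\mathbf{G}|_T)/\operatorname{Aut}_S(T),$$ where $\operatorname{Aut}_S(T)$ acts on $H^1(T,\mathbf{G}|_T)$ by base change, and which sends the class of $\mathcal{I}som(s_S,(T\to S,\mathcal{P}))$ to the orbit of $[\mathcal{P}]$ in the component of $[T]$. -/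

import Mathlib

open CategoryTheory Limits Opposite

namespace TorsorGerbe

section Torsors

universe w v₁ u₁

variable {C : Type u₁} [Category.{v₁} C] {J : GrothendieckTopology C}

/-- A right `G|_X`-torsor on the site `C/X`, for a sheaf of groups `G` on `C` and an object `X`
of `C`.  The restriction `G|_X` is `Y ↦ G Y.left`. -/
structure Torsor (G : Sheaf J GrpCat.{w}) (X : C) where
  /-- the underlying sheaf of sets on `C/X` -/
  val : (Over X)ᵒᵖ ⥤ Type w
  isSheaf : Presheaf.IsSheaf (J.over X) val
  /-- the right action -/
  act {Y : Over X} : val.obj (op Y) → G.obj.obj (op Y.left) → val.obj (op Y)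
  act_one {Y : Over X} (s : val.obj (op Y)) : act s 1 = s
  act_mul {Y : Over X} (s : val.obj (op Y)) (g h : G.obj.obj (op Y.left)) :
    act s (g * h) = act (act s g) h
  map_act {Y Y' : Over X} (k : Y' ⟶ Y) (s : val.obj (op Y)) (g : G.obj.obj (op Y.left)) :
    val.map k.op (act s g) = act (val.map k.op s) (G.obj.map k.left.op g)
  existsUnique_act {Y : Over X} (s t : val.obj (op Y)) :
    ∃! g : G.obj.obj (op Y.left), act s g = t
  /-- there is a covering of `X` over whose members the torsor has sections -/
  locally_nonempty : ∃ R ∈ J X, ∀ ⦃Y : C⦄ (f : Y ⟶ X), R f → Nonempty (val.obj (op (Over.mk f)))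

namespace Torsor

variable {G : Sheaf J GrpCat.{w}} {X : C}

/-- A morphism of `G|_X`-torsors: an equivariant morphism of sheaves. -/
@[ext]
structure Hom (P Q : Torsor G X) where
  hom : P.val ⟶ Q.val
  hom_act {Y : Over X} (s : P.val.obj (op Y)) (g : G.obj.obj (op Y.left)) :
    hom.app (op Y) (P.act s g) = Q.act (hom.app (op Y) s) g

instance : Category (Torsor G X) where
  Hom := Hom
  id P := { hom := 𝟙 _, hom_act := fun _ _ => rfl }
  comp α β :=
    { hom := α.hom ≫ β.hom
      hom_act := fun s g => by
        simp only [NatTrans.comp_app, types_comp_apply, α.hom_act, β.hom_act] }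

@[ext]
lemma hom_ext {P Q : Torsor G X} {α β : P ⟶ Q} (h : α.hom = β.hom) : α = β := Hom.ext h

@[simp] lemma id_hom (P : Torsor G X) : (𝟙 P : P ⟶ P).hom = 𝟙 _ := rfl
@[simp] lemma comp_hom {P Q R : Torsor G X} (α : P ⟶ Q) (β : Q ⟶ R) :
    (α ≫ β).hom = α.hom ≫ β.hom := rfl

/-- The trivial torsor: `G|_X` acting on itself by right multiplication. -/
def trivial (G : Sheaf J GrpCat.{w}) (X : C) : Torsor G X where
  val := (Over.forget X).op ⋙ G.obj ⋙ CategoryTheory.forget GrpCat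
  isSheaf := Functor.op_comp_isSheaf (Over.forget X) (J.over X) J
    ⟨G.obj ⋙ CategoryTheory.forget GrpCat,
      GrothendieckTopology.HasSheafCompose.isSheaf _ G.property⟩
  act {Y} s g := (show G.obj.obj (op Y.left) from s) * g
  act_one s := mul_one (show G.obj.obj _ from s)
  act_mul s g h := (mul_assoc (show G.obj.obj _ from s) g h).symm
  map_act k s g := map_mul (G.obj.map k.left.op).hom (show G.obj.obj _ from s) g
  existsUnique_act {Y} s t :=
    ⟨(show G.obj.obj (op Y.left) from s)⁻¹ * (show G.obj.obj (op Y.left) from t),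
      mul_inv_cancel_left (show G.obj.obj (op Y.left) from s) _,
      fun _ h => eq_inv_mul_of_mul_eq h⟩
  locally_nonempty := ⟨⊤, J.top_mem X, fun Y _ _ => ⟨(1 : G.obj.obj (op Y))⟩⟩

/-- The restriction (pullback) `g^*P = P|_{X'}` of a torsor along `g : X' ⟶ X`. -/
def res {X' : C} (g : X' ⟶ X) : Torsor G X ⥤ Torsor G X' where
  obj P :=
    { val := (Over.map g).op ⋙ P.val
      isSheaf := Functor.op_comp_isSheaf (Over.map g) (J.over X') (J.over X) ⟨P.val, P.isSheaf⟩
      act := fun {Y} s a => P.act (Y := (Over.map g).obj Y) s a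
      act_one := fun {Y} s => P.act_one (Y := (Over.map g).obj Y) s
      act_mul := fun {Y} s a b => P.act_mul (Y := (Over.map g).obj Y) s a b
      map_act := fun k s a => P.map_act ((Over.map g).map k) s a
      existsUnique_act := fun {Y} s t => P.existsUnique_act (Y := (Over.map g).obj Y) s t
      locally_nonempty := by
        obtain ⟨R, hR, h⟩ := P.locally_nonempty
        exact ⟨R.pullback g, J.pullback_stable g hR, fun Y f hf => h (f ≫ g) hf⟩ }
  map α :=
    { hom := Functor.whiskerLeft (Over.map g).op α.hom
      hom_act := fun {Y} s a => α.hom_act (Y := (Over.map g).obj Y) s a }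

lemma map_map_eq_self (F : (Over X)ᵒᵖ ⥤ Type w) {Y Y' : Over X} (a : Y ⟶ Y') (b : Y' ⟶ Y)
    (h : a ≫ b = 𝟙 Y) (s : F.obj (op Y)) : F.map a.op (F.map b.op s) = s := by
  rw [← types_comp_apply (F.map b.op), ← F.map_comp, ← op_comp, h]
  simp

/-- The canonical isomorphism `P|_{X''} ≅ (P|_{X'})|_{X''}`. -/
def resComp {X' X'' : C} (h : X'' ⟶ X') (g : X' ⟶ X) (P : Torsor G X) :
    (res h).obj ((res g).obj P) ≅ (res (h ≫ g)).obj P where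
  hom :=
    { hom := Functor.whiskerRight (NatTrans.op (Over.mapComp h g).hom) P.val
      hom_act := fun {Y} s a => by
        have := P.map_act ((Over.mapComp h g).hom.app Y) s a
        simpa using! this }
  inv :=
    { hom := Functor.whiskerRight (NatTrans.op (Over.mapComp h g).inv) P.val
      hom_act := fun {Y} s a => by
        have := P.map_act ((Over.mapComp h g).inv.app Y) s a
        simpa using! this }
  hom_inv_id := by
    apply hom_ext
    ext Y s
    exact map_map_eq_self P.val _ _ ((Over.mapComp h g).inv_hom_id_app Y.unop) s
  inv_hom_id := by
    apply hom_ext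
    ext Y s
    exact map_map_eq_self P.val _ _ ((Over.mapComp h g).hom_inv_id_app Y.unop) s


/-- The canonical isomorphism `P ≅ P|_X`. -/
def resId (P : Torsor G X) : P ≅ (res (𝟙 X)).obj P where
  hom :=
    { hom := Functor.whiskerRight (NatTrans.op (Over.mapId X).hom) P.val
      hom_act := fun {Y} s a => by
        have := P.map_act ((Over.mapId X).hom.app Y) s a
        simpa using! this }
  inv :=
    { hom := Functor.whiskerRight (NatTrans.op (Over.mapId X).inv) P.val
      hom_act := fun {Y} s a => by
        have := P.map_act ((Over.mapId X).inv.app Y) s a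
        simpa using! this }
  hom_inv_id := by
    apply hom_ext
    ext Y s
    exact map_map_eq_self P.val _ _ ((Over.mapId X).inv_hom_id_app Y.unop) s
  inv_hom_id := by
    apply hom_ext
    ext Y s
    exact map_map_eq_self P.val _ _ ((Over.mapId X).hom_inv_id_app Y.unop) s

end Torsor

/-- The category of pairs `(X, P)` with `P` a `G|_X`-torsor. -/
structure Tors (G : Sheaf J GrpCat.{w}) where
  base : C
  torsor : Torsor G base

namespace Tors

variable {G : Sheaf J GrpCat.{w}}

/-- A morphism `(X', P') ⟶ (X, P)` is a pair `(g, φ)` with `g : X' ⟶ X` and `φ : P' ≅ g^*P`. -/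
structure Hom (A B : Tors G) where
  base : A.base ⟶ B.base
  iso : A.torsor ≅ (Torsor.res base).obj B.torsor

/-- The value on sections over `y : Y ⟶ X'` of the torsor isomorphism of `(g, φ)`. -/
def Hom.ap {A B : Tors G} (u : Hom A B) {Y : C} (y : Y ⟶ A.base)
    (s : A.torsor.val.obj (op (Over.mk y))) : B.torsor.val.obj (op (Over.mk (y ≫ u.base))) :=
  u.iso.hom.hom.app (op (Over.mk y)) s

/-- Transport of sections along an equality of structure morphisms. -/
def cast {B : Tors G} {Y : C} {y y' : Y ⟶ B.base} (h : y = y')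
    (s : B.torsor.val.obj (op (Over.mk y))) : B.torsor.val.obj (op (Over.mk y')) :=
  B.torsor.val.map (Over.homMk (𝟙 Y) (by simp [h]) : Over.mk y' ⟶ Over.mk y).op s

lemma cast_rfl {B : Tors G} {Y : C} {y : Y ⟶ B.base} (h : y = y)
    (s : B.torsor.val.obj (op (Over.mk y))) : cast h s = s := by
  have : (Over.homMk (𝟙 Y) (by simp) : Over.mk y ⟶ Over.mk y) = 𝟙 _ := by ext; simp
  simp [cast, this]

lemma Hom.ext_ap {A B : Tors G} {u v : Hom A B} (h : u.base = v.base)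
    (h' : ∀ {Y : C} (y : Y ⟶ A.base) (s : A.torsor.val.obj (op (Over.mk y))),
      cast (by rw [h]) (u.ap y s) = v.ap y s) : u = v := by
  obtain ⟨b, i⟩ := u
  obtain ⟨b', i'⟩ := v
  obtain rfl : b = b' := h
  congr 1
  ext Y s
  have := h' Y.unop.hom s
  rw [cast_rfl] at this
  exact this

lemma cast_cast {B : Tors G} {Y : C} {y y' y'' : Y ⟶ B.base} (h : y = y') (h' : y' = y'')
    (s : B.torsor.val.obj (op (Over.mk y))) : cast h' (cast h s) = cast (h.trans h') s := by
  subst h h'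
  rw [cast_rfl]

lemma Hom.ap_cast {A B : Tors G} (u : Hom A B) {Y : C} {y y' : Y ⟶ A.base} (h : y = y')
    (s : A.torsor.val.obj (op (Over.mk y))) :
    u.ap y' (cast h s) = cast (by rw [h]) (u.ap y s) := by
  subst h
  rw [cast_rfl, cast_rfl]

/-- The identity of `(X, P)`. -/
def Hom.id (A : Tors G) : Hom A A := { base := 𝟙 _, iso := A.torsor.resId }

/-- Composition: `(g, φ) ∘ (h, ψ) = (g ∘ h, h^*(φ) ∘ ψ)`. -/
def Hom.comp {A B D : Tors G} (u : Hom A B) (v : Hom B D) : Hom A D where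
  base := u.base ≫ v.base
  iso := u.iso ≪≫ (Torsor.res u.base).mapIso v.iso ≪≫ Torsor.resComp _ _ _

lemma Hom.ap_id (A : Tors G) {Y : C} (y : Y ⟶ A.base) (s : A.torsor.val.obj (op (Over.mk y))) :
    (Hom.id A).ap y s = cast (Category.comp_id y).symm s := rfl

lemma Hom.ap_comp {A B D : Tors G} (u : Hom A B) (v : Hom B D) {Y : C} (y : Y ⟶ A.base)
    (s : A.torsor.val.obj (op (Over.mk y))) :
    (u.comp v).ap y s = cast (Category.assoc _ _ _) (v.ap (y ≫ u.base) (u.ap y s)) := rfl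

lemma Hom.id_comp {A B : Tors G} (u : Hom A B) : (Hom.id A).comp u = u :=
  Hom.ext_ap (Category.id_comp u.base) (fun y s => by
    have h1 := u.ap_cast (Category.comp_id y).symm s
    refine (congrArg (cast _) ((Hom.ap_comp _ _ _ _).trans (congrArg (cast _) h1))).trans ?_
    refine (cast_cast _ _ _).trans ((cast_cast _ _ _).trans (cast_rfl _ _)))

lemma Hom.comp_id {A B : Tors G} (u : Hom A B) : u.comp (Hom.id B) = u :=
  Hom.ext_ap (Category.comp_id u.base) (fun {Y} y s => by
    have h1 : (u.comp (Hom.id B)).ap y s =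
        cast (Category.assoc y u.base (𝟙 B.base))
          (cast (Category.comp_id (y ≫ u.base)).symm (u.ap y s)) := rfl
    rw [h1, cast_cast]
    exact (cast_cast _ _ _).trans (cast_rfl _ _))

lemma Hom.assoc {A B D E : Tors G} (u : Hom A B) (v : Hom B D) (z : Hom D E) :
    (u.comp v).comp z = u.comp (v.comp z) :=
  Hom.ext_ap (Category.assoc _ _ _) (fun {Y} y s => by
    have h1 := z.ap_cast (Category.assoc y u.base v.base) (v.ap _ (u.ap y s))
    have h2 : ((u.comp v).comp z).ap y s = cast (Category.assoc y (u.base ≫ v.base) z.base)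
        (z.ap (y ≫ u.base ≫ v.base) (cast (Category.assoc y u.base v.base)
          (v.ap _ (u.ap y s)))) := rfl
    have h3 : (u.comp (v.comp z)).ap y s =
        cast (Category.assoc y u.base (v.base ≫ z.base)) (cast (Category.assoc _ v.base z.base)
          (z.ap ((y ≫ u.base) ≫ v.base) (v.ap _ (u.ap y s)))) := rfl
    rw [h2, h3, h1, cast_cast, cast_cast]
    exact cast_cast _ _ _)

instance : Category (Tors G) where
  Hom := Hom
  id := Hom.id
  comp := Hom.comp
  id_comp := Hom.id_comp
  comp_id := Hom.comp_id
  assoc := Hom.assoc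

/-- The structure functor `(X, P) ↦ X`. -/
def proj (G : Sheaf J GrpCat.{w}) : Tors G ⥤ C where
  obj A := A.base
  map u := u.base

end Tors

end Torsors

section FiberedCategories

universe v₁ v₂ v₃ u₁ u₂ u₃

variable {C : Type u₁} [Category.{v₁} C] {E : Type u₂} [Category.{v₂} E] {p : E ⥤ C}

/-- A chosen pullback `f^*x` in the fiber over `Y`, for `f : Y ⟶ X` and `x` in the fiber
over `X`. -/
noncomputable def pull [p.IsFibered] {X Y : C} (f : Y ⟶ X) (x : p.Fiber X) : p.Fiber Y :=
  ⟨Functor.IsPreFibered.pullbackObj x.2 f, Functor.IsPreFibered.pullbackObj_proj x.2 f⟩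

/-- The chosen cartesian morphism `f^*x ⟶ x`. -/
noncomputable def pullMap [p.IsFibered] {X Y : C} (f : Y ⟶ X) (x : p.Fiber X) :
    (pull f x).1 ⟶ x.1 :=
  Functor.IsPreFibered.pullbackMap x.2 f

instance pullMap_isCartesian [p.IsFibered] {X Y : C} (f : Y ⟶ X) (x : p.Fiber X) :
    p.IsCartesian f (pullMap f x) :=
  Functor.IsPreFibered.pullbackMap.IsCartesian x.2 f

instance fiberHom_isHomLift {X : C} {x x' : p.Fiber X} (φ : x ⟶ x') : p.IsHomLift (𝟙 X) φ.1 := φ.2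

/-- The canonical morphism `k^*x ⟶ f^*x` over `h`, where `k = f ∘ h`. -/
noncomputable def pullLift [p.IsFibered] {X Y Z : C} (h : Z ⟶ Y) (f : Y ⟶ X) (k : Z ⟶ X)
    (hk : k = h ≫ f) (x : p.Fiber X) : (pull k x).1 ⟶ (pull f x).1 :=
  Functor.IsStronglyCartesian.map p f (pullMap f x) hk (pullMap k x)

instance [p.IsFibered] {X Y Z : C} (h : Z ⟶ Y) (f : Y ⟶ X) (k : Z ⟶ X)
    (hk : k = h ≫ f) (x : p.Fiber X) : p.IsHomLift h (pullLift h f k hk x) := by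
  unfold pullLift; infer_instance

lemma pullLift_pullMap [p.IsFibered] {X Y Z : C} (h : Z ⟶ Y) (f : Y ⟶ X) (k : Z ⟶ X)
    (hk : k = h ≫ f) (x : p.Fiber X) : pullLift h f k hk x ≫ pullMap f x = pullMap k x :=
  Functor.IsStronglyCartesian.fac ..

lemma restrict_aux [p.IsFibered] {X X' Y Z : C} {f : Y ⟶ X} {f' : Y ⟶ X'} {x : p.Fiber X}
    {x' : p.Fiber X'} (φ : pull f x ⟶ pull f' x') (h : Z ⟶ Y) (k : Z ⟶ X) (k' : Z ⟶ X')
    (hk : k = h ≫ f) (hk' : k' = h ≫ f') :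
    p.IsHomLift k' (pullLift h f k hk x ≫ φ.1 ≫ pullMap f' x') := by
  subst hk'
  have : p.IsHomLift f' (φ.1 ≫ pullMap f' x') := inferInstance
  infer_instance

/-- The restriction `φ|_Z = h^*φ : (f h)^*x ⟶ (f' h)^*x'` of a morphism `φ : f^*x ⟶ f'^*x'` of
the fiber over `Y` along `h : Z ⟶ Y`: the unique morphism of the fiber over `Z` that is
compatible with `φ`. -/
noncomputable def restrict [p.IsFibered] {X X' Y Z : C} {f : Y ⟶ X} {f' : Y ⟶ X'}
    {x : p.Fiber X} {x' : p.Fiber X'} (φ : pull f x ⟶ pull f' x') (h : Z ⟶ Y) (k : Z ⟶ X)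
    (k' : Z ⟶ X') (hk : k = h ≫ f) (hk' : k' = h ≫ f') : pull k x ⟶ pull k' x' :=
  haveI := restrict_aux φ h k k' hk hk'
  ⟨Functor.IsCartesian.map p k' (pullMap k' x') (pullLift h f k hk x ≫ φ.1 ≫ pullMap f' x'),
    inferInstance⟩

lemma restrict_spec [p.IsFibered] {X X' Y Z : C} {f : Y ⟶ X} {f' : Y ⟶ X'}
    {x : p.Fiber X} {x' : p.Fiber X'} (φ : pull f x ⟶ pull f' x') (h : Z ⟶ Y) (k : Z ⟶ X)
    (k' : Z ⟶ X') (hk : k = h ≫ f) (hk' : k' = h ≫ f') :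
    (restrict φ h k k' hk hk').1 ≫ pullMap k' x' = pullLift h f k hk x ≫ φ.1 ≫ pullMap f' x' :=
  haveI := restrict_aux φ h k k' hk hk'
  Functor.IsCartesian.fac p k' (pullMap k' x') (pullLift h f k hk x ≫ φ.1 ≫ pullMap f' x')

lemma fiberHom_ext [p.IsFibered] {X Y : C} {f : Y ⟶ X} {y : p.Fiber Y} {x : p.Fiber X}
    {φ ψ : y ⟶ pull f x} (h : φ.1 ≫ pullMap f x = ψ.1 ≫ pullMap f x) : φ = ψ :=
  Subtype.ext (Functor.IsCartesian.ext p f (pullMap f x) φ.1 ψ.1 h)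

lemma restrict_pullLift [p.IsFibered] {X X' Y Z : C} {f : Y ⟶ X} {f' : Y ⟶ X'}
    {x : p.Fiber X} {x' : p.Fiber X'} (φ : pull f x ⟶ pull f' x') (h : Z ⟶ Y) (k : Z ⟶ X)
    (k' : Z ⟶ X') (hk : k = h ≫ f) (hk' : k' = h ≫ f') :
    (restrict φ h k k' hk hk').1 ≫ pullLift h f' k' hk' x' = pullLift h f k hk x ≫ φ.1 := by
  have i1 : p.IsHomLift h ((restrict φ h k k' hk hk').1 ≫ pullLift h f' k' hk' x') :=
    inferInstance
  have i2 : p.IsHomLift h (pullLift h f k hk x ≫ φ.1) := inferInstance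
  refine Functor.IsStronglyCartesian.ext p f' (pullMap f' x') h ?_
  rw [Category.assoc, pullLift_pullMap, restrict_spec, Category.assoc]

lemma pullLift_comp [p.IsFibered] {X Y Z Z' : C} (h : Z ⟶ Y) (h' : Z' ⟶ Z) (f : Y ⟶ X)
    (k : Z ⟶ X) (k' : Z' ⟶ X) (hk : k = h ≫ f) (hk' : k' = h' ≫ k) (x : p.Fiber X) :
    pullLift h' k k' hk' x ≫ pullLift h f k hk x =
      pullLift (h' ≫ h) f k' (by rw [hk', hk, Category.assoc]) x := by
  refine Functor.IsStronglyCartesian.ext p f (pullMap f x) (h' ≫ h) ?_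
  rw [Category.assoc, pullLift_pullMap, pullLift_pullMap, pullLift_pullMap]

lemma pullLift_id [p.IsFibered] {X Y : C} (f : Y ⟶ X) (hk : f = 𝟙 Y ≫ f) (x : p.Fiber X) :
    pullLift (𝟙 Y) f f hk x = 𝟙 _ := by
  have : p.IsHomLift (𝟙 Y) (𝟙 (pull f x).1) := IsHomLift.id (pull f x).2
  refine Functor.IsStronglyCartesian.ext p f (pullMap f x) (𝟙 Y) ?_
  rw [pullLift_pullMap, Category.id_comp]

lemma restrict_id [p.IsFibered] {X X' Y : C} {f : Y ⟶ X} {f' : Y ⟶ X'}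
    {x : p.Fiber X} {x' : p.Fiber X'} (φ : pull f x ⟶ pull f' x') (hk : f = 𝟙 Y ≫ f)
    (hk' : f' = 𝟙 Y ≫ f') : restrict φ (𝟙 Y) f f' hk hk' = φ := by
  refine fiberHom_ext ?_
  rw [restrict_spec, pullLift_id, Category.id_comp]

lemma restrict_restrict [p.IsFibered] {X X' Y Z W : C} {f : Y ⟶ X} {f' : Y ⟶ X'}
    {x : p.Fiber X} {x' : p.Fiber X'} (φ : pull f x ⟶ pull f' x') (h : Z ⟶ Y) (k : Z ⟶ X)
    (k' : Z ⟶ X') (hk : k = h ≫ f) (hk' : k' = h ≫ f') (l : W ⟶ Z) (m : W ⟶ X) (m' : W ⟶ X')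
    (hm : m = l ≫ k) (hm' : m' = l ≫ k') :
    restrict (restrict φ h k k' hk hk') l m m' hm hm' =
      restrict φ (l ≫ h) m m' (by rw [hm, hk, Category.assoc])
        (by rw [hm', hk', Category.assoc]) := by
  refine fiberHom_ext ?_
  rw [restrict_spec, restrict_spec, restrict_spec, ← pullLift_comp h l f k m hk hm,
    Category.assoc]

/-- The presheaf `Hom(x, x')` on `C/X`, `Y ↦ Hom_{E(Y)}(x|_Y, x'|_Y)`. -/
noncomputable def homPresheaf [p.IsFibered] {X : C} (x x' : p.Fiber X) :
    (Over X)ᵒᵖ ⥤ Type v₂ where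
  obj Y := pull Y.unop.hom x ⟶ pull Y.unop.hom x'
  map {Y Z} k := ↾fun φ => restrict φ k.unop.left Z.unop.hom Z.unop.hom (Over.w k.unop).symm
    (Over.w k.unop).symm
  map_id Y := by
    apply ConcreteCategory.hom_ext
    intro φ
    exact restrict_id φ (Category.id_comp _).symm (Category.id_comp _).symm
  map_comp {Y Z W} k l := by
    apply ConcreteCategory.hom_ext
    intro φ
    exact (restrict_restrict φ k.unop.left Z.unop.hom Z.unop.hom (Over.w k.unop).symm
      (Over.w k.unop).symm l.unop.left W.unop.hom W.unop.hom (Over.w l.unop).symm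
      (Over.w l.unop).symm).symm

/-- A stack over the site `(C, J)`. -/
class IsStack (p : E ⥤ C) (J : GrothendieckTopology C) [HasPullbacks C] : Prop
    extends p.IsFibered where
  /-- the presheaves `Hom(x, x')` are sheaves -/
  isSheaf_hom {X : C} (x x' : p.Fiber X) : Presheaf.IsSheaf (J.over X) (homPresheaf x x')
  /-- for a covering family `U i ⟶ X`, objects `x i` over `U i` with isomorphisms
  `ψ i j : (x i)|_{U i ×_X U j} ≅ (x j)|_{U i ×_X U j}` satisfying the cocycle condition on all
  triple fiber products come from an object over `X` -/
  descent {X : C} {ι : Type (max u₁ v₁)} (U : ι → C) (f : ∀ i, U i ⟶ X)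
    (hf : Sieve.ofArrows U f ∈ J X) (x : ∀ i, p.Fiber (U i))
    (ψ : ∀ i j, pull (pullback.fst (f i) (f j)) (x i) ≅ pull (pullback.snd (f i) (f j)) (x j))
    (cocycle : ∀ (i j k : ι) (Z : C) (a : Z ⟶ U i) (b : Z ⟶ U j) (c : Z ⟶ U k)
      (hab : a ≫ f i = b ≫ f j) (hbc : b ≫ f j = c ≫ f k),
      restrict (ψ i j).hom (pullback.lift a b hab) a b
          (pullback.lift_fst _ _ _).symm (pullback.lift_snd _ _ _).symm ≫
        restrict (ψ j k).hom (pullback.lift b c hbc) b c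
          (pullback.lift_fst _ _ _).symm (pullback.lift_snd _ _ _).symm =
      restrict (ψ i k).hom (pullback.lift a c (hab.trans hbc)) a c
          (pullback.lift_fst _ _ _).symm (pullback.lift_snd _ _ _).symm) :
    ∃ (y : p.Fiber X) (α : ∀ i, x i ≅ pull (f i) y), ∀ i j,
      (ψ i j).hom.1 ≫ pullMap (pullback.snd (f i) (f j)) (x j) ≫ (α j).hom.1 ≫ pullMap (f j) y =
        pullMap (pullback.fst (f i) (f j)) (x i) ≫ (α i).hom.1 ≫ pullMap (f i) y

/-- A gerbe over the site `(C, J)`. -/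
class IsGerbe (p : E ⥤ C) (J : GrothendieckTopology C) [HasPullbacks C] : Prop
    extends IsStack p J where
  isIso_fiberHom {X : C} {x x' : p.Fiber X} (φ : x ⟶ x') : IsIso φ
  locally_nonempty (X : C) :
    ∃ R ∈ J X, ∀ ⦃Y : C⦄ (f : Y ⟶ X), R f → Nonempty (p.Fiber Y)
  locally_iso {X : C} (x x' : p.Fiber X) :
    ∃ R ∈ J X, ∀ ⦃Y : C⦄ (f : Y ⟶ X), R f → Nonempty (pull f x ≅ pull f x')

/-- The functor `E(X) ⥤ E'(X)` induced on the fibers by a functor over `C`. -/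
def fiberFunctor {E' : Type u₃} [Category.{v₃} E'] {p' : E' ⥤ C} (Φ : E ⥤ E')
    (h : Φ ⋙ p' = p) (X : C) : p.Fiber X ⥤ p'.Fiber X :=
  Functor.Fiber.inducedFunctor (F := Functor.Fiber.fiberInclusion ⋙ Φ) (by
    rw [Functor.assoc, h, Functor.Fiber.fiberInclusion_comp_eq_const])

/-- `Φ` is a morphism of fibered categories over `C` and an equivalence on every fiber. -/
structure IsFiberedEquivalence {E' : Type u₃} [Category.{v₃} E'] (p : E ⥤ C) (p' : E' ⥤ C)
    (Φ : E ⥤ E') : Prop where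
  comp_eq : Φ ⋙ p' = p
  map_isCartesian {X Y : C} (f : X ⟶ Y) {a b : E} (φ : a ⟶ b) (hφ : p.IsStronglyCartesian f φ) :
    p'.IsStronglyCartesian f (Φ.map φ)
  isEquivalence (X : C) : (fiberFunctor Φ comp_eq X).IsEquivalence

end FiberedCategories

section CoverTors

universe w v₁ u₁

variable {C : Type u₁} [Category.{v₁} C] {J : GrothendieckTopology C}

/-- The objects of the fibered category of pairs `(T → X, P)` with `T → X` a morphism having the
property `Q` and `P` a `G|_T`-torsor. -/
structure CoverTors (G : Sheaf J GrpCat.{w}) (Q : MorphismProperty C) where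
  X : C
  /-- the pair `(T, P)` -/
  tors : Tors G
  π : tors.base ⟶ X
  hπ : Q π

namespace CoverTors

variable {G : Sheaf J GrpCat.{w}} {Q : MorphismProperty C}

/-- A morphism `(f, g, φ) : (T' → X', P') ⟶ (T → X, P)`: here `t = (g, φ)` with `g : T' ⟶ T` and
`φ : P' ≅ g^*P`, and `f`, `g` form a pullback square. -/
@[ext]
structure Hom (A B : CoverTors G Q) where
  f : A.X ⟶ B.X
  t : A.tors ⟶ B.tors
  isPullback : IsPullback t.base A.π B.π f

instance : Category (CoverTors G Q) where
  Hom := Hom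
  id A := { f := 𝟙 _, t := 𝟙 _, isPullback := IsPullback.id_horiz A.π }
  comp a b :=
    { f := a.f ≫ b.f
      t := a.t ≫ b.t
      isPullback := a.isPullback.paste_horiz b.isPullback }
  id_comp a := Hom.ext (Category.id_comp a.f) (Category.id_comp a.t)
  comp_id a := Hom.ext (Category.comp_id a.f) (Category.comp_id a.t)
  assoc a b c := Hom.ext (Category.assoc a.f b.f c.f) (Category.assoc a.t b.t c.t)

/-- The structure functor `(T → X, P) ↦ X`, `(f, g, φ) ↦ f`. -/
def proj (G : Sheaf J GrpCat.{w}) (Q : MorphismProperty C) : CoverTors G Q ⥤ C where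
  obj A := A.X
  map a := a.f

end CoverTors

/-- The morphism `(g, id) : (X', G|_{X'}) ⟶ (X, G|_X)` of trivial torsors over `g : X' ⟶ X`. -/
def Tors.trivialMap (G : Sheaf J GrpCat.{w}) {X' X : C} (g : X' ⟶ X) :
    (⟨X', Torsor.trivial G X'⟩ : Tors G) ⟶ ⟨X, Torsor.trivial G X⟩ where
  base := g
  iso :=
    { hom := { hom := 𝟙 _, hom_act := fun _ _ => rfl }
      inv := { hom := 𝟙 _, hom_act := fun _ _ => rfl }
      hom_inv_id := Torsor.hom_ext (Category.id_comp _)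
      inv_hom_id := Torsor.hom_ext (Category.id_comp _) }

end CoverTors

section H1

universe w v₁ u₁

variable {C : Type u₁} [Category.{v₁} C] {J : GrothendieckTopology C}

/-- `H^1(X, G|_X)`: the set of isomorphism classes of `G|_X`-torsors. -/
def H1 (G : Sheaf J GrpCat.{w}) (X : C) : Type _ := Quotient (isIsomorphicSetoid (Torsor G X))

/-- The class of a torsor. -/
def H1.mk {G : Sheaf J GrpCat.{w}} {X : C} (P : Torsor G X) : H1 G X := Quotient.mk _ P

/-- Base change `g^* : H^1(X, G|_X) → H^1(X', G|_{X'})`. -/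
def H1.res {G : Sheaf J GrpCat.{w}} {X X' : C} (g : X' ⟶ X) : H1 G X → H1 G X' :=
  Quotient.map (Torsor.res g).obj (fun _ _ ⟨i⟩ => ⟨(Torsor.res g).mapIso i⟩)

/-- The set of orbits of `Aut(X)` acting on `H^1(X, G|_X)` by base change. -/
def H1.Orbits (G : Sheaf J GrpCat.{w}) (X : C) : Type _ :=
  Quot (fun a b : H1 G X => ∃ g : Aut X, a = H1.res g.hom b)

end H1

section Schemes

universe u

open AlgebraicGeometry

/-- Finite étale morphisms of (constant) degree `d`. -/
def finEtale (d : ℕ) : MorphismProperty Scheme.{u} := fun _ X f =>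
  IsFinite f ∧ Etale f ∧ ∀ x : X, f.finrank x = d

/-- The fold morphism `X ⊔ ⋯ ⊔ X ⟶ X`. -/
noncomputable def schemeFold (d : ℕ) (X : Scheme.{u}) : (∐ fun _ : Fin d => X) ⟶ X :=
  Sigma.desc fun _ => 𝟙 X

lemma schemeFold_isPullback (d : ℕ) {X Y : Scheme.{u}} (g : X ⟶ Y) :
    IsPullback (Limits.Sigma.map fun _ : Fin d => g) (schemeFold d X) (schemeFold d Y) g := by
  have H := IsUniversalColimit.isPullback_of_isColimit_right
    (X := fun _ : Fin d => Y) (P := fun _ : Fin d => X)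
    (FinitaryPreExtensive.isUniversal_finiteCoproducts (coproductIsCoproduct _))
    (fun _ => 𝟙 Y) (schemeFold d Y) g (fun _ => g) (fun _ => 𝟙 X)
    (fun _ => (IsPullback.of_vert_isIso ⟨by rw [Category.comp_id, Category.id_comp]⟩ : IsPullback g (𝟙 X) (𝟙 Y) g)) (coproductIsCoproduct _)
    (fun i => by simp [schemeFold])
  convert! H using 1

lemma schemeFold_finEtale (d : ℕ) (X : Scheme.{u}) : finEtale d (schemeFold d X) := by
  let R := ULift.{u} ℤ
  have h1 : schemeFold d (Spec (.of R)) =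
      (Sigma.reindex (Equiv.ulift.{u} : _ ≃ Fin d) fun _ => Spec (.of R)).inv ≫
      sigmaSpec (fun _ : ULift.{u} (Fin d) => .of R) ≫
      Spec.map (CommRingCat.ofHom (algebraMap R (ULift.{u} (Fin d) → R))) := by
    rw [Iso.eq_inv_comp]
    refine Sigma.hom_ext _ _ fun i => ?_
    refine (Sigma.ι_reindex_hom_assoc _ _ _ _).trans ?_
    refine Eq.trans ?_ (ι_sigmaSpec_assoc (fun _ : ULift.{u} (Fin d) => .of R) i _).symm
    rw [← Spec.map_comp, schemeFold, Sigma.ι_desc]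
    exact (Spec.map_id _).symm
  have h2 : IsFinite (Spec.map (CommRingCat.ofHom (algebraMap R (ULift.{u} (Fin d) → R)))) := by
    rw [IsFinite.SpecMap_iff]
    exact RingHom.finite_algebraMap.2 inferInstance
  have h3 : Flat (Spec.map (CommRingCat.ofHom (algebraMap R (ULift.{u} (Fin d) → R)))) := by
    rw [Flat.SpecMap_iff]
    exact (RingHom.flat_algebraMap_iff).2 inferInstance
  have h4 : IsFinite (schemeFold d (Spec (.of R))) := by rw [h1]; infer_instance
  have h5 : Flat (schemeFold d (Spec (.of R))) := by rw [h1]; infer_instance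
  have h6 := schemeFold_isPullback d (specULiftZIsTerminal.from X)
  refine ⟨MorphismProperty.of_isPullback h6 h4, ?_, fun x => ?_⟩
  · have : IsZariskiLocalAtSource @Etale.{u} :=
      HasRingHomProperty.instIsZariskiLocalAtSource (Q := RingHom.Etale)
    exact IsZariskiLocalAtSource.sigmaDesc (P := @Etale) fun _ => inferInstance
  · rw [Scheme.Hom.finrank_of_isPullback _ _ _ _ h6, h1, Scheme.Hom.finrank_comp_left_of_isIso,
      Scheme.Hom.finrank_comp_left_of_isIso]
    refine (Scheme.Hom.finrank_SpecMap_algebraMap R (ULift.{u} (Fin d) → R) _).trans ?_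
    rw [Module.rankAtStalk_eq_finrank_of_free]
    rw [Module.finrank_fintype_fun_eq_card, Fintype.card_ulift, Fintype.card_fin]
    exact (Pi.natCast_apply _ _).trans (Nat.cast_id _)

variable {S : Scheme.{u}}

/-- The `S`-scheme `X ⊔ ⋯ ⊔ X` (`d` copies). -/
noncomputable def copies (d : ℕ) (X : Over S) : Over S :=
  Over.mk (schemeFold d X.left ≫ X.hom)

/-- The fold morphism `X ⊔ ⋯ ⊔ X ⟶ X` over `S`. -/
noncomputable def fold (d : ℕ) (X : Over S) : copies d X ⟶ X :=
  Over.homMk (schemeFold d X.left) rfl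

/-- The inclusion of the `i`-th copy of `X`. -/
noncomputable def inc (d : ℕ) (X : Over S) (i : Fin d) : X ⟶ copies d X :=
  Over.homMk (Sigma.ι (fun _ : Fin d => X.left) i) (by simp [copies, schemeFold])

/-- The morphism `X ⊔ ⋯ ⊔ X ⟶ Y ⊔ ⋯ ⊔ Y` induced by `g : X ⟶ Y`. -/
noncomputable def copiesMap (d : ℕ) {X Y : Over S} (g : X ⟶ Y) : copies d X ⟶ copies d Y :=
  Over.homMk (Limits.Sigma.map fun _ : Fin d => g.left) (by
    change _ ≫ schemeFold d Y.left ≫ Y.hom = schemeFold d X.left ≫ X.hom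
    rw [← Category.assoc, (schemeFold_isPullback d g.left).w, Category.assoc, Over.w])

lemma copies_isPullback (d : ℕ) {X Y : Over S} (g : X ⟶ Y) :
    IsPullback (copiesMap d g) (fold d X) (fold d Y) g := by
  refine IsPullback.of_map_of_faithful (Over.forget S) ?_
  exact schemeFold_isPullback d g.left

end Schemes

section Permutations

universe u

open AlgebraicGeometry

variable {S : Scheme.{u}}

/-- `σ` is constant with value `a` along `k : Y ⟶ Z`. -/
def ConstOn {A : Type*} {Z Y : Over S} (σ : LocallyConstant Z.left A) (k : Y ⟶ Z) (a : A) : Prop :=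
  ∀ y : Y.left, σ (k.left y) = a

lemma ConstOn.comp {A : Type*} {Z Y Y' : Over S} {σ : LocallyConstant Z.left A} {k : Y ⟶ Z} {a : A}
    (h : ConstOn σ k a) (l : Y' ⟶ Y) : ConstOn σ (l ≫ k) a := fun y => by
  have := h (l.left y)
  simpa using this

/-- The sieve of all `Y ⟶ Z` along which `σ` is constant. -/
def constSieve {A : Type*} {Z : Over S} (σ : LocallyConstant Z.left A) : Sieve Z where
  arrows _ k := ∃ a, ConstOn σ k a
  downward_closed := fun ⟨a, h⟩ l => ⟨a, h.comp l⟩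

lemma constSieve_mem {A : Type*} {Z : Over S} (σ : LocallyConstant Z.left A) :
    constSieve σ ∈ Scheme.fppfTopology.over S Z := by
  rw [GrothendieckTopology.mem_over_iff]
  let U : A → Z.left.Opens := fun a => ⟨σ ⁻¹' {a}, σ.isLocallyConstant.isOpen_fiber a⟩
  have h : Presieve.ofArrows _ (fun a => (U a).ι) ∈ Scheme.fppfPrecoverage Z.left := by
    refine (Scheme.ofArrows_mem_precoverage_iff _).2 ⟨fun x => ⟨σ x, ?_⟩, fun a =>
      ⟨inferInstance, inferInstance⟩⟩
    exact ⟨⟨x, rfl⟩, rfl⟩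
  refine GrothendieckTopology.superset_covering _ ?_ (Precoverage.generate_mem_toGrothendieck h)
  rw [Sieve.generate_le_iff]
  rintro _ _ ⟨a⟩
  exact (Sieve.overEquiv_iff _ _).2 ⟨a, fun y => y.2⟩

lemma subsingleton_of_isEmpty {P : (Over S)ᵒᵖ ⥤ Type u}
    (hP : Presheaf.IsSheaf (Scheme.fppfTopology.over S) P) (Y : Over S) [IsEmpty Y.left] :
    Subsingleton (P.obj (op Y)) := by
  have h : (⊥ : Sieve Y) ∈ Scheme.fppfTopology.over S Y := by
    rw [GrothendieckTopology.mem_over_iff]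
    refine GrothendieckTopology.superset_covering _ ?_ (Precoverage.generate_mem_toGrothendieck
      (Scheme.bot_mem_precoverage _ Y.left))
    rw [Sieve.generate_le_iff]
    rintro _ _ ⟨⟩
  refine ⟨fun a b => ?_⟩
  exact ((isSheaf_iff_isSheaf_of_type _ _).1 hP).isSeparated ⊥ h |>.ext fun _ _ h => h.elim

lemma ext_of_locallyConstant {A : Type*} {P : (Over S)ᵒᵖ ⥤ Type u}
    (hP : Presheaf.IsSheaf (Scheme.fppfTopology.over S) P) {Z : Over S}
    (σ : LocallyConstant Z.left A) {s t : P.obj (op Z)}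
    (h : ∀ ⦃Y : Over S⦄ (k : Y ⟶ Z) (a : A), ConstOn σ k a → P.map k.op s = P.map k.op t) :
    s = t :=
  ((isSheaf_iff_isSheaf_of_type _ _).1 hP).isSeparated _ (constSieve_mem σ) |>.ext
    fun _ k ⟨a, hk⟩ => h k a hk

lemma exists_glue {A : Type*} {P : (Over S)ᵒᵖ ⥤ Type u}
    (hP : Presheaf.IsSheaf (Scheme.fppfTopology.over S) P) {Z : Over S}
    (σ : LocallyConstant Z.left A) (s : A → P.obj (op Z)) :
    ∃ t : P.obj (op Z), ∀ ⦃Y : Over S⦄ (k : Y ⟶ Z) (a : A), ConstOn σ k a →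
      P.map k.op t = P.map k.op (s a) := by
  let x : Presieve.FamilyOfElements P (constSieve σ).arrows := fun Y k hk => P.map k.op (s hk.choose)
  have key : ∀ ⦃Y : Over S⦄ (k : Y ⟶ Z) (a b : A), ConstOn σ k a → ConstOn σ k b →
      P.map k.op (s a) = P.map k.op (s b) := by
    intro Y k a b ha hb
    by_cases hY : IsEmpty Y.left
    · have := subsingleton_of_isEmpty hP Y
      exact Subsingleton.elim _ _
    · obtain ⟨y⟩ := not_isEmpty_iff.1 hY
      rw [← ha y, ← hb y]
  have hx : x.Compatible := by
    rw [Presieve.compatible_iff_sieveCompatible]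
    intro Y Y' k l hk
    rw [← Functor.map_comp_apply, ← op_comp]
    exact key _ _ _ (Exists.choose_spec (_ : ∃ a, ConstOn σ (l ≫ k) a)) (hk.choose_spec.comp l)
  obtain ⟨t, ht, -⟩ := ((isSheaf_iff_isSheaf_of_type _ _).1 hP) _ (constSieve_mem σ) x hx
  exact ⟨t, fun Y k a hk => (ht k ⟨a, hk⟩).trans (key k _ _ (Exists.choose_spec _) hk)⟩

/-- The presheaf of groups `S_d` on `Sch_S`: locally constant functions with values in the
symmetric group on `d` letters. -/
def permPresheaf (S : Scheme.{u}) (d : ℕ) : (Over S)ᵒᵖ ⥤ GrpCat.{u} where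
  obj Z := GrpCat.of (LocallyConstant Z.unop.left (Equiv.Perm (Fin d)))
  map k := GrpCat.ofHom (LocallyConstant.comapMonoidHom k.unop.left.base.hom)

end Permutations

section Semidirect

universe u

open AlgebraicGeometry

variable {S : Scheme.{u}} (G : Sheaf (Scheme.fppfTopology.over S) GrpCat.{u}) (d : ℕ)

lemma sheaf_forget : Presheaf.IsSheaf (Scheme.fppfTopology.over S)
    (G.obj ⋙ CategoryTheory.forget GrpCat) :=
  GrothendieckTopology.HasSheafCompose.isSheaf _ G.property

variable {G}

lemma grp_ext {A : Type*} {Z : Over S} (σ : LocallyConstant Z.left A) {s t : G.obj.obj (op Z)}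
    (h : ∀ ⦃Y : Over S⦄ (k : Y ⟶ Z) (a : A), ConstOn σ k a →
      G.obj.map k.op s = G.obj.map k.op t) : s = t :=
  ext_of_locallyConstant (sheaf_forget G) σ h

lemma grp_glue {A : Type*} {Z : Over S} (σ : LocallyConstant Z.left A)
    (s : A → G.obj.obj (op Z)) :
    ∃ t : G.obj.obj (op Z), ∀ ⦃Y : Over S⦄ (k : Y ⟶ Z) (a : A), ConstOn σ k a →
      G.obj.map k.op t = G.obj.map k.op (s a) :=
  exists_glue (sheaf_forget G) σ s

variable {d}

/-- The permutation action of `σ ∈ S_d(Z)` on `G(Z)^d`: the `i`-th component of `σ • n` is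
`n (τ⁻¹ i)` wherever `σ` is constant with value `τ`. -/
noncomputable def permAct {Z : Over S} (σ : LocallyConstant Z.left (Equiv.Perm (Fin d)))
    (n : Fin d → G.obj.obj (op Z)) : Fin d → G.obj.obj (op Z) :=
  fun i => (grp_glue σ (fun τ => n (τ⁻¹ i))).choose

lemma permAct_spec {Z : Over S} (σ : LocallyConstant Z.left (Equiv.Perm (Fin d)))
    (n : Fin d → G.obj.obj (op Z)) (i : Fin d) {Y : Over S} {k : Y ⟶ Z} {τ : Equiv.Perm (Fin d)}
    (hk : ConstOn σ k τ) : G.obj.map k.op (permAct σ n i) = G.obj.map k.op (n (τ⁻¹ i)) :=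
  (grp_glue σ (fun τ => n (τ⁻¹ i))).choose_spec k τ hk

/-- `permAct` as a homomorphism `S_d(Z) → Aut(G(Z)^d)`. -/
noncomputable def permHom (G : Sheaf (Scheme.fppfTopology.over S) GrpCat.{u}) (d : ℕ) (Z : Over S) :
    LocallyConstant Z.left (Equiv.Perm (Fin d)) →* MulAut (Fin d → G.obj.obj (op Z)) :=
  letI : MulDistribMulAction (LocallyConstant Z.left (Equiv.Perm (Fin d)))
      (Fin d → G.obj.obj (op Z)) :=
    { smul := permAct
      one_smul := fun n => funext fun i => grp_ext
        (1 : LocallyConstant Z.left (Equiv.Perm (Fin d))) fun Y k τ _ =>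
          permAct_spec (τ := 1) _ _ _ (fun _ => rfl)
      mul_smul := fun σ σ' n => funext fun i => grp_ext
        (⟨fun z => (σ z, σ' z), σ.isLocallyConstant.prodMk σ'.isLocallyConstant⟩ :
          LocallyConstant Z.left (Equiv.Perm (Fin d) × Equiv.Perm (Fin d))) fun Y k τ hk => by
          have h1 : ConstOn σ k τ.1 := fun y => congrArg Prod.fst (hk y)
          have h2 : ConstOn σ' k τ.2 := fun y => congrArg Prod.snd (hk y)
          have h3 : ConstOn (σ * σ') k (τ.1 * τ.2) := fun y =>
            congrArg₂ (· * ·) (h1 y) (h2 y)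
          refine (permAct_spec _ _ _ h3).trans ?_
          refine Eq.trans ?_ (permAct_spec _ _ _ h1).symm
          refine Eq.trans ?_ (permAct_spec _ _ _ h2).symm
          rw [mul_inv_rev]
          rfl
      smul_mul := fun σ n n' => funext fun i => grp_ext σ fun Y k τ hk => by
        refine (permAct_spec _ _ _ hk).trans ?_
        rw [Pi.mul_apply, Pi.mul_apply, map_mul, map_mul]
        exact congrArg₂ _ (permAct_spec _ _ _ hk).symm (permAct_spec _ _ _ hk).symm
      smul_one := fun σ => funext fun i => grp_ext σ fun Y k τ hk => by
        refine (permAct_spec _ _ _ hk).trans ?_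
        rfl }
  MulDistribMulAction.toMulAut _ _

lemma ConstOn.comap {A : Type*} {Z Z' Y : Over S} (g : Z' ⟶ Z) {σ : LocallyConstant Z.left A}
    {k : Y ⟶ Z'} {a : A} (h : ConstOn (σ.comap g.left.base.hom) k a) : ConstOn σ (k ≫ g) a :=
  fun y => by
    have := h y
    rw [LocallyConstant.coe_comap] at this
    simpa using this

lemma map_permAct {Z Z' : Over S} (g : Z' ⟶ Z)
    (σ : LocallyConstant Z.left (Equiv.Perm (Fin d))) (n : Fin d → G.obj.obj (op Z)) (i : Fin d) :
    G.obj.map g.op (permAct σ n i) =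
      permAct (σ.comap g.left.base.hom) (fun j => G.obj.map g.op (n j)) i := by
  refine grp_ext (σ.comap g.left.base.hom) fun Y k τ hk => ?_
  refine Eq.trans ?_ (permAct_spec _ _ _ hk).symm
  have h1 := permAct_spec σ n i hk.comap
  rw [op_comp, G.obj.map_comp, GrpCat.comp_apply, GrpCat.comp_apply] at h1
  exact h1

/-- The presheaf of groups `G^d ⋊ S_d`. -/
noncomputable def semidirectPresheaf (G : Sheaf (Scheme.fppfTopology.over S) GrpCat.{u}) (d : ℕ) :
    (Over S)ᵒᵖ ⥤ GrpCat.{u} where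
  obj Z := GrpCat.of ((Fin d → G.obj.obj Z) ⋊[permHom G d Z.unop]
    LocallyConstant Z.unop.left (Equiv.Perm (Fin d)))
  map {Z Z'} k := GrpCat.ofHom (SemidirectProduct.map
    (MonoidHom.pi fun i => (G.obj.map k).hom.comp (Pi.evalMonoidHom _ i))
    (LocallyConstant.comapMonoidHom k.unop.left.base.hom)
    (fun σ => MonoidHom.ext fun n => funext fun i => map_permAct k.unop σ n i))
  map_id Z := by
    refine ConcreteCategory.hom_ext _ _ fun x => SemidirectProduct.ext ?_ ?_
    · funext i
      exact congrArg (fun f => f (x.left i)) (G.obj.map_id Z)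
    · rfl
  map_comp {Z Z' Z''} k l := by
    refine ConcreteCategory.hom_ext _ _ fun x => SemidirectProduct.ext ?_ ?_
    · funext i
      exact congrArg (fun f => f (x.left i)) (G.obj.map_comp k l)
    · rfl

lemma permPresheaf_isSheaf (S : Scheme.{u}) (d : ℕ) :
    Presheaf.IsSheaf (Scheme.fppfTopology.over S) (permPresheaf S d) := by
  apply Presheaf.isSheaf_of_isSheaf_comp _ _ (CategoryTheory.forget GrpCat)
  let _ : TopologicalSpace (Equiv.Perm (Fin d)) := ⊥
  have : DiscreteTopology (Equiv.Perm (Fin d)) := ⟨rfl⟩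
  have h1 : Presheaf.IsSheaf Scheme.fppfTopology
      (continuousMapPresheaf.{0, u} (Equiv.Perm (Fin d))) :=
    Presheaf.IsSheaf.of_le Scheme.fppfTopology_le_fpqcTopology
      (isSheaf_fpqcTopology_continuousMapPresheaf _)
  have h2 := Functor.op_comp_isSheaf (Over.forget S) (Scheme.fppfTopology.over S)
    Scheme.fppfTopology ⟨_, h1⟩
  let e : permPresheaf S d ⋙ CategoryTheory.forget GrpCat ≅
      (Over.forget S).op ⋙ continuousMapPresheaf.{0, u} (Equiv.Perm (Fin d)) :=
    NatIso.ofComponents (fun Z => Equiv.toIso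
      { toFun := fun (f : LocallyConstant Z.unop.left (Equiv.Perm (Fin d))) =>
          (⟨f, f.isLocallyConstant.continuous⟩ : C(Z.unop.left, Equiv.Perm (Fin d)))
        invFun := fun (f : C(Z.unop.left, Equiv.Perm (Fin d))) =>
          (⟨f, (IsLocallyConstant.iff_continuous f).2 f.continuous⟩ :
            LocallyConstant Z.unop.left (Equiv.Perm (Fin d)))
        left_inv := fun _ => rfl
        right_inv := fun _ => rfl }) (fun _ => rfl)
  exact (Presheaf.isSheaf_of_iso_iff e).2 h2

/-- The sheaf of groups `S_d`. -/
def permSheaf (S : Scheme.{u}) (d : ℕ) : Sheaf (Scheme.fppfTopology.over S) GrpCat.{u} :=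
  ⟨permPresheaf S d, permPresheaf_isSheaf S d⟩

lemma semidirectPresheaf_isSheaf (G : Sheaf (Scheme.fppfTopology.over S) GrpCat.{u}) (d : ℕ) :
    Presheaf.IsSheaf (Scheme.fppfTopology.over S) (semidirectPresheaf G d) := by
  apply Presheaf.isSheaf_of_isSheaf_comp _ _ (CategoryTheory.forget GrpCat)
  rw [isSheaf_iff_isSheaf_of_type]
  intro Z R hR x hx
  have hG := (isSheaf_iff_isSheaf_of_type _ _).1 (sheaf_forget G) R hR
  have hS := (isSheaf_iff_isSheaf_of_type _ _).1 (sheaf_forget (permSheaf S d)) R hR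
  let xl : Fin d → Presieve.FamilyOfElements (G.obj ⋙ CategoryTheory.forget GrpCat) R.arrows :=
    fun i Y k hk => SemidirectProduct.left (x k hk) i
  let xr : Presieve.FamilyOfElements ((permSheaf S d).obj ⋙ CategoryTheory.forget GrpCat)
    R.arrows := fun Y k hk => SemidirectProduct.right (x k hk)
  have hxl : ∀ i, (xl i).Compatible := fun i Y₁ Y₂ Y g₁ g₂ f₁ f₂ h₁ h₂ e =>
    congrFun (congrArg SemidirectProduct.left (hx g₁ g₂ h₁ h₂ e)) i
  have hxr : xr.Compatible := fun Y₁ Y₂ Y g₁ g₂ f₁ f₂ h₁ h₂ e =>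
    congrArg SemidirectProduct.right (hx g₁ g₂ h₁ h₂ e)
  choose tl htl htl' using fun i => hG (xl i) (hxl i)
  obtain ⟨tr, htr, htr'⟩ := hS xr hxr
  refine ⟨SemidirectProduct.mk tl tr, fun Y k hk => SemidirectProduct.ext ?_ ?_, fun t ht =>
    SemidirectProduct.ext ?_ ?_⟩
  · exact funext fun i => htl i k hk
  · exact htr k hk
  · exact funext fun i => htl' i _ fun Y k hk =>
      congrFun (congrArg SemidirectProduct.left (ht k hk)) i
  · exact htr' _ fun Y k hk => congrArg SemidirectProduct.right (ht k hk)

/-- The sheaf of groups `G^d ⋊ S_d`. -/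
noncomputable def semidirect (G : Sheaf (Scheme.fppfTopology.over S) GrpCat.{u}) (d : ℕ) :
    Sheaf (Scheme.fppfTopology.over S) GrpCat.{u} :=
  ⟨semidirectPresheaf G d, semidirectPresheaf_isSheaf G d⟩

end Semidirect

section Main

universe u

open AlgebraicGeometry

variable {S : Scheme.{u}}

/-- Finite étale covers of degree `d` in `Sch_S`. -/
def coverProp (S : Scheme.{u}) (d : ℕ) : MorphismProperty (Over S) :=
  (finEtale d).inverseImage (Over.forget S)

/-- The category of pairs `(T → X, P)` with `X` an `S`-scheme, `T → X` a finite étale cover of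
degree `d`, and `P` a `G|_T`-torsor. -/
abbrev EtTors (G : Sheaf (Scheme.fppfTopology.over S) GrpCat.{u}) (d : ℕ) :=
  CoverTors G (coverProp S d)

/-- Its structure functor to `Sch_S`. -/
abbrev etProj (G : Sheaf (Scheme.fppfTopology.over S) GrpCat.{u}) (d : ℕ) : EtTors G d ⥤ Over S :=
  CoverTors.proj G (coverProp S d)

variable {G : Sheaf (Scheme.fppfTopology.over S) GrpCat.{u}} {d : ℕ}

/-- An object of `EtTors G d` as an object of its fiber. -/
def toFiber (x : EtTors G d) : (etProj G d).Fiber x.X := ⟨x, rfl⟩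

/-- The split object `(X ⊔ ⋯ ⊔ X → X, G|_{X ⊔ ⋯ ⊔ X})`. -/
noncomputable def split (G : Sheaf (Scheme.fppfTopology.over S) GrpCat.{u}) (d : ℕ) (X : Over S) :
    EtTors G d where
  X := X
  tors := ⟨copies d X, Torsor.trivial G (copies d X)⟩
  π := fold d X
  hπ := schemeFold_finEtale d X.left

/-- The morphism of split objects over `g : X' ⟶ X`, which makes the split object over `X'` a
pullback of the one over `X`. -/
noncomputable def splitMap (G : Sheaf (Scheme.fppfTopology.over S) GrpCat.{u}) (d : ℕ)
    {X' X : Over S} (g : X' ⟶ X) : split G d X' ⟶ split G d X where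
  f := g
  t := Tors.trivialMap G (copiesMap d g)
  isPullback := copies_isPullback d g

/-- The identification of the sheaf of groups `G^d ⋊ S_d` with the automorphism sheaf of the split
objects: `(n, σ)` corresponds to `(id, g, φ)` where `g` maps the `i`-th copy of `Z` to the
`σ(i)`-th one, and `φ` is the isomorphism of trivial torsors whose value at the section `1` is
`n (σ i)` on the `i`-th copy.  (The first two conditions determine `iso`.) -/
structure SplitAut (G : Sheaf (Scheme.fppfTopology.over S) GrpCat.{u}) (d : ℕ) where
  iso (Z : Over S) : (semidirect G d).obj.obj (op Z) ≃* Aut (toFiber (split G d Z))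
  base {Z : Over S} (w : (semidirect G d).obj.obj (op Z)) {Y : Over S} (k : Y ⟶ Z)
    (τ : Equiv.Perm (Fin d)) (hk : ConstOn (SemidirectProduct.right w) k τ) (i : Fin d) :
    k ≫ inc d Z i ≫ (iso Z w).hom.1.t.base = k ≫ inc d Z (τ i)
  value {Z : Over S} (w : (semidirect G d).obj.obj (op Z)) {Y : Over S} (k : Y ⟶ Z)
    (τ : Equiv.Perm (Fin d)) (hk : ConstOn (SemidirectProduct.right w) k τ) (i : Fin d) :
    G.obj.map (k ≫ inc d Z i).op
        ((iso Z w).hom.1.t.ap (𝟙 (copies d Z)) (1 : G.obj.obj (op (copies d Z)))) =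
      G.obj.map k.op (SemidirectProduct.left w (τ i))
  naturality {Z' Z : Over S} (g : Z' ⟶ Z) (w : (semidirect G d).obj.obj (op Z)) :
    splitMap G d g ≫ (iso Z w).hom.1 =
      (iso Z' ((semidirect G d).obj.map g.op w)).hom.1 ≫ splitMap G d g

/-- An identification of the `(G^d ⋊ S_d)`-torsor `P` over `X` with the sheaf
`Y ↦ Isom((Y ⊔ ⋯ ⊔ Y → Y, G|_{Y ⊔ ⋯ ⊔ Y}), x|_Y)` on which `G^d ⋊ S_d`, as the automorphism
sheaf of the split objects, acts by composition. -/
structure IsomSheaf (θ : SplitAut G d) [(etProj G d).IsFibered] (x : EtTors G d)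
    (P : Torsor (semidirect G d) x.X) where
  equiv (Y : Over x.X) :
    P.val.obj (op Y) ≃ (toFiber (split G d Y.left) ≅ pull Y.hom (toFiber x))
  map {Y' Y : Over x.X} (k : Y' ⟶ Y) (q : P.val.obj (op Y)) :
    (equiv Y' (P.val.map k.op q)).hom.1 ≫ pullMap Y'.hom (toFiber x) =
      splitMap G d k.left ≫ (equiv Y q).hom.1 ≫ pullMap Y.hom (toFiber x)
  act {Y : Over x.X} (q : P.val.obj (op Y)) (w : (semidirect G d).obj.obj (op Y.left)) :
    equiv Y (P.act q w) = θ.iso Y.left w ≪≫ equiv Y q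

/-- The functor `x ↦ Isom((X ⊔ ⋯ ⊔ X → X, G|_{X ⊔ ⋯ ⊔ X}), x)` over `Sch_S`; on a morphism
`v : x ⟶ x'` it is composition with `v`. -/
structure IsomFunctor (θ : SplitAut G d) [(etProj G d).IsFibered] where
  torsor (x : EtTors G d) : Torsor (semidirect G d) x.X
  isom (x : EtTors G d) : IsomSheaf θ x (torsor x)
  map {x x' : EtTors G d} (v : x ⟶ x') : torsor x ≅ (Torsor.res v.f).obj (torsor x')
  isom_map {x x' : EtTors G d} (v : x ⟶ x') (Y : Over x.X) (q : (torsor x).val.obj (op Y)) :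
    ((isom x').equiv ((Over.map v.f).obj Y) ((map v).hom.hom.app (op Y) q)).hom.1 ≫
        pullMap (Y.hom ≫ v.f) (toFiber x') =
      ((isom x).equiv Y q).hom.1 ≫ pullMap Y.hom (toFiber x) ≫ v
  map_id (x : EtTors G d) :
    (⟨𝟙 x.X, map (𝟙 x)⟩ : Tors.Hom ⟨x.X, torsor x⟩ ⟨x.X, torsor x⟩) = Tors.Hom.id _
  map_comp {x y z : EtTors G d} (v : x ⟶ y) (v' : y ⟶ z) :
    (⟨v.f ≫ v'.f, map (v ≫ v')⟩ : Tors.Hom ⟨x.X, torsor x⟩ ⟨z.X, torsor z⟩) =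
      Tors.Hom.comp (B := ⟨y.X, torsor y⟩) ⟨v.f, map v⟩ ⟨v'.f, map v'⟩

/-- The underlying functor of an `IsomFunctor`. -/
def IsomFunctor.functor {θ : SplitAut G d} [(etProj G d).IsFibered] (Φ : IsomFunctor θ) :
    EtTors G d ⥤ Tors (semidirect G d) where
  obj x := ⟨x.X, Φ.torsor x⟩
  map v := { base := v.f, iso := Φ.map v }
  map_id x := Φ.map_id x
  map_comp v v' := Φ.map_comp v v'

/-- `S` as an `S`-scheme. -/
abbrev baseObj (S : Scheme.{u}) : Over S := Over.mk (𝟙 S)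

/-- Finite étale covers of `S` of degree `d`. -/
def Cover (S : Scheme.{u}) (d : ℕ) := { T : Over S // finEtale d T.hom }

/-- `S`-isomorphism classes of finite étale covers of `S` of degree `d`. -/
def CoverClass (S : Scheme.{u}) (d : ℕ) :=
  Quot fun T T' : Cover S d => Nonempty (T.1 ≅ T'.1)

/-- The object `(T → S, P)`. -/
noncomputable def Cover.pair (T : Cover S d) (P : Torsor G T.1) : EtTors G d where
  X := baseObj S
  tors := ⟨T.1, P⟩
  π := Over.mkIdTerminal.from T.1
  hπ := by
    have h : (Over.mkIdTerminal.from T.1).left = T.1.hom := by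
      simp
    change finEtale d (Over.mkIdTerminal.from T.1).left
    rw [h]
    exact T.2

/-- An identification of the `S_d`-torsor `R` over `S` with the sheaf
`Y ↦ Isom_Y(Y ⊔ ⋯ ⊔ Y, T ×_S Y)`, on which `S_d` acts through permutations of the copies of
`Y`. -/
structure CoverSheaf (T : Cover S d) (R : Torsor (permSheaf S d) (baseObj S)) where
  equiv (Y : Over (baseObj S)) : R.val.obj (op Y) ≃
    (Over.mk (fold d Y.left) ≅ Over.mk (pullback.snd (Over.mkIdTerminal.from T.1) Y.hom))
  map {Y' Y : Over (baseObj S)} (k : Y' ⟶ Y) (r : R.val.obj (op Y)) :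
    (equiv Y' (R.val.map k.op r)).hom.left ≫ pullback.fst _ _ =
      copiesMap d k.left ≫ (equiv Y r).hom.left ≫ pullback.fst _ _
  act {Y : Over (baseObj S)} (r : R.val.obj (op Y)) (σ : (permSheaf S d).obj.obj (op Y.left))
    {Z : Over S} (k : Z ⟶ Y.left) (τ : Equiv.Perm (Fin d))
    (hk : ConstOn (A := Equiv.Perm (Fin d)) σ k τ) (i : Fin d) :
    k ≫ inc d Y.left i ≫ (equiv Y (R.act r σ)).hom.left =
      k ≫ inc d Y.left (τ i) ≫ (equiv Y r).hom.left

end Main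

end TorsorGerbe

open TorsorGerbe AlgebraicGeometry

universe u

/-!
The theorem compares two categories over `Sch_S`: pairs of a finite étale cover of degree `d` with a
`G`-torsor on it (`EtTors G d`), and torsors under `G^d ⋊ S_d` (`Tors (semidirect G d)`). In both,
every morphism is cartesian (`IsGroupoidFibration`), so that being a gerbe amounts to four
statements that mention no chosen pullbacks (`IsGroupoidFibration.isGerbe`): morphisms glue
(`HomsGlue`), objects glue (`ObjectsGlue`), there are objects, and any two are locally isomorphic.

A torsor is handled through its sections over all `Y ⟶ X`, and a morphism from a trivial torsor is
the same as a section. Morphisms of torsors glue because their values on sections do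
(`Tors.homsGlue`); a descent datum of torsors is glued to the torsor of compatible families of
sections (`Tors.objectsGlue`).

The comparison is by frames. The automorphisms of the split object `Y ⊔ ⋯ ⊔ Y` with trivial torsor
are the sections of `G^d ⋊ S_d` (`splitAut`): an automorphism permutes the copies in a locally
constant way and multiplies by an element of `G` on each of them. Every object `x` is fppf-locally
split, because étale algebras of constant rank split after a faithfully flat étale base change
(`frameSieve_mem`). Hence the cartesian morphisms from split objects to `x`, the frames of `x`, form
a torsor under `G^d ⋊ S_d` (`frames`), which is the sheaf of isomorphisms from the split object to
`x`. A morphism `x ⟶ x'` is locally determined by the image of a single frame and morphisms glue, so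
`x ↦ frames x` is fully faithful (`existsUnique_framesMap_eq`).

It is essentially surjective (`FrameForm.nonempty_id`) by descent. A torsor `B` is locally trivial,
hence locally the torsor of frames of a split object, and any two objects whose frames are `B` are
related by a unique isomorphism. So `B` puts a descent datum on the covers and on the torsors over
them. An fppf covering is refined by an open covering and, over each open subscheme, a single
faithfully flat morphism of affine schemes (`exists_affine_refinement`). For the latter, covers are
affine and descend by flat descent of algebras (`bijective_lift_equalizer`,
`Transport.exists_descent`); for the former they are glued as schemes over the base
(`FrameOpens.nonempty_frameForm`). In both cases the torsors are then glued over the resulting cover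
(`FrameForm.nonempty_of_glue`). Since torsors glue and all of them are torsors of frames, covers
with torsors glue too (`etProj_objectsGlue`), which is what was missing for `etProj G d` to be a
gerbe.

The classification over `S` is the equivalence on isomorphism classes of the fiber over `S`. For the
trivial group in place of `G` a pair is just a cover and `1^d ⋊ S_d = S_d`, so covers correspond to
`S_d`-torsors (`Cover.exists_classEquiv`, `Cover.isFrames_iff`). For general `G`, two pairs `(T, P)`
and `(T, P')` on the same cover are isomorphic if and only if `P` and `P'` lie in one orbit under
the automorphisms of `T` (`Cover.exists_orbitsEquiv`).
-/

open CategoryTheory Limits Opposite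

namespace TorsorGerbe

/-! ### Sections of torsors -/

section TorsorSections

universe w v₁ u₁

variable {C : Type u₁} [Category.{v₁} C] {J : GrothendieckTopology C}
  {G : Sheaf J GrpCat.{w}} {X : C}

namespace Torsor

/-- The sections of a torsor over `y : Y ⟶ X`. -/
abbrev sec (P : Torsor G X) {Y : C} (y : Y ⟶ X) : Type w := P.val.obj (op (Over.mk y))

/-- Restriction of sections along `g : Z ⟶ Y`; the structure morphism of the target is only
required to be equal to `g ≫ y`, so that no transports are needed. -/
def rs (P : Torsor G X) {Y Z : C} (g : Z ⟶ Y) {y : Y ⟶ X} {z : Z ⟶ X} (h : g ≫ y = z)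
    (s : P.sec y) : P.sec z :=
  P.val.map (Over.homMk g h : Over.mk z ⟶ Over.mk y).op s

/-- The action of `G(Y)` on the sections over `y : Y ⟶ X`. -/
def ac (P : Torsor G X) {Y : C} {y : Y ⟶ X} (s : P.sec y) (a : G.obj.obj (op Y)) : P.sec y :=
  P.act (Y := Over.mk y) s a

variable (P : Torsor G X) {Y Z W : C}

@[simp]
lemma rs_id {y : Y ⟶ X} (h : 𝟙 Y ≫ y = y) (s : P.sec y) : P.rs (𝟙 Y) h s = s := by
  have : (Over.homMk (𝟙 Y) h : Over.mk y ⟶ Over.mk y) = 𝟙 _ := by ext; simp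
  simp [rs, this]

lemma rs_rs (g : Z ⟶ Y) (k : W ⟶ Z) {y : Y ⟶ X} {z : Z ⟶ X} {w : W ⟶ X} (h : g ≫ y = z)
    (h' : k ≫ z = w) (s : P.sec y) :
    P.rs k h' (P.rs g h s) = P.rs (k ≫ g) (by rw [← h', ← h, Category.assoc]) s := by
  have : (Over.homMk (k ≫ g) (by simp [← h', ← h]) : Over.mk w ⟶ Over.mk y) =
      Over.homMk (U := Over.mk w) (V := Over.mk z) k h' ≫
        Over.homMk (U := Over.mk z) (V := Over.mk y) g h := by ext; simp
  simp [rs, this]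

lemma rs_congr {g g' : Z ⟶ Y} (e : g = g') {y : Y ⟶ X} {z : Z ⟶ X} (h : g ≫ y = z)
    (s : P.sec y) : P.rs g h s = P.rs g' (by rw [← e, h]) s := by
  subst e; rfl

lemma rs_ac (g : Z ⟶ Y) {y : Y ⟶ X} {z : Z ⟶ X} (h : g ≫ y = z) (s : P.sec y)
    (a : G.obj.obj (op Y)) : P.rs g h (P.ac s a) = P.ac (P.rs g h s) (G.obj.map g.op a) :=
  P.map_act (Over.homMk g h : Over.mk z ⟶ Over.mk y) s a

@[simp]
lemma ac_one {y : Y ⟶ X} (s : P.sec y) : P.ac s 1 = s := P.act_one (Y := Over.mk y) s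

lemma ac_mul {y : Y ⟶ X} (s : P.sec y) (a b : G.obj.obj (op Y)) :
    P.ac s (a * b) = P.ac (P.ac s a) b := P.act_mul (Y := Over.mk y) s a b

lemma existsUnique_ac {y : Y ⟶ X} (s t : P.sec y) : ∃! a : G.obj.obj (op Y), P.ac s a = t :=
  P.existsUnique_act (Y := Over.mk y) s t

lemma ac_left_injective {y : Y ⟶ X} (s : P.sec y) {a b : G.obj.obj (op Y)}
    (h : P.ac s a = P.ac s b) : a = b :=
  (P.existsUnique_ac s (P.ac s b)).unique h rfl

lemma sec_ext {y : Y ⟶ X} {R : Sieve Y} (hR : R ∈ J Y) {s t : P.sec y}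
    (h : ∀ ⦃Z : C⦄ (g : Z ⟶ Y), R g → P.rs g rfl s = P.rs g rfl t) : s = t := by
  refine ((isSheaf_iff_isSheaf_of_type _ _).1 P.isSheaf).isSeparated _
    (J.overEquiv_symm_mem_over (Over.mk y) R hR) |>.ext ?_
  intro Z g hg
  rw [Sieve.overEquiv_symm_iff] at hg
  have := congrArg (P.rs (𝟙 _) (show 𝟙 Z.left ≫ g.left ≫ y = Z.hom by simpa using Over.w g))
    (h g.left hg)
  rw [rs_rs, rs_rs] at this
  have e : (Over.homMk (𝟙 Z.left ≫ g.left) (by simpa using Over.w g) : Z ⟶ Over.mk y) = g := by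
    ext; simp
  change P.val.map (Over.homMk (𝟙 Z.left ≫ g.left) (by simpa using Over.w g) :
    Z ⟶ Over.mk y).op s = P.val.map (Over.homMk (𝟙 Z.left ≫ g.left) (by simpa using Over.w g) :
    Z ⟶ Over.mk y).op t at this
  rwa [e] at this

lemma glue {y : Y ⟶ X} {R : Sieve Y} (hR : R ∈ J Y)
    (s : ∀ ⦃Z : C⦄ (g : Z ⟶ Y), R g → P.sec (g ≫ y))
    (hs : ∀ ⦃Z Z' : C⦄ (g : Z ⟶ Y) (k : Z' ⟶ Z) (hg : R g),
      P.rs k (by simp) (s g hg) = s (k ≫ g) (R.downward_closed hg k)) :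
    ∃ t : P.sec y, ∀ ⦃Z : C⦄ (g : Z ⟶ Y) (hg : R g), P.rs g rfl t = s g hg := by
  let R' := (Sieve.overEquiv (Over.mk y)).symm R
  have hR' := J.overEquiv_symm_mem_over (Over.mk y) R hR
  have hm : ∀ {Z : Over X} {g : Z ⟶ Over.mk y}, R' g → R g.left := fun h =>
    (Sieve.overEquiv_symm_iff _ _).1 h
  let x : Presieve.FamilyOfElements P.val R'.arrows := fun Z g hg =>
    P.rs (y := g.left ≫ y) (z := Z.hom) (𝟙 _) (by simpa using Over.w g) (s g.left (hm hg))
  have hx : x.Compatible := by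
    rw [Presieve.compatible_iff_sieveCompatible]
    intro Z Z' g k hg
    have h1 : P.val.map k.op (x g hg) = P.rs (z := Z'.hom) k.left (Over.w k) (x g hg) := rfl
    rw [h1]
    simp only [x]
    rw [rs_rs]
    change P.rs (𝟙 Z'.left) _ (s (k.left ≫ g.left) _) = _
    rw [← hs g.left k.left (hm hg), rs_rs]
    exact P.rs_congr (by simp) _ _
  obtain ⟨t, ht, -⟩ := ((isSheaf_iff_isSheaf_of_type _ _).1 P.isSheaf) _ hR' x hx
  refine ⟨t, fun Z g hg => ?_⟩
  have := ht (Over.homMk g : Over.mk (g ≫ y) ⟶ Over.mk y)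
    ((Sieve.overEquiv_symm_iff (Y := Over.mk y) R (Over.homMk g : Over.mk (g ≫ y) ⟶ Over.mk y)).2
      hg)
  exact this.trans (P.rs_id (by simp) _)

/-- A morphism of torsors from its values on sections. -/
def homMk {P Q : Torsor G X} (φ : ∀ {Y : C} (y : Y ⟶ X), P.sec y → Q.sec y)
    (nat : ∀ {Y Z : C} (g : Z ⟶ Y) (y : Y ⟶ X) (z : Z ⟶ X) (h : g ≫ y = z) (s : P.sec y),
      φ z (P.rs g h s) = Q.rs g h (φ y s))
    (act : ∀ {Y : C} (y : Y ⟶ X) (s : P.sec y) (a : G.obj.obj (op Y)),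
      φ y (P.ac s a) = Q.ac (φ y s) a) : P ⟶ Q where
  hom :=
    { app Y := ↾fun s => φ Y.unop.hom s
      naturality Y Z g := by
        ext s
        exact nat g.unop.left Y.unop.hom Z.unop.hom (Over.w g.unop) s }
  hom_act {Y} s a := act Y.hom s a

/-- The value of a morphism of torsors on a section. -/
def on {P Q : Torsor G X} (α : P ⟶ Q) {y : Y ⟶ X} (s : P.sec y) : Q.sec y :=
  α.hom.app (op (Over.mk y)) s

lemma on_rs {P Q : Torsor G X} (α : P ⟶ Q) (g : Z ⟶ Y) {y : Y ⟶ X} {z : Z ⟶ X} (h : g ≫ y = z)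
    (s : P.sec y) : on α (P.rs g h s) = Q.rs g h (on α s) :=
  congrArg (fun f => f s)
    (α.hom.naturality (Over.homMk g h : Over.mk z ⟶ Over.mk y).op)

lemma on_ac {P Q : Torsor G X} (α : P ⟶ Q) {y : Y ⟶ X} (s : P.sec y) (a : G.obj.obj (op Y)) :
    on α (P.ac s a) = Q.ac (on α s) a := α.hom_act (Y := Over.mk y) s a

lemma hom_ext_on {P Q : Torsor G X} {α β : P ⟶ Q}
    (h : ∀ {Y : C} (y : Y ⟶ X) (s : P.sec y), on α s = on β s) : α = β := by
  apply hom_ext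
  ext Y s
  exact h Y.unop.hom s

/-- There is a covering over which a torsor acquires sections, after base change to `Y`. -/
lemma locally_nonempty' (y : Y ⟶ X) :
    ∃ R ∈ J Y, ∀ ⦃Z : C⦄ (g : Z ⟶ Y), R g → Nonempty (P.sec (g ≫ y)) := by
  obtain ⟨R, hR, h⟩ := P.locally_nonempty
  exact ⟨R.pullback y, J.pullback_stable y hR, fun Z g hg => h _ hg⟩

lemma on_injective {P Q : Torsor G X} (α : P ⟶ Q) {y : Y ⟶ X} :
    Function.Injective (on α : P.sec y → Q.sec y) := by
  intro s t h
  obtain ⟨a, rfl, -⟩ := P.existsUnique_ac s t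
  rw [on_ac] at h
  have : a = 1 := Q.ac_left_injective (on α s) (by rw [← h, ac_one])
  rw [this, ac_one]

/-- Locally a preimage is obtained by correcting the image of any section by the group action; the
local preimages glue by injectivity. -/
lemma on_surjective {P Q : Torsor G X} (α : P ⟶ Q) {y : Y ⟶ X} :
    Function.Surjective (on α : P.sec y → Q.sec y) := by
  intro t
  obtain ⟨R, hR, h⟩ := P.locally_nonempty' y
  have key : ∀ ⦃Z : C⦄ (g : Z ⟶ Y), R g → ∃ s : P.sec (g ≫ y), on α s = Q.rs g rfl t := by
    intro Z g hg
    obtain ⟨s⟩ := h g hg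
    obtain ⟨a, ha, -⟩ := Q.existsUnique_ac (on α s) (Q.rs g rfl t)
    exact ⟨P.ac s a, by rw [on_ac, ha]⟩
  choose s hs using key
  obtain ⟨s', hs'⟩ := P.glue hR s (fun Z Z' g k hg => on_injective α (by
    rw [on_rs, hs, hs, rs_rs]))
  exact ⟨s', Q.sec_ext hR fun Z g hg => by rw [← on_rs, hs' g hg, hs]⟩

/-- Every morphism of torsors is an isomorphism. -/
instance isIso_hom {P Q : Torsor G X} (α : P ⟶ Q) : IsIso α := by
  choose β hβ using fun (Y : C) (y : Y ⟶ X) (t : Q.sec y) => on_surjective α t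
  have hβ' : ∀ (Y : C) (y : Y ⟶ X) (s : P.sec y), β Y y (on α s) = s := fun Y y s =>
    on_injective α (hβ _ _ _)
  refine ⟨homMk (fun {Y} y t => β Y y t) (fun g y z h s => on_injective α ?_)
    (fun y s a => on_injective α ?_), hom_ext_on fun y s => hβ' _ _ _,
    hom_ext_on fun y s => hβ _ _ _⟩
  · rw [on_rs, hβ, hβ]
  · rw [on_ac, hβ, hβ]

/-- A section of the trivial torsor given by an element of `G(Y)`. -/
abbrev triv {Y : C} (y : Y ⟶ X) (a : G.obj.obj (op Y)) : (trivial G X).sec y := a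

lemma triv_ac (y : Y ⟶ X) (a b : G.obj.obj (op Y)) :
    (trivial G X).ac (triv y a) b = triv y (a * b) := rfl

lemma triv_rs (g : Z ⟶ Y) {y : Y ⟶ X} {z : Z ⟶ X} (h : g ≫ y = z) (a : G.obj.obj (op Y)) :
    (trivial G X).rs g h (triv y a) = triv z (G.obj.map g.op a) := rfl

end Torsor

end TorsorSections

/-! ### Morphisms of torsors over varying bases -/

section TorsMorphisms

universe w v₁ u₁

variable {C : Type u₁} [Category.{v₁} C] {J : GrothendieckTopology C}
  {G : Sheaf J GrpCat.{w}}

namespace Tors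

/-- The value of a morphism `u : A ⟶ B` on a section of `A` over `y`, as a section of `B` over any
`z` that is equal to `y ≫ u.base`. -/
def on {A B : Tors G} (u : A ⟶ B) {Y : C} {y : Y ⟶ A.base} {z : Y ⟶ B.base}
    (h : y ≫ u.base = z) (s : A.torsor.sec y) : B.torsor.sec z :=
  B.torsor.rs (𝟙 Y) (by rw [← h, Category.id_comp]) (Hom.ap u y s)

variable {A B D : Tors G} {Y Z : C}

@[simp] lemma id_base (A : Tors G) : Hom.base (𝟙 A) = 𝟙 A.base := rfl

@[simp] lemma comp_base (u : A ⟶ B) (v : B ⟶ D) : (u ≫ v).base = u.base ≫ v.base := rfl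

lemma on_rfl (u : A ⟶ B) {y : Y ⟶ A.base} (s : A.torsor.sec y) : on u rfl s = u.ap y s :=
  B.torsor.rs_id _ _

lemma rs_on (u : A ⟶ B) (g : Z ⟶ Y) {y : Y ⟶ A.base} {y' : Z ⟶ A.base} {z : Y ⟶ B.base}
    {z' : Z ⟶ B.base} (h : y ≫ u.base = z) (e : g ≫ y = y') (e' : g ≫ z = z')
    (s : A.torsor.sec y) :
    B.torsor.rs g e' (on u h s) = on u (by rw [← e, ← e', ← h, Category.assoc])
      (A.torsor.rs g e s) := by
  subst h e e'
  simp only [on]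
  have : u.ap (g ≫ y) (A.torsor.rs g rfl s) = B.torsor.rs g (by simp) (u.ap y s) :=
    Torsor.on_rs u.iso.hom g rfl s
  rw [this, Torsor.rs_rs, Torsor.rs_rs]
  exact Torsor.rs_congr _ (by simp) _ _

lemma on_ac (u : A ⟶ B) {y : Y ⟶ A.base} {z : Y ⟶ B.base} (h : y ≫ u.base = z)
    (s : A.torsor.sec y) (a : G.obj.obj (op Y)) :
    on u h (A.torsor.ac s a) = B.torsor.ac (on u h s) a := by
  subst h
  rw [on_rfl, on_rfl]
  exact Torsor.on_ac u.iso.hom s a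

@[simp]
lemma on_id {y : Y ⟶ A.base} (h : y ≫ (𝟙 A : A ⟶ A).base = y) (s : A.torsor.sec y) :
    on (𝟙 A) h s = s := by
  have : Hom.ap (𝟙 A) y s = A.torsor.rs (𝟙 Y) (by simp) s := Hom.ap_id A y s
  rw [on, this, Torsor.rs_rs]
  exact (A.torsor.rs_congr (Category.comp_id _) _ _).trans (A.torsor.rs_id (by simp) s)

lemma on_comp (u : A ⟶ B) (v : B ⟶ D) {y : Y ⟶ A.base} {z : Y ⟶ B.base} {z' : Y ⟶ D.base}
    (h : y ≫ u.base = z) (h' : z ≫ v.base = z') (e : y ≫ (u ≫ v).base = z')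
    (s : A.torsor.sec y) : on (u ≫ v) e s = on v h' (on u h s) := by
  subst h h'
  rw [on_rfl, on_rfl]
  have : Hom.ap (u ≫ v) y s = D.torsor.rs (𝟙 Y) (by simp) (v.ap _ (u.ap y s)) :=
    Hom.ap_comp u v y s
  rw [on, this]
  refine (Torsor.rs_rs _ _ _ _ _ _).trans ?_
  exact (D.torsor.rs_congr (Category.comp_id _) _ _).trans (D.torsor.rs_id (by simp) _)

lemma on_bijective (u : A ⟶ B) {y : Y ⟶ A.base} {z : Y ⟶ B.base} (h : y ≫ u.base = z) :
    Function.Bijective (on u h : A.torsor.sec y → B.torsor.sec z) := by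
  subst h
  have : (on u rfl : A.torsor.sec y → B.torsor.sec (y ≫ u.base)) = Torsor.on u.iso.hom :=
    funext fun s => on_rfl u s
  rw [this]
  exact ⟨Torsor.on_injective _, Torsor.on_surjective _⟩

lemma hom_ext {u v : A ⟶ B} (h : u.base = v.base)
    (h' : ∀ {Y : C} (y : Y ⟶ A.base) (s : A.torsor.sec y),
      ∀ (z : Y ⟶ B.base) (hu : y ≫ u.base = z) (hv : y ≫ v.base = z), on u hu s = on v hv s) :
    u = v :=
  Hom.ext_ap h fun y s => (h' y s _ (by rw [h]) rfl).trans (on_rfl v s)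

/-- A morphism of `Tors G` from its values on sections. -/
noncomputable def mkHom (b : A.base ⟶ B.base)
    (φ : ∀ {Y : C} (y : Y ⟶ A.base), A.torsor.sec y → B.torsor.sec (y ≫ b))
    (nat : ∀ {Y Z : C} (g : Z ⟶ Y) (y : Y ⟶ A.base) (z : Z ⟶ A.base) (h : g ≫ y = z)
      (s : A.torsor.sec y), φ z (A.torsor.rs g h s) = B.torsor.rs g (by simp [← h]) (φ y s))
    (act : ∀ {Y : C} (y : Y ⟶ A.base) (s : A.torsor.sec y) (a : G.obj.obj (op Y)),
      φ y (A.torsor.ac s a) = B.torsor.ac (φ y s) a) : A ⟶ B where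
  base := b
  iso := @asIso _ _ _ _
    (Torsor.homMk (P := A.torsor) (Q := (Torsor.res b).obj B.torsor) φ nat act)
    (Torsor.isIso_hom _)

/-- Every morphism of `Tors G` is strongly cartesian; this is the universal property. -/
lemma exists_lift (u : A ⟶ B) (v : D ⟶ B) (g : D.base ⟶ A.base) (h : g ≫ u.base = v.base) :
    ∃ w : D ⟶ A, w.base = g ∧ w ≫ u = v := by
  have key : ∀ (Y : C) (y : Y ⟶ D.base) (s : D.torsor.sec y),
      ∃ t : A.torsor.sec (y ≫ g), on u (z := y ≫ v.base) (by rw [← h, Category.assoc]) t =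
        on v rfl s :=
    fun Y y s => (on_bijective u _).2 _
  choose φ hφ using key
  let w : D ⟶ A := mkHom g (fun {Y} y s => φ Y y s)
    (fun k y z e s => (on_bijective u (z := z ≫ v.base) (by rw [← h, Category.assoc])).1 (by
      rw [hφ, ← rs_on u k (z := y ≫ v.base) (z' := z ≫ v.base) (by rw [← h, Category.assoc]) _
        (by rw [← e, Category.assoc]), hφ, rs_on _ _ _ e]))
    (fun y s a => (on_bijective u (z := y ≫ v.base) (by rw [← h, Category.assoc])).1 (by
      rw [hφ, on_ac, on_ac, hφ]))
  refine ⟨w, rfl, hom_ext h fun {Y} y s z hu hv => ?_⟩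
  rw [on_comp w u (z := y ≫ g) rfl (by rw [← hv, ← h, Category.assoc])]
  have e1 : on w (z := y ≫ g) rfl s = φ Y y s := A.torsor.rs_id _ _
  subst hv
  rw [e1, hφ]

lemma hom_ext_of_comp {u : A ⟶ B} {w w' : D ⟶ A} (h : w.base = w'.base) (e : w ≫ u = w' ≫ u) :
    w = w' := by
  refine hom_ext h fun {Y} y s z hw hw' => (on_bijective u rfl).1 ?_
  -- the composite is named `v`, so that `e` can be used although it occurs in types
  have key : ∀ (v : D ⟶ B) (h1 : v = w ≫ u) (h2 : v = w' ≫ u),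
      on u rfl (on w hw s) = on u rfl (on w' hw' s) := by
    intro v h1 h2
    have h3 : y ≫ v.base = z ≫ u.base := by rw [h1, comp_base, ← hw, Category.assoc]
    trans on v h3 s
    · subst h1
      rw [on_comp w u hw rfl]
    · subst h2
      rw [on_comp w' u hw' rfl]
  exact key _ rfl e

/-- The canonical morphism from the restriction of a torsor. -/
noncomputable def resMap (B : Tors G) {X : C} (g : X ⟶ B.base) :
    (⟨X, (Torsor.res g).obj B.torsor⟩ : Tors G) ⟶ B :=
  mkHom g (fun _ s => s) (fun _ _ _ h _ => by subst h; rfl) (fun _ _ _ => rfl)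

@[simp] lemma resMap_base (B : Tors G) {X : C} (g : X ⟶ B.base) : (resMap B g).base = g := rfl

/-- The morphism from a trivial torsor over `X` given by a section over `X`. -/
noncomputable def ofSection (B : Tors G) {X : C} (t : X ⟶ B.base) (s : B.torsor.sec t) :
    (⟨X, Torsor.trivial G X⟩ : Tors G) ⟶ B :=
  mkHom t (fun y a => B.torsor.ac (B.torsor.rs y rfl s) (show G.obj.obj _ from a))
    (fun k y z h a => by
      rw [Torsor.rs_ac, Torsor.rs_rs]
      subst h
      rfl)
    (fun y a b => B.torsor.ac_mul _ _ _)

@[simp] lemma ofSection_base (B : Tors G) {X : C} (t : X ⟶ B.base) (s : B.torsor.sec t) :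
    (ofSection B t s).base = t := rfl

lemma on_ofSection (B : Tors G) {X : C} (t : X ⟶ B.base) (s : B.torsor.sec t) {y : Y ⟶ X}
    {z : Y ⟶ B.base} (h : y ≫ (ofSection B t s).base = z) (a : G.obj.obj (op Y)) :
    on (ofSection B t s) h (Torsor.triv y a) =
      B.torsor.ac (B.torsor.rs y (by rw [← h, ofSection_base]) s) a := by
  subst h
  exact B.torsor.rs_id _ _

lemma on_ofSection_one (B : Tors G) {X : C} (t : X ⟶ B.base) (s : B.torsor.sec t)
    (h : 𝟙 X ≫ (ofSection B t s).base = t) :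
    on (ofSection B t s) h (Torsor.triv (𝟙 X) 1) = s := by
  rw [on_ofSection, Torsor.ac_one, Torsor.rs_id]

lemma hom_ext_trivial {X : C} {u v : (⟨X, Torsor.trivial G X⟩ : Tors G) ⟶ B}
    (h : u.base = v.base) (h' : ∀ (z : X ⟶ B.base) (hu : 𝟙 X ≫ u.base = z)
      (hv : 𝟙 X ≫ v.base = z), on u hu (Torsor.triv (𝟙 X) 1) = on v hv (Torsor.triv (𝟙 X) 1)) :
    u = v := by
  refine hom_ext h fun {Y} y a z hu hv => ?_
  have e : a = (Torsor.trivial G X).ac ((Torsor.trivial G X).rs y (Category.comp_id y)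
      (Torsor.triv (𝟙 X) 1)) (show G.obj.obj (op Y) from a) := by
    rw [Torsor.triv_rs, map_one, Torsor.triv_ac, one_mul]
  have key := h' v.base (by rw [h, Category.id_comp]) (Category.id_comp _)
  have key' := congrArg (B.torsor.rs y hv) key
  rw [rs_on u y _ (Category.comp_id y), rs_on v y _ (Category.comp_id y)] at key'
  rw [e]
  refine (on_ac u hu _ _).trans (Eq.trans ?_ (on_ac v hv _ _).symm)
  rw [key']

/-- The section corresponding to a morphism from a trivial torsor: its value at `1`. -/
def toSection {X : C} (u : (⟨X, Torsor.trivial G X⟩ : Tors G) ⟶ B) {t : X ⟶ B.base}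
    (h : u.base = t) : B.torsor.sec t :=
  on u (by rw [h, Category.id_comp]) (Torsor.triv (𝟙 X) 1)

@[simp]
lemma toSection_ofSection {X : C} (t : X ⟶ B.base) (s : B.torsor.sec t)
    (h : (ofSection B t s).base = t) : toSection (ofSection B t s) h = s :=
  on_ofSection_one _ _ _ _

lemma ofSection_toSection {X : C} (u : (⟨X, Torsor.trivial G X⟩ : Tors G) ⟶ B) {t : X ⟶ B.base}
    (h : u.base = t) : ofSection B t (toSection u h) = u := by
  subst h
  refine hom_ext_trivial rfl fun z hu hv => ?_
  obtain rfl : u.base = z := by rw [← hv, Category.id_comp]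
  rw [on_ofSection_one]
  rfl

lemma ofSection_injective {X : C} {t : X ⟶ B.base} {s s' : B.torsor.sec t}
    (h : ofSection B t s = ofSection B t s') : s = s' := by
  rw [← toSection_ofSection t s rfl, ← toSection_ofSection t s' rfl]
  congr 1

@[simp]
lemma trivialMap_base {X' X : C} (g : X' ⟶ X) : (trivialMap G g).base = g := rfl

lemma on_trivialMap {X' X : C} (g : X' ⟶ X) {y : Y ⟶ X'} {z : Y ⟶ X}
    (h : y ≫ (trivialMap G g).base = z) (a : G.obj.obj (op Y)) :
    on (trivialMap G g) h (Torsor.triv y a) = Torsor.triv z a := by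
  subst h
  exact on_rfl (trivialMap G g) _

lemma trivialMap_comp_ofSection (B : Tors G) {X X' : C} (g : X' ⟶ X) (t : X ⟶ B.base)
    {t' : X' ⟶ B.base} (h : g ≫ t = t') (s : B.torsor.sec t) :
    trivialMap G g ≫ ofSection B t s = ofSection B t' (B.torsor.rs g h s) := by
  refine hom_ext_trivial h fun z hu hv => ?_
  obtain rfl : t' = z := by rw [← hv, ofSection_base, Category.id_comp]
  rw [on_ofSection_one, on_comp (trivialMap G g) (ofSection B t s) (z := g) (by simp)
      (by rw [ofSection_base, h]),
    on_trivialMap, on_ofSection, Torsor.ac_one]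

lemma ofSection_comp {B D : Tors G} {X : C} (t : X ⟶ B.base) (s : B.torsor.sec t) (u : B ⟶ D)
    {t' : X ⟶ D.base} (h : t ≫ u.base = t') :
    ofSection B t s ≫ u = ofSection D t' (on u h s) := by
  refine hom_ext_trivial h fun z hu hv => ?_
  obtain rfl : t' = z := by rw [← hv, ofSection_base, Category.id_comp]
  rw [on_ofSection_one, on_comp (ofSection B t s) u (z := t) (by simp) h, on_ofSection_one]

/-- Morphisms out of `A` are determined by their composites with the sections of `A`. -/
lemma hom_ext_ofSection {u v : A ⟶ B} (hb : u.base = v.base)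
    (h : ∀ {Y : C} (y : Y ⟶ A.base) (s : A.torsor.sec y),
      ofSection A y s ≫ u = ofSection A y s ≫ v) : u = v := by
  refine hom_ext hb fun {Y} y s z hu hv => ?_
  have := h y s
  rw [ofSection_comp y s u hu, ofSection_comp y s v hv] at this
  exact ofSection_injective this

end Tors

end TorsMorphisms

/-! ### Torsors presented by sections in any universe -/

section PreTorsors

universe t w v₁ u₁

variable {C : Type u₁} [Category.{v₁} C] {J : GrothendieckTopology C}

/-- A torsor presented by sections in an arbitrary universe, with restriction maps and gluing
expressed through morphisms `Y ⟶ X` rather than on the slice site. -/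
structure PreTorsor (G : Sheaf J GrpCat.{w}) (X : C) where
  /-- the sections over `y : Y ⟶ X` -/
  sec {Y : C} (y : Y ⟶ X) : Type t
  /-- restriction of sections -/
  rs {Y Z : C} (g : Z ⟶ Y) {y : Y ⟶ X} {z : Z ⟶ X} (h : g ≫ y = z) (s : sec y) : sec z
  rs_id {Y : C} {y : Y ⟶ X} (h : 𝟙 Y ≫ y = y) (s : sec y) : rs (𝟙 Y) h s = s
  rs_rs {Y Z W : C} (g : Z ⟶ Y) (k : W ⟶ Z) {y : Y ⟶ X} {z : Z ⟶ X} {w : W ⟶ X}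
    (h : g ≫ y = z) (h' : k ≫ z = w) (h'' : (k ≫ g) ≫ y = w) (s : sec y) :
    rs k h' (rs g h s) = rs (k ≫ g) h'' s
  /-- the right action -/
  ac {Y : C} {y : Y ⟶ X} (s : sec y) (a : G.obj.obj (op Y)) : sec y
  ac_one {Y : C} {y : Y ⟶ X} (s : sec y) : ac s 1 = s
  ac_mul {Y : C} {y : Y ⟶ X} (s : sec y) (a b : G.obj.obj (op Y)) :
    ac s (a * b) = ac (ac s a) b
  rs_ac {Y Z : C} (g : Z ⟶ Y) {y : Y ⟶ X} {z : Z ⟶ X} (h : g ≫ y = z) (s : sec y)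
    (a : G.obj.obj (op Y)) : rs g h (ac s a) = ac (rs g h s) (G.obj.map g.op a)
  existsUnique_ac {Y : C} {y : Y ⟶ X} (s s' : sec y) :
    ∃! a : G.obj.obj (op Y), ac s a = s'
  existsUnique_glue {Y : C} (y : Y ⟶ X) (R : Sieve Y) (_ : R ∈ J Y)
    (s : ∀ ⦃Z : C⦄ (g : Z ⟶ Y), R g → sec (g ≫ y))
    (_ : ∀ ⦃Z Z' : C⦄ (g : Z ⟶ Y) (k : Z' ⟶ Z) (hg : R g) (h : k ≫ g ≫ y = (k ≫ g) ≫ y),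
      rs k h (s g hg) = s (k ≫ g) (R.downward_closed hg k)) :
    ∃! s' : sec y, ∀ ⦃Z : C⦄ (g : Z ⟶ Y) (hg : R g), rs g rfl s' = s g hg
  locally_nonempty : ∃ R ∈ J X, ∀ ⦃Y : C⦄ (f : Y ⟶ X), R f → Nonempty (sec f)

namespace PreTorsor

variable {G : Sheaf J GrpCat.{w}} {X : C} (P : PreTorsor.{t} G X)

/-- Sections of a torsor are in bijection with `G(Y)` as soon as there is one. -/
instance small_sec {Y : C} (y : Y ⟶ X) : Small.{w} (P.sec y) := by
  rcases isEmpty_or_nonempty (P.sec y) with h | ⟨⟨s⟩⟩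
  · infer_instance
  · exact small_of_surjective (f := fun a : G.obj.obj (op Y) => P.ac s a)
      fun s' => (P.existsUnique_ac s s').exists

/-- The presheaf on `C/X` of sections of a `PreTorsor`. -/
def presheaf : (Over X)ᵒᵖ ⥤ Type t where
  obj Y := P.sec Y.unop.hom
  map k := ↾fun s => P.rs k.unop.left (Over.w k.unop) s
  map_id Y := by
    ext s
    exact P.rs_id _ s
  map_comp k l := by
    ext s
    exact (P.rs_rs _ _ _ _ _ s).symm

/-- The presheaf `PreTorsor.presheaf`, in the universe of `G`. -/
noncomputable def shrinkPresheaf : (Over X)ᵒᵖ ⥤ Type w where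
  obj Y := Shrink.{w} (P.sec Y.unop.hom)
  map k := ↾fun s => equivShrink _ (P.rs k.unop.left (Over.w k.unop) ((equivShrink _).symm s))
  map_id Y := by
    apply ConcreteCategory.hom_ext
    intro s
    exact (congrArg (equivShrink _) (P.rs_id (Category.id_comp _) _)).trans
      (Equiv.apply_symm_apply _ _)
  map_comp k l := by
    apply ConcreteCategory.hom_ext
    intro s
    refine congrArg (equivShrink _) ?_
    refine (P.rs_rs _ _ (Over.w k.unop) (Over.w l.unop) (Over.w (k ≫ l).unop) _).symm.trans ?_
    exact congrArg _ (Equiv.symm_apply_apply _ _).symm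

lemma presheaf_isSheaf : Presieve.IsSheaf (J.over X) P.presheaf := by
  intro Y R hR x hx
  obtain ⟨s, hs, hs'⟩ := P.existsUnique_glue Y.hom (Sieve.overEquiv Y R) hR
    (fun Z g hg => x (Over.homMk g : Over.mk (g ≫ Y.hom) ⟶ Y) ((Sieve.overEquiv_iff _ _).1 hg))
    (fun Z Z' g k hg h => by
      have := hx (Over.homMk k : Over.mk ((k ≫ g) ≫ Y.hom) ⟶ Over.mk (g ≫ Y.hom)) (𝟙 _)
        (f₁ := (Over.homMk g : Over.mk (g ≫ Y.hom) ⟶ Y))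
        (f₂ := (Over.homMk (k ≫ g) : Over.mk ((k ≫ g) ≫ Y.hom) ⟶ Y))
        ((Sieve.overEquiv_iff _ _).1 hg)
        ((Sieve.overEquiv_iff _ _).1 ((Sieve.overEquiv Y R).downward_closed hg k))
        (by ext; simp)
      exact this.trans (P.rs_id (Category.id_comp _) _))
  refine ⟨s, fun Z g hg => ?_, fun s₁ h₁ => hs' s₁ fun Z g hg =>
    h₁ (Over.homMk g : Over.mk (g ≫ Y.hom) ⟶ Y) ((Sieve.overEquiv_iff _ _).1 hg)⟩
  obtain ⟨g', w', hgw⟩ : ∃ (g' : Z.left ⟶ Y.left) (w' : g' ≫ Y.hom = Z.hom),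
    g = Over.homMk g' w' := ⟨g.left, Over.w g, rfl⟩
  subst hgw
  obtain ⟨Z, ⟨⟨⟩⟩, z⟩ := Z
  change Z ⟶ Y.left at g'
  change g' ≫ Y.hom = z at w'
  subst w'
  exact hs g' ((Sieve.overEquiv_iff _ _).2 hg)

/-- The torsor given by a `PreTorsor`. -/
noncomputable def toTorsor : Torsor G X where
  val := P.shrinkPresheaf
  isSheaf := by
    rw [isSheaf_iff_isSheaf_of_type]
    exact Presieve.isSheaf_of_nat_equiv (P₁ := P.presheaf)
      (fun Y => equivShrink (P.sec Y.hom))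
      (fun Y Z f x => congrArg (fun q => equivShrink (P.sec _) (P.rs f.left (Over.w f) q))
        (Equiv.symm_apply_apply (equivShrink (P.sec _)) x).symm) P.presheaf_isSheaf
  act {Y} s a := equivShrink _ (P.ac ((equivShrink _).symm s) a)
  act_one s := (congrArg (equivShrink _) (P.ac_one _)).trans (Equiv.apply_symm_apply _ _)
  act_mul s a b := (congrArg (equivShrink _) (P.ac_mul _ a b)).trans
    (congrArg (fun q => equivShrink _ (P.ac q b)) (Equiv.symm_apply_apply _ _).symm)
  map_act k s a := by
    refine congrArg (equivShrink _) ?_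
    refine (congrArg _ (Equiv.symm_apply_apply _ _)).trans ?_
    refine (P.rs_ac _ _ _ _).trans ?_
    exact congrArg (fun q => P.ac q _) (Equiv.symm_apply_apply _ _).symm
  existsUnique_act {Y} s s' := by
    obtain ⟨a, ha, ha'⟩ :=
      P.existsUnique_ac (y := Y.hom) ((equivShrink _).symm s) ((equivShrink _).symm s')
    exact ⟨a, (Equiv.eq_symm_apply _).1 ha, fun b hb => ha' b ((Equiv.eq_symm_apply _).2 hb)⟩
  locally_nonempty := by
    obtain ⟨R, hR, h⟩ := P.locally_nonempty
    exact ⟨R, hR, fun Y f hf => (h f hf).map (equivShrink _)⟩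

/-- The sections of `P.toTorsor` are those of `P`. -/
noncomputable def equiv {Y : C} (y : Y ⟶ X) : P.sec y ≃ P.toTorsor.sec y := equivShrink _

lemma rs_equiv {Y Z : C} (g : Z ⟶ Y) {y : Y ⟶ X} {z : Z ⟶ X} (h : g ≫ y = z) (s : P.sec y) :
    P.toTorsor.rs g h (P.equiv y s) = P.equiv z (P.rs g h s) :=
  congrArg (fun q => equivShrink _ (P.rs g h q)) (Equiv.symm_apply_apply _ _)

lemma ac_equiv {Y : C} {y : Y ⟶ X} (s : P.sec y) (a : G.obj.obj (op Y)) :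
    P.toTorsor.ac (P.equiv y s) a = P.equiv y (P.ac s a) :=
  congrArg (fun q => equivShrink _ (P.ac q a)) (Equiv.symm_apply_apply _ _)

lemma rs_equiv_symm {Y Z : C} (g : Z ⟶ Y) {y : Y ⟶ X} {z : Z ⟶ X} (h : g ≫ y = z)
    (s : P.toTorsor.sec y) :
    (P.equiv z).symm (P.toTorsor.rs g h s) = P.rs g h ((P.equiv y).symm s) := by
  obtain ⟨s, rfl⟩ := (P.equiv y).surjective s
  rw [rs_equiv, Equiv.symm_apply_apply, Equiv.symm_apply_apply]

lemma ac_equiv_symm {Y : C} {y : Y ⟶ X} (s : P.toTorsor.sec y) (a : G.obj.obj (op Y)) :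
    (P.equiv y).symm (P.toTorsor.ac s a) = P.ac ((P.equiv y).symm s) a := by
  obtain ⟨s, rfl⟩ := (P.equiv y).surjective s
  rw [ac_equiv, Equiv.symm_apply_apply, Equiv.symm_apply_apply]

end PreTorsor

end PreTorsors

/-! ### Categories fibered in groupoids and gluing of morphisms -/

section GroupoidFibrations

universe v₁ v₂ u₁ u₂

variable {C : Type u₁} [Category.{v₁} C] {E : Type u₂} [Category.{v₂} E]

/-- A functor all of whose morphisms are strongly cartesian and that admits pullbacks of objects
(a category fibered in groupoids), expressed without lifting predicates. -/
structure IsGroupoidFibration (p : E ⥤ C) : Prop where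
  exists_lift {a b d : E} (u : a ⟶ b) (v : d ⟶ b) (g : p.obj d ⟶ p.obj a)
    (h : g ≫ p.map u = p.map v) : ∃ w : d ⟶ a, p.map w = g ∧ w ≫ u = v
  hom_ext {a b d : E} {w w' : d ⟶ a} (u : a ⟶ b) (h : p.map w = p.map w')
    (h' : w ≫ u = w' ≫ u) : w = w'
  exists_pullback (b : E) {X : C} (g : X ⟶ p.obj b) :
    ∃ (a : E) (e : p.obj a = X) (u : a ⟶ b), p.map u = eqToHom e ≫ g

namespace IsGroupoidFibration

variable {p : E ⥤ C} (hp : IsGroupoidFibration p)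

include hp

lemma isStronglyCartesian {X Y : C} {a b : E} (f : X ⟶ Y) (u : a ⟶ b) (h : p.IsHomLift f u) :
    p.IsStronglyCartesian f u := by
  obtain ⟨⟩ := h
  refine ⟨fun {d} g v hv => ?_⟩
  have hv' : p.map v = g ≫ p.map u := (IsHomLift.eq_of_isHomLift p _ v).symm
  obtain ⟨w, hw, hw'⟩ := hp.exists_lift u v g hv'.symm
  subst hw
  refine ⟨w, ⟨inferInstance, hw'⟩, fun w' ⟨h1, h2⟩ => ?_⟩
  exact hp.hom_ext u (IsHomLift.eq_of_isHomLift p _ w').symm (h2.trans hw'.symm)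

lemma isFibered : p.IsFibered := by
  refine Functor.IsFibered.of_exists_isStronglyCartesian fun b X g => ?_
  obtain ⟨a, rfl, u, hu⟩ := hp.exists_pullback b g
  refine ⟨a, u, hp.isStronglyCartesian _ _ ?_⟩
  obtain rfl : g = p.map u := by simpa using hu.symm
  infer_instance

lemma isIso_of_isIso_map {a b : E} (u : a ⟶ b) [IsIso (p.map u)] : IsIso u := by
  obtain ⟨v, hv, hvu⟩ := hp.exists_lift u (𝟙 b) (inv (p.map u)) (by simp)
  refine ⟨v, hp.hom_ext u ?_ ?_, hvu⟩
  · rw [p.map_comp, hv, IsIso.hom_inv_id, p.map_id]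
  · rw [Category.assoc, hvu, Category.comp_id, Category.id_comp]

lemma isIso_fiberHom {X : C} {x x' : p.Fiber X} (φ : x ⟶ x') : IsIso φ := by
  obtain ⟨x, rfl⟩ := x
  obtain ⟨x', e⟩ := x'
  obtain ⟨φ, hφ⟩ := φ
  change x ⟶ x' at φ
  have h1 : IsIso (p.map φ) := by
    have := IsHomLift.fac' p (𝟙 (p.obj x)) φ
    rw [this]
    infer_instance
  have h2 := hp.isIso_of_isIso_map φ
  have h3 : p.IsHomLift (𝟙 (p.obj x)) (inv φ) := inferInstance
  exact ⟨⟨inv φ, h3⟩, Subtype.ext (IsIso.hom_inv_id φ), Subtype.ext (IsIso.inv_hom_id φ)⟩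

end IsGroupoidFibration

/-- Morphisms `a ⟶ b` over a given `φ` can be glued from compatible families indexed by the
morphisms `z ⟶ a` lying over a covering sieve. -/
def HomsGlue (p : E ⥤ C) (J : GrothendieckTopology C) : Prop :=
  ∀ ⦃a b : E⦄ (φ : p.obj a ⟶ p.obj b) (R : Sieve (p.obj a)) (_ : R ∈ J (p.obj a))
    (m : ∀ ⦃z : E⦄ (u : z ⟶ a), R (p.map u) → (z ⟶ b))
    (_ : ∀ ⦃z : E⦄ (u : z ⟶ a) (hu : R (p.map u)), p.map (m u hu) = p.map u ≫ φ)
    (_ : ∀ ⦃z z' : E⦄ (u : z ⟶ a) (v : z' ⟶ z) (hu : R (p.map u)) (hvu : R (p.map (v ≫ u))),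
      m (v ≫ u) hvu = v ≫ m u hu),
    ∃! n : a ⟶ b, p.map n = φ ∧ ∀ ⦃z : E⦄ (u : z ⟶ a) (hu : R (p.map u)), u ≫ n = m u hu

/-- Effectivity of descent data: objects `x i` over the members of a covering of `X`, with
isomorphisms of their restrictions to the fiber products, given by spans `l i j`, `r i j`, that
satisfy the cocycle condition, are glued to an object over `X`. -/
def ObjectsGlue (p : E ⥤ C) (J : GrothendieckTopology C) : Prop :=
  ∀ ⦃X : C⦄ ⦃ι : Type (max u₁ v₁)⦄ (x : ι → E) (f : ∀ i, p.obj (x i) ⟶ X)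
    (_ : Sieve.ofArrows (fun i => p.obj (x i)) f ∈ J X) (z : ι → ι → E)
    (l : ∀ i j, z i j ⟶ x i) (r : ∀ i j, z i j ⟶ x j)
    (_ : ∀ i j, IsPullback (p.map (l i j)) (p.map (r i j)) (f i) (f j))
    (_ : ∀ (i j k : ι) (o : E) (α : o ⟶ z i j) (β : o ⟶ z j k) (γ : o ⟶ z i k),
      α ≫ r i j = β ≫ l j k → α ≫ l i j = γ ≫ l i k →
      p.map (β ≫ r j k) = p.map (γ ≫ r i k) → β ≫ r j k = γ ≫ r i k),
    ∃ (y : E) (e : X = p.obj y) (k : ∀ i, x i ⟶ y),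
      (∀ i, p.map (k i) = f i ≫ eqToHom e) ∧ ∀ i j, l i j ≫ k i = r i j ≫ k j

variable {p : E ⥤ C} {J : GrothendieckTopology C}

/-- Gluing of morphisms between objects of one fiber, with the condition on underlying morphisms
expressed by `IsHomLift`, as it is for the chosen pullbacks. -/
lemma HomsGlue.fiber (h : HomsGlue p J) {Y : C} (a b : p.Fiber Y) (R : Sieve Y) (hR : R ∈ J Y)
    (m : ∀ ⦃Z : C⦄ (g : Z ⟶ Y) (_ : R g) (z : E) (u : z ⟶ a.1), p.IsHomLift g u → (z ⟶ b.1))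
    (hm : ∀ ⦃Z : C⦄ (g : Z ⟶ Y) (hg : R g) (z : E) (u : z ⟶ a.1) (hu : p.IsHomLift g u),
      p.IsHomLift g (m g hg z u hu))
    (hc : ∀ ⦃Z Z' : C⦄ (g : Z ⟶ Y) (hg : R g) (g' : Z' ⟶ Z) (z z' : E) (u : z ⟶ a.1)
      (v : z' ⟶ z) (hu : p.IsHomLift g u) (_ : p.IsHomLift g' v)
      (hvu : p.IsHomLift (g' ≫ g) (v ≫ u)),
      m (g' ≫ g) (R.downward_closed hg g') z' (v ≫ u) hvu = v ≫ m g hg z u hu) :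
    ∃! n : a ⟶ b, ∀ ⦃Z : C⦄ (g : Z ⟶ Y) (hg : R g) (z : E) (u : z ⟶ a.1)
      (hu : p.IsHomLift g u), u ≫ n.1 = m g hg z u hu := by
  obtain ⟨a, rfl⟩ := a
  obtain ⟨b, e⟩ := b
  obtain ⟨n, ⟨hn, hn'⟩, hu⟩ := h (a := a) (b := b) (eqToHom e.symm) R hR
    (fun z u hu => m (p.map u) hu z u inferInstance)
    (fun z u hu => by
      have := hm (p.map u) hu z u inferInstance
      have := IsHomLift.fac' p (p.map u) (m (p.map u) hu z u inferInstance)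
      simpa using this)
    (fun z z' u v hu hvu => by
      have e : p.map (v ≫ u) = p.map v ≫ p.map u := p.map_comp v u
      have h1 := hc (p.map u) hu (p.map v) z z' u v inferInstance inferInstance inferInstance
      refine Eq.trans ?_ h1
      congr 1)
  have hlift : ∀ n' : a ⟶ b, p.map n' = eqToHom e.symm → p.IsHomLift (𝟙 (p.obj a)) n' := by
    intro n' h'
    exact IsHomLift.of_fac' p _ _ rfl e (by simpa using h')
  refine ⟨⟨n, hlift n hn⟩, ?_, ?_⟩
  · intro Z g hg z u hu'
    obtain rfl := IsHomLift.domain_eq p g u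
    obtain rfl := IsHomLift.eq_of_isHomLift p g u
    exact hn' u hg
  · rintro ⟨n', hl⟩ h'
    refine Subtype.ext (hu n' ⟨?_, fun z u hu => h' _ hu z u inferInstance⟩)
    have := IsHomLift.fac' p (𝟙 (p.obj a)) n'
    simpa using this

/-- If morphisms glue, the presheaf of morphisms between the chosen pullbacks of two objects is a
sheaf.  A section `s'` of it over `g` is turned into the morphisms `z ⟶ x|_Z ⟶ x'|_Z ⟶ x'|_Y`, for
`z ⟶ x|_Y` over `g`, and these are glued. -/
lemma HomsGlue.isSheaf_homPresheaf (h : HomsGlue p J) [p.IsFibered] {X : C} (x x' : p.Fiber X) :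
    Presheaf.IsSheaf (J.over X) (homPresheaf x x') := by
  rw [isSheaf_iff_isSheaf_of_type]
  intro Y R hR s hs
  let ov : ∀ {Z : C} (g : Z ⟶ Y.left), Over.mk (g ≫ Y.hom) ⟶ Y := fun g => Over.homMk g
  have hov : ∀ {Z : C} {g : Z ⟶ Y.left}, Sieve.overEquiv Y R g → R (ov g) := fun hg =>
    (Sieve.overEquiv_iff _ _).1 hg
  -- the family `s`, indexed by morphisms of the base and with values in morphisms of the fibers
  obtain ⟨s', hs'⟩ : ∃ s' : ∀ {Z : C} (g : Z ⟶ Y.left) (_ : Sieve.overEquiv Y R g),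
      pull (g ≫ Y.hom) x ⟶ pull (g ≫ Y.hom) x', ∀ {Z : C} (g : Z ⟶ Y.left)
      (hg : Sieve.overEquiv Y R g), s (ov g) (hov hg) = s' g hg := ⟨_, fun _ _ => rfl⟩
  have ipl : ∀ {Z : C} (g : Z ⟶ Y.left), p.IsHomLift g (pullLift g Y.hom _ rfl x) :=
    fun g => inferInstance
  -- the morphism `z ⟶ x|_Z` through which `u : z ⟶ x|_Y` factors
  let q : ∀ {Z : C} (g : Z ⟶ Y.left) (z : E) (u : z ⟶ (pull Y.hom x).1) (_ : p.IsHomLift g u),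
      z ⟶ (pull (g ≫ Y.hom) x).1 := fun g z u hu =>
    Functor.IsCartesian.map p (g ≫ Y.hom) (pullMap (g ≫ Y.hom) x) (u ≫ pullMap Y.hom x)
  have hq : ∀ {Z : C} (g : Z ⟶ Y.left) (z : E) (u : z ⟶ (pull Y.hom x).1)
      (hu : p.IsHomLift g u), p.IsHomLift (𝟙 Z) (q g z u hu) := fun g z u hu => inferInstance
  have hq' : ∀ {Z : C} (g : Z ⟶ Y.left) (z : E) (u : z ⟶ (pull Y.hom x).1)
      (hu : p.IsHomLift g u), q g z u hu ≫ pullMap (g ≫ Y.hom) x = u ≫ pullMap Y.hom x :=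
    fun g z u hu => Functor.IsCartesian.fac ..
  -- the morphisms to be glued
  let m : ∀ ⦃Z : C⦄ (g : Z ⟶ Y.left) (_ : Sieve.overEquiv Y R g) (z : E)
      (u : z ⟶ (pull Y.hom x).1), p.IsHomLift g u → (z ⟶ (pull Y.hom x').1) :=
    fun Z g hg z u hu => q g z u hu ≫ (s' g hg).1 ≫ pullLift g Y.hom _ rfl x'
  have hm : ∀ ⦃Z : C⦄ (g : Z ⟶ Y.left) (hg : Sieve.overEquiv Y R g) (z : E)
      (u : z ⟶ (pull Y.hom x).1) (hu : p.IsHomLift g u), p.IsHomLift g (m g hg z u hu) := by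
    intro Z g hg z u hu
    have := hq g z u hu
    have h1 : p.IsHomLift (𝟙 Z) (s' g hg).1 := (s' g hg).2
    have h2 : p.IsHomLift (𝟙 Z) (q g z u hu ≫ (s' g hg).1) := inferInstance
    have h3 : p.IsHomLift (𝟙 Z ≫ g) ((q g z u hu ≫ (s' g hg).1) ≫
      pullLift g Y.hom _ rfl x') := inferInstance
    simpa [m] using h3
  -- compatibility of the family, in terms of `restrict`
  have hsr : ∀ {Z Z' : C} (g : Z ⟶ Y.left) (hg : Sieve.overEquiv Y R g) (g' : Z' ⟶ Z)
      (hg' : Sieve.overEquiv Y R (g' ≫ g)),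
      restrict (s' g hg) g' ((g' ≫ g) ≫ Y.hom) ((g' ≫ g) ≫ Y.hom)
        (Category.assoc _ _ _) (Category.assoc _ _ _) = s' (g' ≫ g) hg' := by
    intro Z Z' g hg g' hg'
    have := hs (Over.homMk g' : Over.mk ((g' ≫ g) ≫ Y.hom) ⟶ Over.mk (g ≫ Y.hom)) (𝟙 _)
      (f₁ := ov g) (f₂ := ov (g' ≫ g)) (hov hg) (hov hg') (by ext; simp [ov])
    rw [hs', hs'] at this
    refine Eq.trans ?_ (this.trans ?_)
    · rfl
    · exact restrict_id _ (Category.id_comp _).symm (Category.id_comp _).symm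
  obtain ⟨n, hn, hn'⟩ := h.fiber (pull Y.hom x) (pull Y.hom x') (Sieve.overEquiv Y R) hR m hm (by
    intro Z Z' g hg g' z z' u v hu hv hvu
    have i1 := hm g hg z u hu
    have i2 := hm (g' ≫ g) (Sieve.downward_closed _ hg g') z' (v ≫ u) hvu
    have i3 : p.IsHomLift (g' ≫ g) (v ≫ m g hg z u hu) := inferInstance
    refine Functor.IsStronglyCartesian.ext p Y.hom (pullMap Y.hom x') (g' ≫ g) ?_
    simp only [m, Category.assoc, pullLift_pullMap]
    rw [← hsr g hg g' (Sieve.downward_closed _ hg g'), restrict_spec, ← Category.assoc,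
      ← Category.assoc v]
    congr 1
    have j1 := hq g z u hu
    have j2 := hq (g' ≫ g) z' (v ≫ u) hvu
    have j3 : p.IsHomLift g' (v ≫ q g z u hu) := inferInstance
    have j4 : p.IsHomLift g' (q (g' ≫ g) z' (v ≫ u) hvu ≫
      pullLift g' (g ≫ Y.hom) ((g' ≫ g) ≫ Y.hom) (Category.assoc _ _ _) x) := by
      have : p.IsHomLift (𝟙 Z' ≫ g') (q (g' ≫ g) z' (v ≫ u) hvu ≫
        pullLift g' (g ≫ Y.hom) ((g' ≫ g) ≫ Y.hom) (Category.assoc _ _ _) x) := inferInstance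
      simpa using this
    refine Functor.IsStronglyCartesian.ext p (g ≫ Y.hom) (pullMap (g ≫ Y.hom) x) g' ?_
    simp only [Category.assoc, pullLift_pullMap]
    rw [hq' (g' ≫ g) z' (v ≫ u) hvu, hq' g z u hu, Category.assoc])
  -- that `n'` restricts to `s'` is a statement about composites with the projections to `x|_Y`,
  -- `x'|_Y`
  have key : ∀ (n' : pull Y.hom x ⟶ pull Y.hom x') {Z : C} (g : Z ⟶ Y.left)
      (hg : Sieve.overEquiv Y R g),
      restrict n' g (g ≫ Y.hom) (g ≫ Y.hom) rfl rfl = s' g hg ↔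
        pullLift g Y.hom _ rfl x ≫ n'.1 =
          (s' g hg).1 ≫ pullLift g Y.hom _ rfl x' := by
    intro n' Z g hg
    constructor
    · intro e
      rw [← restrict_pullLift, e]
    · intro e
      refine fiberHom_ext ?_
      rw [restrict_spec, ← Category.assoc, e, Category.assoc, pullLift_pullMap]
  have hamal : ∀ (n' : pull Y.hom x ⟶ pull Y.hom x'),
      (s.IsAmalgamation (show (homPresheaf x x').obj (op Y) from n')) ↔
      ∀ {Z : C} (g : Z ⟶ Y.left) (hg : Sieve.overEquiv Y R g),
        restrict n' g (g ≫ Y.hom) (g ≫ Y.hom) rfl rfl = s' g hg := by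
    intro n'
    constructor
    · intro ha Z g hg
      exact (ha (ov g) (hov hg)).trans (hs' g hg)
    · intro ha Z g hg
      obtain ⟨g', w', hgw⟩ : ∃ (g' : Z.left ⟶ Y.left) (w' : g' ≫ Y.hom = Z.hom),
        g = Over.homMk g' w' := ⟨g.left, Over.w g, rfl⟩
      subst hgw
      obtain ⟨Z, ⟨⟨⟩⟩, z⟩ := Z
      change Z ⟶ Y.left at g'
      change g' ≫ Y.hom = z at w'
      subst w'
      exact (ha g' ((Sieve.overEquiv_iff _ _).2 hg)).trans (hs' _ _).symm
  have qpl : ∀ {Z : C} (g : Z ⟶ Y.left), q g _ (pullLift g Y.hom _ rfl x) (ipl g) = 𝟙 _ := by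
    intro Z g
    have := hq g _ (pullLift g Y.hom _ rfl x) (ipl g)
    have : p.IsHomLift (𝟙 Z) (𝟙 (pull (g ≫ Y.hom) x).1) := IsHomLift.id (pull (g ≫ Y.hom) x).2
    refine Functor.IsCartesian.ext p (g ≫ Y.hom) (pullMap (g ≫ Y.hom) x) _ _ ?_
    rw [hq' g _ _ (ipl g), pullLift_pullMap, Category.id_comp]
  refine ⟨n, (hamal n).2 fun {Z} g hg => (key n g hg).2 ?_, fun n' h' => hn' n' ?_⟩
  · rw [hn g hg _ (pullLift g Y.hom _ rfl x) (ipl g)]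
    simp only [m]
    rw [qpl, Category.id_comp]
  · intro Z g hg z u hu
    have h1 := (key n' g hg).1 ((hamal n').1 h' g hg)
    have i1 := hq g z u hu
    have h2 : q g z u hu ≫ pullLift g Y.hom _ rfl x = u := by
      have : p.IsHomLift (𝟙 Z ≫ g) (q g z u hu ≫ pullLift g Y.hom _ rfl x) := inferInstance
      rw [Category.id_comp] at this
      refine Functor.IsStronglyCartesian.ext p Y.hom (pullMap Y.hom x) g ?_
      rw [Category.assoc, pullLift_pullMap, hq' g z u hu]
    simp only [m]
    rw [← h1, ← Category.assoc, h2]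

end GroupoidFibrations

/-! ### A criterion for gerbes -/

section Gerbes

universe v₁ v₂ u₁ u₂

variable {C : Type u₁} [Category.{v₁} C] {E : Type u₂} [Category.{v₂} E]
  {p : E ⥤ C} {J : GrothendieckTopology C}

/-- An object, as an object of its fiber. -/
abbrev fiberObj (p : E ⥤ C) (a : E) : p.Fiber (p.obj a) := ⟨a, rfl⟩

/-- The morphism `h^*φ` is determined by its effect on morphisms into `k^*x`. -/
lemma comp_restrict [p.IsFibered] {X X' Y Z : C} {f : Y ⟶ X} {f' : Y ⟶ X'} {x : p.Fiber X}
    {x' : p.Fiber X'} (φ : pull f x ⟶ pull f' x') (h : Z ⟶ Y) (k : Z ⟶ X) (k' : Z ⟶ X')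
    (hk : k = h ≫ f) (hk' : k' = h ≫ f') {o : E} (q : o ⟶ (pull k x).1) (α : o ⟶ (pull f x).1)
    (hq : p.IsHomLift (𝟙 Z) q) (hα : p.IsHomLift h α)
    (e : α ≫ pullMap f x = q ≫ pullMap k x) :
    q ≫ (restrict φ h k k' hk hk').1 ≫ pullMap k' x' = α ≫ φ.1 ≫ pullMap f' x' := by
  have h1 : α = q ≫ pullLift h f k hk x := by
    have : p.IsHomLift h (q ≫ pullLift h f k hk x) := by
      have : p.IsHomLift (𝟙 Z ≫ h) (q ≫ pullLift h f k hk x) := inferInstance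
      simpa using this
    refine Functor.IsStronglyCartesian.ext p f (pullMap f x) h ?_
    rw [Category.assoc, pullLift_pullMap, e]
  rw [restrict_spec, h1, Category.assoc]

lemma map_eq_of_isHomLift {a b : E} {X Y : C} (f : X ⟶ Y) (u : a ⟶ b) [p.IsHomLift f u]
    (e : p.obj b = Y) : p.map u = eqToHom (IsHomLift.domain_eq p f u) ≫ f ≫ eqToHom e.symm :=
  IsHomLift.fac' p f u

/-- Effectivity of descent data expressed by chosen pullbacks, for objects of the form
`fiberObj p (x i)`: the span for `i`, `j` consists of the projection of `pr₁^* (x i)` and of `ψ i j`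
followed by the projection of `pr₂^* (x j)`. -/
lemma ObjectsGlue.descent_aux (h : ObjectsGlue p J) (hp : IsGroupoidFibration p) [HasPullbacks C]
    [p.IsFibered]
    {X : C} {ι : Type (max u₁ v₁)} (x : ι → E) (f : ∀ i, p.obj (x i) ⟶ X)
    (hf : Sieve.ofArrows (fun i => p.obj (x i)) f ∈ J X)
    (ψ : ∀ i j, pull (pullback.fst (f i) (f j)) (fiberObj p (x i)) ≅
      pull (pullback.snd (f i) (f j)) (fiberObj p (x j)))
    (cocycle : ∀ (i j k : ι) (Z : C) (a : Z ⟶ p.obj (x i)) (b : Z ⟶ p.obj (x j))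
      (c : Z ⟶ p.obj (x k)) (hab : a ≫ f i = b ≫ f j) (hbc : b ≫ f j = c ≫ f k),
      restrict (ψ i j).hom (pullback.lift a b hab) a b
          (pullback.lift_fst _ _ _).symm (pullback.lift_snd _ _ _).symm ≫
        restrict (ψ j k).hom (pullback.lift b c hbc) b c
          (pullback.lift_fst _ _ _).symm (pullback.lift_snd _ _ _).symm =
      restrict (ψ i k).hom (pullback.lift a c (hab.trans hbc)) a c
          (pullback.lift_fst _ _ _).symm (pullback.lift_snd _ _ _).symm) :
    ∃ (y : p.Fiber X) (α : ∀ i, (fiberObj p (x i)) ≅ pull (f i) y), ∀ i j,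
      (ψ i j).hom.1 ≫ pullMap (pullback.snd (f i) (f j)) (fiberObj p (x j)) ≫
          (α j).hom.1 ≫ pullMap (f j) y =
        pullMap (pullback.fst (f i) (f j)) (fiberObj p (x i)) ≫
          (α i).hom.1 ≫ pullMap (f i) y := by
  let x' : ∀ i, p.Fiber (p.obj (x i)) := fun i => fiberObj p (x i)
  let l : ∀ i j, (pull (pullback.fst (f i) (f j)) (x' i)).1 ⟶ x i := fun i j => pullMap _ (x' i)
  let r : ∀ i j, (pull (pullback.fst (f i) (f j)) (x' i)).1 ⟶ x j := fun i j =>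
    (ψ i j).hom.1 ≫ pullMap _ (x' j)
  have hz : ∀ i j, p.obj (pull (pullback.fst (f i) (f j)) (x' i)).1 = pullback (f i) (f j) :=
    fun i j => (pull _ _).2
  have ll : ∀ i j, p.map (l i j) = eqToHom (hz i j) ≫ pullback.fst (f i) (f j) := fun i j => by
    have : p.IsHomLift (pullback.fst (f i) (f j)) (l i j) :=
      inferInstanceAs (p.IsHomLift _ (pullMap _ (x' i)))
    simpa using map_eq_of_isHomLift (pullback.fst (f i) (f j)) (l i j) rfl
  have lr : ∀ i j, p.map (r i j) = eqToHom (hz i j) ≫ pullback.snd (f i) (f j) := fun i j => by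
    have : p.IsHomLift (pullback.snd (f i) (f j)) (r i j) := by
      have h1 : p.IsHomLift (𝟙 _) (ψ i j).hom.1 := (ψ i j).hom.2
      have h2 : p.IsHomLift (pullback.snd (f i) (f j))
          (pullMap (pullback.snd (f i) (f j)) (x' j)) := inferInstance
      have : p.IsHomLift (𝟙 _ ≫ pullback.snd (f i) (f j)) (r i j) :=
        inferInstanceAs (p.IsHomLift _ ((ψ i j).hom.1 ≫ pullMap _ (x' j)))
      simpa using this
    simpa using map_eq_of_isHomLift (pullback.snd (f i) (f j)) (r i j) rfl
  -- a morphism to the apex of the span lies over the morphism to the fiber product given by its two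
  -- composites
  have hl : ∀ {i j : ι} {o : E} (α : o ⟶ (pull (pullback.fst (f i) (f j)) (x' i)).1)
      (a : p.obj o ⟶ p.obj (x i)) (b : p.obj o ⟶ p.obj (x j)) (ha : p.map (α ≫ l i j) = a)
      (hb : p.map (α ≫ r i j) = b) (hab : a ≫ f i = b ≫ f j),
      p.IsHomLift (pullback.lift a b hab) α := by
    intro i j o α a b ha hb hab
    refine IsHomLift.of_fac' p _ _ rfl (hz i j) ?_
    rw [← cancel_mono (eqToHom (hz i j))]
    apply pullback.hom_ext
    · simp only [Category.assoc, pullback.lift_fst, eqToHom_refl, Category.id_comp,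
        eqToHom_trans_assoc]
      rw [← ha, p.map_comp, ll]
    · simp only [Category.assoc, pullback.lift_snd, eqToHom_refl, Category.id_comp,
        eqToHom_trans_assoc]
      rw [← hb, p.map_comp, lr]
  obtain ⟨y, e, k, hk, hk'⟩ := h x f hf (fun i j => (pull (pullback.fst (f i) (f j)) (x' i)).1) l r
    (fun i j => IsPullback.of_iso_pullback ⟨by rw [ll, lr, Category.assoc, Category.assoc,
      pullback.condition]⟩ (eqToIso (hz i j)) (ll i j).symm (lr i j).symm)
    (by
      intro i j k o α β γ h1 h2 h3
      obtain ⟨a, ha⟩ : ∃ a, a = p.map (α ≫ l i j) := ⟨_, rfl⟩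
      obtain ⟨b, hb⟩ : ∃ b, b = p.map (α ≫ r i j) := ⟨_, rfl⟩
      obtain ⟨c, hc⟩ : ∃ c, c = p.map (β ≫ r j k) := ⟨_, rfl⟩
      have hab : a ≫ f i = b ≫ f j := by
        rw [ha, hb, p.map_comp, p.map_comp, ll, lr]
        simp [pullback.condition]
      have hbc : b ≫ f j = c ≫ f k := by
        rw [hb, hc, h1, p.map_comp, p.map_comp, ll, lr]
        simp [pullback.condition]
      have iα := hl α a b ha.symm hb.symm hab
      have iβ := hl β b c (by rw [hb, h1]) hc.symm hbc
      have iγ := hl γ a c (by rw [ha, h2]) (by rw [hc, h3]) (hab.trans hbc)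
      have ia : p.IsHomLift a (α ≫ l i j) := by rw [ha]; infer_instance
      -- `o` is compared with `a^* (x i)`, on which the cocycle condition holds; by `comp_restrict`,
      -- each `ψ` may be evaluated after restriction to `o`
      let q : o ⟶ (pull a (x' i)).1 := Functor.IsCartesian.map p a (pullMap a (x' i)) (α ≫ l i j)
      have iq : p.IsHomLift (𝟙 (p.obj o)) q := inferInstance
      have hq : q ≫ pullMap a (x' i) = α ≫ l i j := Functor.IsCartesian.fac ..
      have c1 := comp_restrict (ψ i j).hom (pullback.lift a b hab) a b
        (pullback.lift_fst _ _ _).symm (pullback.lift_snd _ _ _).symm q α iq iα hq.symm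
      have c3 := comp_restrict (ψ i k).hom (pullback.lift a c (hab.trans hbc)) a c
        (pullback.lift_fst _ _ _).symm (pullback.lift_snd _ _ _).symm q γ iq iγ
        (h2.symm.trans hq.symm)
      have iq' : p.IsHomLift (𝟙 (p.obj o)) (q ≫ (restrict (ψ i j).hom (pullback.lift a b hab) a b
        (pullback.lift_fst _ _ _).symm (pullback.lift_snd _ _ _).symm).1) := inferInstance
      have c2 := comp_restrict (ψ j k).hom (pullback.lift b c hbc) b c
        (pullback.lift_fst _ _ _).symm (pullback.lift_snd _ _ _).symm _ β iq' iβ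
        (h1.symm.trans (c1.symm.trans (Category.assoc _ _ _).symm))
      refine c2.symm.trans (Eq.trans ?_ c3)
      have := congrArg (fun t => q ≫ t.1 ≫ pullMap c (x' k)) (cocycle i j k _ a b c hab hbc)
      refine Eq.trans ?_ this
      rw [Category.assoc]
      exact congrArg (q ≫ ·) (Category.assoc _ _ _).symm)
  subst e
  have lk : ∀ i, p.IsHomLift (f i) (k i) := fun i => by
    have h1 := hk i
    rw [eqToHom_refl, Category.comp_id] at h1
    rw [← h1]
    infer_instance
  let y' : p.Fiber (p.obj y) := fiberObj p y
  -- morphisms over `f i` are morphisms to the chosen pullback along `f i`, and these are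
  -- isomorphisms as all morphisms of fibers are
  have key : ∀ i, ∃ α : x' i ⟶ pull (f i) y', α.1 ≫ pullMap (f i) y' = k i := fun i => by
    have := lk i
    exact ⟨⟨Functor.IsCartesian.map p (f i) (pullMap (f i) y') (k i), inferInstance⟩,
      Functor.IsCartesian.fac p (f i) (pullMap (f i) y') (k i)⟩
  choose α hα using key
  have iso : ∀ i, IsIso (α i) := fun i => hp.isIso_fiberHom _
  refine ⟨y', fun i => asIso (α i), fun i j => ?_⟩
  have := hk' i j
  rw [← hα i, ← hα j] at this
  exact (Category.assoc _ _ _).symm.trans this.symm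

/-- Effectivity of descent data expressed by chosen pullbacks.  An object of the fiber over `U i` is
replaced by an object of the total category lying over `U i` by definition. -/
lemma ObjectsGlue.descent (h : ObjectsGlue p J) (hp : IsGroupoidFibration p) [HasPullbacks C]
    [p.IsFibered]
    {X : C} {ι : Type (max u₁ v₁)} (U : ι → C) (f : ∀ i, U i ⟶ X)
    (hf : Sieve.ofArrows U f ∈ J X) (x : ∀ i, p.Fiber (U i))
    (ψ : ∀ i j, pull (pullback.fst (f i) (f j)) (x i) ≅ pull (pullback.snd (f i) (f j)) (x j))
    (cocycle : ∀ (i j k : ι) (Z : C) (a : Z ⟶ U i) (b : Z ⟶ U j) (c : Z ⟶ U k)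
      (hab : a ≫ f i = b ≫ f j) (hbc : b ≫ f j = c ≫ f k),
      restrict (ψ i j).hom (pullback.lift a b hab) a b
          (pullback.lift_fst _ _ _).symm (pullback.lift_snd _ _ _).symm ≫
        restrict (ψ j k).hom (pullback.lift b c hbc) b c
          (pullback.lift_fst _ _ _).symm (pullback.lift_snd _ _ _).symm =
      restrict (ψ i k).hom (pullback.lift a c (hab.trans hbc)) a c
          (pullback.lift_fst _ _ _).symm (pullback.lift_snd _ _ _).symm) :
    ∃ (y : p.Fiber X) (α : ∀ i, x i ≅ pull (f i) y), ∀ i j,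
      (ψ i j).hom.1 ≫ pullMap (pullback.snd (f i) (f j)) (x j) ≫ (α j).hom.1 ≫ pullMap (f j) y =
        pullMap (pullback.fst (f i) (f j)) (x i) ≫ (α i).hom.1 ≫ pullMap (f i) y := by
  obtain ⟨x', hx'⟩ : ∃ x' : ι → E, ∀ i, (x i).1 = x' i := ⟨_, fun _ => rfl⟩
  obtain rfl : U = fun i => p.obj (x' i) := funext fun i => by rw [← hx', (x i).2]
  obtain rfl : x = fun i => fiberObj p (x' i) := funext fun i => Subtype.ext (hx' i)
  exact h.descent_aux hp x' f hf ψ cocycle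

/-- A criterion for gerbes that does not mention chosen pullbacks. -/
lemma IsGroupoidFibration.isGerbe (hp : IsGroupoidFibration p) [HasPullbacks C]
    (hh : HomsGlue p J) (ho : ObjectsGlue p J) (hne : ∀ X, ∃ a, p.obj a = X)
    (hiso : ∀ (a b : E) (e : p.obj a = p.obj b), ∃ R ∈ J (p.obj a), ∀ ⦃Y : C⦄ (f : Y ⟶ p.obj a),
      R f → ∃ (z : E) (h : p.obj z = Y) (u : z ⟶ a) (v : z ⟶ b),
        p.map u = eqToHom h ≫ f ∧ p.map v = eqToHom h ≫ f ≫ eqToHom e) : IsGerbe p J := by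
  have := hp.isFibered
  exact
  { isSheaf_hom := fun x x' => hh.isSheaf_homPresheaf x x'
    descent := fun U f hf x ψ c => ho.descent hp U f hf x ψ c
    isIso_fiberHom := fun φ => hp.isIso_fiberHom φ
    locally_nonempty := fun X => ⟨⊤, J.top_mem X, fun Y _ _ =>
      let ⟨a, ha⟩ := hne Y
      ⟨⟨a, ha⟩⟩⟩
    locally_iso := fun {X} x x' => by
      obtain ⟨a, rfl⟩ := x
      obtain ⟨b, e⟩ := x'
      obtain ⟨R, hR, h⟩ := hiso a b e.symm
      refine ⟨R, hR, fun Y f hf => ?_⟩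
      obtain ⟨z, rfl, u, v, hu, hv⟩ := h f hf
      rw [eqToHom_refl, Category.id_comp] at hu hv
      have iu : p.IsHomLift f u := by rw [← hu]; infer_instance
      let b' : p.Fiber (p.obj a) := ⟨b, e⟩
      have iv : p.IsHomLift f v := IsHomLift.of_fac' p _ _ rfl e (by simpa using hv)
      let α : fiberObj p z ⟶ pull f (fiberObj p a) :=
        ⟨Functor.IsCartesian.map p f (pullMap f (fiberObj p a)) u, inferInstance⟩
      let β : fiberObj p z ⟶ pull f b' :=
        ⟨Functor.IsCartesian.map p f (pullMap f b') v, inferInstance⟩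
      have := hp.isIso_fiberHom α
      have := hp.isIso_fiberHom β
      exact ⟨(asIso α).symm ≪≫ asIso β⟩ }

end Gerbes

/-! ### Gluing of morphisms of torsors -/

section TorsStack

universe w v₁ u₁

variable {C : Type u₁} [Category.{v₁} C] {J : GrothendieckTopology C}
  {G : Sheaf J GrpCat.{w}}

namespace Tors

lemma isGroupoidFibration_proj (G : Sheaf J GrpCat.{w}) : IsGroupoidFibration (proj G) where
  exists_lift u v g h := exists_lift u v g h
  hom_ext _ h h' := hom_ext_of_comp h h'
  exists_pullback b _ g := ⟨_, rfl, resMap b g, (Category.id_comp _).symm⟩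

variable {A B : Tors G}

lemma rs_toSection {X X' : C} (u : (⟨X, Torsor.trivial G X⟩ : Tors G) ⟶ B) {t : X ⟶ B.base}
    (h : u.base = t) (g : X' ⟶ X) {t' : X' ⟶ B.base} (e : g ≫ t = t') :
    B.torsor.rs g e (toSection u h) = toSection (trivialMap G g ≫ u) (by rw [← e, ← h]; rfl) := by
  have h1 : trivialMap G g ≫ u = ofSection B t' (B.torsor.rs g e (toSection u h)) := by
    rw [← trivialMap_comp_ofSection, ofSection_toSection]
  have h2 : ∀ (v : (⟨X', Torsor.trivial G X'⟩ : Tors G) ⟶ B) (hv : v.base = t')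
      (_ : v = ofSection B t' (B.torsor.rs g e (toSection u h))),
      B.torsor.rs g e (toSection u h) = toSection v hv := by
    rintro _ hv rfl
    rw [toSection_ofSection]
  exact h2 _ _ h1

lemma ofSection_ac {X : C} (t : X ⟶ B.base) (s : B.torsor.sec t) (a : G.obj.obj (op X)) :
    ofSection B t (B.torsor.ac s a) =
      ofSection ⟨X, Torsor.trivial G X⟩ (𝟙 X) (Torsor.triv (𝟙 X) a) ≫ ofSection B t s := by
  refine Eq.trans ?_ (ofSection_comp (𝟙 X) _ (ofSection B t s) (t' := t) (Category.id_comp t)).symm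
  congr 1
  exact ((on_ofSection B t s _ a).trans (by rw [Torsor.rs_id])).symm

lemma toSection_congr {X : C} {u v : (⟨X, Torsor.trivial G X⟩ : Tors G) ⟶ B} (e : u = v)
    {t : X ⟶ B.base} (h : u.base = t) (h' : v.base = t) : toSection u h = toSection v h' := by
  subst e; rfl

/-- The glued morphism sends `s` to the section that is locally the value at `1` of the given
morphism on the morphism from a trivial torsor corresponding to `s`. -/
lemma homsGlue (G : Sheaf J GrpCat.{w}) : HomsGlue (proj G) J := by
  intro A B φ R hR m hm hmc
  change A.base ⟶ B.base at φ
  change Sieve A.base at R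
  -- `m` with the underlying morphism of its argument as a separate variable
  obtain ⟨m', hm'⟩ : ∃ m' : ∀ {z : Tors G} (u : z ⟶ A) {y : z.base ⟶ A.base} (_ : u.base = y)
      (_ : R y), z ⟶ B, ∀ {z : Tors G} (u : z ⟶ A) (hu : R u.base), m u hu = m' u rfl hu :=
    ⟨fun u _ e hy => m u (show R u.base from e ▸ hy), fun _ _ => rfl⟩
  have hb : ∀ {z : Tors G} (u : z ⟶ A) {y : z.base ⟶ A.base} (e : u.base = y) (hy : R y),
      (m' u e hy).base = y ≫ φ := by
    rintro z u _ rfl hy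
    rw [← hm']
    exact hm u hy
  have hc : ∀ {z z' : Tors G} (v : z' ⟶ z) (u : z ⟶ A) {y : z.base ⟶ A.base} (e : u.base = y)
      (hy : R y) (w : z' ⟶ A) (_ : w = v ≫ u) {y' : z'.base ⟶ A.base} (e' : w.base = y')
      (hy' : R y'), m' w e' hy' = v ≫ m' u e hy := by
    rintro z z' v u _ rfl hy _ rfl _ rfl hy'
    rw [← hm', ← hm']
    exact hmc u v hy hy'
  -- values on sections over morphisms belonging to `R`
  obtain ⟨v, hv⟩ : ∃ v : ∀ {Z : C} (y : Z ⟶ A.base) (_ : R y) (s : A.torsor.sec y)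
      {z : Z ⟶ B.base} (_ : y ≫ φ = z), B.torsor.sec z,
      ∀ {Z : C} (y : Z ⟶ A.base) (hy : R y) (s : A.torsor.sec y) {z : Z ⟶ B.base}
      (e : y ≫ φ = z), ofSection B z (v y hy s e) =
        m' (ofSection A y s) (ofSection_base A y s) hy :=
    ⟨fun y hy s _ e => toSection (m' (ofSection A y s) (ofSection_base A y s) hy)
      ((hb _ _ hy).trans e), fun _ _ _ _ _ => ofSection_toSection _ _⟩
  have hvrs : ∀ {Z Z' : C} (g : Z' ⟶ Z) (y : Z ⟶ A.base) (hy : R y) (s : A.torsor.sec y)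
      {z : Z ⟶ B.base} (e : y ≫ φ = z) {y' : Z' ⟶ A.base} (hy' : R y') {z' : Z' ⟶ B.base}
      (ey : g ≫ y = y') (ez : g ≫ z = z') (e' : y' ≫ φ = z'),
      B.torsor.rs g ez (v y hy s e) = v y' hy' (A.torsor.rs g ey s) e' := by
    intro Z Z' g y hy s z e y' hy' z' ey ez e'
    apply ofSection_injective
    rw [hv, ← trivialMap_comp_ofSection, hv]
    exact (hc _ _ _ hy _ (trivialMap_comp_ofSection A g y ey s).symm _ _).symm
  have hvac : ∀ {Z : C} (y : Z ⟶ A.base) (hy : R y) (s : A.torsor.sec y) {z : Z ⟶ B.base}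
      (e : y ≫ φ = z) (a : G.obj.obj (op Z)),
      v y hy (A.torsor.ac s a) e = B.torsor.ac (v y hy s e) a := by
    intro Z y hy s z e a
    apply ofSection_injective
    rw [hv, ofSection_ac z (v y hy s e) a, hv]
    exact hc _ _ _ hy _ (ofSection_ac _ _ _) _ _
  -- the value on an arbitrary section is glued from the values on its restrictions to members of
  -- `R`
  have key : ∀ (Y : C) (y : Y ⟶ A.base) (s : A.torsor.sec y), ∃ t : B.torsor.sec (y ≫ φ),
      ∀ ⦃Z : C⦄ (g : Z ⟶ Y) (hg : R (g ≫ y)), B.torsor.rs g rfl t =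
        v (g ≫ y) hg (A.torsor.rs g rfl s) (Category.assoc _ _ _) := by
    intro Y y s
    refine B.torsor.glue (J.pullback_stable y hR)
      (fun Z g hg => v (g ≫ y) hg (A.torsor.rs g rfl s) (Category.assoc _ _ _)) ?_
    intro Z Z' g k hg
    have h1 : R ((k ≫ g) ≫ y) := by
      have := R.downward_closed (f := g ≫ y) hg k
      rwa [← Category.assoc] at this
    refine (hvrs k _ hg _ _ (y' := (k ≫ g) ≫ y) h1 (by simp) (by simp) (by simp)).trans ?_
    rw [Torsor.rs_rs]
  choose n hn₀ using key
  have hn : ∀ {Y Z : C} (y : Y ⟶ A.base) (s : A.torsor.sec y) (g : Z ⟶ Y) {y' : Z ⟶ A.base}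
      (hy' : R y') (e : g ≫ y = y') {z : Z ⟶ B.base} (h : g ≫ y ≫ φ = z) (h' : y' ≫ φ = z),
      B.torsor.rs g h (n Y y s) = v y' hy' (A.torsor.rs g e s) h' := by
    rintro Y Z y s g _ hy' rfl _ rfl h'
    exact hn₀ Y y s g hy'
  have hn' : ∀ {Y : C} (y : Y ⟶ A.base) (hy : R y) (s : A.torsor.sec y),
      n Y y s = v y hy s rfl := by
    intro Y y hy s
    refine B.torsor.sec_ext (J.pullback_stable y hR) fun Z g hg => ?_
    rw [hn y s g hg rfl _ (Category.assoc _ _ _)]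
    exact (hvrs g y hy s rfl hg rfl rfl _).symm
  let N : A ⟶ B := mkHom φ (fun {Y} y s => n Y y s)
    (by
      intro Y Z g y z h s
      refine B.torsor.sec_ext (J.pullback_stable z hR) fun Z' k hk => ?_
      rw [hn z _ k hk rfl _ (Category.assoc _ _ _), Torsor.rs_rs, Torsor.rs_rs]
      exact (hn y s (k ≫ g) hk (by rw [Category.assoc, h]) _ _).symm)
    (by
      intro Y y s a
      refine B.torsor.sec_ext (J.pullback_stable y hR) fun Z g hg => ?_
      rw [Torsor.rs_ac, hn y _ g hg rfl _ (Category.assoc _ _ _),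
        hn y _ g hg rfl _ (Category.assoc _ _ _), Torsor.rs_ac]
      exact hvac _ _ _ _ _)
  have hN : ∀ {Y : C} (y : Y ⟶ A.base) (s : A.torsor.sec y), on N (z := y ≫ φ) rfl s = n Y y s :=
    fun y s => B.torsor.rs_id _ _
  refine ⟨N, ⟨rfl, ?_⟩, ?_⟩
  · intro z u hu
    change R u.base at hu
    rw [hm']
    refine hom_ext_ofSection (hb u rfl hu).symm fun {Y} y s => ?_
    have hy : R (y ≫ u.base) := R.downward_closed hu y
    rw [← Category.assoc, ofSection_comp y s u rfl,
      ofSection_comp _ _ N (t' := (y ≫ u.base) ≫ φ) rfl,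
      hN, hn' _ hy, hv]
    exact hc _ _ _ hu _ (ofSection_comp y s u rfl).symm _ _
  · rintro N' ⟨h1, h2⟩
    change N'.base = φ at h1
    refine hom_ext h1 fun {Y} y s z hu hv => ?_
    subst hv
    refine Eq.trans ?_ (hN y s).symm
    refine B.torsor.sec_ext (J.pullback_stable y hR) fun Z g hg => ?_
    rw [rs_on N' g _ rfl rfl]
    refine Eq.trans ?_ (hn y s g hg rfl rfl (Category.assoc _ _ _)).symm
    apply ofSection_injective
    refine Eq.trans ?_ (((h2 (ofSection A (g ≫ y) (A.torsor.rs g rfl s)) hg).trans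
      (hm' (ofSection A (g ≫ y) (A.torsor.rs g rfl s)) hg)).trans
        (hv _ _ _ (Category.assoc _ _ _)).symm)
    exact (ofSection_comp _ _ _ _).symm

/-- Over a subcanonical site, morphisms of `Tors G` together with their underlying morphisms of the
base glue. -/
lemma existsUnique_glue [J.Subcanonical] {A B : Tors G} (R : Sieve A.base) (hR : R ∈ J A.base)
    (m : ∀ ⦃z : Tors G⦄ (u : z ⟶ A), R u.base → (z ⟶ B))
    (hmc : ∀ ⦃z z' : Tors G⦄ (u : z ⟶ A) (v : z' ⟶ z) (hu : R u.base)
      (hvu : R (v ≫ u).base), m (v ≫ u) hvu = v ≫ m u hu) :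
    ∃! n : A ⟶ B, ∀ ⦃z : Tors G⦄ (u : z ⟶ A) (hu : R u.base), u ≫ n = m u hu := by
  have hs := GrothendieckTopology.Subcanonical.isSheaf_of_isRepresentable (J := J)
    (yoneda.obj B.base) R hR
  have mcongr : ∀ {z : Tors G} {u u' : z ⟶ A} (e : u = u') (hu : R u.base) (hu' : R u'.base),
      m u hu = m u' hu' := by
    rintro z u _ rfl _ _; rfl
  -- the underlying morphism of `m u` depends only on that of `u`
  have hbase : ∀ {z : Tors G} (u : z ⟶ A) (hu : R u.base),
      (m u hu).base = (m (resMap A u.base) hu).base := by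
    intro z u hu
    obtain ⟨w, hw, hw'⟩ := exists_lift (resMap A u.base) u (𝟙 _) (by simp)
    rw [← mcongr hw' (by rw [hw']; exact hu) hu, hmc _ w hu (by rw [hw']; exact hu), comp_base, hw,
      Category.id_comp]
  let x : Presieve.FamilyOfElements (yoneda.obj B.base) R.arrows := fun Y g hg =>
    (m (resMap A g) hg).base
  have hx : x.Compatible := by
    rw [Presieve.compatible_iff_sieveCompatible]
    intro Y Z g k hg
    have h1 : R (resMap ⟨Y, (Torsor.res g).obj A.torsor⟩ k ≫ resMap A g).base :=
      R.downward_closed hg k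
    exact (hbase _ h1).symm.trans (by rw [hmc _ _ hg h1]; rfl)
  obtain ⟨φ, hφ, hφ'⟩ := hs x hx
  obtain ⟨n, ⟨-, hn⟩, hn'⟩ := homsGlue G (a := A) (b := B) φ R hR m
    (fun z u hu => (hbase u hu).trans (hφ u.base hu).symm) hmc
  refine ⟨n, hn, fun n' h => hn' n' ⟨hφ' _ fun Y g hg => ?_, h⟩⟩
  exact congrArg Tors.Hom.base (h (resMap A g) hg)

end Tors

end TorsStack

/-! ### Descent data for torsors -/

section TorsDescent

universe w v₁ u₁

variable {C : Type u₁} [Category.{v₁} C] {J : GrothendieckTopology C}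
  {G : Sheaf J GrpCat.{w}}

/-- A descent datum for torsors: torsors over the members `f i` of a covering of `X` with
compatible transition maps between their sections over equal morphisms to `X`. -/
structure TorsDescent (G : Sheaf J GrpCat.{w}) {X : C} {ι : Type (max u₁ v₁)} (x : ι → Tors G)
    (f : ∀ i, (x i).base ⟶ X) where
  covering : Sieve.ofArrows (fun i => (x i).base) f ∈ J X
  tr {i j : ι} {Z : C} {a : Z ⟶ (x i).base} {b : Z ⟶ (x j).base} (h : a ≫ f i = b ≫ f j)
    (s : (x i).torsor.sec a) : (x j).torsor.sec b
  tr_rs {i j : ι} {Z Z' : C} {a : Z ⟶ (x i).base} {b : Z ⟶ (x j).base} (h : a ≫ f i = b ≫ f j)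
    (k : Z' ⟶ Z) {a' : Z' ⟶ (x i).base} {b' : Z' ⟶ (x j).base} (h' : a' ≫ f i = b' ≫ f j)
    (ea : k ≫ a = a') (eb : k ≫ b = b') (s : (x i).torsor.sec a) :
    tr h' ((x i).torsor.rs k ea s) = (x j).torsor.rs k eb (tr h s)
  tr_ac {i j : ι} {Z : C} {a : Z ⟶ (x i).base} {b : Z ⟶ (x j).base} (h : a ≫ f i = b ≫ f j)
    (s : (x i).torsor.sec a) (g : G.obj.obj (op Z)) :
    tr h ((x i).torsor.ac s g) = (x j).torsor.ac (tr h s) g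
  tr_refl {i : ι} {Z : C} {a : Z ⟶ (x i).base} (h : a ≫ f i = a ≫ f i)
    (s : (x i).torsor.sec a) : tr h s = s
  tr_tr {i j k : ι} {Z : C} {a : Z ⟶ (x i).base} {b : Z ⟶ (x j).base} {c : Z ⟶ (x k).base}
    (h : a ≫ f i = b ≫ f j) (h' : b ≫ f j = c ≫ f k) (h'' : a ≫ f i = c ≫ f k)
    (s : (x i).torsor.sec a) :
    tr h' (tr h s) = tr h'' s

namespace TorsDescent

variable {X : C} {ι : Type (max u₁ v₁)} {x : ι → Tors G} {f : ∀ i, (x i).base ⟶ X}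
  (D : TorsDescent G x f)

/-- Sections over `y` of the glued torsor: compatible families of sections of the given ones. -/
@[ext]
structure Sec {Y : C} (y : Y ⟶ X) where
  val {i : ι} {Z : C} (g : Z ⟶ Y) (a : Z ⟶ (x i).base) (h : g ≫ y = a ≫ f i) :
    (x i).torsor.sec a
  rs_val {i : ι} {Z Z' : C} (g : Z ⟶ Y) (a : Z ⟶ (x i).base) (h : g ≫ y = a ≫ f i) (k : Z' ⟶ Z)
    (g' : Z' ⟶ Y) (a' : Z' ⟶ (x i).base) (h' : g' ≫ y = a' ≫ f i) (eg : k ≫ g = g')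
    (ea : k ≫ a = a') : (x i).torsor.rs k ea (val g a h) = val g' a' h'
  tr_val {i j : ι} {Z : C} (g : Z ⟶ Y) (a : Z ⟶ (x i).base) (b : Z ⟶ (x j).base)
    (h : g ≫ y = a ≫ f i) (h' : g ≫ y = b ≫ f j) (h'' : a ≫ f i = b ≫ f j) :
    D.tr h'' (val g a h) = val g b h'

variable {D}

/-- Over an object mapping to one of the `x i`, a compatible family is determined by a single
value: the others follow by restriction and transition. -/
lemma Sec.ext_of_factor {Y : C} {y : Y ⟶ X} {s s' : D.Sec y} {i : ι} (c : Y ⟶ (x i).base)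
    (h : 𝟙 Y ≫ y = c ≫ f i) (e : s.val (𝟙 Y) c h = s'.val (𝟙 Y) c h) : s = s' := by
  have h0 : ∀ {Z : C} (g : Z ⟶ Y), g ≫ y = (g ≫ c) ≫ f i := fun g => by
    rw [Category.assoc, ← h, Category.id_comp]
  ext j Z g a h'
  rw [← s.tr_val g (g ≫ c) a (h0 g) h' ((h0 g).symm.trans h'),
    ← s'.tr_val g (g ≫ c) a (h0 g) h' ((h0 g).symm.trans h'),
    ← s.rs_val (𝟙 Y) c h g g (g ≫ c) _ (Category.comp_id _) rfl,
    ← s'.rs_val (𝟙 Y) c h g g (g ≫ c) _ (Category.comp_id _) rfl, e]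

variable (D)

/-- The section over `c ≫ f i` defined by a section over `c` of the `i`-th torsor. -/
def spread {i : ι} {Y : C} {c : Y ⟶ (x i).base} {y : Y ⟶ X} (hy : c ≫ f i = y)
    (s : (x i).torsor.sec c) : D.Sec y where
  val g a h := D.tr (a := g ≫ c) (by rw [Category.assoc, hy, h]) ((x i).torsor.rs g rfl s)
  rs_val g a h k g' a' h' eg ea := by
    rw [← D.tr_rs _ k (a' := g' ≫ c) (by rw [Category.assoc, hy, h']) (by rw [← eg, Category.assoc])
      ea, Torsor.rs_rs]
    congr 1
    exact Torsor.rs_congr _ eg _ _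
  tr_val g a b h h' h'' := D.tr_tr _ _ _ _

/-- The value of `spread` at the identity is given by the transition map. -/
lemma spread_val_id {i j : ι} {Y : C} {c : Y ⟶ (x i).base} {y : Y ⟶ X} (hy : c ≫ f i = y)
    (s : (x i).torsor.sec c) (a : Y ⟶ (x j).base) (h : 𝟙 Y ≫ y = a ≫ f j) :
    (D.spread hy s).val (𝟙 Y) a h = D.tr (by rw [hy, ← h, Category.id_comp]) s := by
  change D.tr _ ((x i).torsor.rs (𝟙 Y) rfl s) = _
  have : ∀ {c' : Y ⟶ (x i).base} (e : 𝟙 Y ≫ c = c') (h' : c' ≫ f i = a ≫ f j),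
      D.tr h' ((x i).torsor.rs (𝟙 Y) e s) = D.tr (by rw [hy, ← h, Category.id_comp]) s := by
    intro c' e h'
    obtain rfl : c = c' := by rw [← e, Category.id_comp]
    rw [Torsor.rs_id]
  exact this _ _

lemma spread_val_self {i : ι} {Y : C} {c : Y ⟶ (x i).base} {y : Y ⟶ X} (hy : c ≫ f i = y)
    (s : (x i).torsor.sec c) (h : 𝟙 Y ≫ y = c ≫ f i) :
    (D.spread hy s).val (𝟙 Y) c h = s := by
  rw [spread_val_id, D.tr_refl]

/-- Every `Y ⟶ X` locally factors through the members of the covering. -/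
lemma exists_factor (D : TorsDescent G x f) {Y : C} (y : Y ⟶ X) :
    ∃ R ∈ J Y, ∀ ⦃Z : C⦄ (g : Z ⟶ Y), R g →
      ∃ (i : ι) (a : Z ⟶ (x i).base), g ≫ y = a ≫ f i := by
  refine ⟨_, J.pullback_stable y D.covering, fun Z g hg => ?_⟩
  obtain ⟨_, a, _, ⟨i⟩, e⟩ := hg
  exact ⟨i, a, e.symm⟩

/-- The action on compatible families. -/
def Sec.ac {Y : C} {y : Y ⟶ X} (s : D.Sec y) (b : G.obj.obj (op Y)) : D.Sec y where
  val {i} Z g a h := (x i).torsor.ac (s.val g a h) (G.obj.map g.op b)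
  rs_val g a h k g' a' h' eg ea := by
    rw [Torsor.rs_ac, s.rs_val g a h k g' a' h' eg ea]
    subst eg
    simp
  tr_val g a b h h' h'' := by rw [D.tr_ac, s.tr_val g a b h h' h'']

/-- Restriction of compatible families. -/
def Sec.rs {Y Z : C} (g : Z ⟶ Y) {y : Y ⟶ X} {z : Z ⟶ X} (h : g ≫ y = z) (s : D.Sec y) :
    D.Sec z where
  val k a h' := s.val (k ≫ g) a (by rw [Category.assoc, h, h'])
  rs_val k a h' l k' a' h'' e e' := s.rs_val _ _ _ _ _ _ _ (by rw [← e, Category.assoc]) e'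
  tr_val k a b h' h'' e := s.tr_val _ _ _ _ _ _

/-- The group acts simply transitively on compatible families: on each of the given torsors, two
families locally differ by a unique element, which does not depend on the torsor since the
transition maps are equivariant, and these elements glue. -/
lemma existsUnique_ac {Y : C} {y : Y ⟶ X} (s s' : D.Sec y) :
    ∃! b : G.obj.obj (op Y), Sec.ac D s b = s' := by
  obtain ⟨R, hR, hf⟩ := D.exists_factor y
  have huniq : ∀ b b' : G.obj.obj (op Y), Sec.ac D s b = s' → Sec.ac D s b' = s' → b = b' := by
    intro b b' h h'
    have := (Torsor.trivial G Y).sec_ext (y := 𝟙 Y) hR (s := Torsor.triv (𝟙 Y) b)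
      (t := Torsor.triv (𝟙 Y) b') fun Z g hg => by
        obtain ⟨i, a, e⟩ := hf g hg
        rw [Torsor.triv_rs, Torsor.triv_rs]
        have h1 : (Sec.ac D s b).val g a e = (Sec.ac D s b').val g a e := by rw [h, h']
        exact (x i).torsor.ac_left_injective _ h1
    exact this
  -- the element by which the two families differ is independent of the index
  have key : ∀ ⦃Z : C⦄ (g : Z ⟶ Y), R g → ∃ c : G.obj.obj (op Z), ∀ (j : ι) (Z' : C) (k : Z' ⟶ Z)
      (a : Z' ⟶ (x j).base) (e : (k ≫ g) ≫ y = a ≫ f j),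
      (x j).torsor.ac (s.val (k ≫ g) a e) (G.obj.map k.op c) = s'.val (k ≫ g) a e := by
    intro Z g hg
    obtain ⟨i, a, e⟩ := hf g hg
    obtain ⟨c, hc, -⟩ := (x i).torsor.existsUnique_ac (s.val g a e) (s'.val g a e)
    refine ⟨c, fun j Z' k a' e' => ?_⟩
    have e1 : (k ≫ g) ≫ y = (k ≫ a) ≫ f i := by rw [Category.assoc, e, Category.assoc]
    rw [← s.tr_val (k ≫ g) (k ≫ a) a' e1 e' (e1.symm.trans e'),
      ← s'.tr_val (k ≫ g) (k ≫ a) a' e1 e' (e1.symm.trans e'), ← D.tr_ac,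
      ← s.rs_val g a e k (k ≫ g) (k ≫ a) e1 rfl rfl, ← s'.rs_val g a e k (k ≫ g) (k ≫ a) e1 rfl rfl,
      ← hc, Torsor.rs_ac]
  choose c hc using key
  -- a single index determines the element
  have hcu : ∀ ⦃Z : C⦄ (g : Z ⟶ Y) (hg : R g) (d : G.obj.obj (op Z)) (j : ι)
      (a : Z ⟶ (x j).base) (e : g ≫ y = a ≫ f j),
      (x j).torsor.ac (s.val g a e) d = s'.val g a e → d = c g hg := by
    intro Z g hg d j a e h
    have := hc g hg j Z (𝟙 Z) a (by rw [Category.id_comp, e])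
    simp only [Category.id_comp, op_id, CategoryTheory.Functor.map_id, GrpCat.id_apply] at this
    exact (x j).torsor.ac_left_injective _ (h.trans this.symm)
  obtain ⟨b, hb⟩ := (Torsor.trivial G Y).glue (y := 𝟙 Y) hR
    (fun Z g hg => Torsor.triv _ (c g hg)) (fun Z Z' g k hg => by
      have hk := R.downward_closed hg k
      obtain ⟨j, a, e⟩ := hf _ hk
      rw [Torsor.triv_rs]
      exact hcu (k ≫ g) hk _ j a e (hc g hg j Z' k a e))
  have hb' : ∀ ⦃Z : C⦄ (g : Z ⟶ Y) (hg : R g), G.obj.map g.op b = c g hg := fun Z g hg => hb g hg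
  refine ⟨b, ?_, fun b' h' => huniq _ _ h' ?_⟩ <;>
  · ext j Z g a e
    refine (x j).torsor.sec_ext (J.pullback_stable g hR) fun Z' k hk => ?_
    rw [s'.rs_val g a e k (k ≫ g) (k ≫ a) (by rw [Category.assoc, Category.assoc, e]) rfl rfl,
      (Sec.ac D s b).rs_val g a e k (k ≫ g) (k ≫ a) (by rw [Category.assoc, Category.assoc, e])
      rfl rfl]
    change (x j).torsor.ac (s.val _ _ _) (G.obj.map (k ≫ g).op b) = _
    have := hc (k ≫ g) hk j Z' (𝟙 Z') (k ≫ a) (by simp [e])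
    simp only [Category.id_comp, op_id, CategoryTheory.Functor.map_id, GrpCat.id_apply] at this
    rw [hb' _ hk, this]

/-- Compatible families form a sheaf: each of their values glues. -/
lemma existsUnique_glue {Y : C} (y : Y ⟶ X) (R : Sieve Y) (hR : R ∈ J Y)
    (s : ∀ ⦃Z : C⦄ (g : Z ⟶ Y), R g → D.Sec (g ≫ y))
    (hs : ∀ ⦃Z Z' : C⦄ (g : Z ⟶ Y) (k : Z' ⟶ Z) (hg : R g) (h : k ≫ g ≫ y = (k ≫ g) ≫ y),
      Sec.rs D k h (s g hg) = s (k ≫ g) (R.downward_closed hg k)) :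
    ∃! s' : D.Sec y, ∀ ⦃Z : C⦄ (g : Z ⟶ Y) (hg : R g), Sec.rs D g rfl s' = s g hg := by
  -- values on morphisms belonging to `R`
  have hs' : ∀ {i : ι} {Z Z' : C} (g : Z ⟶ Y) (hg : R g) (k : Z' ⟶ Z) (g' : Z' ⟶ Y)
      (hg' : R g') (e : k ≫ g = g') (a : Z' ⟶ (x i).base) (h : k ≫ g ≫ y = a ≫ f i)
      (h' : 𝟙 Z' ≫ g' ≫ y = a ≫ f i),
      (s g hg).val k a h = (s g' hg').val (𝟙 Z') a h' := by
    rintro i Z Z' g hg k _ hg' rfl a h h'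
    rw [← hs g k hg (Category.assoc _ _ _).symm]
    change _ = (s g hg).val (𝟙 Z' ≫ k) a _
    congr 1
    rw [Category.id_comp]
  have key : ∀ (i : ι) (Z : C) (g : Z ⟶ Y) (a : Z ⟶ (x i).base) (_ : g ≫ y = a ≫ f i),
      ∃ t : (x i).torsor.sec a, ∀ ⦃Z' : C⦄ (k : Z' ⟶ Z) (g' : Z' ⟶ Y) (hg' : R g')
        (_ : k ≫ g = g') (a' : Z' ⟶ (x i).base) (ea : k ≫ a = a')
        (h' : 𝟙 Z' ≫ g' ≫ y = a' ≫ f i),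
        (x i).torsor.rs k ea t = (s g' hg').val (𝟙 Z') a' h' := by
    intro i Z g a h
    have h0 : ∀ {Z' : C} (k : Z' ⟶ Z), 𝟙 Z' ≫ (k ≫ g) ≫ y = (k ≫ a) ≫ f i := fun k => by
      simp [h]
    obtain ⟨t, ht⟩ := (x i).torsor.glue (y := a) (J.pullback_stable g hR)
      (fun Z' k hk => (s (k ≫ g) hk).val (𝟙 Z') (k ≫ a) (h0 k)) (by
        intro Z' Z'' k l hk
        have hlk : R ((l ≫ k) ≫ g) := by
          rw [Category.assoc]; exact R.downward_closed (f := k ≫ g) hk l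
        refine ((s (k ≫ g) hk).rs_val _ _ _ l l _ (by simp [h]) (Category.comp_id _) _).trans ?_
        exact hs' _ _ _ _ hlk (Category.assoc _ _ _).symm _ _ _)
    refine ⟨t, ?_⟩
    rintro Z' k _ hg' rfl _ rfl h'
    exact ht k hg'
  choose t₀ ht₀ using key
  obtain ⟨t, ht⟩ : ∃ t : ∀ {i : ι} {Z : C} (g : Z ⟶ Y) (a : Z ⟶ (x i).base)
      (_ : g ≫ y = a ≫ f i), (x i).torsor.sec a, ∀ {i : ι} {Z : C} (g : Z ⟶ Y)
      (a : Z ⟶ (x i).base) (h : g ≫ y = a ≫ f i) ⦃Z' : C⦄ (k : Z' ⟶ Z) (g' : Z' ⟶ Y) (hg' : R g')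
        (_ : k ≫ g = g') (a' : Z' ⟶ (x i).base) (ea : k ≫ a = a')
        (h' : 𝟙 Z' ≫ g' ≫ y = a' ≫ f i),
        (x i).torsor.rs k ea (t g a h) = (s g' hg').val (𝟙 Z') a' h' :=
    ⟨fun {i Z} g a h => t₀ i Z g a h, fun g a h => ht₀ _ _ g a h⟩
  have hcov : ∀ {Z : C} (g : Z ⟶ Y), R.pullback g ∈ J Z := fun g => J.pullback_stable g hR
  let S : D.Sec y :=
    { val := fun g a h => t g a h
      rs_val := by
        rintro i Z Z' g a h k _ _ h' rfl rfl
        refine (x i).torsor.sec_ext (hcov (k ≫ g)) fun W l hl => ?_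
        rw [Torsor.rs_rs, ht _ _ h' l _ hl rfl _ rfl (by simp [h])]
        exact ht _ _ h (l ≫ k) _ hl (by simp) _ (by simp) _
      tr_val := by
        intro i j Z g a b h h' h''
        refine (x j).torsor.sec_ext (hcov g) fun W l hl => ?_
        have e1 : 𝟙 W ≫ (l ≫ g) ≫ y = (l ≫ a) ≫ f i := by simp [h]
        have e2 : 𝟙 W ≫ (l ≫ g) ≫ y = (l ≫ b) ≫ f j := by simp [h']
        rw [← D.tr_rs h'' l (e1.symm.trans e2) rfl rfl, ht _ _ h l _ hl rfl _ rfl e1,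
          ht _ _ h' l _ hl rfl _ rfl e2]
        exact (s _ hl).tr_val _ _ _ _ _ _ }
  refine ⟨S, fun Z g hg => ?_, fun S' hS' => ?_⟩
  · ext i W k a h
    have hk := R.downward_closed hg k
    change t (k ≫ g) a _ = _
    rw [hs' g hg k _ hk rfl a h (by simpa using h)]
    rw [← ht (k ≫ g) a (by simpa using h) (𝟙 _) _ hk (Category.id_comp _) a (Category.id_comp _)]
    simp
  · ext i Z g a h
    refine (x i).torsor.sec_ext (hcov g) fun W l hl => ?_
    have e1 : 𝟙 W ≫ (l ≫ g) ≫ y = (l ≫ a) ≫ f i := by simp [h]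
    rw [ht _ _ h l _ hl rfl _ rfl e1, ← hS' _ hl]
    exact S'.rs_val _ _ _ _ _ _ _ (by simp) _

/-- The glued torsor. -/
def preTorsor : PreTorsor G X where
  sec y := D.Sec y
  rs g _ _ h s := Sec.rs D g h s
  rs_id h s := by
    ext i Z g a h'
    change s.val (g ≫ 𝟙 _) a _ = _
    congr 1
    rw [Category.comp_id]
  rs_rs g k _ _ _ h h' h'' s := by
    ext i Z l a e
    change s.val ((l ≫ k) ≫ g) a _ = s.val (l ≫ k ≫ g) a _
    congr 1
    rw [Category.assoc]
  ac s b := Sec.ac D s b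
  ac_one s := by
    ext i Z g a h
    change (x i).torsor.ac _ (G.obj.map g.op 1) = _
    rw [map_one, Torsor.ac_one]
  ac_mul s b c := by
    ext i Z g a h
    change (x i).torsor.ac _ (G.obj.map g.op (b * c)) = (x i).torsor.ac ((x i).torsor.ac _ _) _
    rw [map_mul, Torsor.ac_mul]
  rs_ac g _ _ h s b := by
    ext i Z k a e
    change (x i).torsor.ac _ (G.obj.map (k ≫ g).op b) =
      (x i).torsor.ac _ (G.obj.map k.op (G.obj.map g.op b))
    simp
    rfl
  existsUnique_ac s s' := D.existsUnique_ac s s'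
  existsUnique_glue y R hR s hs := D.existsUnique_glue y R hR s hs
  locally_nonempty := by
    refine ⟨{ arrows := fun Y f => Nonempty (D.Sec f), downward_closed := ?_ }, ?_,
      fun Y f h => h⟩
    · rintro Y Z y ⟨s⟩ g
      exact ⟨Sec.rs D g rfl s⟩
    -- over a member of the covering, a section of its torsor spreads to a compatible family
    · refine J.transitive D.covering _ fun Y y hy => ?_
      obtain ⟨_, a, _, ⟨i⟩, rfl⟩ := hy
      obtain ⟨R, hR, h⟩ := (x i).torsor.locally_nonempty' a
      refine J.superset_covering (fun Z g hg => ?_) hR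
      obtain ⟨s⟩ := h g hg
      exact ⟨D.spread (Category.assoc _ _ _) s⟩

end TorsDescent

end TorsDescent

/-! ### The gerbe of torsors -/

section TorsGerbe

universe w v₁ u₁

variable {C : Type u₁} [Category.{v₁} C] {J : GrothendieckTopology C}
  {G : Sheaf J GrpCat.{w}}

namespace TorsDescent

variable {X : C} {ι : Type (max u₁ v₁)} {x : ι → Tors G} {f : ∀ i, (x i).base ⟶ X}
  (D : TorsDescent G x f)

/-- The glued object of `Tors G`. -/
noncomputable def glued : Tors G := ⟨X, D.preTorsor.toTorsor⟩

/-- The morphism from the `i`-th given object to the glued one. -/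
noncomputable def toGlued (i : ι) : x i ⟶ D.glued :=
  Tors.mkHom (f i) (fun y s => D.preTorsor.equiv (y ≫ f i) (D.spread rfl s))
    (fun g y z h s => by
      refine Eq.trans ?_ (D.preTorsor.rs_equiv (z := z ≫ f i) g (by rw [← h, Category.assoc])
        (D.spread rfl s)).symm
      congr 1
      refine Sec.ext_of_factor z (Category.id_comp _) ?_
      rw [spread_val_self]
      subst h
      change _ = D.tr _ ((x i).torsor.rs (𝟙 _ ≫ g) rfl s)
      -- the identity `𝟙 _ ≫ g = g` is generalized, since `D.tr` depends on the morphism in its type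
      have : ∀ (g' : _) (e : g' = g), (x i).torsor.rs g rfl s =
          D.tr (a := g' ≫ y) (b := g ≫ y) (by rw [e]) ((x i).torsor.rs g' rfl s) := by
        rintro _ rfl
        rw [D.tr_refl]
      exact this _ (Category.id_comp g))
    (fun y s a => by
      refine Eq.trans ?_ (D.preTorsor.ac_equiv (D.spread rfl s) a).symm
      congr 1
      refine Sec.ext_of_factor y (Category.id_comp _) ?_
      rw [spread_val_self]
      change _ = (x i).torsor.ac ((D.spread rfl s).val (𝟙 _) y (Category.id_comp _))
        (G.obj.map (𝟙 _) a)
      rw [spread_val_self]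
      simp)

lemma on_toGlued {i : ι} {Y : C} (y : Y ⟶ (x i).base) {z : Y ⟶ X}
    (h : y ≫ (D.toGlued i).base = z) (h' : y ≫ f i = z) (s : (x i).torsor.sec y) :
    Tors.on (B := D.glued) (D.toGlued i) h s = D.preTorsor.equiv z (D.spread h' s) := by
  subst h
  exact Torsor.rs_id _ _ _

/-- The morphisms to the glued object identify the given torsors through the transition maps. -/
lemma on_toGlued_eq {i j : ι} {Y : C} (a : Y ⟶ (x i).base) (b : Y ⟶ (x j).base) {z : Y ⟶ X}
    (h : a ≫ (D.toGlued i).base = z) (h' : b ≫ (D.toGlued j).base = z)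
    (s : (x i).torsor.sec a) :
    Tors.on (B := D.glued) (D.toGlued i) h s =
      Tors.on (B := D.glued) (D.toGlued j) h'
        (D.tr (show a ≫ f i = b ≫ f j from h.trans h'.symm) s) := by
  have e : a ≫ f i = z := h
  have e' : b ≫ f j = z := h'
  refine (D.on_toGlued a h e s).trans (Eq.trans ?_ (D.on_toGlued b h' e' _).symm)
  congr 1
  refine Sec.ext_of_factor b (by rw [Category.id_comp, e']) ?_
  rw [spread_val_self, spread_val_id]

end TorsDescent

namespace Tors

/-- Torsors glue: a span of torsors gives the transition map that sends the image of a section under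
one leg to its image under the other. -/
lemma objectsGlue (G : Sheaf J GrpCat.{w}) : ObjectsGlue (proj G) J := by
  intro X ι x f hf z l r hpb hcoc
  change ∀ i, (x i).base ⟶ X at f
  have hpb' : ∀ i j, IsPullback (l i j).base (r i j).base (f i) (f j) := hpb
  have hcoc' : ∀ (i j k : ι) (o : Tors G) (α : o ⟶ z i j) (β : o ⟶ z j k) (γ : o ⟶ z i k),
      α ≫ r i j = β ≫ l j k → α ≫ l i j = γ ≫ l i k →
      (β ≫ r j k).base = (γ ≫ r i k).base → β ≫ r j k = γ ≫ r i k := hcoc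
  -- transition maps between sections
  have key : ∀ (i j : ι) (Z : C) (a : Z ⟶ (x i).base) (b : Z ⟶ (x j).base)
      (_ : a ≫ f i = b ≫ f j), ∃ t : (x i).torsor.sec a → (x j).torsor.sec b,
      ∀ (q : Z ⟶ (z i j).base) (hl : q ≫ (l i j).base = a) (hr : q ≫ (r i j).base = b)
        (s : (z i j).torsor.sec q), t (on (l i j) hl s) = on (r i j) hr s := by
    intro i j Z a b h
    let q := (hpb' i j).lift a b h
    have hl : q ≫ (l i j).base = a := (hpb' i j).lift_fst _ _ _
    have hr : q ≫ (r i j).base = b := (hpb' i j).lift_snd _ _ _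
    let e := Equiv.ofBijective _ (on_bijective (l i j) hl)
    refine ⟨fun s => on (r i j) hr (e.symm s), fun q' hl' hr' s => ?_⟩
    obtain rfl : q' = q := (hpb' i j).hom_ext (hl'.trans hl.symm) (hr'.trans hr.symm)
    change on (r i j) hr (e.symm (e s)) = _
    rw [Equiv.symm_apply_apply]
  choose t ht using key
  -- every section is the image of a section of the apex of the span
  have hq : ∀ {i j : ι} {Z : C} {a : Z ⟶ (x i).base} {b : Z ⟶ (x j).base}
      (_ : a ≫ f i = b ≫ f j) (s : (x i).torsor.sec a), ∃ (q : Z ⟶ (z i j).base)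
      (hl : q ≫ (l i j).base = a) (_ : q ≫ (r i j).base = b) (s' : (z i j).torsor.sec q),
      on (l i j) hl s' = s := fun {i j Z a b} h s =>
    ⟨(hpb' i j).lift a b h, (hpb' i j).lift_fst _ _ _, (hpb' i j).lift_snd _ _ _,
      (on_bijective (l i j) _).2 s⟩
  -- the cocycle condition, applied to the morphisms from trivial torsors given by sections
  have htt : ∀ {i j k : ι} {Z : C} {a : Z ⟶ (x i).base} {b : Z ⟶ (x j).base}
      {c : Z ⟶ (x k).base} (h : a ≫ f i = b ≫ f j) (h' : b ≫ f j = c ≫ f k)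
      (h'' : a ≫ f i = c ≫ f k) (s : (x i).torsor.sec a),
      t j k Z b c h' (t i j Z a b h s) = t i k Z a c h'' s := by
    intro i j k Z a b c h h' h'' s
    obtain ⟨q₁, hl₁, hr₁, s₁, hs₁⟩ := hq h s
    obtain ⟨q₂, hl₂, hr₂, s₂, hs₂⟩ := hq h' (t i j Z a b h s)
    obtain ⟨q₃, hl₃, hr₃, s₃, hs₃⟩ := hq h'' s
    have e := hcoc' i j k _ (ofSection _ q₁ s₁) (ofSection _ q₂ s₂) (ofSection _ q₃ s₃)
      (by rw [ofSection_comp _ _ _ hr₁, ofSection_comp _ _ _ hl₂, hs₂, ← hs₁,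
        ht _ _ _ _ _ _ q₁ hl₁ hr₁])
      (by rw [ofSection_comp _ _ _ hl₁, ofSection_comp _ _ _ hl₃, hs₁, hs₃])
      (hr₂.trans hr₃.symm)
    rw [ofSection_comp _ _ _ hr₂, ofSection_comp _ _ _ hr₃] at e
    have e' := ofSection_injective e
    rw [← hs₂, ht _ _ _ _ _ _ q₂ hl₂ hr₂, e', ← hs₃, ht _ _ _ _ _ _ q₃ hl₃ hr₃]
  have hinj : ∀ {i j : ι} {Z : C} {a : Z ⟶ (x i).base} {b : Z ⟶ (x j).base}
      (h : a ≫ f i = b ≫ f j), Function.Injective (t i j Z a b h) := by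
    intro i j Z a b h s s' e
    obtain ⟨q₁, hl₁, hr₁, s₁, rfl⟩ := hq h s
    obtain ⟨q₂, hl₂, hr₂, s₂, rfl⟩ := hq h s'
    obtain rfl : q₁ = q₂ := (hpb' i j).hom_ext (hl₁.trans hl₂.symm) (hr₁.trans hr₂.symm)
    rw [ht _ _ _ _ _ _ q₁ hl₁ hr₁, ht _ _ _ _ _ _ q₁ hl₁ hr₁] at e
    rw [(on_bijective (r i j) hr₁).1 e]
  let D : TorsDescent G x f :=
    { covering := hf
      tr := fun {i j Z a b} h s => t i j Z a b h s
      tr_rs := by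
        intro i j Z Z' a b h k a' b' h' ea eb s
        obtain ⟨q, hl, hr, s, rfl⟩ := hq h s
        rw [ht _ _ _ _ _ _ q hl hr, rs_on (l i j) k hl (rfl : k ≫ q = _) ea,
          rs_on (r i j) k hr (rfl : k ≫ q = _) eb, ht]
      tr_ac := by
        intro i j Z a b h s g
        obtain ⟨q, hl, hr, s, rfl⟩ := hq h s
        rw [ht _ _ _ _ _ _ q hl hr, ← on_ac, ← on_ac, ht]
      -- a transition map from an `x i` to itself is idempotent by the cocycle condition, and
      -- injective
      tr_refl := fun h s => hinj h (htt h h h s)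
      tr_tr := fun h h' h'' s => htt h h' h'' s }
  refine ⟨D.glued, rfl, D.toGlued, fun i => (Category.comp_id _).symm, fun i j => ?_⟩
  refine hom_ext (hpb' i j).w fun {Y} y s q hu hv => ?_
  have hu' : (y ≫ (l i j).base) ≫ (D.toGlued i).base = q := by rw [Category.assoc]; exact hu
  have hv' : (y ≫ (r i j).base) ≫ (D.toGlued j).base = q := by rw [Category.assoc]; exact hv
  rw [on_comp (l i j) (D.toGlued i) (rfl : y ≫ (l i j).base = _) hu',
    on_comp (r i j) (D.toGlued j) (rfl : y ≫ (r i j).base = _) hv']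
  refine (D.on_toGlued_eq _ _ hu' hv' _).trans ?_
  congr 1
  exact ht _ _ _ _ _ _ y rfl rfl s

/-- Torsors form a gerbe: where two torsors both have sections, they receive morphisms from the same
trivial torsor. -/
lemma isGerbe (G : Sheaf J GrpCat.{w}) [HasPullbacks C] : IsGerbe (proj G) J := by
  refine (isGroupoidFibration_proj G).isGerbe (homsGlue G) (objectsGlue G)
    (fun X => ⟨⟨X, Torsor.trivial G X⟩, rfl⟩) fun A B e => ?_
  obtain ⟨R, hR, h⟩ := A.torsor.locally_nonempty
  obtain ⟨R', hR', h'⟩ := B.torsor.locally_nonempty' (eqToHom e : A.base ⟶ B.base)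
  refine ⟨R ⊓ R', J.intersection_covering hR hR', fun Y f hf => ?_⟩
  obtain ⟨s⟩ := h f hf.1
  obtain ⟨s'⟩ := h' f hf.2
  exact ⟨⟨Y, Torsor.trivial G Y⟩, rfl, ofSection A f s, ofSection B _ s',
    (Category.id_comp _).symm, (Category.id_comp _).symm⟩

end Tors

end TorsGerbe

/-! ### Covers with torsors as a fibered category -/

section CoverTorsFibration

universe w v₁ u₁

variable {C : Type u₁} [Category.{v₁} C] {J : GrothendieckTopology C}

lemma hom_ext_of_mem [J.Subcanonical] {X Y : C} {R : Sieve Y} (hR : R ∈ J Y) {f f' : Y ⟶ X}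
    (h : ∀ ⦃Z : C⦄ (g : Z ⟶ Y), R g → g ≫ f = g ≫ f') : f = f' :=
  (GrothendieckTopology.Subcanonical.isSheaf_of_isRepresentable (J := J)
    (yoneda.obj X)).isSeparated R hR |>.ext fun _ g hg => h g hg

lemma exists_hom_of_mem [J.Subcanonical] {X Y : C} {R : Sieve Y} (hR : R ∈ J Y)
    (m : ∀ ⦃Z : C⦄ (g : Z ⟶ Y), R g → (Z ⟶ X))
    (hm : ∀ ⦃Z Z' : C⦄ (g : Z ⟶ Y) (k : Z' ⟶ Z) (hg : R g),
      m (k ≫ g) (R.downward_closed hg k) = k ≫ m g hg) :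
    ∃ f : Y ⟶ X, ∀ ⦃Z : C⦄ (g : Z ⟶ Y) (hg : R g), g ≫ f = m g hg := by
  obtain ⟨f, hf, -⟩ := GrothendieckTopology.Subcanonical.isSheaf_of_isRepresentable (J := J)
    (yoneda.obj X) R hR (fun Z g hg => m g hg) (by
      refine (Presieve.compatible_iff_sieveCompatible _).2 ?_
      intro Z Z' g k hg
      exact hm g k hg)
  exact ⟨f, fun Z g hg => hf g hg⟩

namespace CoverTors

variable {G : Sheaf J GrpCat.{w}} {Q : MorphismProperty C}

@[simp] lemma comp_t {a b c : CoverTors G Q} (u : a ⟶ b) (v : b ⟶ c) : (u ≫ v).t = u.t ≫ v.t := rfl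
@[simp] lemma comp_f {a b c : CoverTors G Q} (u : a ⟶ b) (v : b ⟶ c) : (u ≫ v).f = u.f ≫ v.f := rfl

lemma hom_ext {a b : CoverTors G Q} {u v : a ⟶ b} (h : u.f = v.f) (h' : u.t = v.t) : u = v :=
  Hom.ext h h'

lemma exists_lift {a b d : CoverTors G Q} (u : a ⟶ b) (v : d ⟶ b) (g : d.X ⟶ a.X)
    (h : g ≫ u.f = v.f) : ∃ w : d ⟶ a, w.f = g ∧ w ≫ u = v := by
  have e : v.t.base ≫ b.π = (d.π ≫ g) ≫ u.f := by rw [v.isPullback.w, Category.assoc, h]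
  obtain ⟨t, ht, ht'⟩ := Tors.exists_lift u.t v.t (u.isPullback.lift v.t.base (d.π ≫ g) e)
    (u.isPullback.lift_fst _ _ _)
  have hpb : IsPullback (t.base ≫ u.t.base) d.π b.π (g ≫ u.f) := by
    rw [← Tors.comp_base, ht', h]
    exact v.isPullback
  refine ⟨⟨g, t, IsPullback.of_right hpb ?_ u.isPullback⟩, rfl, hom_ext h ht'⟩
  rw [ht]
  exact u.isPullback.lift_snd _ _ _

lemma hom_ext_of_comp {a b d : CoverTors G Q} {w w' : d ⟶ a} (u : a ⟶ b) (h : w.f = w'.f)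
    (h' : w ≫ u = w' ≫ u) : w = w' := by
  have ht : w.t ≫ u.t = w'.t ≫ u.t := congrArg Hom.t h'
  refine hom_ext h (Tors.hom_ext_of_comp (u.isPullback.hom_ext ?_ ?_) ht)
  · exact congrArg Tors.Hom.base ht
  · rw [w.isPullback.w, w'.isPullback.w, h]

variable [HasPullbacks C] [Q.IsStableUnderBaseChange]

lemma exists_pullback (b : CoverTors G Q) {X : C} (g : X ⟶ b.X) :
    ∃ (a : CoverTors G Q) (e : a.X = X) (u : a ⟶ b), u.f = eqToHom e ≫ g :=
  ⟨⟨X, ⟨pullback b.π g, (Torsor.res (pullback.fst b.π g)).obj b.tors.torsor⟩,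
    pullback.snd b.π g, MorphismProperty.pullback_snd _ _ b.hπ⟩, rfl,
    ⟨g, Tors.resMap b.tors _, IsPullback.of_hasPullback _ _⟩, (Category.id_comp _).symm⟩

/-- A point `u` of the torsor of `a` with values in `z` is given by a section `l` of the pullback of
`a` to the base of `z`. -/
lemma exists_pullback_section (a : CoverTors G Q) {z : Tors G} (u : z ⟶ a.tors) :
    ∃ (c : CoverTors G Q) (w : c ⟶ a) (l : z ⟶ c.tors) (e : c.X = z.base),
      w.f = eqToHom e ≫ u.base ≫ a.π ∧ l.base ≫ c.π = eqToHom e.symm ∧ l ≫ w.t = u := by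
  obtain ⟨c, e, w, hw⟩ := exists_pullback a (u.base ≫ a.π)
  obtain ⟨l, hl, hl'⟩ := Tors.exists_lift w.t u
    (w.isPullback.lift u.base (eqToHom e.symm) (by rw [hw]; simp)) (w.isPullback.lift_fst _ _ _)
  exact ⟨c, w, l, e, hw, by rw [hl]; exact w.isPullback.lift_snd _ _ _, hl'⟩

variable (G Q) in
lemma isGroupoidFibration_proj : IsGroupoidFibration (proj G Q) where
  exists_lift u v g h := exists_lift u v g h
  hom_ext u h h' := hom_ext_of_comp u h h'
  exists_pullback b _ g := exists_pullback b g

variable (G Q) in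
/-- Morphisms of covers with torsors glue. The sieve `R` pulls back to a covering of the cover
underlying `a`, along which the given morphisms of torsors are glued to `t`. The resulting square of
covers is a pullback because points of a pullback can be found locally on the base. -/
lemma homsGlue [J.Subcanonical] : HomsGlue (proj G Q) J := by
  intro a b φ R hR m hm hc
  change a.X ⟶ b.X at φ
  change Sieve a.X at R
  have hm' : ∀ {z : CoverTors G Q} (u : z ⟶ a) (hu : R u.f), (m u hu).f = u.f ≫ φ :=
    fun u hu => hm u hu
  have hc' : ∀ {z z' : CoverTors G Q} (u : z ⟶ a) (v : z' ⟶ z) (w : z' ⟶ a) (_ : v ≫ u = w)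
      (hu : R u.f) (hw : R w.f), m w hw = v ≫ m u hu := by
    rintro z z' u v _ rfl hu hw
    exact hc u v hu hw
  -- the given morphisms, on torsors mapping to the torsor of `a`
  have key : ∀ ⦃z : Tors G⦄ (u : z ⟶ a.tors), (R.pullback a.π) u.base → ∃ M : z ⟶ b.tors,
      ∀ (c : CoverTors G Q) (w : c ⟶ a) (hw : R w.f) (l : z ⟶ c.tors), l ≫ w.t = u →
        M = l ≫ (m w hw).t := by
    intro z u hu
    obtain ⟨c₀, w₀, l₀, e₀, h₀, h₀', hl₀⟩ := exists_pullback_section a u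
    have hw₀ : R w₀.f := by rw [h₀]; exact R.downward_closed hu _
    refine ⟨l₀ ≫ (m w₀ hw₀).t, fun c w hw l hl => ?_⟩
    have hπ : u.base ≫ a.π = l.base ≫ c.π ≫ w.f := by
      rw [← w.isPullback.w, ← Category.assoc, ← Tors.comp_base, hl]
    obtain ⟨k, hk, hk'⟩ := exists_lift w w₀ (eqToHom e₀ ≫ l.base ≫ c.π) (by
      rw [h₀, hπ]; simp)
    rw [hc' w k w₀ hk' hw hw₀, comp_t, ← Category.assoc]
    congr 1
    have e1 : (l₀ ≫ k.t) ≫ w.t = l ≫ w.t := by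
      rw [Category.assoc, ← comp_t, hk', hl₀, hl]
    refine Tors.hom_ext_of_comp (w.isPullback.hom_ext (congrArg Tors.Hom.base e1) ?_) e1
    rw [Tors.comp_base, Category.assoc, k.isPullback.w, hk, ← Category.assoc, h₀']
    simp
  choose M hM using key
  obtain ⟨t, ht, ht'⟩ := Tors.existsUnique_glue (R.pullback a.π) (J.pullback_stable a.π hR) M (by
    intro z z' u v hu hvu
    obtain ⟨c, w, l, e, h, -, hl⟩ := exists_pullback_section a u
    have hw : R w.f := by rw [h]; exact R.downward_closed hu _
    rw [hM u hu c w hw l hl, hM (v ≫ u) hvu c w hw (v ≫ l) (by rw [Category.assoc, hl]),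
      Category.assoc])
  have ht₂ : ∀ {c : CoverTors G Q} (w : c ⟶ a) (hw : R w.f), w.t ≫ t = (m w hw).t := by
    intro c w hw
    have h1 : (R.pullback a.π) w.t.base := by
      change R _
      rw [w.isPullback.w]
      exact R.downward_closed hw _
    rw [ht w.t h1, hM w.t h1 c w hw (𝟙 _) (Category.id_comp _), Category.id_comp]
  have ht₃ : ∀ {c : CoverTors G Q} (w : c ⟶ a) (hw : R w.f),
      w.t.base ≫ t.base = (m w hw).t.base := fun w hw =>
    congrArg Tors.Hom.base (ht₂ w hw)
  have hcomm : t.base ≫ b.π = a.π ≫ φ := by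
    refine hom_ext_of_mem (J.pullback_stable a.π hR) fun Z g hg => ?_
    obtain ⟨c, w, l, e, h, -, hl⟩ := exists_pullback_section a (Tors.resMap a.tors g)
    have hw : R w.f := by rw [h]; exact R.downward_closed hg _
    have hl' : g = l.base ≫ w.t.base := (congrArg Tors.Hom.base hl).symm
    rw [hl', Category.assoc, ← Category.assoc w.t.base, ht₃ w hw, (m w hw).isPullback.w, hm',
      Category.assoc, ← Category.assoc c.π, ← w.isPullback.w, Category.assoc]
  -- points of `a` over a member of `R` correspond to points of `b`
  have hpt : ∀ {Z : C} (k : Z ⟶ a.X) (_ : R k) (s : Z ⟶ b.tors.base) (_ : s ≫ b.π = k ≫ φ),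
      ∃! s' : Z ⟶ a.tors.base, s' ≫ t.base = s ∧ s' ≫ a.π = k := by
    intro Z k hk s hs
    obtain ⟨c, rfl, w, hw⟩ := exists_pullback a k
    rw [eqToHom_refl, Category.id_comp] at hw
    subst hw
    have hs' : s ≫ b.π = 𝟙 _ ≫ (m w hk).f := by rw [hs, hm', Category.id_comp]
    refine ⟨(m w hk).isPullback.lift s (𝟙 _) hs' ≫ w.t.base, ⟨?_, ?_⟩, ?_⟩
    · rw [Category.assoc, ht₃ w hk]
      exact (m w hk).isPullback.lift_fst _ _ _
    · rw [Category.assoc, w.isPullback.w, ← Category.assoc, IsPullback.lift_snd, Category.id_comp]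
    · rintro s' ⟨h1, h2⟩
      have h3 : w.isPullback.lift s' (𝟙 _) (by rw [h2, Category.id_comp]) =
          (m w hk).isPullback.lift s (𝟙 _) hs' := by
        refine (m w hk).isPullback.hom_ext ?_ ?_
        · rw [IsPullback.lift_fst, ← ht₃ w hk, ← Category.assoc, IsPullback.lift_fst, h1]
        · rw [IsPullback.lift_snd, IsPullback.lift_snd]
      rw [← h3, IsPullback.lift_fst]
  have hpt' : ∀ {Y : C} (y₁ : Y ⟶ b.tors.base) (y₂ : Y ⟶ a.X) (_ : y₁ ≫ b.π = y₂ ≫ φ),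
      ∃! s : Y ⟶ a.tors.base, s ≫ t.base = y₁ ∧ s ≫ a.π = y₂ := by
    intro Y y₁ y₂ e
    -- by `hpt` such a point is unique and exists after restriction along members of `R`
    have huniq : ∀ s s' : Y ⟶ a.tors.base, s ≫ t.base = y₁ ∧ s ≫ a.π = y₂ →
        s' ≫ t.base = y₁ ∧ s' ≫ a.π = y₂ → s = s' := by
      rintro s s' ⟨h1, h2⟩ ⟨h3, h4⟩
      refine hom_ext_of_mem (J.pullback_stable y₂ hR) fun Z g hg => ?_
      refine (hpt (g ≫ y₂) hg (g ≫ y₁) (by simp [e])).unique ⟨?_, ?_⟩ ⟨?_, ?_⟩ <;>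
        simp only [Category.assoc, h1, h2, h3, h4]
    have hex : ∀ ⦃Z : C⦄ (g : Z ⟶ Y) (_ : (R.pullback y₂) g), ∃ s : Z ⟶ a.tors.base,
        s ≫ t.base = g ≫ y₁ ∧ s ≫ a.π = g ≫ y₂ := fun Z g hg =>
      (hpt (g ≫ y₂) hg (g ≫ y₁) (by simp [e])).exists
    choose s hs using hex
    obtain ⟨s', hs'⟩ := exists_hom_of_mem (J.pullback_stable y₂ hR) s (by
      intro Z Z' g k hg
      have hkg : R ((k ≫ g) ≫ y₂) := by
        rw [Category.assoc]; exact R.downward_closed hg k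
      refine (hpt ((k ≫ g) ≫ y₂) hkg ((k ≫ g) ≫ y₁) (by simp [e])).unique (hs _ _) ⟨?_, ?_⟩
      · rw [Category.assoc, (hs g hg).1, Category.assoc]
      · rw [Category.assoc, (hs g hg).2, Category.assoc])
    have hs'' : s' ≫ t.base = y₁ ∧ s' ≫ a.π = y₂ :=
      ⟨hom_ext_of_mem (J.pullback_stable y₂ hR) fun Z g hg => by
        rw [← Category.assoc, hs' g hg, (hs g hg).1],
      hom_ext_of_mem (J.pullback_stable y₂ hR) fun Z g hg => by
        rw [← Category.assoc, hs' g hg, (hs g hg).2]⟩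
    exact ⟨s', hs'', fun s h => huniq _ _ h hs''⟩
  have hpb : IsPullback t.base a.π b.π φ := by
    choose L hL hL' using @hpt'
    exact ⟨⟨hcomm⟩, ⟨PullbackCone.IsLimit.mk _ (fun s => L s.fst s.snd s.condition)
      (fun s => (hL _ _ s.condition).1) (fun s => (hL _ _ s.condition).2)
      (fun s m h1 h2 => hL' _ _ s.condition m ⟨h1, h2⟩)⟩⟩
  refine ⟨⟨φ, t, hpb⟩, ⟨rfl, fun z u hu => ?_⟩, ?_⟩
  · exact hom_ext (hm' u hu).symm (ht₂ u hu)
  · rintro n' ⟨h1, h2⟩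
    refine hom_ext h1 (ht' n'.t fun z u hu => ?_)
    obtain ⟨c, w, l, e, h, -, hl⟩ := exists_pullback_section a u
    have hw : R w.f := by rw [h]; exact R.downward_closed hu _
    rw [hM u hu c w hw l hl, ← h2 w hw, comp_t, ← Category.assoc, hl]

end CoverTors

end CoverTorsFibration

/-! ### Disjoint unions of copies of a scheme -/

section Copies

variable {S : Scheme.{u}} {d : ℕ}

instance subcanonical_fppf_over (S : Scheme.{u}) :
    (Scheme.fppfTopology.over S).Subcanonical := inferInstance

@[simp]
lemma inc_fold (X : Over S) (i : Fin d) : inc d X i ≫ fold d X = 𝟙 X := by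
  ext : 1
  change Sigma.ι (fun _ : Fin d => X.left) i ≫ Sigma.desc (fun _ => 𝟙 X.left) = 𝟙 X.left
  exact Sigma.ι_desc _ _

lemma inc_copiesMap {X Y : Over S} (g : X ⟶ Y) (i : Fin d) :
    inc d X i ≫ copiesMap d g = g ≫ inc d Y i := by
  ext : 1
  change Sigma.ι (fun _ : Fin d => X.left) i ≫ Limits.Sigma.map (fun _ => g.left) =
    g.left ≫ Sigma.ι (fun _ : Fin d => Y.left) i
  exact Sigma.ι_map _ _

lemma copies_hom_ext {X Y : Over S} {f g : copies d X ⟶ Y}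
    (h : ∀ i, inc d X i ≫ f = inc d X i ≫ g) : f = g := by
  ext : 1
  exact Sigma.hom_ext _ _ fun i => congrArg CommaMorphism.left (h i)

/-- The morphism out of `X ⊔ ⋯ ⊔ X` with given components. -/
noncomputable def copiesDesc {X Y : Over S} (m : Fin d → (X ⟶ Y)) : copies d X ⟶ Y :=
  Over.homMk (Sigma.desc fun i => (m i).left) (by
    refine Sigma.hom_ext _ _ fun i => ?_
    refine (Sigma.ι_desc_assoc _ _ _).trans ?_
    rw [Over.w]
    change _ = Sigma.ι (fun _ : Fin d => X.left) i ≫ schemeFold d X.left ≫ X.hom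
    rw [schemeFold, Sigma.ι_desc_assoc, Category.id_comp])

@[simp]
lemma inc_copiesDesc {X Y : Over S} (m : Fin d → (X ⟶ Y)) (i : Fin d) :
    inc d X i ≫ copiesDesc m = m i := by
  ext : 1
  exact Sigma.ι_desc _ _

lemma copiesMap_id (X : Over S) : copiesMap d (𝟙 X) = 𝟙 _ :=
  copies_hom_ext fun i => by rw [inc_copiesMap, Category.id_comp, Category.comp_id]

lemma copiesMap_comp {X Y Z : Over S} (f : X ⟶ Y) (g : Y ⟶ Z) :
    copiesMap d (f ≫ g) = copiesMap d f ≫ copiesMap d g :=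
  copies_hom_ext fun i => by
    rw [inc_copiesMap, ← Category.assoc, inc_copiesMap]
    simp only [Category.assoc, inc_copiesMap]

lemma exists_inc_apply (X : Over S) (y : (copies d X).left) :
    ∃ (i : Fin d) (x : X.left), (inc d X i).left x = y := by
  obtain ⟨i, x, h⟩ := (sigmaOpenCover (fun _ : Fin d => X.left)).exists_eq y
  exact ⟨i, x, h⟩

lemma eq_of_inc_apply_eq {X : Over S} {i j : Fin d} {x x' : X.left}
    (h : (inc d X i).left x = (inc d X j).left x') : i = j := by
  have := (AlgebraicGeometry.sigmaι_eq_iff (fun _ : Fin d => X.left) i j x x').1 h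
  exact congrArg Sigma.fst this

instance isOpenImmersion_inc (X : Over S) (i : Fin d) : IsOpenImmersion (inc d X i).left :=
  inferInstanceAs (IsOpenImmersion (Sigma.ι (fun _ : Fin d => X.left) i))

/-- The locally constant function on `X ⊔ ⋯ ⊔ X` with value `i` on the `i`-th copy. -/
noncomputable def copiesIdx (d : ℕ) (X : Over S) : LocallyConstant (copies d X).left (Fin d) where
  toFun y := (exists_inc_apply X y).choose
  isLocallyConstant := by
    rw [IsLocallyConstant.iff_exists_open]
    intro y
    obtain ⟨x, hx⟩ := (exists_inc_apply X y).choose_spec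
    refine ⟨(inc d X _).left.opensRange, (inc d X _).left.opensRange.2, ⟨x, hx⟩, ?_⟩
    rintro _ ⟨x', rfl⟩
    obtain ⟨x'', hx''⟩ := (exists_inc_apply X ((inc d X
      (exists_inc_apply X y).choose).left x')).choose_spec
    exact eq_of_inc_apply_eq hx''

lemma exists_inc_copiesIdx (X : Over S) (y : (copies d X).left) :
    ∃ x : X.left, (inc d X (copiesIdx d X y)).left x = y :=
  (exists_inc_apply X y).choose_spec

@[simp]
lemma copiesIdx_inc (X : Over S) (i : Fin d) (x : X.left) :
    copiesIdx d X ((inc d X i).left x) = i := by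
  obtain ⟨x', hx'⟩ := exists_inc_copiesIdx X ((inc d X i).left x)
  exact eq_of_inc_apply_eq hx'

lemma inc_fold_apply (X : Over S) (y : (copies d X).left) :
    (inc d X (copiesIdx d X y)).left ((fold d X).left y) = y := by
  obtain ⟨x, hx⟩ := exists_inc_copiesIdx X y
  have h : (fold d X).left ((inc d X (copiesIdx d X y)).left x) = x := by
    rw [← Scheme.Hom.comp_apply, ← Over.comp_left, inc_fold]
    rfl
  rw [hx] at h
  rw [h, hx]

/-- A morphism to `X ⊔ ⋯ ⊔ X` with image in the `i`-th copy factors through it. -/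
lemma eq_comp_inc {X Y : Over S} {f : Y ⟶ copies d X} {i : Fin d}
    (h : ConstOn (copiesIdx d X) f i) : f = (f ≫ fold d X) ≫ inc d X i := by
  have hr : Set.range f.left ⊆ Set.range (inc d X i).left := by
    rintro _ ⟨y, rfl⟩
    rw [← h y]
    exact ⟨_, inc_fold_apply X _⟩
  have h1 : IsOpenImmersion.lift (inc d X i).left f.left hr ≫ (inc d X i).left = f.left :=
    IsOpenImmersion.lift_fac _ _ _
  have h2 : f.left ≫ (fold d X).left = IsOpenImmersion.lift (inc d X i).left f.left hr := by
    conv_lhs => rw [← h1]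
    rw [Category.assoc, ← Over.comp_left, inc_fold, Over.id_left, Category.comp_id]
  ext : 1
  rw [Over.comp_left, Over.comp_left, h2, h1]

lemma constOn_comp_inc {X Y : Over S} (f : Y ⟶ X) (i : Fin d) :
    ConstOn (copiesIdx d X) (f ≫ inc d X i) i := fun y => by
  rw [Over.comp_left, Scheme.Hom.comp_apply, copiesIdx_inc]

/-- The sieve on `X ⊔ ⋯ ⊔ X` consisting of the morphisms that factor through a member of `R`
followed by the inclusion of one of the copies. -/
def copiesSieve (d : ℕ) {X : Over S} (R : Sieve X) : Sieve (copies d X) where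
  arrows _ f := ∃ (i : Fin d), R (f ≫ fold d X) ∧ f = (f ≫ fold d X) ≫ inc d X i
  downward_closed := by
    rintro Y Z f ⟨i, h, h'⟩ g
    exact ⟨i, by rw [Category.assoc]; exact R.downward_closed h g, by
      conv_lhs => rw [h']
      simp only [Category.assoc]⟩

lemma copiesSieve_mem {X : Over S} {R : Sieve X} (hR : R ∈ Scheme.fppfTopology.over S X) :
    copiesSieve d R ∈ Scheme.fppfTopology.over S (copies d X) := by
  refine GrothendieckTopology.superset_covering _ ?_ (GrothendieckTopology.intersection_covering _
    (constSieve_mem (copiesIdx d X)) (GrothendieckTopology.pullback_stable _ (fold d X) hR))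
  rintro Y f ⟨⟨i, hi⟩, h⟩
  exact ⟨i, h, eq_comp_inc hi⟩

/-- The empty scheme is covered by the empty family. -/
lemma bot_mem_of_isEmpty (X : Over S) [IsEmpty X.left] :
    (⊥ : Sieve X) ∈ Scheme.fppfTopology.over S X := by
  rw [GrothendieckTopology.mem_over_iff]
  refine GrothendieckTopology.superset_covering _ ?_ (Precoverage.generate_mem_toGrothendieck
    (Scheme.bot_mem_precoverage _ X.left))
  rw [Sieve.generate_le_iff]
  rintro _ _ ⟨⟩

end Copies

/-! ### Trivial torsors on disjoint unions -/

section CopiesTorsors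

variable {S : Scheme.{u}} {d : ℕ} {G : Sheaf (Scheme.fppfTopology.over S) GrpCat.{u}}

/-- Multiplication by `a` on the left, as an endomorphism of the trivial torsor. -/
noncomputable def Tors.mulLeft {X : Over S} (a : G.obj.obj (op X)) :
    (⟨X, Torsor.trivial G X⟩ : Tors G) ⟶ ⟨X, Torsor.trivial G X⟩ :=
  Tors.ofSection _ (𝟙 X) (Torsor.triv (𝟙 X) a)

@[simp] lemma Tors.mulLeft_base {X : Over S} (a : G.obj.obj (op X)) :
    (Tors.mulLeft a).base = 𝟙 X := rfl

lemma Tors.trivialMap_mulLeft {X Y : Over S} (k : Y ⟶ X) (a : G.obj.obj (op X)) :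
    Tors.trivialMap G k ≫ Tors.mulLeft a =
      Tors.mulLeft (G.obj.map k.op a) ≫ Tors.trivialMap G k := by
  have h1 := Tors.trivialMap_comp_ofSection (⟨X, Torsor.trivial G X⟩ : Tors G) k (𝟙 X)
    (Category.comp_id k) (Torsor.triv (𝟙 X) a)
  have h2 := Tors.ofSection_comp (B := ⟨Y, Torsor.trivial G Y⟩) (𝟙 Y)
    (Torsor.triv (𝟙 Y) (G.obj.map k.op a)) (Tors.trivialMap G k) (t' := k) (Category.id_comp k)
  refine h1.trans (Eq.trans ?_ h2.symm)
  congr 1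
  exact (Tors.on_trivialMap k _ _).symm

lemma Tors.mulLeft_ofSection (B : Tors G) {X : Over S} (t : X ⟶ B.base) (s : B.torsor.sec t)
    (a : G.obj.obj (op X)) :
    Tors.mulLeft a ≫ Tors.ofSection B t s = Tors.ofSection B t (B.torsor.ac s a) :=
  (Tors.ofSection_ac t s a).symm

lemma Tors.mulLeft_mulLeft {X : Over S} (a b : G.obj.obj (op X)) :
    Tors.mulLeft a ≫ Tors.mulLeft b = Tors.mulLeft (b * a) :=
  Tors.mulLeft_ofSection _ _ _ _

lemma Tors.mulLeft_one {X : Over S} : Tors.mulLeft (1 : G.obj.obj (op X)) = 𝟙 _ := by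
  refine Tors.hom_ext_trivial rfl fun z hu hv => ?_
  obtain rfl : 𝟙 X = z := by rw [← hu, Category.id_comp]; rfl
  exact (Tors.on_ofSection_one _ _ _ _).trans (Tors.on_id (A := ⟨X, Torsor.trivial G X⟩) _ _).symm

lemma Tors.trivialMap_comp {X Y Z : Over S} (f : X ⟶ Y) (g : Y ⟶ Z) :
    Tors.trivialMap G (f ≫ g) = Tors.trivialMap G f ≫ Tors.trivialMap G g := by
  refine Tors.hom_ext_trivial rfl fun z hu hv => ?_
  have hz : f ≫ (trivialMap G g).base = z := by rw [← hv]; exact (Category.id_comp _).symm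
  refine (Tors.on_trivialMap _ hu _).trans (Eq.symm ?_)
  refine (Tors.on_comp (trivialMap G f) (trivialMap G g) (Category.id_comp f : 𝟙 X ≫ f = f)
    hz hv _).trans ?_
  refine (congrArg (Tors.on (trivialMap G g) hz) (Tors.on_trivialMap f _ _)).trans ?_
  exact Tors.on_trivialMap g hz _

lemma Tors.trivialMap_id {X : Over S} : Tors.trivialMap G (𝟙 X) = 𝟙 _ := by
  refine Tors.hom_ext_trivial rfl fun z hu hv => ?_
  obtain rfl : 𝟙 X = z := by rw [← hu, Category.id_comp]; rfl
  exact (Tors.on_trivialMap _ _ _).trans (Tors.on_id (A := ⟨X, Torsor.trivial G X⟩) _ _).symm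

/-- Morphisms out of the trivial torsor over `X ⊔ ⋯ ⊔ X` are determined locally on `X` on each of
the copies. -/
lemma hom_ext_copies {X : Over S} {A : Tors G}
    {u v : (⟨copies d X, Torsor.trivial G (copies d X)⟩ : Tors G) ⟶ A} (R : Sieve X)
    (hR : R ∈ Scheme.fppfTopology.over S X)
    (h : ∀ (i : Fin d) {Y : Over S} (k : Y ⟶ X), R k →
      Tors.trivialMap G (k ≫ inc d X i) ≫ u = Tors.trivialMap G (k ≫ inc d X i) ≫ v) : u = v := by
  have hb : u.base = v.base := by
    refine copies_hom_ext fun i => hom_ext_of_mem hR fun Y k hk => ?_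
    have := congrArg Tors.Hom.base (h i k hk)
    simpa using this
  refine Tors.hom_ext_trivial hb fun z hu hv => ?_
  refine A.torsor.sec_ext (copiesSieve_mem (d := d) hR) fun Y g ⟨i, hg, e⟩ => ?_
  have h1 := h i _ hg
  rw [← e] at h1
  have hz : u.base = z := by rw [← hu, Category.id_comp]
  have hz' : v.base = z := by rw [← hv, Category.id_comp]
  refine (Tors.rs_toSection u hz g rfl).trans (Eq.trans ?_ (Tors.rs_toSection v hz' g rfl).symm)
  exact Tors.toSection_congr h1 _ _

/-- A morphism out of the trivial torsor over `X ⊔ ⋯ ⊔ X` with given restrictions to the copies. -/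
lemma exists_hom_copies {X : Over S} {A : Tors G}
    (m : Fin d → ((⟨X, Torsor.trivial G X⟩ : Tors G) ⟶ A)) :
    ∃ u : (⟨copies d X, Torsor.trivial G (copies d X)⟩ : Tors G) ⟶ A,
      ∀ i, Tors.trivialMap G (inc d X i) ≫ u = m i := by
  let b : copies d X ⟶ A.base := copiesDesc fun i => (m i).base
  have hb : ∀ i, inc d X i ≫ b = (m i).base := fun i => inc_copiesDesc _ i
  have hc : ∀ {Y : Over S} (g : Y ⟶ copies d X) (i : Fin d) (_ : g = (g ≫ fold d X) ≫ inc d X i),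
      (g ≫ fold d X) ≫ (m i).base = g ≫ b := fun g i e => by
    conv_rhs => rw [e]
    rw [Category.assoc _ _ b, hb]
  -- the section over a morphism that factors through the `i`-th copy
  let s : ∀ {Y : Over S} (g : Y ⟶ copies d X) (i : Fin d) (_ : g = (g ≫ fold d X) ≫ inc d X i),
      A.torsor.sec (g ≫ b) := fun g i e =>
    A.torsor.rs (g ≫ fold d X) (hc g i e) (Tors.toSection (m i) rfl)
  -- only a morphism from the empty scheme factors through two different copies, and over the empty
  -- scheme a torsor has just one section
  have hs : ∀ {Y : Over S} (g : Y ⟶ copies d X) (i j : Fin d) (e : g = (g ≫ fold d X) ≫ inc d X i)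
      (e' : g = (g ≫ fold d X) ≫ inc d X j), s g i e = s g j e' := by
    intro Y g i j e e'
    by_cases hY : IsEmpty Y.left
    · exact A.torsor.sec_ext (bot_mem_of_isEmpty Y) fun _ _ h => h.elim
    · obtain ⟨y⟩ := not_isEmpty_iff.1 hY
      have h1 := constOn_comp_inc (d := d) (g ≫ fold d X) i y
      have h2 := constOn_comp_inc (d := d) (g ≫ fold d X) j y
      rw [← e] at h1
      rw [← e'] at h2
      obtain rfl : i = j := h1.symm.trans h2
      rfl
  obtain ⟨t, ht⟩ := A.torsor.glue (y := b) (copiesSieve_mem (d := d)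
    (GrothendieckTopology.top_mem _ X)) (fun Y g hg => s g hg.choose hg.choose_spec.2) (by
      intro Y Z g k hg
      have hkg := (copiesSieve d ⊤).downward_closed hg k
      have e1 := hg.choose_spec.2
      have e2 : k ≫ g = ((k ≫ g) ≫ fold d X) ≫ inc d X hg.choose := by
        conv_lhs => rw [e1]
        simp only [Category.assoc]
      refine Eq.trans ?_ (hs (k ≫ g) hg.choose _ e2 hkg.choose_spec.2)
      refine (Torsor.rs_rs _ _ _ _ _ _).trans ?_
      exact Torsor.rs_congr _ (Category.assoc _ _ _).symm _ _)
  refine ⟨Tors.ofSection A b t, fun i => ?_⟩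
  have hi : (copiesSieve d (⊤ : Sieve X)) (inc d X i) := ⟨i, trivial, by simp⟩
  rw [Tors.trivialMap_comp_ofSection A (inc d X i) b (hb i)]
  conv_rhs => rw [← Tors.ofSection_toSection (m i) rfl]
  congr 1
  have h1 := ht (inc d X i) hi
  rw [hs _ hi.choose i hi.choose_spec.2 (by simp)] at h1
  have h2 : ∀ {z : X ⟶ A.base} (e : inc d X i ≫ b = z) (t' : A.torsor.sec (inc d X i ≫ b)),
      A.torsor.rs (inc d X i) rfl t = t' → A.torsor.rs (inc d X i) e t =
        A.torsor.rs (𝟙 X) (by rw [Category.id_comp, e]) t' := by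
    rintro _ rfl _ rfl
    simp
  rw [h2 (hb i) _ h1]
  refine (Torsor.rs_rs _ _ _ _ _ _).trans ?_
  refine (Torsor.rs_congr _ (?_ : _ = 𝟙 X) _ _).trans (Torsor.rs_id _ _ _)
  simp

end CopiesTorsors

/-! ### Finite étale morphisms: splitting and descent -/

section FiniteEtale

open TensorProduct

lemma finEtale_of_isPullback {d : ℕ} {T' X' T X : Scheme.{u}} {g : T' ⟶ T} {p' : T' ⟶ X'}
    {p : T ⟶ X} {f : X' ⟶ X} (h : IsPullback g p' p f) (hp : finEtale d p) : finEtale d p' := by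
  obtain ⟨h1, h2, h3⟩ := hp
  have h4 : IsFinite p' := MorphismProperty.of_isPullback h h1
  have h5 : Etale p' := MorphismProperty.of_isPullback h h2
  refine ⟨h4, h5, fun x => ?_⟩
  rw [Scheme.Hom.finrank_of_isPullback _ _ _ _ h, h3]

instance coverProp_isStableUnderBaseChange (S : Scheme.{u}) (d : ℕ) :
    (coverProp S d).IsStableUnderBaseChange where
  of_isPullback h hp := finEtale_of_isPullback (h.map (Over.forget S)) hp

/-- The spectrum of a totally split algebra is a disjoint union of copies of the spectrum of the
base ring. -/
lemma exists_iso_schemeFold (n : ℕ) (B C : Type u) [CommRing B] [CommRing C] [Algebra B C]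
    (e : C ≃ₐ[B] (Fin n → B)) :
    ∃ a : (∐ fun _ : Fin n => Spec (.of B)) ≅ Spec (.of C),
      a.hom ≫ Spec.map (CommRingCat.ofHom (algebraMap B C)) = schemeFold n (Spec (.of B)) := by
  let e' : C ≃+* (ULift.{u} (Fin n) → B) :=
    e.toRingEquiv.trans (RingEquiv.piCongrLeft' (fun _ => B) Equiv.ulift.symm)
  have h : Spec.map (CommRingCat.ofHom e'.toRingHom) ≫
      Spec.map (CommRingCat.ofHom (algebraMap B C)) =
      Spec.map (CommRingCat.ofHom (algebraMap B (ULift.{u} (Fin n) → B))) := by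
    rw [← Spec.map_comp, ← CommRingCat.ofHom_comp]
    congr 2
    ext b i
    exact congrFun (e.commutes b) i.down
  have hiso : IsIso (Spec.map (CommRingCat.ofHom e'.toRingHom)) :=
    inferInstanceAs (IsIso (Spec.map e'.toCommRingCatIso.hom))
  refine ⟨(Sigma.reindex (Equiv.ulift.{u} : _ ≃ Fin n) fun _ => Spec (.of B)).symm ≪≫
    asIso (sigmaSpec (fun _ : ULift.{u} (Fin n) => .of B)) ≪≫
      asIso (Spec.map (CommRingCat.ofHom e'.toRingHom)), ?_⟩
  simp only [Iso.trans_hom, Iso.symm_hom, Category.assoc, asIso_hom]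
  rw [h, Iso.inv_comp_eq]
  refine Sigma.hom_ext _ _ fun i => ?_
  refine Eq.trans ?_ (Sigma.ι_reindex_hom_assoc _ _ _ _).symm
  refine (ι_sigmaSpec_assoc (fun _ : ULift.{u} (Fin n) => .of B) i _).trans ?_
  rw [← Spec.map_comp, schemeFold, Sigma.ι_desc]
  exact Spec.map_id _

/-- A finite étale cover of degree `d` of a nonempty affine scheme is a disjoint union of `d` copies
of the base, after a faithfully flat étale base change. -/
lemma exists_split_of_isAffine {d : ℕ} {X T : Scheme.{u}} [IsAffine X] [Nonempty X] (f : T ⟶ X)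
    (hf : finEtale d f) : ∃ (Y : Scheme.{u}) (b : Y ⟶ X) (_ : Surjective b) (_ : Etale b)
      (a : (∐ fun _ : Fin d => Y) ⟶ T), IsPullback a (schemeFold d Y) f b := by
  obtain ⟨h1, h2, h3⟩ := hf
  wlog hX : ∃ R, X = Spec R generalizing X
  · have hpb : IsPullback (𝟙 T) f (f ≫ X.isoSpec.hom) X.isoSpec.hom :=
      IsPullback.of_horiz_isIso ⟨by simp⟩
    have hpb' : IsPullback (𝟙 T) (f ≫ X.isoSpec.hom) f X.isoSpec.inv :=
      IsPullback.of_horiz_isIso ⟨by simp⟩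
    have hne : Nonempty (Spec Γ(X, ⊤)) := ⟨X.isoSpec.hom (Classical.arbitrary X)⟩
    obtain ⟨Y, b, hb, hb', a, ha⟩ := this (f ≫ X.isoSpec.hom) inferInstance inferInstance
      (fun x => by rw [Scheme.Hom.finrank_of_isPullback _ _ _ _ hpb', h3]) ⟨_, rfl⟩
    refine ⟨Y, b ≫ X.isoSpec.inv, inferInstance, inferInstance, a, ?_⟩
    have := ha.paste_horiz hpb'
    rwa [Category.comp_id] at this
  obtain ⟨R, rfl⟩ := hX
  have : IsAffine T := isAffine_of_isAffineHom f
  wlog hT : ∃ A, T = Spec A generalizing T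
  · have hpb : IsPullback T.isoSpec.inv (T.isoSpec.inv ≫ f) f (𝟙 _) :=
      IsPullback.of_horiz_isIso ⟨by simp⟩
    obtain ⟨Y, b, hb, hb', a, ha⟩ := this (T.isoSpec.inv ≫ f) inferInstance inferInstance
      (fun x => by rw [Scheme.Hom.finrank_of_isPullback _ _ _ _ hpb, h3]) inferInstance ⟨_, rfl⟩
    refine ⟨Y, b, hb, hb', a ≫ T.isoSpec.inv, ?_⟩
    have := ha.paste_horiz hpb
    rwa [Category.comp_id] at this
  obtain ⟨A, rfl⟩ := hT
  obtain ⟨φ, rfl⟩ := Spec.map_surjective f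
  algebraize [φ.hom]
  have e1 : Module.Finite R A := RingHom.finite_algebraMap.1 ((IsFinite.SpecMap_iff φ).1 h1)
  have e2 : Algebra.Etale R A := RingHom.etale_algebraMap.1
    ((HasRingHomProperty.Spec_iff (P := @Etale)).1 h2)
  have e3 : Module.rankAtStalk (R := R) A = d := by
    ext x
    rw [← Scheme.Hom.finrank_SpecMap_algebraMap R A]
    exact h3 x
  obtain ⟨B, _, _, hB1, hB2, hB3, hB4⟩ := Algebra.IsFiniteSplit.exists_tensorProduct_of_etale e3
  obtain ⟨n, ⟨e⟩⟩ := Algebra.IsFiniteSplit.nonempty_algEquiv_fun B (B ⊗[R] A)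
  obtain ⟨a, ha⟩ := exists_iso_schemeFold n B (B ⊗[R] A) e
  let b : Spec (.of B) ⟶ Spec R := Spec.map (CommRingCat.ofHom (algebraMap R B))
  have hpb := (isPullback_SpecMap_of_isPushout _ _ _ _
    (CommRingCat.isPushout_tensorProduct R B A)).flip
  have hpb' : IsPullback (a.hom ≫ Spec.map (CommRingCat.ofHom
      (Algebra.TensorProduct.includeRight (R := R) (A := B) (B := A)).toRingHom))
      (schemeFold n (Spec (.of B))) (Spec.map φ) b := by
    refine IsPullback.of_iso hpb a.symm (Iso.refl _) (Iso.refl _) (Iso.refl _) ?_ ?_ ?_ ?_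
    · simp
    · rw [← ha]
      simp
    · simp
      rfl
    · simp
      rfl
  have hsurj : Surjective b := by
    have := (flat_and_surjective_SpecMap_iff (CommRingCat.ofHom (algebraMap R B))).2
      ((RingHom.faithfullyFlat_algebraMap_iff).2 hB1)
    exact this.2
  have het : Etale b := (HasRingHomProperty.Spec_iff (P := @Etale)).2
    (RingHom.etale_algebraMap.2 hB3)
  obtain ⟨y, -⟩ := b.surjective (Classical.arbitrary _)
  -- the number of copies is the degree, which is preserved by base change
  have hn : n = d := by
    rw [← (schemeFold_finEtale n (Spec (.of B))).2.2 y,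
      Scheme.Hom.finrank_of_isPullback _ _ _ _ hpb', h3]
  subst hn
  exact ⟨_, b, hsurj, het, _, hpb'⟩

lemma descendsAlong_fppf (P : MorphismProperty Scheme.{u})
    [P.DescendsAlong (@Surjective ⊓ @Flat ⊓ @QuasiCompact)] [IsZariskiLocalAtTarget P] :
    P.DescendsAlong (@Surjective ⊓ @Flat ⊓ @LocallyOfFinitePresentation) := inferInstance

/-- Among affine morphisms, being finite étale of degree `d` descends along fppf coverings. -/
lemma finEtale_of_fppf_descent {d : ℕ} {T' X' T X : Scheme.{u}} {g : T' ⟶ T} {p' : T' ⟶ X'}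
    {p : T ⟶ X} {f : X' ⟶ X} (h : IsPullback g p' p f) [IsAffineHom p] [Surjective f] [Flat f]
    [LocallyOfFinitePresentation f] (hp : finEtale d p') : finEtale d p := by
  obtain ⟨h1, h2, h3⟩ := hp
  have hf : (@Surjective ⊓ @Flat ⊓ @LocallyOfFinitePresentation : MorphismProperty Scheme.{u}) f :=
    ⟨⟨inferInstance, inferInstance⟩, inferInstance⟩
  have d1 := descendsAlong_fppf @UniversallyClosed
  have : IsZariskiLocalAtTarget @Etale.{u} :=
    HasRingHomProperty.instIsZariskiLocalAtTarget (P := @Etale) (Q := RingHom.Etale)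
  have d2 := descendsAlong_fppf @Etale
  have e1 : UniversallyClosed p := MorphismProperty.of_isPullback_of_descendsAlong
    (Q := @Surjective ⊓ @Flat ⊓ @LocallyOfFinitePresentation) h.flip hf inferInstance
  have e2 : Etale p := MorphismProperty.of_isPullback_of_descendsAlong
    (Q := @Surjective ⊓ @Flat ⊓ @LocallyOfFinitePresentation) h.flip hf h2
  -- finite means universally closed, affine and of finite type; the first descends
  have e3 : IsIntegralHom p := IsIntegralHom.iff_universallyClosed_and_isAffineHom.2
    ⟨e1, inferInstance⟩
  have e4 : IsFinite p := (IsFinite.iff_isIntegralHom_and_locallyOfFiniteType p).2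
    ⟨e3, inferInstance⟩
  refine ⟨e4, e2, fun x => ?_⟩
  obtain ⟨y, rfl⟩ := f.surjective x
  rw [← Scheme.Hom.finrank_of_isPullback _ _ _ _ h, h3]

end FiniteEtale

/-! ### Finite étale covers are locally split -/

section Splitting

variable {S : Scheme.{u}} {d : ℕ}

/-- A sieve is covering for the fppf topology on `Sch_S` if it contains a jointly surjective family
of flat morphisms locally of finite presentation. -/
lemma mem_fppf_over_of_family {X : Over S} (R : Sieve X) {ι : Type u} {U : ι → Scheme.{u}}
    (f : ∀ i, U i ⟶ X.left) [∀ i, Flat (f i)] [∀ i, LocallyOfFinitePresentation (f i)]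
    (hf : ∀ x : X.left, ∃ (i : ι) (y : U i), f i y = x)
    (hR : ∀ i, R (Over.homMk (f i) rfl : Over.mk (f i ≫ X.hom) ⟶ X)) :
    R ∈ Scheme.fppfTopology.over S X := by
  rw [GrothendieckTopology.mem_over_iff]
  have h : Presieve.ofArrows _ f ∈ Scheme.fppfPrecoverage X.left :=
    (Scheme.ofArrows_mem_precoverage_iff _).2 ⟨hf, fun i => ⟨inferInstance, inferInstance⟩⟩
  refine GrothendieckTopology.superset_covering _ ?_ (Precoverage.generate_mem_toGrothendieck h)
  rw [Sieve.generate_le_iff]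
  rintro _ _ ⟨a⟩
  exact (Sieve.overEquiv_iff _ _).2 (hR a)

lemma ofArrows_mem_fppf_over {W X : Over S} (p : W ⟶ X) [Surjective p.left] [Flat p.left]
    [LocallyOfFinitePresentation p.left] :
    Sieve.generate (Presieve.singleton p) ∈ Scheme.fppfTopology.over S X := by
  refine mem_fppf_over_of_family _ (fun _ : PUnit.{u+1} => p.left)
    (fun x => ⟨⟨⟩, p.left.surjective x⟩) fun _ => ?_
  exact ⟨W, Over.homMk (𝟙 _) (by simp), p, ⟨⟩, by ext : 1; simp⟩

/-- The sieve of those `Y ⟶ X` over which `π : T ⟶ X` becomes isomorphic to `Y ⊔ ⋯ ⊔ Y`. -/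
def splitSieve (d : ℕ) {T X : Over S} (π : T ⟶ X) : Sieve X where
  arrows Y g := ∃ a : copies d Y ⟶ T, IsPullback a (fold d Y) π g
  downward_closed := by
    rintro Y Z g ⟨a, ha⟩ k
    exact ⟨_, (copies_isPullback d k).paste_horiz ha⟩

/-- Finite étale covers are locally split. -/
lemma splitSieve_mem {T X : Over S} (π : T ⟶ X) (hπ : coverProp S d π) :
    splitSieve d π ∈ Scheme.fppfTopology.over S X := by
  have key : ∀ x : X.left, ∃ (Y : Scheme.{u}) (b : Y ⟶ X.left) (_ : Etale b)
      (a : (∐ fun _ : Fin d => Y) ⟶ T.left), IsPullback a (schemeFold d Y) π.left b ∧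
        ∃ y, b y = x := by
    intro x
    obtain ⟨U, hU, hx, -⟩ := exists_isAffineOpen_mem_and_subset (x := x) (U := ⊤) trivial
    -- the affine case is applied to an affine neighbourhood of `x`
    have : IsAffine U := hU
    have : Nonempty U := ⟨⟨x, hx⟩⟩
    have hpb := IsPullback.of_hasPullback π.left U.ι
    obtain ⟨Y, b, hb, hb', a, ha⟩ := exists_split_of_isAffine _ (finEtale_of_isPullback hpb hπ)
    obtain ⟨y, hy⟩ := b.surjective ⟨x, hx⟩
    refine ⟨Y, b ≫ U.ι, inferInstance, _, ha.paste_horiz hpb, y, ?_⟩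
    rw [Scheme.Hom.comp_apply, hy]
    rfl
  choose Y b hb a ha hb' using key
  refine mem_fppf_over_of_family _ b (fun x => ⟨x, hb' x⟩) fun x => ?_
  have hw : (schemeFold d (Y x) ≫ b x ≫ X.hom) = a x ≫ T.hom := by
    rw [← Category.assoc, ← (ha x).w, Category.assoc, Over.w]
  refine ⟨Over.homMk (a x) hw.symm, IsPullback.of_map_of_faithful (Over.forget S) (ha x)⟩

end Splitting

/-! ### Automorphisms of split objects -/

section SplitAutomorphisms

variable {S : Scheme.{u}} {d : ℕ} {G : Sheaf (Scheme.fppfTopology.over S) GrpCat.{u}}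

/-- A locally constant function is constant on a neighbourhood of every point. -/
lemma exists_constOn {A : Type*} {Z : Over S} (σ : LocallyConstant Z.left A) (z : Z.left) :
    ∃ (Y : Over S) (k : Y ⟶ Z) (y : Y.left), k.left y = z ∧ ConstOn σ k (σ z) := by
  let U : Z.left.Opens := ⟨σ ⁻¹' {σ z}, σ.isLocallyConstant.isOpen_fiber _⟩
  exact ⟨Over.mk (U.ι ≫ Z.hom), Over.homMk U.ι rfl, ⟨z, rfl⟩, rfl, fun y => y.2⟩

/-- A morphism of trivial torsors is left multiplication by its value at `1`. -/
lemma Tors.exists_eq_mulLeft {X Y : Over S}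
    (u : (⟨X, Torsor.trivial G X⟩ : Tors G) ⟶ ⟨Y, Torsor.trivial G Y⟩) :
    ∃ a : G.obj.obj (op X), u = Tors.mulLeft a ≫ Tors.trivialMap G u.base := by
  refine ⟨(Tors.toSection u rfl : (Torsor.trivial G Y).sec u.base), ?_⟩
  conv_lhs => rw [← Tors.ofSection_toSection u rfl]
  refine Eq.symm ((Tors.ofSection_comp (B := ⟨X, Torsor.trivial G X⟩) (𝟙 X) (Torsor.triv (𝟙 X) _)
    (Tors.trivialMap G u.base) (t' := u.base) (Category.id_comp _)).trans ?_)
  congr 1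
  exact Tors.on_trivialMap _ _ _

lemma Tors.mulLeft_trivialMap {X Y : Over S} (a : G.obj.obj (op X)) (f : X ⟶ Y) :
    Tors.mulLeft a ≫ Tors.trivialMap G f =
      Tors.ofSection ⟨Y, Torsor.trivial G Y⟩ f (Torsor.triv f a) := by
  refine (Tors.ofSection_comp (B := ⟨X, Torsor.trivial G X⟩) (𝟙 X) (Torsor.triv (𝟙 X) a)
    (Tors.trivialMap G f) (t' := f) (Category.id_comp _)).trans ?_
  congr 1
  exact Tors.on_trivialMap _ _ _

lemma Tors.mulLeft_trivialMap_injective {X Y : Over S} {a b : G.obj.obj (op X)} {f : X ⟶ Y}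
    (h : Tors.mulLeft a ≫ Tors.trivialMap G f = Tors.mulLeft b ≫ Tors.trivialMap G f) : a = b := by
  rw [Tors.mulLeft_trivialMap, Tors.mulLeft_trivialMap] at h
  exact Tors.ofSection_injective h

/-- A morphism of trivial torsors which after restriction along `g` becomes left multiplication by
`a` has value `a` at `1`, after restriction along `g`. -/
lemma Tors.map_ap_one {X' X Y : Over S} {g : X' ⟶ X} {f : X' ⟶ Y} {a : G.obj.obj (op X')}
    {u : (⟨X, Torsor.trivial G X⟩ : Tors G) ⟶ ⟨Y, Torsor.trivial G Y⟩}
    (h : Tors.trivialMap G g ≫ u = Tors.mulLeft a ≫ Tors.trivialMap G f) :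
    G.obj.map g.op (u.ap (𝟙 X) (1 : G.obj.obj (op X))) = a := by
  have hb : g ≫ u.base = f := (congrArg Tors.Hom.base h).trans (Category.id_comp f)
  have h1 := ((Tors.rs_toSection u rfl g hb).trans
    (Tors.toSection_congr (h.trans (Tors.mulLeft_trivialMap a f)) hb rfl)).trans
    (Tors.toSection_ofSection (B := ⟨Y, Torsor.trivial G Y⟩) f (Torsor.triv f a) rfl)
  refine Eq.trans ?_ h1
  refine congrArg (G.obj.map g.op) ?_
  have h2 : ∀ {z : X ⟶ Y} (hz : 𝟙 X ≫ u.base = z),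
      (u.ap (𝟙 X) (1 : G.obj.obj (op X)) : G.obj.obj (op X)) =
        (Tors.on u hz (Torsor.triv (𝟙 X) 1) : (Torsor.trivial G Y).sec z) := by
    rintro _ rfl
    exact (Tors.on_rfl u _).symm
  exact h2 _

/-- Morphisms from a trivial torsor are equal if they are so locally. -/
lemma Tors.hom_ext_of_mem {X : Over S} {A : Tors G}
    {u v : (⟨X, Torsor.trivial G X⟩ : Tors G) ⟶ A} {R : Sieve X}
    (hR : R ∈ Scheme.fppfTopology.over S X)
    (h : ∀ {Y : Over S} (k : Y ⟶ X), R k →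
      Tors.trivialMap G k ≫ u = Tors.trivialMap G k ≫ v) : u = v := by
  have hb : u.base = v.base := TorsorGerbe.hom_ext_of_mem hR fun Y k hk =>
    congrArg Tors.Hom.base (h k hk)
  refine Tors.hom_ext_trivial hb fun z hu hv => A.torsor.sec_ext hR fun Y g hg => ?_
  have hz : u.base = z := by rw [← hu, Category.id_comp]
  have hz' : v.base = z := by rw [← hv, Category.id_comp]
  refine (Tors.rs_toSection u hz g rfl).trans (Eq.trans ?_ (Tors.rs_toSection v hz' g rfl).symm)
  exact Tors.toSection_congr (h g hg) _ _

/-- Where `σ` takes the value `τ`, the endomorphism `u` of the split object is the one given by `n`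
and `τ`. -/
def IsSplitEnd {Z : Over S} (n : Fin d → G.obj.obj (op Z))
    (σ : LocallyConstant Z.left (Equiv.Perm (Fin d)))
    (u : (⟨copies d Z, Torsor.trivial G (copies d Z)⟩ : Tors G) ⟶
      ⟨copies d Z, Torsor.trivial G (copies d Z)⟩) : Prop :=
  ∀ ⦃Y : Over S⦄ (k : Y ⟶ Z) (τ : Equiv.Perm (Fin d)), ConstOn σ k τ → ∀ i : Fin d,
    Tors.trivialMap G (k ≫ inc d Z i) ≫ u =
      Tors.mulLeft (G.obj.map k.op (n (τ i))) ≫ Tors.trivialMap G (k ≫ inc d Z (τ i))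

variable {Z : Over S} {n : Fin d → G.obj.obj (op Z)}
  {σ : LocallyConstant Z.left (Equiv.Perm (Fin d))}
  {u v : (⟨copies d Z, Torsor.trivial G (copies d Z)⟩ : Tors G) ⟶
      ⟨copies d Z, Torsor.trivial G (copies d Z)⟩}

/-- `n` and `σ` determine the endomorphism. -/
lemma IsSplitEnd.unique (hu : IsSplitEnd n σ u) (hv : IsSplitEnd n σ v) : u = v :=
  hom_ext_copies (constSieve σ) (constSieve_mem σ) fun i Y k ⟨τ, hk⟩ => by
    rw [hu k τ hk, hv k τ hk]

/-- It suffices to check the condition on the parts of `Z` where a finer locally constant function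
is constant. -/
lemma IsSplitEnd.of_refinement {A : Type*} (ρ : LocallyConstant Z.left A)
    (F : A → Equiv.Perm (Fin d)) (hF : ∀ z, σ z = F (ρ z))
    (h : ∀ {Y : Over S} (k : Y ⟶ Z) (c : A), ConstOn ρ k c → ∀ i : Fin d,
      Tors.trivialMap G (k ≫ inc d Z i) ≫ u =
        Tors.mulLeft (G.obj.map k.op (n (F c i))) ≫ Tors.trivialMap G (k ≫ inc d Z (F c i))) :
    IsSplitEnd n σ u := by
  intro Y k τ hk i
  refine Tors.hom_ext_of_mem (constSieve_mem (ρ.comap k.left.base.hom)) fun {Y'} l ⟨c, hl⟩ => ?_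
  by_cases hY : IsEmpty Y'.left
  · exact Tors.hom_ext_of_mem (bot_mem_of_isEmpty Y') fun _ h => h.elim
  · obtain ⟨y⟩ := not_isEmpty_iff.1 hY
    have hτ : τ = F c := by
      rw [← hk.comp l y, hF, ConstOn.comap k hl y]
    have h1 := h (l ≫ k) c (ConstOn.comap k hl) i
    rw [← hτ] at h1
    rw [← Category.assoc, ← Tors.trivialMap_comp, ← Category.assoc, h1, ← Category.assoc,
      Tors.trivialMap_mulLeft, Category.assoc (Tors.mulLeft _), ← Tors.trivialMap_comp,
      Category.assoc l, op_comp, G.obj.map_comp, GrpCat.comp_apply]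

variable (n σ) in
/-- Every `n` and `σ` give an endomorphism: its restriction to the `i`-th copy is glued from the
morphisms to the copies `σ(i)`, which are given where `σ` is constant, and from the elements `n (σ
i)`. -/
lemma exists_isSplitEnd : ∃ u, IsSplitEnd n σ u := by
  have h1 : ∀ i : Fin d, ∃ b : Z ⟶ copies d Z, ∀ ⦃Y : Over S⦄ (k : Y ⟶ Z)
      (τ : Equiv.Perm (Fin d)), ConstOn σ k τ → k ≫ b = k ≫ inc d Z (τ i) := fun i =>
    exists_glue (P := yoneda.obj (copies d Z)) ((isSheaf_iff_isSheaf_of_type _ _).2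
      (GrothendieckTopology.Subcanonical.isSheaf_of_isRepresentable _)) σ
      (fun τ => inc d Z (τ i))
  choose b hb using h1
  choose a ha using fun i : Fin d => grp_glue σ (fun τ => n (τ i))
  obtain ⟨u, hu⟩ := exists_hom_copies (fun i => Tors.mulLeft (a i) ≫ Tors.trivialMap G (b i))
  refine ⟨u, fun Y k τ hk i => ?_⟩
  rw [Tors.trivialMap_comp, Category.assoc, hu i, ← Category.assoc, Tors.trivialMap_mulLeft,
    Category.assoc, ← Tors.trivialMap_comp, hb i k τ hk, ha i k τ hk]

lemma IsSplitEnd.one : IsSplitEnd (G := G) (1 : Fin d → G.obj.obj (op Z)) 1 (𝟙 _) := by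
  refine IsSplitEnd.of_refinement (LocallyConstant.const _ ()) (fun _ => 1) (fun _ => rfl) ?_
  intro Y k c _ i
  have h : G.obj.map k.op ((1 : Fin d → G.obj.obj (op Z)) i) = 1 := map_one _
  rw [Equiv.Perm.one_apply, h, Tors.mulLeft_one, Category.comp_id, Category.id_comp]

/-- The composite in which `v` comes first corresponds to the product `(n, σ) * (n', σ')`: the
`i`-th copy goes to the copy `σ (σ' i)`, with multiplication by `n' (σ' i)` and then by `n (σ (σ'
i))`. -/
lemma IsSplitEnd.mul {n' : Fin d → G.obj.obj (op Z)}
    {σ' : LocallyConstant Z.left (Equiv.Perm (Fin d))} (hu : IsSplitEnd n σ u)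
    (hv : IsSplitEnd n' σ' v) : IsSplitEnd (n * permAct σ n') (σ * σ') (v ≫ u) := by
  refine IsSplitEnd.of_refinement
    (⟨fun z => (σ z, σ' z), σ.isLocallyConstant.prodMk σ'.isLocallyConstant⟩ :
      LocallyConstant Z.left (Equiv.Perm (Fin d) × Equiv.Perm (Fin d)))
    (fun c => c.1 * c.2) (fun _ => rfl) fun {Y} k c hk i => ?_
  have h1 : ConstOn σ k c.1 := fun y => congrArg Prod.fst (hk y)
  have h2 : ConstOn σ' k c.2 := fun y => congrArg Prod.snd (hk y)
  rw [← Category.assoc, hv k _ h2, Category.assoc, hu k _ h1, ← Category.assoc,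
    Tors.mulLeft_mulLeft, Equiv.Perm.mul_apply, Pi.mul_apply, map_mul, permAct_spec _ _ _ h1]
  rw [show c.1⁻¹ (c.1 (c.2 i)) = c.2 i from c.1.symm_apply_apply _]

lemma IsSplitEnd.base_fold (hu : IsSplitEnd n σ u) : u.base ≫ fold d Z = fold d Z := by
  refine copies_hom_ext fun i => hom_ext_of_mem (constSieve_mem σ) fun Y k ⟨τ, hk⟩ => ?_
  have h1 := congrArg Tors.Hom.base (hu k τ hk i)
  simp only [Tors.comp_base, Tors.trivialMap_base, Tors.mulLeft_base, Category.id_comp] at h1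
  rw [← Category.assoc, ← Category.assoc, h1]
  simp

/-- Endomorphisms given by restrictions of `n` and `σ` are compatible with base change. -/
lemma IsSplitEnd.map {Z' : Over S} (g : Z' ⟶ Z) (hu : IsSplitEnd n σ u)
    {u' : (⟨copies d Z', Torsor.trivial G (copies d Z')⟩ : Tors G) ⟶
      ⟨copies d Z', Torsor.trivial G (copies d Z')⟩}
    (hu' : IsSplitEnd (fun i => G.obj.map g.op (n i)) (σ.comap g.left.base.hom) u') :
    Tors.trivialMap G (copiesMap d g) ≫ u = u' ≫ Tors.trivialMap G (copiesMap d g) := by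
  refine hom_ext_copies _ (constSieve_mem (σ.comap g.left.base.hom)) fun i Y k ⟨τ, hk⟩ => ?_
  have h1 := hu (k ≫ g) τ hk.comap i
  have e : ∀ j, (k ≫ inc d Z' j) ≫ copiesMap d g = (k ≫ g) ≫ inc d Z j := fun j => by
    rw [Category.assoc, Category.assoc, inc_copiesMap]
  rw [← Category.assoc, ← Tors.trivialMap_comp, e, h1, ← Category.assoc, hu' k τ hk,
    Category.assoc (Tors.mulLeft _), ← Tors.trivialMap_comp, e, op_comp, G.obj.map_comp,
    GrpCat.comp_apply]

/-- `σ` is read off from the copy in which the image of a point of the `i`-th copy lies. -/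
lemma IsSplitEnd.copiesIdx_apply (hu : IsSplitEnd n σ u) (z : Z.left) (i : Fin d) :
    copiesIdx d Z (u.base.left ((inc d Z i).left z)) = σ z i := by
  obtain ⟨Y, k, y, rfl, hk⟩ := exists_constOn σ z
  have h1 : k ≫ inc d Z i ≫ u.base = k ≫ inc d Z (σ (k.left y) i) := by
    have := congrArg Tors.Hom.base (hu k _ hk i)
    simpa using this
  have h2 := congrArg (fun f => f.left y) h1
  simp only [Over.comp_left, Scheme.Hom.comp_apply] at h2
  rw [h2, copiesIdx_inc]

/-- The endomorphism determines `n` and `σ`. -/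
lemma IsSplitEnd.injective {n' : Fin d → G.obj.obj (op Z)}
    {σ' : LocallyConstant Z.left (Equiv.Perm (Fin d))} (hu : IsSplitEnd n σ u)
    (hu' : IsSplitEnd n' σ' u) : n = n' ∧ σ = σ' := by
  obtain rfl : σ = σ' := by
    ext z i
    rw [← hu.copiesIdx_apply, ← hu'.copiesIdx_apply]
  refine ⟨funext fun j => grp_ext σ fun Y k τ hk => ?_, rfl⟩
  have h1 := (hu k τ hk (τ⁻¹ j)).symm.trans (hu' k τ hk (τ⁻¹ j))
  rw [show τ (τ⁻¹ j) = j from τ.apply_symm_apply j] at h1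
  exact Tors.mulLeft_trivialMap_injective h1

/-- Automorphisms of the split object over the identity are given by some `n` and `σ`: the
permutation `σ z` sends `i` to the index of the copy that contains the image of the point `z` of the
`i`-th copy, and `n (σ i)` is the value at `1` on the `i`-th copy. -/
lemma exists_isSplitEnd_eq (hf : u.base ≫ fold d Z = fold d Z) [IsIso u.base] :
    ∃ n σ, IsSplitEnd n σ u := by
  have hinj : Function.Injective u.base.left :=
    (Scheme.homeoOfIso ((Over.forget S).mapIso (asIso u.base))).injective
  have hfold : ∀ (i : Fin d) (z : Z.left),
      (fold d Z).left (u.base.left ((inc d Z i).left z)) = z := fun i z => by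
    have h1 : inc d Z i ≫ u.base ≫ fold d Z = 𝟙 Z := by rw [hf, inc_fold]
    have h2 := congrArg (fun f => f.left z) h1
    simpa using h2
  let ρ : Fin d → LocallyConstant Z.left (Fin d) := fun i =>
    (copiesIdx d Z).comap (inc d Z i ≫ u.base).left.base.hom
  have hρ : ∀ i z, ρ i z = copiesIdx d Z (u.base.left ((inc d Z i).left z)) := fun i z => by
    simp [ρ]
  -- two copies of `z` have different images, which lie over `z`; so they lie in different copies
  have hρ' : ∀ z, Function.Injective fun i => ρ i z := fun z i j hij => by
    simp only [hρ] at hij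
    have h1 := inc_fold_apply Z (u.base.left ((inc d Z i).left z))
    have h2 := inc_fold_apply Z (u.base.left ((inc d Z j).left z))
    rw [hfold] at h1 h2
    rw [hij, h2] at h1
    exact (eq_of_inc_apply_eq (hinj h1)).symm
  let f : Z.left → Equiv.Perm (Fin d) := fun z =>
    Equiv.ofBijective (fun i => ρ i z) (Finite.injective_iff_bijective.1 (hρ' z))
  let σ : LocallyConstant Z.left (Equiv.Perm (Fin d)) :=
    ⟨f, IsLocallyConstant.desc f (fun τ => (τ : Fin d → Fin d))
      (LocallyConstant.unflip ρ).isLocallyConstant DFunLike.coe_injective⟩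
  have hσ : ∀ z i, σ z i = ρ i z := fun z i => rfl
  choose a ha using fun i : Fin d => Tors.exists_eq_mulLeft (Tors.trivialMap G (inc d Z i) ≫ u)
  -- on the part where `σ` is `τ`, the element `n j` belongs to the copy `τ⁻¹ j`, which is sent to
  -- the `j`-th
  choose n hn using fun j : Fin d => grp_glue σ (fun τ => a (τ⁻¹ j))
  refine ⟨n, σ, fun Y k τ hk i => ?_⟩
  have h1 : k ≫ inc d Z i ≫ u.base = k ≫ inc d Z (τ i) := by
    have h2 : ConstOn (copiesIdx d Z) (k ≫ inc d Z i ≫ u.base) (τ i) := fun y => by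
      rw [← hk y, hσ, hρ]
      simp
    rw [eq_comp_inc h2, Category.assoc k, Category.assoc (inc d Z i), hf, inc_fold,
      Category.comp_id]
  rw [Tors.trivialMap_comp, Category.assoc, ha i, ← Category.assoc, Tors.trivialMap_mulLeft,
    Category.assoc, ← Tors.trivialMap_comp, hn _ k τ hk,
    show τ⁻¹ (τ i) = i from τ.symm_apply_apply i]
  exact congrArg (fun x => _ ≫ Tors.trivialMap G x) h1

/-- The endomorphism of the split object over `Z` corresponding to a section of `G^d ⋊ S_d`. -/
noncomputable def splitEnd (w : (semidirect G d).obj.obj (op Z)) :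
    (⟨copies d Z, Torsor.trivial G (copies d Z)⟩ : Tors G) ⟶
      ⟨copies d Z, Torsor.trivial G (copies d Z)⟩ :=
  (exists_isSplitEnd (SemidirectProduct.left w) (SemidirectProduct.right w)).choose

lemma isSplitEnd_splitEnd (w : (semidirect G d).obj.obj (op Z)) :
    IsSplitEnd (SemidirectProduct.left w) (SemidirectProduct.right w) (splitEnd w) :=
  (exists_isSplitEnd (SemidirectProduct.left w) (SemidirectProduct.right w)).choose_spec

lemma splitEnd_one : splitEnd (1 : (semidirect G d).obj.obj (op Z)) = 𝟙 _ :=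
  (isSplitEnd_splitEnd _).unique IsSplitEnd.one

lemma splitEnd_mul (w w' : (semidirect G d).obj.obj (op Z)) :
    splitEnd (w * w') = splitEnd w' ≫ splitEnd w :=
  (isSplitEnd_splitEnd _).unique ((isSplitEnd_splitEnd w).mul (isSplitEnd_splitEnd w'))

lemma splitEnd_injective {w w' : (semidirect G d).obj.obj (op Z)}
    (h : splitEnd w = splitEnd w') : w = w' := by
  have h1 := isSplitEnd_splitEnd w
  rw [h] at h1
  obtain ⟨h2, h3⟩ := h1.injective (isSplitEnd_splitEnd w')
  exact SemidirectProduct.ext h2 h3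

lemma splitEnd_naturality {Z' : Over S} (g : Z' ⟶ Z) (w : (semidirect G d).obj.obj (op Z)) :
    Tors.trivialMap G (copiesMap d g) ≫ splitEnd w =
      splitEnd ((semidirect G d).obj.map g.op w) ≫ Tors.trivialMap G (copiesMap d g) :=
  (isSplitEnd_splitEnd w).map g (isSplitEnd_splitEnd ((semidirect G d).obj.map g.op w))

instance (w : (semidirect G d).obj.obj (op Z)) : IsIso (splitEnd w) :=
  ⟨splitEnd w⁻¹, by rw [← splitEnd_mul, inv_mul_cancel, splitEnd_one], by
    rw [← splitEnd_mul, mul_inv_cancel, splitEnd_one]⟩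

lemma splitEnd_isPullback (w : (semidirect G d).obj.obj (op Z)) :
    IsPullback (splitEnd w).base (fold d Z) (fold d Z) (𝟙 Z) := by
  have : IsIso (splitEnd w).base := inferInstanceAs (IsIso ((Tors.proj G).map (splitEnd w)))
  exact IsPullback.of_horiz_isIso ⟨(isSplitEnd_splitEnd w).base_fold.trans
    (Category.comp_id _).symm⟩

/-- `splitEnd w` as a morphism of `EtTors G d`. -/
noncomputable def splitHom (w : (semidirect G d).obj.obj (op Z)) : split G d Z ⟶ split G d Z where
  f := 𝟙 Z
  t := splitEnd w
  isPullback := splitEnd_isPullback w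

/-- The order of the composition is that of the multiplication of `Aut`, where `φ * ψ` is `ψ`
followed by `φ`. -/
lemma splitHom_mul (w w' : (semidirect G d).obj.obj (op Z)) :
    splitHom (w * w') = splitHom w' ≫ splitHom w :=
  CoverTors.hom_ext (Category.comp_id _).symm (splitEnd_mul w w')

lemma splitHom_one : splitHom (1 : (semidirect G d).obj.obj (op Z)) = 𝟙 _ :=
  CoverTors.hom_ext rfl splitEnd_one

lemma splitHom_injective {w w' : (semidirect G d).obj.obj (op Z)}
    (h : splitHom w = splitHom w') : w = w' :=
  splitEnd_injective (congrArg CoverTors.Hom.t h)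

lemma splitHom_naturality {Z' : Over S} (g : Z' ⟶ Z) (w : (semidirect G d).obj.obj (op Z)) :
    splitMap G d g ≫ splitHom w =
      splitHom ((semidirect G d).obj.map g.op w) ≫ splitMap G d g :=
  CoverTors.hom_ext ((Category.comp_id g).trans (Category.id_comp g).symm)
    (splitEnd_naturality g w)

/-- Every endomorphism of a split object over the identity comes from a section of `G^d ⋊ S_d`. -/
lemma exists_splitHom_eq (v : split G d Z ⟶ split G d Z) (hv : v.f = 𝟙 Z) :
    ∃ w : (semidirect G d).obj.obj (op Z), splitHom w = v := by
  have hb : IsIso (show copies d Z ⟶ copies d Z from v.t.base) := by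
    have : IsIso v.f := by rw [hv]; exact inferInstanceAs (IsIso (𝟙 Z))
    exact v.isPullback.isIso_fst_of_isIso
  have hf : v.t.base ≫ fold d Z = fold d Z :=
    v.isPullback.w.trans ((congrArg (fold d Z ≫ ·) hv).trans (Category.comp_id _))
  obtain ⟨n, σ, h⟩ := @exists_isSplitEnd_eq _ _ _ _ v.t hf hb
  exact ⟨SemidirectProduct.mk n σ, CoverTors.hom_ext hv.symm
    ((isSplitEnd_splitEnd (SemidirectProduct.mk n σ)).unique h)⟩

/-- The automorphism of the split object over `Z` corresponding to a section of `G^d ⋊ S_d`. -/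
noncomputable def splitIso (w : (semidirect G d).obj.obj (op Z)) :
    Aut (toFiber (split G d Z)) where
  hom := ⟨splitHom w, IsHomLift.map (etProj G d) (splitHom w)⟩
  inv := ⟨splitHom w⁻¹, IsHomLift.map (etProj G d) (splitHom w⁻¹)⟩
  hom_inv_id := Subtype.ext (by
    refine (splitHom_mul w⁻¹ w).symm.trans ?_
    rw [inv_mul_cancel, splitHom_one]
    rfl)
  inv_hom_id := Subtype.ext (by
    refine (splitHom_mul w w⁻¹).symm.trans ?_
    rw [mul_inv_cancel, splitHom_one]
    rfl)

lemma splitIso_bijective (Z : Over S) : Function.Bijective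
    (splitIso : (semidirect G d).obj.obj (op Z) → Aut (toFiber (split G d Z))) := by
  refine ⟨fun w w' h => splitHom_injective
    (congrArg (fun φ : Aut (toFiber (split G d Z)) => φ.hom.1) h), fun φ => ?_⟩
  obtain ⟨w, hw⟩ := exists_splitHom_eq φ.hom.1 (by
    have : (etProj G d).IsHomLift (𝟙 Z) φ.hom.1 := φ.hom.2
    have := IsHomLift.fac (etProj G d) (𝟙 Z) φ.hom.1
    simpa using! this.symm)
  exact ⟨w, Iso.ext (Subtype.ext hw)⟩

variable (G d) in
/-- The isomorphism of `G^d ⋊ S_d` with the automorphism sheaf of the split objects. -/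
noncomputable def splitAut : SplitAut G d where
  iso Z := MulEquiv.mk' (Equiv.ofBijective splitIso (splitIso_bijective Z)) (fun w w' =>
    Iso.ext (Subtype.ext (splitHom_mul w w')))
  base {Z} w {Y} k τ hk i := by
    have := congrArg Tors.Hom.base (isSplitEnd_splitEnd w k τ hk i)
    simpa using! this
  value {Z} w {Y} k τ hk i := by
    exact Tors.map_ap_one (u := splitEnd w) (isSplitEnd_splitEnd w k τ hk i)
  naturality g w := splitHom_naturality g w

end SplitAutomorphisms

/-! ### The torsor of frames -/

section Frames

variable {S : Scheme.{u}} {d : ℕ} {G : Sheaf (Scheme.fppfTopology.over S) GrpCat.{u}}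

lemma splitMap_id (X : Over S) : splitMap G d (𝟙 X) = 𝟙 _ :=
  CoverTors.hom_ext rfl (by
    change Tors.trivialMap G (copiesMap d (𝟙 X)) = _
    rw [copiesMap_id, Tors.trivialMap_id]
    rfl)

lemma splitMap_comp {X Y Z : Over S} (f : X ⟶ Y) (g : Y ⟶ Z) :
    splitMap G d (f ≫ g) = splitMap G d f ≫ splitMap G d g :=
  CoverTors.hom_ext rfl (by
    change Tors.trivialMap G (copiesMap d (f ≫ g)) = _
    rw [copiesMap_comp, Tors.trivialMap_comp]
    rfl)

/-- The frames of `x` over `y : Y ⟶ X`: the cartesian morphisms over `y` from the split object to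
`x`. -/
def Frame (x : EtTors G d) {Y : Over S} (y : Y ⟶ x.X) := { q : split G d Y ⟶ x // q.f = y }

/-- An object with a morphism to a split object is the split object. -/
lemma exists_lift_splitMap {z : EtTors G d} {Y : Over S} (u : z ⟶ split G d Y) (g : z.X ⟶ Y)
    (hg : u.f = g) : ∃ l : z ⟶ split G d z.X, l.f = 𝟙 z.X ∧ l ≫ splitMap G d g = u :=
  CoverTors.exists_lift (splitMap G d g) u (𝟙 z.X) (by
    rw [hg]; exact Category.id_comp g)

/-- The sieve of those `Y ⟶ X` over which `x` has a frame. -/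
def frameSieve (x : EtTors G d) : Sieve x.X where
  arrows _ y := Nonempty (Frame x y)
  downward_closed := by
    rintro Y Z y ⟨q, rfl⟩ k
    exact ⟨splitMap G d k ≫ q, rfl⟩

/-- Every object is locally split. -/
lemma frameSieve_mem (x : EtTors G d) : frameSieve x ∈ Scheme.fppfTopology.over S x.X := by
  refine GrothendieckTopology.transitive _ (splitSieve_mem x.π x.hπ) _ ?_
  rintro Y₀ g ⟨a, ha⟩
  obtain ⟨R, hR, h⟩ := x.tors.torsor.locally_nonempty
  -- where the cover is split, sections of the torsor are chosen on all of the copies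
  have hR' : (Finset.univ.inf fun i : Fin d => R.pullback (inc d Y₀ i ≫ a)) ∈
      Scheme.fppfTopology.over S Y₀ :=
    Finset.inf_induction (p := fun R : Sieve Y₀ => R ∈ Scheme.fppfTopology.over S Y₀)
      (GrothendieckTopology.top_mem _ _)
      (fun _ h _ h' => GrothendieckTopology.intersection_covering _ h h')
      (fun i _ => GrothendieckTopology.pullback_stable _ _ hR)
  refine GrothendieckTopology.superset_covering _ ?_ hR'
  rintro Y' k hk
  have hk' : ∀ i : Fin d, R (k ≫ inc d Y₀ i ≫ a) := fun i =>
    (Finset.inf_le (f := fun i : Fin d => R.pullback (inc d Y₀ i ≫ a)) (Finset.mem_univ i)) _ hk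
  have s : ∀ i, x.tors.torsor.sec (k ≫ inc d Y₀ i ≫ a) := fun i => (h _ (hk' i)).some
  obtain ⟨u, hu⟩ := exists_hom_copies (fun i => Tors.ofSection x.tors (k ≫ inc d Y₀ i ≫ a) (s i))
  have hb : u.base = copiesMap d k ≫ a := copies_hom_ext fun i => by
    rw [← Category.assoc, inc_copiesMap, Category.assoc]
    exact congrArg Tors.Hom.base (hu i)
  refine ⟨⟨k ≫ g, u, ?_⟩, rfl⟩
  rw [hb]
  exact (copies_isPullback d k).paste_horiz ha

/-- Two frames over the same morphism differ by an automorphism of the split object. -/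
lemma Frame.existsUnique_splitHom {x : EtTors G d} {Y : Over S} {y : Y ⟶ x.X} (s s' : Frame x y) :
    ∃! a : (semidirect G d).obj.obj (op Y), splitHom a ≫ s.1 = s'.1 := by
  obtain ⟨w, hw, hw'⟩ := CoverTors.exists_lift s.1 s'.1 (𝟙 Y) (by
    rw [s.2, s'.2]; exact Category.id_comp y)
  obtain ⟨a, rfl⟩ := exists_splitHom_eq w hw
  exact ⟨a, hw', fun b hb => splitHom_injective
    (CoverTors.hom_ext_of_comp s.1 rfl (hb.trans hw'.symm))⟩

/-- Frames form a sheaf.  This is the gluing of morphisms from the split object over `Y`, once the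
morphisms `u` to that object are factored as `z ⟶ split G d z.X ⟶ split G d Y`; the first factor is
`l z u`. -/
lemma Frame.existsUnique_glue {x : EtTors G d} {Y : Over S} (y : Y ⟶ x.X) (R : Sieve Y)
    (hR : R ∈ Scheme.fppfTopology.over S Y) (s : ∀ ⦃Z : Over S⦄ (g : Z ⟶ Y), R g → Frame x (g ≫ y))
    (hs : ∀ ⦃Z Z' : Over S⦄ (g : Z ⟶ Y) (k : Z' ⟶ Z) (hg : R g),
      splitMap G d k ≫ (s g hg).1 = (s (k ≫ g) (R.downward_closed hg k)).1) :
    ∃! s' : Frame x y, ∀ ⦃Z : Over S⦄ (g : Z ⟶ Y) (hg : R g),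
      splitMap G d g ≫ s'.1 = (s g hg).1 := by
  choose l hl hl' using fun (z : EtTors G d) (u : z ⟶ split G d Y) =>
    exists_lift_splitMap u u.f rfl
  have hlv : ∀ {z z' : EtTors G d} (u : z ⟶ split G d Y) (v : z' ⟶ z),
      l z' (v ≫ u) ≫ splitMap G d v.f = v ≫ l z u := by
    intro z z' u v
    refine CoverTors.hom_ext_of_comp (splitMap G d u.f) ?_ ?_
    · rw [CoverTors.comp_f, CoverTors.comp_f, hl, hl]
      exact (Category.id_comp v.f).trans (Category.comp_id v.f).symm
    · refine ((Category.assoc _ _ _).trans (congrArg (l z' (v ≫ u) ≫ ·)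
        (splitMap_comp v.f u.f).symm)).trans ((hl' z' (v ≫ u)).trans ?_)
      exact (congrArg (v ≫ ·) (hl' z u).symm).trans (Category.assoc _ _ _).symm
  obtain ⟨n, ⟨hn, hn'⟩, hu⟩ := CoverTors.homsGlue G (coverProp S d) (a := split G d Y) (b := x)
    y R hR
    (fun z u hu => l z u ≫ (s u.f hu).1)
    (fun z u hu => by
      refine (congrArg₂ (· ≫ ·) (hl z u) (s u.f hu).2).trans ?_
      exact Category.id_comp _)
    (fun z z' u v hu hvu => by
      have h1 : (s (v ≫ u).f hvu).1 = splitMap G d v.f ≫ (s u.f hu).1 := (hs u.f v.f hu).symm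
      rw [h1, ← Category.assoc, hlv, Category.assoc])
  have hid : ∀ {Z : Over S} (g : Z ⟶ Y), l _ (splitMap G d g) = 𝟙 _ := fun g =>
    CoverTors.hom_ext_of_comp (splitMap G d g) (hl _ _) ((hl' _ _).trans (Category.id_comp _).symm)
  refine ⟨⟨n, hn⟩, fun Z g hg => ?_, fun s' h => Subtype.ext (hu s'.1 ⟨s'.2, fun z u hu => ?_⟩)⟩
  · refine (hn' (splitMap G d g) hg).trans ?_
    rw [hid]
    exact Category.id_comp _
  · have h1 : u = l z u ≫ splitMap G d u.f := (hl' z u).symm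
    refine (congrArg (· ≫ s'.1) h1).trans ?_
    exact (Category.assoc _ _ _).trans (congrArg (l z u ≫ ·) (h u.f hu))

/-- The torsor of frames of `x`. -/
noncomputable def frames (x : EtTors G d) : PreTorsor (semidirect G d) x.X where
  sec y := Frame x y
  rs g _ _ h s := ⟨splitMap G d g ≫ s.1, (congrArg (g ≫ ·) s.2).trans h⟩
  rs_id h s := Subtype.ext (by
    refine (congrArg (· ≫ s.1) (splitMap_id _)).trans (Category.id_comp _))
  rs_rs g k _ _ _ h h' h'' s := Subtype.ext (by
    refine ((congrArg (· ≫ s.1) (splitMap_comp k g)).trans (Category.assoc _ _ _)).symm)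
  ac s a := ⟨splitHom a ≫ s.1, (Category.id_comp s.1.f).trans s.2⟩
  ac_one s := Subtype.ext ((congrArg (· ≫ s.1) splitHom_one).trans (Category.id_comp _))
  ac_mul s a b := Subtype.ext ((congrArg (· ≫ s.1) (splitHom_mul a b)).trans (Category.assoc _ _ _))
  rs_ac g _ _ h s a := Subtype.ext (by
    refine (Category.assoc _ _ _).symm.trans ?_
    exact (congrArg (· ≫ s.1) (splitHom_naturality g a)).trans (Category.assoc _ _ _))
  existsUnique_ac s s' := by
    obtain ⟨a, ha, ha'⟩ := Frame.existsUnique_splitHom s s'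
    exact ⟨a, Subtype.ext ha, fun b hb => ha' b (congrArg Subtype.val hb)⟩
  existsUnique_glue y R hR s hs := by
    obtain ⟨s', h, h'⟩ := Frame.existsUnique_glue y R hR s
      (fun Z Z' g k hg => congrArg Subtype.val (hs g k hg (Category.assoc _ _ _).symm))
    exact ⟨s', fun Z g hg => Subtype.ext (h g hg), fun s'' h'' => h' s'' fun Z g hg =>
      congrArg Subtype.val (h'' g hg)⟩
  locally_nonempty := ⟨frameSieve x, frameSieve_mem x, fun _ _ h => h⟩

/-- The torsor of frames, as an object of `Tors (semidirect G d)`. -/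
noncomputable abbrev framesTors (x : EtTors G d) : Tors (semidirect G d) :=
  ⟨x.X, (frames x).toTorsor⟩

/-- Composition with `v`, as a morphism between the torsors of frames. -/
noncomputable def framesMap {x x' : EtTors G d} (v : x ⟶ x') : framesTors x ⟶ framesTors x' :=
  Tors.mkHom v.f
    (fun y s => (frames x').equiv (y ≫ v.f)
      ⟨(((frames x).equiv y).symm s).1 ≫ v, congrArg (· ≫ v.f) (((frames x).equiv y).symm s).2⟩)
    (fun g y z h s => by
      refine Eq.trans ?_ ((frames x').rs_equiv g _ _).symm
      refine congrArg _ (Subtype.ext ?_)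
      refine (congrArg (fun q : Frame x z => q.1 ≫ v) ((frames x).rs_equiv_symm g h s)).trans ?_
      exact Category.assoc _ _ _)
    (fun y s a => by
      refine Eq.trans ?_ ((frames x').ac_equiv _ _).symm
      refine congrArg _ (Subtype.ext ?_)
      refine (congrArg (fun q : Frame x y => q.1 ≫ v) ((frames x).ac_equiv_symm s a)).trans ?_
      exact Category.assoc _ _ _)

lemma on_framesMap {x x' : EtTors G d} (v : x ⟶ x') {Y : Over S} {y : Y ⟶ x.X} {z : Y ⟶ x'.X}
    (h : y ≫ (framesMap v).base = z) (q : Frame x y) :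
    Tors.on (framesMap v) h ((frames x).equiv y q) =
      (frames x').equiv z ⟨q.1 ≫ v, (congrArg (· ≫ v.f) q.2).trans h⟩ := by
  subst h
  refine (Tors.on_rfl (framesMap v) _).trans ?_
  refine congrArg ((frames x').equiv (y ≫ v.f)) (Subtype.ext ?_)
  exact congrArg (fun q : Frame x y => q.1 ≫ v) (Equiv.symm_apply_apply _ _)

lemma framesMap_id (x : EtTors G d) : framesMap (𝟙 x) = 𝟙 _ := by
  refine Tors.hom_ext rfl fun {Y} y s z hu hv => ?_
  obtain ⟨q, rfl⟩ := ((frames x).equiv y).surjective s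
  obtain rfl : y = z := (Category.comp_id y).symm.trans hv
  refine (on_framesMap _ _ _).trans (Eq.trans ?_ (Tors.on_id _ _).symm)
  exact congrArg _ (Subtype.ext (Category.comp_id _))

lemma framesMap_comp {x y z : EtTors G d} (v : x ⟶ y) (v' : y ⟶ z) :
    framesMap (v ≫ v') = framesMap v ≫ framesMap v' := by
  refine Tors.hom_ext rfl fun {Y} t s t' hu hv => ?_
  obtain ⟨q, rfl⟩ := ((frames x).equiv t).surjective s
  have h1 : (t ≫ v.f) ≫ v'.f = t' := (Category.assoc _ _ _).trans hu
  refine (on_framesMap _ _ _).trans (Eq.symm ?_)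
  refine (Tors.on_comp (framesMap v) (framesMap v') (z := t ≫ v.f) rfl h1 hv _).trans ?_
  refine (congrArg _ (on_framesMap v _ q)).trans ((on_framesMap v' _ _).trans ?_)
  exact congrArg _ (Subtype.ext (Category.assoc _ _ _))

/-- The map on frames given by a morphism of torsors of frames. -/
noncomputable def Frame.on {x x' : EtTors G d} (u : framesTors x ⟶ framesTors x') {Y : Over S}
    {y : Y ⟶ x.X} {z : Y ⟶ x'.X} (h : y ≫ u.base = z) (q : Frame x y) : Frame x' z :=
  ((frames x').equiv z).symm (Tors.on u h ((frames x).equiv y q))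

lemma Frame.on_restrict {x x' : EtTors G d} (u : framesTors x ⟶ framesTors x') {Y Y' : Over S}
    {y : Y ⟶ x.X} {z : Y ⟶ x'.X} (h : y ≫ u.base = z) (k : Y' ⟶ Y) {y' : Y' ⟶ x.X} {z' : Y' ⟶ x'.X}
    (h' : y' ≫ u.base = z') (q : Frame x y) (q' : Frame x y') (e : splitMap G d k ≫ q.1 = q'.1) :
    (Frame.on u h' q').1 = splitMap G d k ≫ (Frame.on u h q).1 := by
  have e1 : k ≫ y = y' := (congrArg (k ≫ ·) q.2.symm).trans
    ((congrArg CoverTors.Hom.f e).trans q'.2)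
  have e2 : k ≫ z = z' := by rw [← h, ← h', ← Category.assoc, e1]
  have h1 : (frames x').rs k e2 (Frame.on u h q) = Frame.on u h' q' := by
    refine ((frames x').rs_equiv_symm k e2 _).symm.trans ?_
    refine congrArg ((frames x').equiv z').symm ?_
    refine (Tors.rs_on u k h e1 e2 _).trans (congrArg (Tors.on u h') ?_)
    refine ((frames x).rs_equiv k e1 q).trans (congrArg _ (Subtype.ext e))
  exact (congrArg Subtype.val h1).symm

lemma Frame.on_act {x x' : EtTors G d} (u : framesTors x ⟶ framesTors x') {Y : Over S}
    {y : Y ⟶ x.X} {z : Y ⟶ x'.X} (h : y ≫ u.base = z) (a : (semidirect G d).obj.obj (op Y))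
    (q q' : Frame x y) (e : splitHom a ≫ q.1 = q'.1) :
    (Frame.on u h q').1 = splitHom a ≫ (Frame.on u h q).1 := by
  have h1 : (frames x').ac (Frame.on u h q) a = Frame.on u h q' := by
    refine ((frames x').ac_equiv_symm _ a).symm.trans ?_
    refine congrArg ((frames x').equiv z).symm ?_
    refine (Tors.on_ac u h _ a).symm.trans (congrArg (Tors.on u h) ?_)
    exact ((frames x).ac_equiv q a).trans (congrArg _ (Subtype.ext e))
  exact (congrArg Subtype.val h1).symm

lemma Frame.on_framesMap {x x' : EtTors G d} (v : x ⟶ x') {Y : Over S} {y : Y ⟶ x.X}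
    {z : Y ⟶ x'.X} (h : y ≫ v.f = z) (q : Frame x y) :
    (Frame.on (framesMap v) h q).1 = q.1 ≫ v :=
  congrArg Subtype.val ((congrArg ((frames x').equiv z).symm
    (TorsorGerbe.on_framesMap v h q)).trans (Equiv.symm_apply_apply _ _))

/-- Every morphism of torsors of frames comes from a unique morphism: locally both are determined by
the image of one frame. -/
lemma existsUnique_framesMap_eq {x x' : EtTors G d} (u : framesTors x ⟶ framesTors x') :
    ∃! v : x ⟶ x', framesMap v = u := by
  -- if `c : z ⟶ x` factors as `l ≫ q` through a frame `q`, then `m c` is `l` followed by the image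
  -- of `q` under `u`; another frame differs by an element of the group, which `u` respects
  have key : ∀ (z : EtTors G d) (c : z ⟶ x), frameSieve x c.f → ∃ m : z ⟶ x',
      m.f = c.f ≫ u.base ∧ ∀ (q : Frame x c.f) (l : z ⟶ split G d z.X), l ≫ q.1 = c → l.f = 𝟙 _ →
        m = l ≫ (Frame.on u rfl q).1 := by
    rintro z c ⟨q⟩
    obtain ⟨l, hl, hl'⟩ := CoverTors.exists_lift q.1 c (𝟙 z.X) (by
      rw [q.2]; exact Category.id_comp _)
    refine ⟨l ≫ (Frame.on u rfl q).1, ?_, fun q' l' h h' => ?_⟩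
    · refine (congrArg₂ (· ≫ ·) hl (Frame.on u rfl q).2).trans ?_
      exact Category.id_comp _
    · obtain ⟨a, ha, -⟩ := Frame.existsUnique_splitHom q q'
      have h1 : l = l' ≫ splitHom a := by
        refine CoverTors.hom_ext_of_comp q.1 ?_ ?_
        · rw [hl, CoverTors.comp_f, h']
          exact (Category.id_comp _).symm
        · rw [hl', Category.assoc, ha, h]
      rw [Frame.on_act u rfl a q q' ha, h1, Category.assoc]
  choose m hm hm' using key
  have hml : ∀ {z : EtTors G d} (c : z ⟶ x) (hc : frameSieve x c.f), ∃ (q : Frame x c.f)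
      (l : z ⟶ split G d z.X), l ≫ q.1 = c ∧ l.f = 𝟙 _ ∧ m z c hc = l ≫ (Frame.on u rfl q).1 := by
    rintro z c ⟨q⟩
    obtain ⟨l, hl, hl'⟩ := CoverTors.exists_lift q.1 c (𝟙 z.X) (by
      rw [q.2]; exact Category.id_comp _)
    exact ⟨q, l, hl', hl, hm' z c ⟨q⟩ q l hl' hl⟩
  -- these morphisms are compatible, since `u` respects restriction of frames
  have hmw : ∀ {z z' : EtTors G d} (c : z ⟶ x) (w : z' ⟶ z) (hc : frameSieve x c.f)
      (hwc : frameSieve x (w ≫ c).f), m z' (w ≫ c) hwc = w ≫ m z c hc := by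
    intro z z' c w hc hwc
    obtain ⟨q, l, hl', hl, h⟩ := hml c hc
    let q' : Frame x (w ≫ c).f := ⟨splitMap G d w.f ≫ q.1, congrArg (w.f ≫ ·) q.2⟩
    obtain ⟨l', hl1, hl2⟩ := exists_lift_splitMap (w ≫ l) w.f
      ((congrArg (w.f ≫ ·) hl).trans (Category.comp_id _))
    have e1 : l' ≫ q'.1 = w ≫ c :=
      (Category.assoc _ _ _).symm.trans ((congrArg (· ≫ q.1) hl2).trans
        ((Category.assoc _ _ _).trans (congrArg (w ≫ ·) hl')))
    rw [h, hm' z' (w ≫ c) _ q' l' e1 hl1, Frame.on_restrict u rfl w.f rfl q q' rfl]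
    refine (Category.assoc _ _ _).symm.trans ((congrArg (· ≫ (Frame.on u rfl q).1) hl2).trans ?_)
    exact Category.assoc _ _ _
  obtain ⟨v, ⟨hv, hv'⟩, huniq⟩ := CoverTors.homsGlue G (coverProp S d) (a := x) (b := x') u.base
    (frameSieve x) (frameSieve_mem x) (fun z c hc => m z c hc) (fun z c hc => hm z c hc)
    (fun z z' c w hc hwc => hmw c w hc hwc)
  -- the glued morphism has the effect of `u` on frames
  have hon : ∀ {Y : Over S} {y : Y ⟶ x.X} (q : Frame x y), q.1 ≫ v = (Frame.on u rfl q).1 := by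
    rintro Y _ ⟨q, rfl⟩
    refine (hv' q ⟨⟨q, rfl⟩⟩).trans ?_
    exact (hm' _ q ⟨⟨q, rfl⟩⟩ ⟨q, rfl⟩ (𝟙 _) (Category.id_comp _) rfl).trans (Category.id_comp _)
  refine ⟨v, ?_, fun v' hv'' => huniq v' ⟨?_, fun z c hc => ?_⟩⟩
  · refine Tors.hom_ext hv fun {Y} y s z h1 h2 => ?_
    obtain ⟨q, rfl⟩ := ((frames x).equiv y).surjective s
    subst h2
    refine (on_framesMap v h1 q).trans ?_
    refine (congrArg ((frames x').equiv _) (Subtype.ext (hon q))).trans ?_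
    exact Equiv.apply_symm_apply _ _
  · exact congrArg Tors.Hom.base hv''
  · subst hv''
    obtain ⟨q, l, hl', hl, h⟩ := hml c hc
    refine Eq.trans ?_ h.symm
    exact (congrArg (· ≫ v') hl').symm.trans ((Category.assoc _ _ _).trans
      (congrArg (l ≫ ·) (Frame.on_framesMap v' rfl q).symm))

variable (d G) in
/-- The split object, as an object of the fiber over `Y`. -/
noncomputable def splitFiber (Y : Over S) : (etProj G d).Fiber Y := toFiber (split G d Y)

/-- A frame as a morphism between objects of fibers. -/
def Frame.hom {x : EtTors G d} {Y : Over S} {y : Y ⟶ x.X} (q : Frame x y) :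
    (splitFiber d G Y).1 ⟶ (toFiber x).1 := q.1

instance Frame.isHomLift_hom {x : EtTors G d} {Y : Over S} {y : Y ⟶ x.X} (q : Frame x y) :
    (etProj G d).IsHomLift y q.hom := by
  obtain ⟨q, rfl⟩ := q
  exact inferInstanceAs ((etProj G d).IsHomLift ((etProj G d).map q) q)

lemma f_eq_of_isHomLift {a b : EtTors G d} {y : a.X ⟶ b.X} {m : a ⟶ b}
    (h : (etProj G d).IsHomLift y m) : m.f = y := by
  have := IsHomLift.fac' (etProj G d) y m
  simpa using! this

/-- Frames over `y` are the isomorphisms from the split object to the pullback along `y`. -/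
noncomputable def frameEquivIso [(etProj G d).IsFibered] (x : EtTors G d) {Y : Over S}
    (y : Y ⟶ x.X) : Frame x y ≃ (splitFiber d G Y ≅ pull y (toFiber x)) where
  toFun q :=
    let m : splitFiber d G Y ⟶ pull y (toFiber x) :=
      ⟨Functor.IsCartesian.map (etProj G d) y (pullMap y (toFiber x)) q.hom, inferInstance⟩
    haveI : IsIso m := (CoverTors.isGroupoidFibration_proj G (coverProp S d)).isIso_fiberHom m
    asIso m
  invFun φ := ⟨φ.hom.1 ≫ pullMap y (toFiber x), f_eq_of_isHomLift
    (inferInstanceAs ((etProj G d).IsHomLift y (φ.hom.1 ≫ pullMap y (toFiber x))))⟩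
  left_inv q := Subtype.ext
    (Functor.IsCartesian.fac (etProj G d) y (pullMap y (toFiber x)) q.hom)
  right_inv φ := Iso.ext (fiberHom_ext
    (Functor.IsCartesian.fac (etProj G d) y (pullMap y (toFiber x))
      (φ.hom.1 ≫ pullMap y (toFiber x))))

lemma frameEquivIso_hom_comp [(etProj G d).IsFibered] (x : EtTors G d) {Y : Over S}
    (y : Y ⟶ x.X) (q : Frame x y) :
    ((frameEquivIso x y) q).hom.1 ≫ pullMap y (toFiber x) = q.1 :=
  congrArg Subtype.val ((frameEquivIso x y).left_inv q)

/-- The torsor of frames is the sheaf of isomorphisms from the split object. -/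
noncomputable def framesIsomSheaf [(etProj G d).IsFibered] (x : EtTors G d) :
    IsomSheaf (splitAut d G) x (frames x).toTorsor where
  equiv Y := ((frames x).equiv Y.hom).symm.trans (frameEquivIso x Y.hom)
  map {Y' Y} k q := by
    refine (frameEquivIso_hom_comp x Y'.hom _).trans ?_
    refine Eq.trans ?_ (congrArg (splitMap G d k.left ≫ ·) (frameEquivIso_hom_comp x Y.hom _).symm)
    exact congrArg Subtype.val ((frames x).rs_equiv_symm k.left (Over.w k) q)
  act {Y} q w := by
    refine Iso.ext (fiberHom_ext ?_)
    refine (frameEquivIso_hom_comp x Y.hom _).trans ?_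
    refine Eq.trans ?_ ((congrArg (splitHom w ≫ ·) (frameEquivIso_hom_comp x Y.hom _).symm).trans
      (Category.assoc _ _ _).symm)
    exact congrArg Subtype.val ((frames x).ac_equiv_symm (y := Y.hom) q w)

variable (G d) in
/-- The functor sending `x` to its torsor of frames. -/
noncomputable def framesFunctor [(etProj G d).IsFibered] : IsomFunctor (splitAut d G) where
  torsor x := (frames x).toTorsor
  isom x := framesIsomSheaf x
  map v := (framesMap v).iso
  isom_map {x x'} v Y q := by
    refine (frameEquivIso_hom_comp x' (Y.hom ≫ v.f) _).trans ?_
    refine Eq.trans ?_ ((congrArg (· ≫ v) (frameEquivIso_hom_comp x Y.hom _).symm).trans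
      (Category.assoc _ _ _))
    exact congrArg Subtype.val (Equiv.symm_apply_apply ((frames x').equiv (Y.hom ≫ v.f)) _)
  map_id x := framesMap_id x
  map_comp v v' := framesMap_comp v v'

end Frames

/-! ### Flat descent for affine schemes -/

section AffineDescent

open TensorProduct

/-- Effective flat descent for algebras, with the descent datum on the `B`-algebra `D` given as
a coaction `ρ`: the algebra `D` is the base change of the algebra of coinvariants of `ρ`.  The
inverse of `B ⊗ D^ρ → D` is `ρ` itself, which takes its values in the equalizer that computes
`B ⊗ D^ρ` by flatness. -/
lemma bijective_lift_equalizer {A B D : Type*} [CommRing A] [CommRing B] [CommRing D]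
    [Algebra A B] [Algebra A D] [Algebra B D] [IsScalarTower A B D] [Module.Flat A B]
    (ρ : D →ₐ[A] B ⊗[A] D) (h₁ : ∀ b, ρ (algebraMap B D b) = b ⊗ₜ 1)
    (h₂ : ∀ x, Algebra.TensorProduct.lift (IsScalarTower.toAlgHom A B D) (AlgHom.id A D)
      (fun _ _ => Commute.all _ _) (ρ x) = x)
    (h₃ : ∀ x, Algebra.TensorProduct.map (AlgHom.id A B) ρ (ρ x) =
      Algebra.TensorProduct.map (AlgHom.id A B) Algebra.TensorProduct.includeRight (ρ x)) :
    Function.Bijective (Algebra.TensorProduct.lift (IsScalarTower.toAlgHom A B D)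
      (AlgHom.equalizer ρ Algebra.TensorProduct.includeRight).val
      (fun _ _ => Commute.all _ _)) := by
  let ι : D →ₐ[A] B ⊗[A] D := Algebra.TensorProduct.includeRight
  let μ : B ⊗[A] D →ₐ[A] D := Algebra.TensorProduct.lift (IsScalarTower.toAlgHom A B D)
    (AlgHom.id A D) (fun _ _ => Commute.all _ _)
  let e := AlgHom.tensorEqualizerEquiv B B ρ ι
  have hΨ : ∀ z, Algebra.TensorProduct.lift (IsScalarTower.toAlgHom A B D)
      (AlgHom.equalizer ρ ι).val (fun _ _ => Commute.all _ _) z = μ (e z).1 := by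
    intro z
    change _ = μ (AlgHom.tensorEqualizer B B ρ ι z : B ⊗[A] D)
    rw [AlgHom.coe_tensorEqualizer]
    induction z with
    | zero => simp
    | tmul b m => simp [μ]
    | add x y hx hy => rw [map_add, map_add, map_add, hx, hy]
  -- an element of the equalizer is recovered from its image in `D` by `ρ`
  have hρ : ∀ y : B ⊗[A] D, Algebra.TensorProduct.map (AlgHom.id A B) ρ y =
      Algebra.TensorProduct.map (AlgHom.id A B) ι y → ρ (μ y) = y := by
    intro y hy
    let ν : B ⊗[A] (B ⊗[A] D) →ₐ[A] B ⊗[A] D := Algebra.TensorProduct.lift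
      (Algebra.TensorProduct.includeLeft) (AlgHom.id A _) (fun _ _ => Commute.all _ _)
    have e1 : ∀ z, ν (Algebra.TensorProduct.map (AlgHom.id A B) ρ z) = ρ (μ z) := by
      intro z
      induction z with
      | zero => simp
      | tmul b x => simp [ν, μ, h₁]
      | add x y hx hy => rw [map_add, map_add, map_add, map_add, hx, hy]
    have e2 : ∀ z, ν (Algebra.TensorProduct.map (AlgHom.id A B) ι z) = z := by
      intro z
      induction z with
      | zero => simp
      | tmul b x => simp [ν, ι]
      | add x y hx hy => rw [map_add, map_add, hx, hy]
    rw [← e1, hy, e2]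
  constructor
  · intro z z' h
    have h' := (hΨ z).symm.trans (h.trans (hΨ z'))
    apply e.injective
    apply Subtype.ext
    rw [← hρ _ (e z).2, ← hρ _ (e z').2, h']
  · intro x
    exact ⟨e.symm ⟨ρ x, h₃ x⟩, (hΨ _).trans (by rw [e.apply_symm_apply]; exact h₂ x)⟩

universe v₁ u₁

/-- A descent datum for `a : U ⟶ W` along `p : W ⟶ X`, in terms of points: a point `u` of `U`
may be transported to the fiber of `a` over any point `w` of `W` with the same image in `X`. -/
structure Transport {C : Type u₁} [Category.{v₁} C] {U W X : C} (a : U ⟶ W) (p : W ⟶ X) where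
  tr {Z : C} (u : Z ⟶ U) (w : Z ⟶ W) (h : u ≫ a ≫ p = w ≫ p) : Z ⟶ U
  comp_tr {Z Z' : C} (g : Z' ⟶ Z) (u : Z ⟶ U) (w : Z ⟶ W) (h : u ≫ a ≫ p = w ≫ p) :
    g ≫ tr u w h = tr (g ≫ u) (g ≫ w) (by rw [Category.assoc, h, Category.assoc])
  tr_comp {Z : C} (u : Z ⟶ U) (w : Z ⟶ W) (h : u ≫ a ≫ p = w ≫ p) : tr u w h ≫ a = w
  tr_self {Z : C} (u : Z ⟶ U) (w : Z ⟶ W) (h : u ≫ a ≫ p = w ≫ p) (hw : u ≫ a = w) :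
    tr u w h = u
  tr_tr {Z : C} (u : Z ⟶ U) (w w' : Z ⟶ W) (h : u ≫ a ≫ p = w ≫ p)
    (h' : u ≫ a ≫ p = w' ≫ p) (h'' : tr u w h ≫ a ≫ p = w' ≫ p) :
    tr (tr u w h) w' h'' = tr u w' h'

namespace Transport

section

variable {C : Type u₁} [Category.{v₁} C] {U W X U' W' X' : C} {a : U ⟶ W} {p : W ⟶ X}

lemma tr_congr (τ : Transport a p) {Z : C} {u u' : Z ⟶ U} {w w' : Z ⟶ W} (hu : u = u')
    (hw : w = w') (h : u ≫ a ≫ p = w ≫ p) (h' : u' ≫ a ≫ p = w' ≫ p) :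
    τ.tr u w h = τ.tr u' w' h' := by
  subst hu hw
  rfl

lemma ofIso_aux {a' : U' ⟶ W'} {p' : W' ⟶ X'} (eU : U ≅ U') (eW : W ≅ W') (eX : X ≅ X')
    (ha : eU.hom ≫ a' = a ≫ eW.hom) (hp : eW.hom ≫ p' = p ≫ eX.hom) {Z : C} {u : Z ⟶ U'}
    {w : Z ⟶ W'} (h : u ≫ a' ≫ p' = w ≫ p') :
    (u ≫ eU.inv) ≫ a ≫ p = (w ≫ eW.inv) ≫ p := by
  rw [← cancel_mono eX.hom]
  simp only [Category.assoc]
  rw [← hp, ← reassoc_of% ha, Iso.inv_hom_id_assoc, Iso.inv_hom_id_assoc]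
  exact h

/-- Descent data are transported along isomorphisms. -/
def ofIso (τ : Transport a p) {a' : U' ⟶ W'} {p' : W' ⟶ X'} (eU : U ≅ U') (eW : W ≅ W')
    (eX : X ≅ X') (ha : eU.hom ≫ a' = a ≫ eW.hom) (hp : eW.hom ≫ p' = p ≫ eX.hom) :
    Transport a' p' where
  tr u w h := τ.tr (u ≫ eU.inv) (w ≫ eW.inv) (ofIso_aux eU eW eX ha hp h) ≫ eU.hom
  comp_tr g u w h := by
    rw [← Category.assoc, τ.comp_tr]
    exact congrArg (· ≫ eU.hom) (τ.tr_congr (Category.assoc _ _ _).symm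
      (Category.assoc _ _ _).symm _ _)
  tr_comp u w h := by
    rw [Category.assoc, ha, ← Category.assoc, τ.tr_comp, Category.assoc, Iso.inv_hom_id,
      Category.comp_id]
  tr_self u w h hw := by
    rw [← Iso.eq_comp_inv]
    refine τ.tr_self _ _ _ ?_
    rw [← cancel_mono eW.hom, Category.assoc, Category.assoc, ← ha, Iso.inv_hom_id_assoc, hw,
      Category.assoc, Iso.inv_hom_id, Category.comp_id]
  tr_tr u w w' h h' h'' := by
    have e1 : (τ.tr (u ≫ eU.inv) (w ≫ eW.inv) (ofIso_aux eU eW eX ha hp h) ≫ eU.hom) ≫ eU.inv =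
        τ.tr (u ≫ eU.inv) (w ≫ eW.inv) (ofIso_aux eU eW eX ha hp h) := by simp
    refine congrArg (· ≫ eU.hom) ((τ.tr_congr e1 rfl _ ?_).trans (τ.tr_tr _ _ _ _ _ _))
    rw [← e1]
    exact ofIso_aux eU eW eX ha hp h''

end

/-- Flat descent for affine schemes given by rings. The transport of the universal point, that is of
`Spec (B ⊗ D) ⟶ Spec D`, is a ring homomorphism `ρ : D → B ⊗ D`; the axioms of a `Transport` say
that `ρ` is a coaction, whose coinvariants are the descended algebra. -/
lemma exists_descent_of_flat {A B D : CommRingCat.{u}} (f : A ⟶ B) (k : B ⟶ D)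
    (hf : f.hom.Flat) (τ : Transport (Spec.map k) (Spec.map f)) :
    ∃ (M : CommRingCat.{u}) (m : A ⟶ M) (t : M ⟶ D),
      IsPullback (Spec.map t) (Spec.map k) (Spec.map m) (Spec.map f) ∧
      ∀ ⦃Z : Scheme.{u}⦄ (u : Z ⟶ Spec D) (w : Z ⟶ Spec B) (h), τ.tr u w h ≫ Spec.map t =
        u ≫ Spec.map t := by
  algebraize [f.hom, k.hom, (f ≫ k).hom]
  have : IsScalarTower A B D := IsScalarTower.of_algebraMap_eq' rfl
  have hpb := isPullback_SpecMap_of_isPushout _ _ _ _ (CommRingCat.isPushout_tensorProduct A B D)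
  let E : CommRingCat.{u} := CommRingCat.of (B ⊗[A] D)
  -- `ρ` is the transport of the universal point
  let i₁ : B ⟶ E := CommRingCat.ofHom Algebra.TensorProduct.includeLeftRingHom
  let i₂ : D ⟶ E := CommRingCat.ofHom Algebra.TensorProduct.includeRight.toRingHom
  have hi : Spec.map i₂ ≫ Spec.map k ≫ Spec.map f = Spec.map i₁ ≫ Spec.map f := by
    rw [← Spec.map_comp]
    exact hpb.w.symm
  obtain ⟨r, hr⟩ := Spec.map_surjective (τ.tr (Spec.map i₂) (Spec.map i₁) hi)
  -- every transport of a point is obtained from the universal one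
  have key : ∀ {F : CommRingCat.{u}} (j : E ⟶ F) (h), Spec.map (r ≫ j) =
      τ.tr (Spec.map (i₂ ≫ j)) (Spec.map (i₁ ≫ j)) h := by
    intro F j h
    rw [Spec.map_comp, hr, τ.comp_tr]
    exact τ.tr_congr (Spec.map_comp _ _).symm (Spec.map_comp _ _).symm _ _
  -- `tr_comp`: the map `ρ` is `B`-linear
  have r₁ : k ≫ r = i₁ := by
    apply Spec.map_injective
    rw [Spec.map_comp, hr, τ.tr_comp]
  let ρ : D →ₐ[A] B ⊗[A] D :=
    { r.hom with
      commutes' := fun x => by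
        have h := ConcreteCategory.congr_hom r₁ (f.hom x)
        exact h }
  let μ : E ⟶ D := CommRingCat.ofHom (Algebra.TensorProduct.lift (IsScalarTower.toAlgHom A B D)
    (AlgHom.id A D) (fun _ _ => Commute.all _ _)).toRingHom
  have μ₁ : i₁ ≫ μ = k := by
    ext b
    refine (Algebra.TensorProduct.lift_tmul _ _ (fun _ _ => Commute.all _ _) b (1 : D)).trans ?_
    rw [map_one, mul_one]
    rfl
  have μ₂ : i₂ ≫ μ = 𝟙 D := by
    ext b
    refine (Algebra.TensorProduct.lift_tmul _ _ (fun _ _ => Commute.all _ _) (1 : B) b).trans ?_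
    rw [map_one, one_mul]
    rfl
  -- `tr_self`: the unit axiom
  have r₂ : r ≫ μ = 𝟙 D := by
    apply Spec.map_injective
    rw [key μ (by rw [μ₁, μ₂, Spec.map_id, Category.id_comp])]
    refine (τ.tr_self _ _ _ ?_).trans (by rw [μ₂])
    rw [μ₁, μ₂, Spec.map_id, Category.id_comp]
  let F : CommRingCat.{u} := CommRingCat.of (B ⊗[A] (B ⊗[A] D))
  let j₁ : E ⟶ F := CommRingCat.ofHom
    (Algebra.TensorProduct.map (AlgHom.id A B) ρ).toRingHom
  let j₂ : E ⟶ F := CommRingCat.ofHom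
    (Algebra.TensorProduct.map (AlgHom.id A B) Algebra.TensorProduct.includeRight).toRingHom
  -- `tr_tr`: coassociativity
  have r₃ : r ≫ j₁ = r ≫ j₂ := by
    let l : E ⟶ F := CommRingCat.ofHom Algebra.TensorProduct.includeRight.toRingHom
    have e₁ : i₁ ≫ j₁ = i₁ ≫ j₂ := by
      ext b
      refine (Algebra.TensorProduct.map_tmul _ _ b (1 : D)).trans
        (Eq.trans ?_ (Algebra.TensorProduct.map_tmul _ _ b (1 : D)).symm)
      rw [map_one, map_one]
    have e₂ : i₂ ≫ j₁ = r ≫ l := by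
      ext x
      exact Algebra.TensorProduct.map_tmul (AlgHom.id A B) ρ (1 : B) x
    have e₃ : i₂ ≫ j₂ = i₂ ≫ l := by
      ext x
      exact Algebra.TensorProduct.map_tmul (AlgHom.id A B) _ (1 : B) x
    have hj : ∀ {H : CommRingCat.{u}} (j : E ⟶ H), Spec.map (i₂ ≫ j) ≫ Spec.map k ≫ Spec.map f =
        Spec.map (i₁ ≫ j) ≫ Spec.map f := by
      intro H j
      rw [Spec.map_comp, Category.assoc, hi, ← Category.assoc, ← Spec.map_comp]
    have e₄ : Spec.map (i₂ ≫ l) ≫ Spec.map k ≫ Spec.map f = Spec.map (i₁ ≫ j₂) ≫ Spec.map f := by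
      rw [← e₃]
      exact hj j₂
    apply Spec.map_injective
    rw [key j₁ (hj j₁), key j₂ (hj j₂)]
    have e₅ : Spec.map (i₂ ≫ j₁) = τ.tr (Spec.map (i₂ ≫ l)) (Spec.map (i₁ ≫ l)) (hj l) := by
      rw [e₂, key l (hj l)]
    have e₆ : Spec.map (i₁ ≫ j₁) = Spec.map (i₁ ≫ j₂) := by rw [e₁]
    have e₇ : Spec.map (i₂ ≫ l) = Spec.map (i₂ ≫ j₂) := by rw [e₃]
    exact (τ.tr_congr e₅ e₆ _ (by rw [← e₅, ← e₆]; exact hj j₁)).trans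
      ((τ.tr_tr _ _ _ _ e₄ _).trans (τ.tr_congr e₇ rfl _ _))
  have hb := bijective_lift_equalizer ρ (fun b => ConcreteCategory.congr_hom r₁ b)
    (fun x => ConcreteCategory.congr_hom r₂ x) (fun x => ConcreteCategory.congr_hom r₃ x)
  let M := AlgHom.equalizer ρ Algebra.TensorProduct.includeRight
  refine ⟨CommRingCat.of M, CommRingCat.ofHom (algebraMap A M), CommRingCat.ofHom M.val.toRingHom,
    ?_, ?_⟩
  · refine (isPullback_SpecMap_of_isPushout _ _ _ _
      ((CommRingCat.isPushout_tensorProduct A B M).of_iso (Iso.refl _) (Iso.refl _) (Iso.refl _)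
        (RingEquiv.ofBijective _ hb).toCommRingCatIso ?_ ?_ ?_ ?_)).flip
    · rfl
    · rfl
    · ext b
      simp
      rfl
    · ext b
      simp
  -- points with the same image under the transport have the same image in the coinvariants, as this
  -- holds for the universal point
  · intro Z u w h
    let g := hpb.lift w u (by
      refine h.symm.trans ?_
      rw [← Spec.map_comp]
      rfl)
    have g₁ : g ≫ Spec.map i₁ = w := hpb.lift_fst _ _ _
    have g₂ : g ≫ Spec.map i₂ = u := hpb.lift_snd _ _ _
    have hM : CommRingCat.ofHom M.val.toRingHom ≫ r = CommRingCat.ofHom M.val.toRingHom ≫ i₂ := by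
      ext x
      exact x.2
    rw [τ.tr_congr g₂.symm g₁.symm h (by rw [Category.assoc, hi, Category.assoc]),
      ← τ.comp_tr g _ _ hi, ← hr, Category.assoc, ← Spec.map_comp]
    refine (congrArg (fun m => g ≫ Spec.map m) hM).trans ?_
    rw [Spec.map_comp, ← Category.assoc, g₂]

/-- Flat descent for morphisms of affine schemes, in terms of points. -/
lemma exists_descent {U W X : Scheme.{u}} [IsAffine U] [IsAffine W] [IsAffine X] {a : U ⟶ W}
    {p : W ⟶ X} [Flat p] (τ : Transport a p) :
    ∃ (T : Scheme.{u}) (π : T ⟶ X) (t : U ⟶ T), IsAffine T ∧ IsPullback t a π p ∧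
      ∀ ⦃Z : Scheme.{u}⦄ (u : Z ⟶ U) (w : Z ⟶ W) (h), τ.tr u w h ≫ t = u ≫ t := by
  let τ' := τ.ofIso U.isoSpec W.isoSpec X.isoSpec (Scheme.isoSpec_hom_naturality a)
    (Scheme.isoSpec_hom_naturality p)
  obtain ⟨M, m, t, ht, ht'⟩ := exists_descent_of_flat p.appTop a.appTop
    (by exact (HasRingHomProperty.iff_of_isAffine (P := @Flat)).1 ‹_›) τ'
  refine ⟨Spec M, Spec.map m ≫ X.isoSpec.inv, U.isoSpec.hom ≫ Spec.map t, inferInstance,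
    ht.of_iso U.isoSpec.symm (Iso.refl _) W.isoSpec.symm X.isoSpec.symm ?_ ?_ ?_ ?_, ?_⟩
  · simp
  · exact (Scheme.isoSpec_inv_naturality a)
  · simp
  · exact (Scheme.isoSpec_inv_naturality p)
  · intro Z u w h
    have h1 := ht' (u ≫ U.isoSpec.hom) (w ≫ W.isoSpec.hom) (by
      rw [Category.assoc, Category.assoc, Scheme.isoSpec_hom_naturality_assoc a,
        Scheme.isoSpec_hom_naturality p]
      simpa using h =≫ X.isoSpec.hom)
    rw [← Category.assoc, ← Category.assoc, ← h1]
    refine congrArg (· ≫ Spec.map t) ?_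
    exact congrArg (· ≫ U.isoSpec.hom) (τ.tr_congr (by simp) (by simp) _ _)

end Transport

end AffineDescent

/-! ### The descent datum given by a torsor of frames -/

section FrameTransport

variable {S : Scheme.{u}} {d : ℕ} {G : Sheaf (Scheme.fppfTopology.over S) GrpCat.{u}}
  {B : Tors (semidirect G d)} {a a' a'' : EtTors G d}

/-- Morphisms to `a` are determined by their underlying morphism and the induced morphism of torsors
of frames to `B`. -/
lemma hom_ext_of_framesMap_comp (s : framesTors a ⟶ B) {z : EtTors G d} {v v' : z ⟶ a}
    (h : v.f = v'.f) (h' : framesMap v ≫ s = framesMap v' ≫ s) : v = v' :=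
  (existsUnique_framesMap_eq (framesMap v')).unique (Tors.hom_ext_of_comp h h') rfl

/-- If `framesTors a` is locally the torsor `B`, a morphism from a torsor of frames to `B` comes
from a morphism to `a` as soon as this is so for the underlying morphisms. -/
lemma exists_framesMap_comp_eq (s : framesTors a ⟶ B) {z : EtTors G d} (σ : framesTors z ⟶ B)
    (g : z.X ⟶ a.X) (h : g ≫ s.base = σ.base) :
    ∃ v : z ⟶ a, v.f = g ∧ framesMap v ≫ s = σ := by
  obtain ⟨w, hw, hw'⟩ := Tors.exists_lift s σ g h
  obtain ⟨v, rfl, -⟩ := existsUnique_framesMap_eq w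
  exact ⟨v, hw, hw'⟩

/-- Let the torsors of frames of `a` and `a'` be related to a torsor `B` by morphisms `s` and
`s'`.  Points of `a` and `a'` are related if they correspond to each other under the descent datum
given by `B`: they are the images of one point of an object `c` under morphisms `c ⟶ a` and
`c ⟶ a'` which agree as morphisms to `B`. -/
def FrameRel (s : framesTors a ⟶ B) (s' : framesTors a' ⟶ B) {z : Tors G} (n : z ⟶ a.tors)
    (n' : z ⟶ a'.tors) : Prop :=
  ∃ (c : EtTors G d) (v : c ⟶ a) (v' : c ⟶ a') (l : z ⟶ c.tors),
    framesMap v ≫ s = framesMap v' ≫ s' ∧ l ≫ v.t = n ∧ l ≫ v'.t = n'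

namespace FrameRel

variable {s : framesTors a ⟶ B} {s' : framesTors a' ⟶ B} {s'' : framesTors a'' ⟶ B} {z : Tors G}
  {n : z ⟶ a.tors} {n' : z ⟶ a'.tors} {n'' : z ⟶ a''.tors}

variable (s) in
lemma refl (n : z ⟶ a.tors) : FrameRel s s n n :=
  ⟨a, 𝟙 a, 𝟙 a, n, rfl, Category.comp_id n, Category.comp_id n⟩

lemma symm : FrameRel s s' n n' → FrameRel s' s n' n :=
  fun ⟨c, v, v', l, h, h₁, h₂⟩ => ⟨c, v', v, l, h.symm, h₂, h₁⟩

lemma comp (h : FrameRel s s' n n') {y : Tors G} (k : y ⟶ z) :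
    FrameRel s s' (k ≫ n) (k ≫ n') := by
  obtain ⟨c, v, v', l, h, rfl, rfl⟩ := h
  exact ⟨c, v, v', k ≫ l, h, Category.assoc _ _ _, Category.assoc _ _ _⟩

/-- If `n` is given by a section `l` of the pullback `c` of `a`, then the related `n'` is given by
the same section. -/
lemma exists_of_section (h : FrameRel s s' n n') {c : EtTors G d} {v : c ⟶ a} {l : z ⟶ c.tors}
    (hl : l ≫ v.t = n) [IsIso (l.base ≫ c.π)] :
    ∃ v' : c ⟶ a', framesMap v ≫ s = framesMap v' ≫ s' ∧ l ≫ v'.t = n' := by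
  obtain ⟨c₁, v₁, v₁', l₁, h, h₁, rfl⟩ := h
  have hb : l₁.base ≫ v₁.t.base = l.base ≫ v.t.base :=
    congrArg Tors.Hom.base (h₁.trans hl.symm)
  have hf : l₁.base ≫ c₁.π ≫ v₁.f = l.base ≫ c.π ≫ v.f := by
    rw [← v₁.isPullback.w, ← v.isPullback.w, ← Category.assoc, hb, Category.assoc]
  obtain ⟨m, hm, rfl⟩ := CoverTors.exists_lift v₁ v (inv (l.base ≫ c.π) ≫ l₁.base ≫ c₁.π) (by
    rw [Category.assoc, Category.assoc, hf, IsIso.inv_comp_eq, Category.assoc])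
  have hlm : l ≫ m.t = l₁ := by
    refine Tors.hom_ext_of_comp (u := v₁.t) (v₁.isPullback.hom_ext ?_ ?_)
      ((Category.assoc _ _ _).trans (hl.trans h₁.symm))
    · exact (Category.assoc _ _ _).trans hb.symm
    · refine (Category.assoc _ _ _).trans ((congrArg (l.base ≫ ·) m.isPullback.w).trans ?_)
      rw [hm, ← Category.assoc, IsIso.hom_inv_id_assoc]
  refine ⟨m ≫ v₁', ?_, ?_⟩
  · rw [framesMap_comp, framesMap_comp, Category.assoc, Category.assoc, h]
  · rw [CoverTors.comp_t, ← Category.assoc, hlm]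

/-- A point of the torsor of `a` is given by a section of a pullback of `a`. -/
lemma exists_section (n : z ⟶ a.tors) : ∃ (c : EtTors G d) (v : c ⟶ a) (l : z ⟶ c.tors),
    IsIso (l.base ≫ c.π) ∧ l ≫ v.t = n := by
  obtain ⟨c, v, l, e, -, h, h'⟩ := CoverTors.exists_pullback_section a n
  exact ⟨c, v, l, by rw [h]; infer_instance, h'⟩

/-- Both relations are written with the same pullback of `a'`, along the image of `n'` in the
base. -/
lemma trans (h : FrameRel s s' n n') (h' : FrameRel s' s'' n' n'') : FrameRel s s'' n n'' := by
  obtain ⟨c, v', l, _, hl⟩ := exists_section n'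
  obtain ⟨v, hv, rfl⟩ := h.symm.exists_of_section hl
  obtain ⟨v'', hv', rfl⟩ := h'.exists_of_section hl
  exact ⟨c, v, v'', l, hv.symm.trans hv', rfl, rfl⟩

/-- Points of the same fiber of `a` that are related are equal. -/
lemma eq {n n' : z ⟶ a.tors} (h : FrameRel s s n n') (e : n.base ≫ a.π = n'.base ≫ a.π) :
    n = n' := by
  obtain ⟨c, v, l, _, hl⟩ := exists_section n
  obtain ⟨v', hv, hl'⟩ := h.exists_of_section hl
  have : v = v' := by
    refine hom_ext_of_framesMap_comp s ?_ hv
    rw [← cancel_epi (l.base ≫ c.π), Category.assoc, Category.assoc, ← v.isPullback.w,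
      ← v'.isPullback.w, ← Category.assoc, ← Category.assoc]
    subst hl hl'
    exact e
  rw [← hl, ← hl', this]

/-- Related points have the same image in the base of `B`. -/
lemma base_comp (h : FrameRel s s' n n') :
    n.base ≫ a.π ≫ s.base = n'.base ≫ a'.π ≫ s'.base := by
  obtain ⟨c, v, v', l, h, rfl, rfl⟩ := h
  have h : v.f ≫ s.base = v'.f ≫ s'.base := congrArg Tors.Hom.base h
  rw [Tors.comp_base, Tors.comp_base, Category.assoc, Category.assoc, ← Category.assoc _ a.π,
    v.isPullback.w, Category.assoc, h, ← Category.assoc _ v'.f, ← v'.isPullback.w, Category.assoc]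

variable (s s') in
/-- A point of `a` is related to a point of `a'` over any point `g` of the base of `a'` with the
same image in the base of `B`: the pullback of `a` containing it is also a pullback of `a'`. -/
lemma exists_of_base (n : z ⟶ a.tors) (g : z.base ⟶ a'.X)
    (h : n.base ≫ a.π ≫ s.base = g ≫ s'.base) :
    ∃ n' : z ⟶ a'.tors, FrameRel s s' n n' ∧ n'.base ≫ a'.π = g := by
  obtain ⟨c, v, l, _, rfl⟩ := exists_section n
  obtain ⟨v', hv, hv'⟩ := exists_framesMap_comp_eq s' (framesMap v ≫ s)
    (inv (l.base ≫ c.π) ≫ g) (by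
      rw [Category.assoc, IsIso.inv_comp_eq, ← h, Tors.comp_base, Category.assoc,
        ← Category.assoc _ a.π, v.isPullback.w, Category.assoc, Category.assoc]
      rfl)
  refine ⟨l ≫ v'.t, ⟨c, v, v', l, hv'.symm, rfl, rfl⟩, ?_⟩
  rw [Tors.comp_base, Category.assoc, v'.isPullback.w, hv, ← Category.assoc,
    IsIso.hom_inv_id_assoc]

end FrameRel

lemma FrameRel.exists_of_section_base (s : framesTors a ⟶ B) {Z : Over S} (u : Z ⟶ a.tors.base)
    (w : Z ⟶ a.X) (h : u ≫ a.π ≫ s.base = w ≫ s.base) :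
    ∃ n' : (⟨Z, (Torsor.res u).obj a.tors.torsor⟩ : Tors G) ⟶ a.tors,
      FrameRel s s (Tors.resMap a.tors u) n' ∧ n'.base ≫ a.π = w :=
  FrameRel.exists_of_base (z := ⟨Z, (Torsor.res u).obj a.tors.torsor⟩) s s
    (Tors.resMap a.tors u) w h

/-- The transport of the points of the cover underlying `a`. -/
noncomputable def frameTr (s : framesTors a ⟶ B) {Z : Over S} (u : Z ⟶ a.tors.base)
    (w : Z ⟶ a.X) (h : u ≫ a.π ≫ s.base = w ≫ s.base) : Z ⟶ a.tors.base :=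
  (FrameRel.exists_of_section_base s u w h).choose.base

/-- The transport of a point of the cover is the point underlying any related point of the torsor;
so it does not depend on the torsor used to define it. -/
lemma frameTr_eq (s : framesTors a ⟶ B) {z : Tors G} {n n' : z ⟶ a.tors} (h : FrameRel s s n n')
    {u : z.base ⟶ a.tors.base} {w : z.base ⟶ a.X} (hu : n.base = u) (hw : n'.base ≫ a.π = w)
    (e : u ≫ a.π ≫ s.base = w ≫ s.base) : frameTr s u w e = n'.base := by
  obtain ⟨h₁, h₂⟩ := (FrameRel.exists_of_section_base s u w e).choose_spec
  obtain ⟨k, hk, hk'⟩ := Tors.exists_lift (Tors.resMap a.tors u) n (𝟙 _) (by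
    rw [hu]; exact Category.id_comp u)
  have h₃ : FrameRel s s (k ≫ (FrameRel.exists_of_section_base s u w e).choose) n' := by
    have := (h₁.comp k).symm
    rw [hk'] at this
    exact this.trans h
  have h₄ := h₃.eq (by
    rw [Tors.comp_base, Category.assoc, h₂, hk, hw]
    exact Category.id_comp w)
  refine Eq.trans ?_ (congrArg Tors.Hom.base h₄)
  rw [Tors.comp_base, hk]
  exact (Category.id_comp _).symm

/-- The descent datum for the cover underlying `a`. -/
noncomputable def frameTransport (s : framesTors a ⟶ B) : Transport a.π s.base where
  tr u w h := frameTr s u w h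
  comp_tr g u w h := by
    obtain ⟨h₁, h₂⟩ := (FrameRel.exists_of_section_base s u w h).choose_spec
    exact (frameTr_eq s (h₁.comp
      (Tors.resMap (⟨_, (Torsor.res u).obj a.tors.torsor⟩ : Tors G) g)) rfl
      ((Category.assoc _ _ _).trans (congrArg (g ≫ ·) h₂)) _).symm
  tr_comp u w h := (FrameRel.exists_of_section_base s u w h).choose_spec.2
  tr_self u w h hw := frameTr_eq s (FrameRel.refl s (Tors.resMap a.tors u)) rfl hw h
  tr_tr u w w' h h' h'' := by
    obtain ⟨h₁, h₂⟩ := (FrameRel.exists_of_section_base s u w h).choose_spec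
    obtain ⟨h₁', h₂'⟩ := (FrameRel.exists_of_section_base s u w' h').choose_spec
    exact frameTr_eq s (h₁.symm.trans h₁') rfl h₂' h''

end FrameTransport

/-! ### Descent of torsors of frames -/

section DescentOfFrames

universe w v₁ u₁

/-- Morphisms of torsors are glued along a covering family, given the fiber products of its
members. -/
lemma Tors.exists_desc {C : Type u₁} [Category.{v₁} C] {J : GrothendieckTopology C}
    {G : Sheaf J GrpCat.{w}} [J.Subcanonical] {ι : Type*} {A B : Tors G} {A₀ : ι → Tors G}
    {D : ι → ι → Tors G} (s : ∀ i, A₀ i ⟶ A)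
    (hs : Sieve.ofArrows (fun i => (A₀ i).base) (fun i => (s i).base) ∈ J A.base)
    (s' : ∀ i, A₀ i ⟶ B) (l : ∀ i j, D i j ⟶ A₀ i) (r : ∀ i j, D i j ⟶ A₀ j)
    (hpb : ∀ i j, IsPullback (l i j).base (r i j).base (s i).base (s j).base)
    (h : ∀ i j, l i j ≫ s i = r i j ≫ s j) (h' : ∀ i j, l i j ≫ s' i = r i j ≫ s' j) :
    ∃ n : A ⟶ B, ∀ i, s i ≫ n = s' i := by
  -- the value of the glued morphism on a morphism that factors through `s i` is independent of `i`
  -- and of the factorization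
  have huniq : ∀ {z : Tors G} (i j : ι) (w : z ⟶ A₀ i) (w' : z ⟶ A₀ j), w ≫ s i = w' ≫ s j →
      w ≫ s' i = w' ≫ s' j := by
    intro z i j w w' e
    have eb : w.base ≫ (s i).base = w'.base ≫ (s j).base := congrArg Hom.base e
    obtain ⟨q, hq, hq'⟩ := exists_lift (l i j) w ((hpb i j).lift _ _ eb)
      ((hpb i j).lift_fst _ _ _)
    have hq'' : q ≫ r i j = w' := by
      refine hom_ext_of_comp (u := s j) ?_ ?_
      · rw [comp_base, hq]
        exact (hpb i j).lift_snd _ _ _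
      · rw [Category.assoc, ← h, ← Category.assoc, hq', e]
    rw [← hq', ← hq'', Category.assoc, Category.assoc, h']
  have hex : ∀ {z : Tors G} (u : z ⟶ A)
      (_ : Sieve.ofArrows (fun i => (A₀ i).base) (fun i => (s i).base) u.base),
      ∃ (i : ι) (w : z ⟶ A₀ i), w ≫ s i = u := by
    rintro z u ⟨_, g, _, ⟨i⟩, hg⟩
    obtain ⟨w, -, hw⟩ := exists_lift (s i) u g hg
    exact ⟨i, w, hw⟩
  obtain ⟨n, hn, -⟩ := existsUnique_glue (B := B) _ hs
    (fun z u hu => (hex u hu).choose_spec.choose ≫ s' _)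
    (fun z z' u v hu hvu => by
      rw [← Category.assoc]
      refine huniq _ _ _ _ ?_
      rw [(hex _ hvu).choose_spec.choose_spec, Category.assoc, (hex _ hu).choose_spec.choose_spec])
  refine ⟨n, fun i => ?_⟩
  have hu := Sieve.ofArrows_mk (fun i => (A₀ i).base) (fun i => (s i).base) i
  refine (hn (s i) hu).trans ((huniq _ i _ (𝟙 _) ?_).trans (Category.id_comp _))
  rw [(hex (s i) hu).choose_spec.choose_spec, Category.id_comp]

variable {S : Scheme.{u}} {d : ℕ} {G : Sheaf (Scheme.fppfTopology.over S) GrpCat.{u}}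

lemma Transport.left_aux {U W X : Over S} {a : U ⟶ W} {p : W ⟶ X} {Z : Scheme.{u}}
    {u : Z ⟶ U.left} {w : Z ⟶ W.left} (h : u ≫ a.left ≫ p.left = w ≫ p.left) :
    w ≫ W.hom = u ≫ U.hom := by
  rw [← Over.w p, ← Category.assoc, ← h, Category.assoc, Category.assoc, Over.w, Over.w]

/-- A point of `U` with values in a scheme `Z` makes `Z` an `S`-scheme, so that it may be
transported by a descent datum over `S`. -/
def Transport.leftTr {U W X : Over S} {a : U ⟶ W} {p : W ⟶ X} (τ : Transport a p)
    {Z : Scheme.{u}} (u : Z ⟶ U.left) (w : Z ⟶ W.left)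
    (h : u ≫ a.left ≫ p.left = w ≫ p.left) : Z ⟶ U.left :=
  (τ.tr (Over.homMk u : Over.mk (u ≫ U.hom) ⟶ U)
    (Over.homMk w (Transport.left_aux h)) (by ext; exact h)).left

lemma Transport.leftTr_eq {U W X : Over S} {a : U ⟶ W} {p : W ⟶ X} (τ : Transport a p)
    {Z : Over S} (u : Z ⟶ U) (w : Z ⟶ W) (h : u ≫ a ≫ p = w ≫ p)
    (h' : u.left ≫ a.left ≫ p.left = w.left ≫ p.left) :
    τ.leftTr u.left w.left h' = (τ.tr u w h).left := by
  have h₁ := τ.comp_tr (Over.homMk (𝟙 _) : Z ⟶ Over.mk (u.left ≫ U.hom))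
    (Over.homMk u.left) (Over.homMk w.left (Transport.left_aux h')) (by ext; exact h')
  have h₂ := h₁.trans (τ.tr_congr (u' := u) (w' := w) (by ext; simp) (by ext; simp) _ h)
  have h₃ := congrArg CommaMorphism.left h₂
  exact (Category.id_comp _).symm.trans h₃

/-- A descent datum over `S` is a descent datum for the underlying schemes. -/
def Transport.left {U W X : Over S} {a : U ⟶ W} {p : W ⟶ X} (τ : Transport a p) :
    Transport a.left p.left where
  tr u w h := τ.leftTr u w h
  comp_tr g u w h := by
    have h₁ := τ.comp_tr (Over.homMk g : Over.mk (g ≫ u ≫ U.hom) ⟶ Over.mk (u ≫ U.hom))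
      (Over.homMk u) (Over.homMk w (Transport.left_aux h)) (by ext; exact h)
    refine (congrArg CommaMorphism.left h₁).trans (τ.leftTr_eq _ _ _ ?_).symm
    simp [h]
  tr_comp u w h := congrArg CommaMorphism.left (τ.tr_comp _ _ _)
  tr_self u w h hw := congrArg CommaMorphism.left (τ.tr_self
    (Over.homMk u : Over.mk (u ≫ U.hom) ⟶ U) (Over.homMk w (Transport.left_aux h)) _
    (by ext; exact hw))
  tr_tr u w w' h h' h'' := by
    refine (τ.leftTr_eq (τ.tr (Over.homMk u : Over.mk (u ≫ U.hom) ⟶ U)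
      (Over.homMk w (Transport.left_aux h)) (by ext; exact h))
      (Over.homMk w' (Transport.left_aux h')) ?_ h'').trans ?_
    · ext
      exact h''
    · exact congrArg CommaMorphism.left (τ.tr_tr _ _ _ _ (by ext; exact h') _)

/-- Flat descent for affine schemes over `S`. -/
lemma Transport.exists_descent_over {U W X : Over S} [IsAffine U.left] [IsAffine W.left]
    [IsAffine X.left] {a : U ⟶ W} {p : W ⟶ X} [Flat p.left] (τ : Transport a p) :
    ∃ (T : Over S) (π : T ⟶ X) (t : U ⟶ T), IsAffine T.left ∧ IsPullback t a π p ∧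
      ∀ ⦃Z : Over S⦄ (u : Z ⟶ U) (w : Z ⟶ W) (h), τ.tr u w h ≫ t = u ≫ t := by
  obtain ⟨T, π, t, hT, hpb, ht⟩ := τ.left.exists_descent
  refine ⟨Over.mk (π ≫ X.hom), Over.homMk π, Over.homMk t (by
    change t ≫ π ≫ X.hom = _
    rw [← Category.assoc, hpb.w, Category.assoc, Over.w, Over.w]), hT,
    IsPullback.of_map_of_faithful (Over.forget S) hpb, fun Z u w h => ?_⟩
  have h' : u.left ≫ a.left ≫ p.left = w.left ≫ p.left := congrArg CommaMorphism.left h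
  ext
  refine Eq.trans ?_ (ht u.left w.left h')
  exact congrArg (· ≫ t) (τ.leftTr_eq u w h h').symm

/-- A cover with torsor over `Y` whose torsor of frames is the restriction of `B` along `y`. -/
structure FrameForm (B : Tors (semidirect G d)) {Y : Over S} (y : Y ⟶ B.base) where
  tors : Tors G
  π : tors.base ⟶ Y
  hπ : coverProp S d π
  hom : framesTors (⟨Y, tors, π, hπ⟩ : EtTors G d) ⟶ B
  hom_base : hom.base = y

namespace FrameForm

variable {B : Tors (semidirect G d)} {Y : Over S} {y : Y ⟶ B.base}

/-- The underlying object of `EtTors G d`. -/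
abbrev obj (x : FrameForm B y) : EtTors G d := ⟨Y, x.tors, x.π, x.hπ⟩

lemma nonempty_of_hom {x : EtTors G d} (e : x.X = Y) (σ : framesTors x ⟶ B)
    (h : σ.base = eqToHom e ≫ y) : Nonempty (FrameForm B y) := by
  obtain ⟨X, t, π, hπ⟩ := x
  obtain rfl : X = Y := e
  exact ⟨⟨t, π, hπ, σ, h.trans (Category.id_comp y)⟩⟩

lemma nonempty_restrict (x : FrameForm B y) {Y' : Over S} (k : Y' ⟶ Y) {y' : Y' ⟶ B.base}
    (h : k ≫ y = y') : Nonempty (FrameForm B y') := by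
  obtain ⟨c, e, v, hv⟩ := CoverTors.exists_pullback x.obj k
  refine nonempty_of_hom e (framesMap v ≫ x.hom) ?_
  subst h
  refine (congrArg₂ (· ≫ ·) hv x.hom_base).trans ?_
  exact Category.assoc _ _ _

/-- Over the split object, the torsor of frames is trivial. -/
lemma nonempty_of_section (q : B.torsor.sec y) : Nonempty (FrameForm B y) := by
  let m := Tors.ofSection (framesTors (split G d Y)) (𝟙 Y)
    ((frames (split G d Y)).equiv (𝟙 Y) ⟨𝟙 _, rfl⟩)
  obtain ⟨w, hw, -⟩ := Tors.exists_lift m (𝟙 (framesTors (split G d Y))) (𝟙 Y)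
    (Category.comp_id (𝟙 Y))
  refine nonempty_of_hom (x := split G d Y) rfl (w ≫ Tors.ofSection B y q) ?_
  exact congrArg (· ≫ y) hw

/-- If the torsors of frames of the `a i` are locally the torsor `B`, and the covers underlying
the `a i` are glued to a finite étale cover `T` according to the descent datum given by `B`, then
`B` is a torsor of frames: the torsors underlying the `a i` are glued as well. -/
lemma nonempty_of_glue (B : Tors (semidirect G d)) {ι : Type (u + 1)} {a : ι → EtTors G d}
    (s : ∀ i, framesTors (a i) ⟶ B)
    (hs : Sieve.ofArrows _ (fun i => (s i).base) ∈ Scheme.fppfTopology.over S B.base)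
    {T : Over S} {π : T ⟶ B.base} (hπ : coverProp S d π) (t : ∀ i, (a i).tors.base ⟶ T)
    (hpb : ∀ i, IsPullback (t i) (a i).π π (s i).base)
    (ht : ∀ i j ⦃z : Tors G⦄ (n : z ⟶ (a i).tors) (n' : z ⟶ (a j).tors),
      FrameRel (s i) (s j) n n' → n.base ≫ t i = n'.base ≫ t j) :
    Nonempty (FrameForm B (𝟙 B.base)) := by
  -- the fiber products of the `s i`
  have key : ∀ i j, ∃ (c : EtTors G d) (l : c ⟶ a i) (r : c ⟶ a j),
      framesMap l ≫ s i = framesMap r ≫ s j ∧ IsPullback l.f r.f (s i).base (s j).base := by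
    intro i j
    obtain ⟨c, e, l, hl⟩ := CoverTors.exists_pullback (a i) (pullback.fst (s i).base (s j).base)
    obtain ⟨r, hr, hlr⟩ := exists_framesMap_comp_eq (s j) (framesMap l ≫ s i)
      (eqToHom e ≫ pullback.snd (s i).base (s j).base) (by
        refine (Category.assoc _ _ _).trans ?_
        rw [← pullback.condition, ← Category.assoc, ← hl]
        rfl)
    exact ⟨c, l, r, hlr.symm, (IsPullback.of_hasPullback (s i).base (s j).base).of_iso
      (eqToIso e.symm) (Iso.refl _) (Iso.refl _) (Iso.refl _) (by simp [hl]) (by simp [hr])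
      (by simp) (by simp)⟩
  choose c l r hlr hf using key
  have hrel : ∀ i j {z : Tors G} (n : z ⟶ (c i j).tors),
      FrameRel (s i) (s j) (n ≫ (l i j).t) (n ≫ (r i j).t) := fun i j _ n =>
    ⟨c i j, l i j, r i j, n, hlr i j, rfl, rfl⟩
  -- the covers of the `c i j` are the fiber products of the covers of `a i` and `a j` over `T`
  have hw : ∀ i j, (l i j).t.base ≫ t i = (r i j).t.base ≫ t j := by
    intro i j
    have h := hrel i j (𝟙 (c i j).tors)
    rw [Category.id_comp, Category.id_comp] at h
    exact ht i j _ _ h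
  have hk : ∀ i j, IsPullback (l i j).t.base (r i j).t.base (t i) (t j) := by
    intro i j
    have hex : ∀ {Z : Over S} (u : Z ⟶ (a i).tors.base) (u' : Z ⟶ (a j).tors.base),
        u ≫ t i = u' ≫ t j →
        ∃ m : Z ⟶ (c i j).tors.base, m ≫ (l i j).t.base = u ∧ m ≫ (r i j).t.base = u' := by
      intro Z u u' h
      have h₁ : (u ≫ (a i).π) ≫ (s i).base = (u' ≫ (a j).π) ≫ (s j).base := by
        rw [Category.assoc, ← (hpb i).w, ← Category.assoc, h, Category.assoc, (hpb j).w,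
          Category.assoc]
      obtain ⟨m, hm, hm'⟩ := (l i j).isPullback.exists_lift u ((hf i j).lift _ _ h₁)
        ((hf i j).lift_fst _ _ h₁).symm
      refine ⟨m, hm, (hpb j).hom_ext ?_ ?_⟩
      · rw [Category.assoc, ← hw, ← Category.assoc, hm, h]
      · rw [Category.assoc, (r i j).isPullback.w, ← Category.assoc, hm', (hf i j).lift_snd]
    refine ⟨⟨hw i j⟩, ⟨PullbackCone.IsLimit.mk _ (fun q => (hex q.fst q.snd q.condition).choose)
      (fun q => (hex q.fst q.snd q.condition).choose_spec.1)
      (fun q => (hex q.fst q.snd q.condition).choose_spec.2) fun q m h₁ h₂ => ?_⟩⟩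
    obtain ⟨h₃, h₄⟩ := (hex q.fst q.snd q.condition).choose_spec
    refine (l i j).isPullback.hom_ext (h₁.trans h₃.symm) ((hf i j).hom_ext ?_ ?_)
    · rw [Category.assoc, Category.assoc, ← (l i j).isPullback.w, ← Category.assoc,
        ← Category.assoc, h₁, h₃]
    · rw [Category.assoc, Category.assoc, ← (r i j).isPullback.w, ← Category.assoc,
        ← Category.assoc, h₂, h₄]
  have hcov : Sieve.ofArrows _ t ∈ Scheme.fppfTopology.over S T := by
    refine GrothendieckTopology.superset_covering _ ?_
      (GrothendieckTopology.pullback_stable _ π hs)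
    rintro Z g ⟨_, k, _, ⟨i⟩, hg⟩
    exact ⟨_, (hpb i).lift g k hg.symm, _, ⟨i⟩, (hpb i).lift_fst _ _ _⟩
  -- the torsors of the `a i` are glued to a torsor `P` on `T`; the cocycle condition holds because
  -- being related is transitive
  obtain ⟨⟨y, P⟩, e', k, hk₁, hk₂⟩ := Tors.objectsGlue G (X := T) (fun i => (a i).tors) t hcov
    (fun i j => (c i j).tors) (fun i j => (l i j).t) (fun i j => (r i j).t) hk
    (fun i₁ i₂ i₃ o α β γ h₁ h₂ h₃ => by
      have h₄ := (hrel i₁ i₃ γ).symm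
      rw [← h₂] at h₄
      have h₅ := h₄.trans (hrel i₁ i₂ α)
      rw [h₁] at h₅
      exact ((h₅.trans (hrel i₂ i₃ β)).eq (congrArg (· ≫ (a i₃).π) h₃.symm)).symm)
  obtain rfl : T = y := e'
  have hkt : ∀ i, (k i).base = t i := fun i => (hk₁ i).trans (Category.comp_id (t i))
  let K : ∀ i, a i ⟶ (⟨B.base, ⟨T, P⟩, π, hπ⟩ : EtTors G d) := fun i =>
    ⟨(s i).base, k i, by rw [hkt]; exact hpb i⟩
  have hlK : ∀ i j, l i j ≫ K i = r i j ≫ K j := fun i j =>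
    CoverTors.hom_ext (hf i j).w (hk₂ i j)
  -- the morphisms `s i` are glued to a morphism from the torsor of frames of the new object
  obtain ⟨n, hn⟩ := Tors.exists_desc (fun i => framesMap (K i)) hs s (fun i j => framesMap (l i j))
    (fun i j => framesMap (r i j)) hf
    (fun i j => by rw [← framesMap_comp, hlK, framesMap_comp]) hlr
  refine nonempty_of_hom rfl n ?_
  refine hom_ext_of_mem hs ?_
  rintro Z _ ⟨_, g, _, ⟨i⟩, rfl⟩
  have h := congrArg Tors.Hom.base (hn i)
  refine (Category.assoc _ _ _).trans (Eq.trans (congrArg (g ≫ ·) h) ?_)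
  exact (Category.comp_id _).symm

/-- Descent along a flat covering of affine schemes. -/
lemma nonempty_of_descent (B : Tors (semidirect G d)) {a : EtTors G d} (s : framesTors a ⟶ B)
    [IsAffine a.X.left] [IsAffine B.base.left] [Flat s.base.left] [Surjective s.base.left]
    [LocallyOfFinitePresentation s.base.left] : Nonempty (FrameForm B (𝟙 B.base)) := by
  have hfin : IsFinite a.π.left := a.hπ.1
  have : IsAffine a.tors.base.left := isAffine_of_isAffineHom a.π.left
  obtain ⟨T, π, t, _, hpb, ht⟩ := (frameTransport s).exists_descent_over
  have hpb' : IsPullback t.left a.π.left π.left s.base.left := hpb.map (Over.forget S)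
  refine nonempty_of_glue B (ι := PUnit) (fun _ => s) (GrothendieckTopology.superset_covering _ (by
      rw [Sieve.generate_le_iff]
      rintro _ _ ⟨⟩
      exact Sieve.ofArrows_mk _ _ PUnit.unit) (ofArrows_mem_fppf_over s.base))
    (show finEtale d π.left from finEtale_of_fppf_descent hpb' a.hπ) (fun _ => t) (fun _ => hpb)
    fun _ _ z n n' h => ?_
  have e := h.base_comp.trans (Category.assoc _ _ _).symm
  rw [← ht n.base (n'.base ≫ a.π) e]
  exact congrArg (· ≫ t) (frameTr_eq s h rfl rfl e)

end FrameForm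

end DescentOfFrames

/-! ### Refinement of fppf coverings -/

section AffineRefinement

variable {S : Scheme.{u}}

/-- An fppf covering is refined, locally on the base, by a surjective flat morphism of finite
presentation between affine schemes. -/
lemma exists_affine_refinement {X : Over S} {R : Sieve X}
    (hR : R ∈ Scheme.fppfTopology.over S X) (x : X.left) :
    ∃ (V W : Over S) (p : W ⟶ V) (j : V ⟶ X), IsAffine V.left ∧ IsAffine W.left ∧
      Flat p.left ∧ Surjective p.left ∧ LocallyOfFinitePresentation p.left ∧
      IsOpenImmersion j.left ∧ x ∈ Set.range j.left ∧ R (p ≫ j) := by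
  rw [GrothendieckTopology.mem_over_iff] at hR
  change _ ∈ Precoverage.toGrothendieck _ _ at hR
  have : Scheme.fppfPrecoverage.{u}.HasIsos :=
    ⟨fun f _ => (Scheme.singleton_mem_precoverage_iff _ f).2
      ⟨f.surjective, inferInstance, inferInstance⟩⟩
  rw [Precoverage.mem_toGrothendieck_iff_of_isStableUnderComposition] at hR
  obtain ⟨R', ⟨hR₁, hR₂⟩, hle⟩ := hR
  obtain ⟨_, _, ⟨hf⟩, y, hy⟩ := hR₁ x
  rename_i U f
  obtain ⟨hflat, hlfp⟩ := hR₂ hf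
  change f y = x at hy
  -- affine neighbourhoods `V₀` of `x` and `W₀` of a point over `x`
  obtain ⟨V₀, hV₀, hx, -⟩ := exists_isAffineOpen_mem_and_subset (x := x) (U := ⊤) trivial
  obtain ⟨W₀, hW₀, hyW, hWV⟩ := exists_isAffineOpen_mem_and_subset (x := y) (U := f ⁻¹ᵁ V₀)
    (by change f y ∈ V₀; rwa [hy])
  have : IsAffine V₀ := hV₀
  have : IsAffine W₀ := hW₀
  let g : W₀.toScheme ⟶ V₀.toScheme := f.resLE V₀ W₀ hWV
  have hg : g ≫ V₀.ι = W₀.ι ≫ f := Scheme.Hom.resLE_comp_ι _ _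
  have i₁ : IsZariskiLocalAtSource @Flat.{u} :=
    HasRingHomProperty.instIsZariskiLocalAtSource (Q := RingHom.Flat)
  have i₂ : IsZariskiLocalAtTarget @Flat.{u} :=
    HasRingHomProperty.instIsZariskiLocalAtTarget (P := @Flat) (Q := RingHom.Flat)
  have i₃ : IsZariskiLocalAtSource @LocallyOfFinitePresentation.{u} :=
    HasRingHomProperty.instIsZariskiLocalAtSource (Q := RingHom.FinitePresentation)
  have i₄ : IsZariskiLocalAtTarget @LocallyOfFinitePresentation.{u} :=
    HasRingHomProperty.instIsZariskiLocalAtTarget (P := @LocallyOfFinitePresentation)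
      (Q := RingHom.FinitePresentation)
  have hgf : Flat g := IsZariskiLocalAtSource.resLE hWV hflat
  have hgl : LocallyOfFinitePresentation g := IsZariskiLocalAtSource.resLE hWV hlfp
  -- an affine neighbourhood of `x` in the image of `W₀`
  obtain ⟨V, hV, hxV, hVi⟩ := exists_isAffineOpen_mem_and_subset (x := (⟨x, hx⟩ : V₀))
    (U := ⟨Set.range g, g.isOpenMap.isOpen_range⟩) ⟨⟨y, hyW⟩, by
      apply V₀.ι.injective
      exact (Scheme.Hom.comp_apply g V₀.ι _).symm.trans
        ((congrArg (fun m : W₀.toScheme ⟶ X.left => m ⟨y, hyW⟩) hg).trans hy)⟩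
  have : IsAffine V := hV
  have : IsAffine (g ⁻¹ᵁ V) := hV.preimage g
  have hpf : (g ∣_ V) ≫ V.ι ≫ V₀.ι = ((g ⁻¹ᵁ V).ι ≫ W₀.ι) ≫ f := by
    rw [morphismRestrict_ι_assoc, hg, Category.assoc]
  refine ⟨Over.mk ((V.ι ≫ V₀.ι) ≫ X.hom), Over.mk ((g ∣_ V) ≫ (V.ι ≫ V₀.ι) ≫ X.hom),
    Over.homMk (g ∣_ V), Over.homMk (V.ι ≫ V₀.ι), ‹IsAffine V›, this, ?_, ?_, ?_, ?_, ?_, ?_⟩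
  · exact (inferInstance : Flat (g ∣_ V))
  · refine ⟨fun (v : V) => ?_⟩
    obtain ⟨w, hw⟩ := hVi v.2
    have hw' : w ∈ g ⁻¹ᵁ V := by
      change g w ∈ V
      rw [hw]
      exact v.2
    refine ⟨(⟨w, hw'⟩ : g ⁻¹ᵁ V), V.ι.injective ?_⟩
    exact (Scheme.Hom.comp_apply (g ∣_ V) V.ι _).symm.trans
      ((congrArg (fun m : (g ⁻¹ᵁ V).toScheme ⟶ V₀.toScheme => m ⟨w, hw'⟩)
        (morphismRestrict_ι g V)).trans hw)
  · exact (inferInstance : LocallyOfFinitePresentation (g ∣_ V))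
  · exact (inferInstance : IsOpenImmersion (V.ι ≫ V₀.ι))
  · exact ⟨⟨_, hxV⟩, rfl⟩
  · have h := (Sieve.overEquiv_iff _ _).1 (hle _ _ hf)
    have h' := R.downward_closed h (Over.homMk ((g ⁻¹ᵁ V).ι ≫ W₀.ι) (by
      change ((g ⁻¹ᵁ V).ι ≫ W₀.ι) ≫ f ≫ X.hom = (g ∣_ V) ≫ (V.ι ≫ V₀.ι) ≫ X.hom
      rw [← Category.assoc _ f, ← hpf]
      simp) :
      Over.mk ((g ∣_ V) ≫ (V.ι ≫ V₀.ι) ≫ X.hom) ⟶ Over.mk (f ≫ X.hom))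
    have e : (Over.homMk (g ∣_ V) : Over.mk ((g ∣_ V) ≫ (V.ι ≫ V₀.ι) ≫ X.hom) ⟶
        Over.mk ((V.ι ≫ V₀.ι) ≫ X.hom)) ≫ Over.homMk (V.ι ≫ V₀.ι) = Over.homMk
          ((g ⁻¹ᵁ V).ι ≫ W₀.ι) (by
            change ((g ⁻¹ᵁ V).ι ≫ W₀.ι) ≫ f ≫ X.hom = (g ∣_ V) ≫ (V.ι ≫ V₀.ι) ≫ X.hom
            rw [← Category.assoc _ f, ← hpf]
            simp) ≫ (Over.homMk f : Over.mk (f ≫ X.hom) ⟶ X) := by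
      ext
      exact hpf
    rw [e]
    exact h'

end AffineRefinement

/-! ### Zariski gluing -/

section ZariskiGluing

variable {S : Scheme.{u}} {d : ℕ} {G : Sheaf (Scheme.fppfTopology.over S) GrpCat.{u}}

/-- An open subscheme of an `S`-scheme, over `S`. -/
noncomputable def openOver (X : Over S) (V : X.left.Opens) : Over S := Over.mk (V.ι ≫ X.hom)

/-- The inclusion of an open subscheme. -/
noncomputable def openOverι (X : Over S) (V : X.left.Opens) : openOver X V ⟶ X := Over.homMk V.ι

/-- The inclusion of an open subscheme in a larger one. -/
noncomputable def openOverMap (X : Over S) {V V' : X.left.Opens} (h : V ≤ V') :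
    openOver X V ⟶ openOver X V' :=
  Over.homMk (X.left.homOfLE h) (by
    change X.left.homOfLE h ≫ V'.ι ≫ X.hom = V.ι ≫ X.hom
    rw [← Category.assoc, Scheme.homOfLE_ι])

lemma openOverMap_ι (X : Over S) {V V' : X.left.Opens} (h : V ≤ V') :
    openOverMap X h ≫ openOverι X V' = openOverι X V := by
  ext
  exact Scheme.homOfLE_ι _ h

lemma openOver_hom_ext {X : Over S} {V : X.left.Opens} {Z : Over S} {f f' : Z ⟶ openOver X V}
    (h : f ≫ openOverι X V = f' ≫ openOverι X V) : f = f' := by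
  ext
  exact (cancel_mono V.ι).1 (congrArg CommaMorphism.left h)

/-- A morphism to two open subschemes factors through their intersection. -/
lemma exists_lift_inf {X : Over S} {V V' : X.left.Opens} {Z : Over S} (f : Z ⟶ openOver X V)
    (f' : Z ⟶ openOver X V') (h : f ≫ openOverι X V = f' ≫ openOverι X V') :
    ∃ g : Z ⟶ openOver X (V ⊓ V'), g ≫ openOverMap X inf_le_left = f ∧
      g ≫ openOverMap X inf_le_right = f' := by
  have hpb : IsPullback (openOverMap X (inf_le_left : V ⊓ V' ≤ V)) (openOverMap X inf_le_right)
      (openOverι X V) (openOverι X V') :=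
    IsPullback.of_map_of_faithful (Over.forget S) (isPullback_opens_inf V V')
  exact ⟨hpb.lift f f' h, hpb.lift_fst _ _ _, hpb.lift_snd _ _ _⟩

/-- Being a finite étale cover of degree `d` is local on the target for the Zariski topology. -/
lemma finEtale_of_zariski_local {T X : Scheme.{u}} (f : T ⟶ X)
    (h : ∀ x : X, ∃ (V : X.Opens) (_ : x ∈ V) (T' : Scheme.{u}) (t : T' ⟶ T) (π : T' ⟶ V),
      IsPullback t π f V.ι ∧ finEtale d π) : finEtale d f := by
  -- the neighbourhoods may be taken affine and the restrictions of `f` as the covers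
  have h' : ∀ x : X, ∃ V : X.Opens, x ∈ V ∧ IsAffineOpen V ∧ finEtale d (f ∣_ V) := by
    intro x
    obtain ⟨V, hx, T', t, π, hpb, hπ⟩ := h x
    obtain ⟨V', hV', hx', hle⟩ := exists_isAffineOpen_mem_and_subset (U := V) hx
    have hle : V' ≤ V := hle
    have h₁ := isPullback_morphismRestrict f V'
    have hw : (f ⁻¹ᵁ V').ι ≫ f = ((f ∣_ V') ≫ X.homOfLE hle) ≫ V.ι := by
      rw [Category.assoc, Scheme.homOfLE_ι, h₁.w]
    have h₂ : IsPullback (hpb.lift _ _ hw) (f ∣_ V') π (X.homOfLE hle) := by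
      refine IsPullback.of_right (h₁₂ := t) (h₂₂ := V.ι) (v₁₃ := f) ?_ (hpb.lift_snd _ _ _) hpb
      rw [hpb.lift_fst, Scheme.homOfLE_ι]
      exact h₁.flip
    exact ⟨V', hx', hV', finEtale_of_isPullback h₂ hπ⟩
  have i₁ : IsZariskiLocalAtTarget @Etale.{u} :=
    HasRingHomProperty.instIsZariskiLocalAtTarget (P := @Etale) (Q := RingHom.Etale)
  have e₁ : UniversallyClosed f := by
    refine IsZariskiLocalAtTarget.of_forall_exists_morphismRestrict (P := @UniversallyClosed)
      fun x => ?_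
    obtain ⟨V, hx, -, h⟩ := h' x
    have := h.1
    exact ⟨V, hx, inferInstance⟩
  have e₂ : IsAffineHom f := by
    refine isAffineHom_of_forall_exists_isAffineOpen _ fun x => ?_
    obtain ⟨V, hx, hV, h⟩ := h' x
    have := h.1
    have : IsAffine V := hV
    exact ⟨V, hx, hV, isAffine_of_isAffineHom (f ∣_ V)⟩
  have h₂ : Etale f := by
    refine IsZariskiLocalAtTarget.of_forall_exists_morphismRestrict (P := @Etale) fun x => ?_
    obtain ⟨V, hx, -, h⟩ := h' x
    exact ⟨V, hx, h.2.1⟩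
  have h₁ : IsFinite f := (IsFinite.iff_isIntegralHom_and_locallyOfFiniteType f).2
    ⟨IsIntegralHom.iff_universallyClosed_and_isAffineHom.2 ⟨e₁, e₂⟩, inferInstance⟩
  refine ⟨h₁, h₂, fun x => ?_⟩
  obtain ⟨V, hx, -, h⟩ := h' x
  have h₃ := Scheme.Hom.finrank_of_isPullback _ _ _ _ (isPullback_morphismRestrict f V).flip ⟨x, hx⟩
  exact h₃.symm.trans (h.2.2 _)

variable (B : Tors (semidirect G d))

/-- The open subschemes of the base over which `B` is a torsor of frames. -/
def FrameOpens := { V : B.base.left.Opens // Nonempty (FrameForm B (openOverι B.base V)) }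

namespace FrameOpens

/-- The open subschemes are ordered by inclusion. -/
noncomputable instance : PartialOrder (FrameOpens B) := Subtype.partialOrder _

variable {B}

/-- A chosen object with torsor of frames `B` over an open subscheme. -/
noncomputable def form (V : FrameOpens B) : FrameForm B (openOverι B.base V.1) := V.2.some

lemma exists_map {V V' : FrameOpens B} (h : V ≤ V') : ∃ v : V.form.obj ⟶ V'.form.obj,
    v.f = openOverMap B.base h ∧ framesMap v ≫ V'.form.hom = V.form.hom :=
  exists_framesMap_comp_eq V'.form.hom V.form.hom (openOverMap B.base h)
    ((congrArg (openOverMap B.base h ≫ ·) V'.form.hom_base).trans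
      ((openOverMap_ι _ _).trans V.form.hom_base.symm))

/-- The morphism between the chosen objects over `V ≤ V'`. -/
noncomputable def map {V V' : FrameOpens B} (h : V ≤ V') : V.form.obj ⟶ V'.form.obj :=
  (exists_map h).choose

lemma map_f {V V' : FrameOpens B} (h : V ≤ V') : (map h).f = openOverMap B.base h :=
  (exists_map h).choose_spec.1

lemma framesMap_map {V V' : FrameOpens B} (h : V ≤ V') :
    framesMap (map h) ≫ V'.form.hom = V.form.hom :=
  (exists_map h).choose_spec.2

/-- Since open immersions are monomorphisms, there is no condition on the underlying morphisms. -/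
lemma hom_ext_of_framesMap {V : FrameOpens B} {c : EtTors G d} {v v' : c ⟶ V.form.obj}
    (h : framesMap v ≫ V.form.hom = framesMap v' ≫ V.form.hom) : v = v' := by
  refine hom_ext_of_framesMap_comp V.form.hom (openOver_hom_ext ?_) h
  have h₁ : v.f ≫ V.form.hom.base = v'.f ≫ V.form.hom.base := congrArg Tors.Hom.base h
  rwa [V.form.hom_base] at h₁

lemma map_map {V V' V'' : FrameOpens B} (h : V ≤ V') (h' : V' ≤ V'') :
    map h ≫ map h' = map (h.trans h') := by
  apply hom_ext_of_framesMap
  rw [framesMap_comp, Category.assoc, framesMap_map, framesMap_map, framesMap_map]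

lemma map_refl (V : FrameOpens B) : map (le_refl V) = 𝟙 _ := by
  apply hom_ext_of_framesMap
  rw [framesMap_map, framesMap_id, Category.id_comp]

/-- Smaller open subschemes belong to `FrameOpens B` as well. -/
lemma inf_mem (V : FrameOpens B) (V' : B.base.left.Opens) :
    Nonempty (FrameForm B (openOverι B.base (V.1 ⊓ V'))) :=
  V.form.nonempty_restrict (openOverMap B.base inf_le_left) (openOverMap_ι _ _)

/-- The family of all open subschemes over which `B` is a torsor of frames, if it covers the
base. -/
noncomputable def cover (hB : ∀ x : B.base.left, ∃ V : FrameOpens B, x ∈ V.1) :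
    B.base.left.OpenCover where
  I₀ := FrameOpens B
  X V := V.1
  f V := V.1.ι
  mem₀ := by
    rw [Scheme.presieve₀_mem_precoverage_iff]
    refine ⟨fun x => ?_, inferInstance⟩
    obtain ⟨V, hV⟩ := hB x
    exact ⟨V, ⟨x, hV⟩, rfl⟩

section

variable (hB : ∀ x : B.base.left, ∃ V : FrameOpens B, x ∈ V.1)

noncomputable instance : PartialOrder (cover hB).I₀ := inferInstanceAs (PartialOrder (FrameOpens B))

lemma cover_trans_aux {V V' : FrameOpens B} (h : V ≤ V') :
    V.1 ≤ V'.1 := h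

/-- The open subschemes are closed under intersections. -/
noncomputable instance : (cover hB).LocallyDirected where
  trans {V V'} h := B.base.left.homOfLE (cover_trans_aux (leOfHom h))
  trans_id V := Scheme.homOfLE_rfl _ _
  trans_comp h h' := (Scheme.homOfLE_homOfLE _ _ _).symm
  w h := Scheme.homOfLE_ι _ (cover_trans_aux (leOfHom h))
  property_trans h := (inferInstance : IsOpenImmersion (B.base.left.homOfLE _))
  directed {V V'} x := by
    have hpb := isPullback_opens_inf V.1 V'.1
    refine ⟨(⟨V.1 ⊓ V'.1, inf_mem V V'.1⟩ : FrameOpens B),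
      homOfLE (show V.1 ⊓ V'.1 ≤ V.1 from inf_le_left),
      homOfLE (show V.1 ⊓ V'.1 ≤ V'.1 from inf_le_right), hpb.isoPullback.inv x, ?_⟩
    have e : pullback.lift (B.base.left.homOfLE inf_le_left) (B.base.left.homOfLE inf_le_right)
        hpb.w = hpb.isoPullback.hom :=
      pullback.hom_ext ((pullback.lift_fst _ _ _).trans hpb.isoPullback_hom_fst.symm)
        ((pullback.lift_snd _ _ _).trans hpb.isoPullback_hom_snd.symm)
    refine (congrArg (fun m => m (hpb.isoPullback.inv x)) e).trans ?_
    exact (Scheme.Hom.comp_apply _ _ _).symm.trans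
      (congrArg (fun m => m x) hpb.isoPullback.inv_hom_id)

lemma isPullback_map {V V' : FrameOpens B} (h : V ≤ V') :
    IsPullback (map h).t.base.left V.form.π.left V'.form.π.left (B.base.left.homOfLE h) := by
  have h₁ : IsPullback (map h).t.base.left V.form.π.left V'.form.π.left (map h).f.left :=
    (map h).isPullback.map (Over.forget S)
  have h₂ : (map h).f.left = B.base.left.homOfLE h := congrArg CommaMorphism.left (map_f h)
  exact h₂ ▸ h₁

/-- The covers of the open subschemes, as a datum for their gluing. -/
noncomputable def gluingData : Scheme.Cover.RelativeGluingData (cover hB) where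
  functor :=
    { obj := fun (V : FrameOpens B) => V.form.tors.base.left
      map := fun {V V'} h => (map (leOfHom h : (show FrameOpens B from V) ≤ V')).t.base.left
      map_id := fun V => congrArg (fun v => v.t.base.left) (map_refl (show FrameOpens B from V))
      map_comp := fun h h' =>
        (congrArg (fun v => v.t.base.left) (map_map (leOfHom h) (leOfHom h'))).symm }
  natTrans :=
    { app := fun (V : FrameOpens B) => V.form.π.left
      naturality := fun V V' h =>
        (isPullback_map (leOfHom h : (show FrameOpens B from V) ≤ V')).w }
  equifibered := fun V V' h => isPullback_map (leOfHom h : (show FrameOpens B from V) ≤ V')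

instance : Small.{u} (cover hB).I₀ := inferInstanceAs (Small.{u} (FrameOpens B))

lemma isPullback_ι (V : FrameOpens B) :
    IsPullback (colimit.ι (gluingData hB).functor V) V.form.π.left (gluingData hB).toBase V.1.ι :=
  ((gluingData hB).isPullback_natTrans_ι_toBase V).flip

lemma finEtale_toBase : finEtale d (gluingData hB).toBase := by
  refine finEtale_of_zariski_local _ fun x => ?_
  obtain ⟨V, hx⟩ := hB x
  exact ⟨V.1, hx, _, _, _, isPullback_ι hB V, V.form.hπ⟩

/-- A torsor which is locally on the base, for the Zariski topology, a torsor of frames is a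
torsor of frames. -/
lemma nonempty_frameForm (hB : ∀ x : B.base.left, ∃ V : FrameOpens B, x ∈ V.1) :
    Nonempty (FrameForm B (𝟙 B.base)) := by
  let T : Over S := Over.mk ((gluingData hB).toBase ≫ B.base.hom)
  let π : T ⟶ B.base := Over.homMk (gluingData hB).toBase
  let t : ∀ V : FrameOpens B, V.form.tors.base ⟶ T := fun V =>
    Over.homMk (colimit.ι (gluingData hB).functor V) (by
      change colimit.ι (gluingData hB).functor V ≫ (gluingData hB).toBase ≫ B.base.hom = _
      exact (Category.assoc _ _ _).symm.trans
        ((congrArg (· ≫ B.base.hom) (isPullback_ι hB V).w).trans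
        ((Category.assoc _ _ _).trans (Over.w V.form.π))))
  have hpb : ∀ V : FrameOpens B, IsPullback (t V) V.form.π π V.form.hom.base := fun V => by
    rw [V.form.hom_base]
    exact IsPullback.of_map_of_faithful (Over.forget S) (isPullback_ι hB V)
  have ht : ∀ {V V' : FrameOpens B} (h : V ≤ V'), (map h).t.base ≫ t V' = t V := by
    intro V V' h
    ext
    exact colimit.w (gluingData hB).functor (homOfLE h : (show (cover hB).I₀ from V) ⟶ V')
  refine FrameForm.nonempty_of_glue B (ι := ULift.{u + 1} (FrameOpens B))
    (fun V => V.down.form.hom) ?_ (show coverProp S d π from finEtale_toBase hB) (fun V => t V.down)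
    (fun V => hpb V.down) ?_
  · refine mem_fppf_over_of_family _ (fun V : FrameOpens B => V.1.ι) (fun x => ?_) fun V => ?_
    · obtain ⟨V, hV⟩ := hB x
      exact ⟨V, ⟨x, hV⟩, rfl⟩
    · have h := Sieve.ofArrows_mk _ (fun V : ULift.{u + 1} (FrameOpens B) =>
        V.down.form.hom.base) ⟨V⟩
      rwa [V.form.hom_base] at h
  -- related points come from an object over the intersection `V''`
  · rintro ⟨V⟩ ⟨V'⟩ z _ _ ⟨c, v, v', l, h, rfl, rfl⟩
    have h₁ : v.f ≫ V.form.hom.base = v'.f ≫ V'.form.hom.base := congrArg Tors.Hom.base h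
    rw [V.form.hom_base, V'.form.hom_base] at h₁
    obtain ⟨g, hg, hg'⟩ := exists_lift_inf _ _ h₁
    let V'' : FrameOpens B := ⟨V.1 ⊓ V'.1, inf_mem V V'.1⟩
    have hle : V'' ≤ V := (inf_le_left : V.1 ⊓ V'.1 ≤ V.1)
    have hle' : V'' ≤ V' := (inf_le_right : V.1 ⊓ V'.1 ≤ V'.1)
    obtain ⟨m, hm, hm'⟩ := exists_framesMap_comp_eq V''.form.hom (framesMap v ≫ V.form.hom) g (by
      refine (congrArg (g ≫ ·) V''.form.hom_base).trans ?_
      refine Eq.trans ?_ (congrArg (v.f ≫ ·) V.form.hom_base.symm)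
      rw [← hg, Category.assoc]
      exact congrArg (g ≫ ·) (openOverMap_ι _ _).symm)
    have e : m ≫ map hle = v := by
      apply hom_ext_of_framesMap
      rw [framesMap_comp, Category.assoc, framesMap_map, hm']
    have e' : m ≫ map hle' = v' := by
      apply hom_ext_of_framesMap
      rw [framesMap_comp, Category.assoc, framesMap_map, hm', h]
    rw [← e, ← e']
    change (l ≫ m.t ≫ (map hle).t).base ≫ t V = (l ≫ m.t ≫ (map hle').t).base ≫ t V'
    rw [Tors.comp_base, Tors.comp_base, Tors.comp_base, Tors.comp_base, Category.assoc,
      Category.assoc, Category.assoc, Category.assoc, ht hle, ht hle']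

end

end FrameOpens

end ZariskiGluing

/-! ### The equivalence of gerbes -/

section Equivalence

variable {S : Scheme.{u}} {d : ℕ} {G : Sheaf (Scheme.fppfTopology.over S) GrpCat.{u}}

/-- Every torsor is a torsor of frames: this holds over an affine scheme `W` over which `B` has a
section, descends to the image `V` of `W` if `W ⟶ V` is faithfully flat, and such open subschemes
cover the base. -/
lemma FrameForm.nonempty_id (B : Tors (semidirect G d)) : Nonempty (FrameForm B (𝟙 B.base)) := by
  refine FrameOpens.nonempty_frameForm fun x => ?_
  obtain ⟨R, hR, hs⟩ := B.torsor.locally_nonempty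
  obtain ⟨V, W, p, j, hV, hW, h₁, h₂, h₃, h₄, hx, hpj⟩ := exists_affine_refinement hR x
  let B' : Tors (semidirect G d) := ⟨V, (Torsor.res j).obj B.torsor⟩
  have q : B'.torsor.sec p := (hs _ hpj).some
  obtain ⟨a⟩ := FrameForm.nonempty_of_section q
  have i₀ : IsAffine a.obj.X.left := hW
  have i₀' : IsAffine B'.base.left := hV
  have i₁ : Flat a.hom.base.left := by rw [a.hom_base]; exact h₁
  have i₂ : Surjective a.hom.base.left := by rw [a.hom_base]; exact h₂
  have i₃ : LocallyOfFinitePresentation a.hom.base.left := by rw [a.hom_base]; exact h₃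
  obtain ⟨b⟩ := FrameForm.nonempty_of_descent B' a.hom
  obtain ⟨c⟩ := FrameForm.nonempty_of_hom (B := B) (y := j) (x := b.obj) rfl
    (b.hom ≫ Tors.resMap B j) ((congrArg (· ≫ j) b.hom_base).trans rfl)
  -- the image of `j` is an open subscheme isomorphic to `V`
  let U : B.base.left.Opens := j.left.opensRange
  have hk : (j.left.isoOpensRange.inv ≫ j.left) = U.ι := by simp [U]
  let k : openOver B.base U ⟶ V := Over.homMk j.left.isoOpensRange.inv (by
    change _ = U.ι ≫ B.base.hom
    rw [← hk, Category.assoc, Over.w j]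
    rfl)
  exact ⟨⟨U, c.nonempty_restrict k (by ext; exact hk)⟩, hx⟩

lemma FrameForm.isIso_hom {B : Tors (semidirect G d)} (x : FrameForm B (𝟙 B.base)) :
    IsIso x.hom := by
  have : IsIso ((Tors.proj (semidirect G d)).map x.hom) := by
    change IsIso x.hom.base
    rw [x.hom_base]
    exact inferInstanceAs (IsIso (𝟙 B.base))
  exact (Tors.isGroupoidFibration_proj (semidirect G d)).isIso_of_isIso_map x.hom

/-- Covers with torsors glue: their torsors of frames are glued to a torsor `B`, which is itself a
torsor of frames. -/
lemma etProj_objectsGlue (G : Sheaf (Scheme.fppfTopology.over S) GrpCat.{u}) (d : ℕ) :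
    ObjectsGlue (etProj G d) (Scheme.fppfTopology.over S) := by
  intro X ι x f hf z l r hlr hc
  obtain ⟨B, e, K, hK, hlK⟩ := Tors.objectsGlue (semidirect G d) (fun i => framesTors (x i)) f hf
    (fun i j => framesTors (z i j)) (fun i j => framesMap (l i j)) (fun i j => framesMap (r i j))
    hlr (by
      intro i j k o α β γ h₁ h₂ h₃
      -- the cocycle condition for torsors of frames has to be tested on arbitrary torsors `o`;
      -- these are torsors of frames, so that it follows from the cocycle condition given
      obtain ⟨o'⟩ := FrameForm.nonempty_id o
      have := o'.isIso_hom
      obtain ⟨α', hα, -⟩ := existsUnique_framesMap_eq (o'.hom ≫ α)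
      obtain ⟨β', hβ, -⟩ := existsUnique_framesMap_eq (o'.hom ≫ β)
      obtain ⟨γ', hγ, -⟩ := existsUnique_framesMap_eq (o'.hom ≫ γ)
      have inj : ∀ {a b : EtTors G d} {v v' : a ⟶ b}, framesMap v = framesMap v' → v = v' :=
        fun h => (existsUnique_framesMap_eq _).unique h rfl
      have h := hc i j k o'.obj α' β' γ'
        (inj (by rw [framesMap_comp, framesMap_comp, hα, hβ, Category.assoc, h₁, Category.assoc]))
        (inj (by rw [framesMap_comp, framesMap_comp, hα, hγ, Category.assoc, h₂, Category.assoc]))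
        (by
          change (framesMap (β' ≫ r j k)).base = (framesMap (γ' ≫ r i k)).base
          rw [framesMap_comp, framesMap_comp, hβ, hγ, Category.assoc, Category.assoc,
            Tors.comp_base, Tors.comp_base]
          exact congrArg (o'.hom.base ≫ ·) h₃)
      rw [← cancel_epi o'.hom, ← Category.assoc, ← hβ, ← framesMap_comp, h, framesMap_comp, hγ,
        Category.assoc])
  obtain ⟨y⟩ := FrameForm.nonempty_id B
  have key : ∀ i, ∃ k : x i ⟶ y.obj, k.f = f i ≫ eqToHom e ∧ framesMap k ≫ y.hom = K i := fun i =>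
    exists_framesMap_comp_eq y.hom (K i) (f i ≫ eqToHom e)
      ((congrArg ((f i ≫ eqToHom e) ≫ ·) y.hom_base).trans
        ((Category.comp_id _).trans (hK i).symm))
  choose k hk hk' using key
  refine ⟨y.obj, e, k, hk, fun i j => ?_⟩
  refine hom_ext_of_framesMap_comp y.hom ?_ ?_
  · refine (congrArg ((l i j).f ≫ ·) (hk i)).trans
      (Eq.trans ?_ (congrArg ((r i j).f ≫ ·) (hk j)).symm)
    refine (Category.assoc _ _ _).symm.trans
      ((congrArg (· ≫ eqToHom e) (hlr i j).w).trans (Category.assoc _ _ _))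
  · rw [framesMap_comp, framesMap_comp, Category.assoc, Category.assoc, hk', hk']
    exact hlK i j

/-- Finite étale covers of degree `d` with a torsor form a gerbe. -/
theorem etProj_isGerbe (G : Sheaf (Scheme.fppfTopology.over S) GrpCat.{u}) (d : ℕ) :
    IsGerbe (etProj G d) (Scheme.fppfTopology.over S) := by
  refine (CoverTors.isGroupoidFibration_proj G (coverProp S d)).isGerbe
    (CoverTors.homsGlue G (coverProp S d)) (etProj_objectsGlue G d)
    (fun X => ⟨split G d X, rfl⟩) fun a b e => ?_
  obtain ⟨X, t, π, hπ⟩ := a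
  obtain rfl : X = b.X := e
  refine ⟨_, GrothendieckTopology.intersection_covering _ (frameSieve_mem ⟨b.X, t, π, hπ⟩)
    (frameSieve_mem b), ?_⟩
  rintro Y f ⟨⟨u⟩, ⟨v⟩⟩
  refine ⟨split G d Y, rfl, u.1, v.1, ?_, ?_⟩
  · exact u.2.trans (Category.id_comp f).symm
  · exact v.2.trans ((Category.id_comp _).trans (Category.comp_id f)).symm

/-- The functor of frames is an equivalence of gerbes. -/
theorem framesFunctor_isFiberedEquivalence [(etProj G d).IsFibered] :
    IsFiberedEquivalence (etProj G d) (Tors.proj (semidirect G d)) (framesFunctor d G).functor where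
  comp_eq := rfl
  map_isCartesian {X Y} f {a b} φ hφ := by
    refine (Tors.isGroupoidFibration_proj (semidirect G d)).isStronglyCartesian _ _ ?_
    have : (etProj G d).IsHomLift f φ := inferInstance
    obtain ⟨⟩ := this
    exact inferInstanceAs ((Tors.proj (semidirect G d)).IsHomLift
      ((Tors.proj (semidirect G d)).map ((framesFunctor d G).functor.map φ)) _)
  isEquivalence X :=
    { faithful := ⟨fun {a b} φ ψ h => Subtype.ext
        ((existsUnique_framesMap_eq _).unique (congrArg Subtype.val h) rfl)⟩
      full := ⟨fun {a b} φ => by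
        obtain ⟨v, hv, -⟩ := existsUnique_framesMap_eq (x := a.1) (x' := b.1) φ.1
        have h : (etProj G d).IsHomLift (𝟙 X) v := by
          have h' : (Tors.proj (semidirect G d)).IsHomLift (𝟙 X) φ.1 := φ.2
          have h'' := IsHomLift.fac' (Tors.proj (semidirect G d)) (𝟙 X) φ.1
          refine IsHomLift.of_fac' _ _ _ a.2 b.2 ?_
          exact (congrArg Tors.Hom.base hv).trans h''
        exact ⟨⟨v, h⟩, Subtype.ext hv⟩⟩
      essSurj := ⟨fun B => by
        obtain ⟨B, rfl⟩ := B
        obtain ⟨x⟩ := FrameForm.nonempty_id B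
        have h : (Tors.proj (semidirect G d)).IsHomLift (𝟙 B.base) x.hom := by
          refine IsHomLift.of_fac' (Tors.proj (semidirect G d)) _ _ rfl rfl ?_
          refine x.hom_base.trans ?_
          simp
          rfl
        let φ : (fiberFunctor (framesFunctor d G).functor rfl B.base).obj ⟨x.obj, rfl⟩ ⟶
            (⟨B, rfl⟩ : (Tors.proj (semidirect G d)).Fiber B.base) := ⟨x.hom, h⟩
        have : IsIso φ :=
          (Tors.isGroupoidFibration_proj (semidirect G d)).isIso_fiberHom φ
        exact ⟨⟨x.obj, rfl⟩, ⟨@asIso _ _ _ _ φ this⟩⟩⟩ }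

end Equivalence

/-! ### Torsors under the trivial group -/

section TrivialGroup

universe w v₁ u₁

variable {C : Type u₁} [Category.{v₁} C] {J : GrothendieckTopology C}

/-- Morphisms of `Tors G` over an identity are isomorphisms of torsors. -/
lemma Tors.exists_base_eq_id_iff {G : Sheaf J GrpCat.{w}} {X : C} (P Q : Torsor G X) :
    (∃ u : (⟨X, P⟩ : Tors G) ⟶ ⟨X, Q⟩, u.base = 𝟙 X) ↔ Nonempty (P ≅ Q) := by
  constructor
  · rintro ⟨⟨b, i⟩, h⟩
    obtain rfl : b = 𝟙 X := h
    exact ⟨i ≪≫ Q.resId.symm⟩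
  · rintro ⟨i⟩
    exact ⟨⟨𝟙 X, i ≪≫ Q.resId⟩, rfl⟩

/-- Transport of structure along an isomorphism of sheaves of groups. -/
def Torsor.congr {G H : Sheaf J GrpCat.{w}} (e : ∀ Y : C, G.obj.obj (op Y) ≃* H.obj.obj (op Y))
    (he : ∀ {Y Y' : C} (k : Y' ⟶ Y) (g : G.obj.obj (op Y)),
      e Y' (G.obj.map k.op g) = H.obj.map k.op (e Y g)) {X : C} (P : Torsor H X) : Torsor G X where
  val := P.val
  isSheaf := P.isSheaf
  act {Y} s g := P.act s (e Y.left g)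
  act_one {Y} s := by rw [map_one, P.act_one]
  act_mul {Y} s g h := by rw [map_mul, P.act_mul]
  map_act {Y Y'} k s g := by rw [P.map_act, he]
  existsUnique_act {Y} s t := (e Y.left).bijective.existsUnique_iff.1 (P.existsUnique_act s t)
  locally_nonempty := P.locally_nonempty

/-- The trivial sheaf of groups. -/
def unitSheaf (J : GrothendieckTopology C) : Sheaf J GrpCat.{w} :=
  ⟨(Functor.const _).obj (GrpCat.of PUnit), by
    apply Presheaf.isSheaf_of_isSheaf_comp _ _ (CategoryTheory.forget GrpCat)
    rw [isSheaf_iff_isSheaf_of_type]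
    exact fun X R hR x hx => ⟨PUnit.unit, fun _ _ _ => rfl, fun _ _ => rfl⟩⟩

instance (Y : C) : Unique ((unitSheaf.{w} J).obj.obj (op Y)) :=
  inferInstanceAs (Unique PUnit)

/-- A torsor under the trivial group has a unique section over every object. -/
lemma Torsor.nonempty_unique_sec {X Y : C} (P : Torsor (unitSheaf.{w} J) X) (y : Y ⟶ X) :
    Nonempty (Unique (P.sec y)) := by
  have hsub : ∀ {Z : C} {z : Z ⟶ X} (s t : P.sec z), s = t := fun s t => by
    obtain ⟨g, hg, -⟩ := P.existsUnique_ac s t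
    rw [← hg, Subsingleton.elim g 1, P.ac_one]
  obtain ⟨R, hR, h⟩ := P.locally_nonempty' y
  obtain ⟨t, -⟩ := P.glue hR (fun Z g hg => (h g hg).some) fun _ _ _ _ _ => hsub _ _
  exact ⟨⟨⟨t⟩, fun s => hsub _ _⟩⟩

lemma Tors.existsUnique_unitSheaf (A B : Tors (unitSheaf.{w} J)) (b : A.base ⟶ B.base) :
    ∃! u : A ⟶ B, u.base = b := by
  have hsub : ∀ {Z : C} {z : Z ⟶ B.base} (s t : B.torsor.sec z), s = t := fun {Z z} s t => by
    obtain ⟨i⟩ := B.torsor.nonempty_unique_sec z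
    exact Subsingleton.elim s t
  refine ⟨Tors.mkHom b (fun y _ => (B.torsor.nonempty_unique_sec (y ≫ b)).some.default)
    (fun _ _ _ _ _ => hsub _ _) (fun _ _ _ => hsub _ _), rfl, fun u hu => ?_⟩
  exact Tors.hom_ext hu fun _ _ _ _ _ => hsub _ _

end TrivialGroup

/-! ### Classification over the base scheme -/

section Covers

variable {S : Scheme.{u}} {d : ℕ}

/-- The trivial sheaf of groups on `Sch_S`. -/
abbrev one (S : Scheme.{u}) : Sheaf (Scheme.fppfTopology.over S) GrpCat.{u} := unitSheaf _

/-- For the trivial group, `G^d ⋊ S_d` is `S_d`. -/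
noncomputable def semidirectOneEquiv (d : ℕ) (Z : Over S) :
    (semidirect (one S) d).obj.obj (op Z) ≃* (permSheaf S d).obj.obj (op Z) where
  toFun := SemidirectProduct.right
  invFun σ := SemidirectProduct.inr σ
  left_inv _ := SemidirectProduct.ext (funext fun _ => rfl) rfl
  right_inv _ := rfl
  map_mul' _ _ := rfl

/-- An `S_d`-torsor as a torsor under `1^d ⋊ S_d`. -/
noncomputable abbrev ofPerm {X : Over S} (R : Torsor (permSheaf S d) X) :
    Torsor (semidirect (one S) d) X :=
  Torsor.congr (semidirectOneEquiv d) (fun _ _ => rfl) R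

/-- A torsor under `1^d ⋊ S_d` as an `S_d`-torsor. -/
noncomputable abbrev toPerm {X : Over S} (P : Torsor (semidirect (one S) d) X) :
    Torsor (permSheaf S d) X :=
  Torsor.congr (fun Z => (semidirectOneEquiv d Z).symm)
    (fun _ _ => SemidirectProduct.ext (funext fun _ => rfl) rfl) P

/-- The passage from `S_d` to `1^d ⋊ S_d` changes neither the sections nor the morphisms. -/
lemma ofPerm_iso_iff {X : Over S} (R R' : Torsor (permSheaf S d) X) :
    Nonempty (ofPerm R ≅ ofPerm R') ↔ Nonempty (R ≅ R') := by
  constructor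
  · rintro ⟨i⟩
    let h : R ⟶ R' :=
      { hom := i.hom.hom
        hom_act := fun {Y} s g => i.hom.hom_act s ((semidirectOneEquiv d Y.left).symm g) }
    have := Torsor.isIso_hom h
    exact ⟨asIso h⟩
  · rintro ⟨i⟩
    let h : ofPerm R ⟶ ofPerm R' :=
      { hom := i.hom.hom
        hom_act := fun {Y} s g => i.hom.hom_act s _ }
    have := Torsor.isIso_hom h
    exact ⟨asIso h⟩

lemma nonempty_ofPerm_toPerm {X : Over S} (P : Torsor (semidirect (one S) d) X) :
    Nonempty (P ≅ ofPerm (toPerm P)) := by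
  let h : P ⟶ ofPerm (toPerm P) :=
    { hom := 𝟙 _
      hom_act := fun {Y} s g =>
        congrArg (P.act s) ((semidirectOneEquiv d Y.left).symm_apply_apply g).symm }
  have := Torsor.isIso_hom h
  exact ⟨asIso h⟩

namespace Cover

/-- The torsor of frames of `(T → S, P)`, as a torsor over `S`. -/
noncomputable def framesTorsor {G : Sheaf (Scheme.fppfTopology.over S) GrpCat.{u}} (T : Cover S d)
    (P : Torsor G T.1) : Torsor (semidirect G d) (baseObj S) :=
  (frames (T.pair P)).toTorsor

/-- The torsor of frames of a cover without a torsor, taken as a cover with a torsor under the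
trivial group. -/
noncomputable abbrev unitFrames (T : Cover S d) : Torsor (semidirect (one S) d) (baseObj S) :=
  T.framesTorsor (Torsor.trivial (one S) T.1)

/-- `R` is the torsor of frames of the cover `T`. -/
def IsFrames (T : Cover S d) (R : Torsor (permSheaf S d) (baseObj S)) : Prop :=
  Nonempty (T.unitFrames ≅ ofPerm R)

/-- A morphism over the base is an isomorphism of the covers. -/
lemma nonempty_iso_of_hom {G : Sheaf (Scheme.fppfTopology.over S) GrpCat.{u}} {T T' : Cover S d}
    {P : Torsor G T.1} {P' : Torsor G T'.1} (v : T.pair P ⟶ T'.pair P') (h : v.f = 𝟙 _) :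
    ∃ g : T.1 ≅ T'.1, g.hom = v.t.base ∧ Nonempty (P ≅ (Torsor.res g.hom).obj P') := by
  have i₁ : IsIso v.f := by rw [h]; exact inferInstanceAs (IsIso (𝟙 (baseObj S)))
  have i₂ : IsIso v.t.base := v.isPullback.isIso_fst_of_isIso
  exact ⟨@asIso _ _ _ _ v.t.base i₂, rfl, ⟨v.t.iso⟩⟩

lemma exists_hom_of_iso {G : Sheaf (Scheme.fppfTopology.over S) GrpCat.{u}} {T T' : Cover S d}
    {P : Torsor G T.1} {P' : Torsor G T'.1} (g : T.1 ≅ T'.1)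
    (i : P ≅ (Torsor.res g.hom).obj P') : ∃ v : T.pair P ⟶ T'.pair P', v.f = 𝟙 _ :=
  ⟨{ f := 𝟙 _
     t := (⟨g.hom, i⟩ : Tors.Hom ⟨T.1, P⟩ ⟨T'.1, P'⟩)
     isPullback := IsPullback.of_horiz_isIso (fst := g.hom) (snd := Over.mkIdTerminal.from T.1)
       (f := Over.mkIdTerminal.from T'.1) (g := 𝟙 (baseObj S))
       ⟨Over.mkIdTerminal.hom_ext _ _⟩ }, rfl⟩

/-- Isomorphisms of torsors of frames come from isomorphisms of covers with torsors. -/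
lemma nonempty_frames_iso_iff {G : Sheaf (Scheme.fppfTopology.over S) GrpCat.{u}}
    {T T' : Cover S d} {P : Torsor G T.1} {P' : Torsor G T'.1} :
    Nonempty (T.framesTorsor P ≅ T'.framesTorsor P') ↔
      ∃ g : T.1 ≅ T'.1, Nonempty (P ≅ (Torsor.res g.hom).obj P') := by
  rw [← Tors.exists_base_eq_id_iff]
  constructor
  · rintro ⟨u, hu⟩
    obtain ⟨v, hv, -⟩ := existsUnique_framesMap_eq (x := T.pair P) (x' := T'.pair P') u
    obtain ⟨g, -, i⟩ := nonempty_iso_of_hom v ((congrArg Tors.Hom.base hv).trans hu)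
    exact ⟨g, i⟩
  · rintro ⟨g, ⟨i⟩⟩
    obtain ⟨v, hv⟩ := exists_hom_of_iso g i
    exact ⟨framesMap v, hv⟩

/-- Every torsor over `S` is the torsor of frames of a cover with a torsor. -/
lemma exists_frames_iso {G : Sheaf (Scheme.fppfTopology.over S) GrpCat.{u}}
    (B : Torsor (semidirect G d) (baseObj S)) :
    ∃ (T : Cover S d) (P : Torsor G T.1), Nonempty (T.framesTorsor P ≅ B) := by
  obtain ⟨⟨⟨T, P⟩, π, hπ, hom, h⟩⟩ := FrameForm.nonempty_id ⟨baseObj S, B⟩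
  have hT : T.hom = π.left := by
    have := Over.w π
    exact this.symm.trans (Category.comp_id _)
  obtain rfl : π = Over.mkIdTerminal.from T := Over.mkIdTerminal.hom_ext _ _
  refine ⟨⟨T, by rw [hT]; exact hπ⟩, P, ?_⟩
  rw [← Tors.exists_base_eq_id_iff]
  exact ⟨hom, h⟩

lemma exists_isFrames_left (T : Cover S d) : ∃ R, T.IsFrames R :=
  ⟨_, nonempty_ofPerm_toPerm _⟩

/-- Every `S_d`-torsor is the torsor of frames of a cover; the torsor under the trivial group that
comes with it is trivial. -/
lemma exists_isFrames_right (R : Torsor (permSheaf S d) (baseObj S)) :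
    ∃ T : Cover S d, T.IsFrames R := by
  obtain ⟨T, P, ⟨i⟩⟩ := exists_frames_iso (ofPerm R)
  obtain ⟨u, hu, -⟩ := Tors.existsUnique_unitSheaf ⟨T.1, Torsor.trivial (one S) T.1⟩ ⟨T.1, P⟩ (𝟙 _)
  obtain ⟨j⟩ := (Tors.exists_base_eq_id_iff _ _).1 ⟨u, hu⟩
  obtain ⟨k⟩ := nonempty_frames_iso_iff.2 ⟨Iso.refl T.1, ⟨j ≪≫ P.resId⟩⟩
  exact ⟨T, ⟨k ≪≫ i⟩⟩

/-- Covers are isomorphic if and only if their torsors of frames are; torsors under the trivial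
group impose no condition. -/
lemma IsFrames.iso_iff {T T' : Cover S d} {R R' : Torsor (permSheaf S d) (baseObj S)}
    (h : T.IsFrames R) (h' : T'.IsFrames R') : Nonempty (T.1 ≅ T'.1) ↔ Nonempty (R ≅ R') := by
  obtain ⟨i⟩ := h
  obtain ⟨i'⟩ := h'
  rw [← ofPerm_iso_iff]
  have : Nonempty (ofPerm R ≅ ofPerm R') ↔
      Nonempty (T.unitFrames ≅ T'.unitFrames) :=
    ⟨fun ⟨k⟩ => ⟨i ≪≫ k ≪≫ i'.symm⟩, fun ⟨k⟩ => ⟨i.symm ≪≫ k ≪≫ i'⟩⟩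
  rw [this, nonempty_frames_iso_iff]
  refine ⟨fun ⟨g⟩ => ⟨g, ?_⟩, fun ⟨g, _⟩ => ⟨g⟩⟩
  obtain ⟨u, hu, -⟩ := Tors.existsUnique_unitSheaf ⟨T.1, Torsor.trivial (one S) T.1⟩
    ⟨T'.1, Torsor.trivial (one S) T'.1⟩ g.hom
  obtain ⟨b, j⟩ := u
  obtain rfl : b = g.hom := hu
  exact ⟨j⟩

lemma IsFrames.congr {T : Cover S d} {R R' : Torsor (permSheaf S d) (baseObj S)}
    (h : T.IsFrames R) (i : R ≅ R') : T.IsFrames R' := by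
  obtain ⟨k⟩ := h
  obtain ⟨j⟩ := (ofPerm_iso_iff R R').2 ⟨i⟩
  exact ⟨k ≪≫ j⟩

lemma equivalence_iso :
    Equivalence fun T T' : Cover S d => Nonempty (T.1 ≅ T'.1) :=
  ⟨fun T => ⟨Iso.refl T.1⟩, fun ⟨i⟩ => ⟨i.symm⟩, fun ⟨i⟩ ⟨j⟩ => ⟨i ≪≫ j⟩⟩

/-- Covers are classified by their torsors of frames. -/
lemma exists_classEquiv : ∃ c : CoverClass S d ≃ H1 (permSheaf S d) (baseObj S),
    ∀ (T : Cover S d) (R : Torsor (permSheaf S d) (baseObj S)),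
      c (Quot.mk _ T) = H1.mk R ↔ T.IsFrames R := by
  choose R hR using exists_isFrames_left (S := S) (d := d)
  let f : CoverClass S d → H1 (permSheaf S d) (baseObj S) :=
    Quot.lift (fun T => H1.mk (R T)) fun T T' h => Quotient.sound (((hR T).iso_iff (hR T')).1 h)
  have hf : ∀ (T : Cover S d) (R' : Torsor (permSheaf S d) (baseObj S)),
      f (Quot.mk _ T) = H1.mk R' ↔ T.IsFrames R' := by
    intro T R'
    constructor
    · intro h
      obtain ⟨i⟩ := Quotient.exact h
      exact (hR T).congr i
    · intro h
      exact Quotient.sound (((hR T).iso_iff h).1 ⟨Iso.refl _⟩)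
  refine ⟨Equiv.ofBijective f ⟨?_, ?_⟩, hf⟩
  · rintro ⟨T⟩ ⟨T'⟩ h
    exact Quot.sound (((hR T).iso_iff (hR T')).2 (Quotient.exact h))
  · rintro ⟨R'⟩
    obtain ⟨T, hT⟩ := exists_isFrames_right R'
    exact ⟨Quot.mk _ T, (hf T R').2 hT⟩

/-- Torsors under `G^d ⋊ S_d` are classified by a cover and a torsor over it, up to the
automorphisms of the cover. The set of orbits is the quotient by a relation, so `f` is defined on it
as soon as it is constant on orbits; its injectivity only requires that torsors with isomorphic
torsors of frames be related. -/
lemma exists_orbitsEquiv {G : Sheaf (Scheme.fppfTopology.over S) GrpCat.{u}} {A : Type*}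
    (c : CoverClass S d ≃ A) (T : A → Cover S d) (hT : ∀ q, c (Quot.mk _ (T q)) = q) :
    ∃ e : H1 (semidirect G d) (baseObj S) ≃ Σ q : A, H1.Orbits G (T q).1,
      ∀ q (P : Torsor G (T q).1),
        e (H1.mk ((T q).framesTorsor P)) = ⟨q, Quot.mk _ (H1.mk P)⟩ := by
  have hmk : ∀ {T : Cover S d} {P P' : Torsor G T.1} (g : Aut T.1),
      Nonempty (P ≅ (Torsor.res g.hom).obj P') →
      H1.mk (T.framesTorsor P) = H1.mk (T.framesTorsor P') := fun g h =>
    Quotient.sound (nonempty_frames_iso_iff.2 ⟨g, h⟩)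
  let f : (Σ q : A, H1.Orbits G (T q).1) → H1 (semidirect G d) (baseObj S) := fun ⟨q, a⟩ =>
    Quot.lift (Quotient.lift (fun P => H1.mk ((T q).framesTorsor P))
      fun P P' (h : IsIsomorphic P P') => hmk 1 (h.map fun i => i ≪≫ P'.resId)) (by
        rintro ⟨P⟩ ⟨P'⟩ ⟨g, h⟩
        exact hmk g (Quotient.exact h)) a
  have hf : Function.Bijective f := by
    constructor
    · rintro ⟨q, ⟨⟨P⟩⟩⟩ ⟨q', ⟨⟨P'⟩⟩⟩ h
      obtain ⟨g, ⟨i⟩⟩ := nonempty_frames_iso_iff.1 (Quotient.exact h)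
      obtain rfl : q = q' := by
        rw [← hT q, ← hT q']
        exact congrArg c (Quot.sound ⟨g⟩)
      refine congrArg (Sigma.mk q) (Quot.sound ⟨g, Quotient.sound ⟨i⟩⟩)
    · rintro ⟨B⟩
      obtain ⟨T', P, ⟨i⟩⟩ := exists_frames_iso B
      -- the cover `T'` is replaced by the chosen representative of its class
      obtain ⟨g⟩ := (equivalence_iso.quot_mk_eq_iff (T (c (Quot.mk _ T'))) T').1
        (c.injective (hT _))
      obtain ⟨j⟩ := nonempty_frames_iso_iff (P := (Torsor.res g.hom).obj P).2 ⟨g, ⟨Iso.refl _⟩⟩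
      exact ⟨⟨_, Quot.mk _ (H1.mk ((Torsor.res g.hom).obj P))⟩, Quotient.sound ⟨j ≪≫ i⟩⟩
  exact ⟨(Equiv.ofBijective f hf).symm, fun q P =>
    (Equiv.ofBijective f hf).symm_apply_apply ⟨q, Quot.mk _ (H1.mk P)⟩⟩

end Cover

end Covers

/-! ### The torsor of frames of a cover without torsor -/

section CoverSheaves

variable {S : Scheme.{u}} {d : ℕ}

/-- An object over `B` isomorphic to the pullback of `f` along `g` is itself a pullback. -/
lemma isPullback_of_overIso {C : Type*} [Category C] {A B X D : C} (f : A ⟶ X) (g : B ⟶ X)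
    [HasPullback f g] (p : D ⟶ B) (φ : Over.mk p ≅ Over.mk (pullback.snd f g)) :
    IsPullback (φ.hom.left ≫ pullback.fst f g) p f g := by
  have h : φ.hom.left ≫ pullback.snd f g = p := Over.w φ.hom
  refine IsPullback.of_iso_pullback ⟨?_⟩ ((Over.forget B).mapIso φ) rfl h
  rw [Category.assoc, pullback.condition, ← Category.assoc, h]

namespace Cover

/-- The cover `T`, as an object of `EtTors` for the trivial group. -/
noncomputable abbrev obj (T : Cover S d) : EtTors (one S) d :=
  T.pair (Torsor.trivial (one S) T.1)

lemma isPullback_frame (T : Cover S d) {Y : Over S} {y : Y ⟶ baseObj S} (q : Frame T.obj y) :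
    IsPullback q.1.t.base (fold d Y) (Over.mkIdTerminal.from T.1) y := by
  obtain ⟨q, rfl⟩ := q
  exact q.isPullback

/-- The isomorphism `Y ⊔ ⋯ ⊔ Y ≅ T ×_S Y` over `Y` given by a frame. -/
noncomputable def frameIso (T : Cover S d) {Y : Over S} {y : Y ⟶ baseObj S}
    (q : Frame T.obj y) :
    Over.mk (fold d Y) ≅ Over.mk (pullback.snd (Over.mkIdTerminal.from T.1) y) :=
  Over.isoMk (T.isPullback_frame q).isoPullback (T.isPullback_frame q).isoPullback_hom_snd

lemma frameIso_hom_left_fst (T : Cover S d) {Y : Over S} {y : Y ⟶ baseObj S}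
    (q : Frame T.obj y) : (T.frameIso q).hom.left ≫ pullback.fst _ _ = q.1.t.base :=
  (T.isPullback_frame q).isoPullback_hom_fst

lemma iso_ext (T : Cover S d) {Y : Over S} {y : Y ⟶ baseObj S}
    {φ ψ : Over.mk (fold d Y) ≅ Over.mk (pullback.snd (Over.mkIdTerminal.from T.1) y)}
    (h : φ.hom.left ≫ pullback.fst _ _ = ψ.hom.left ≫ pullback.fst _ _) : φ = ψ := by
  refine Iso.ext (Over.OverMorphism.ext (pullback.hom_ext h ?_))
  exact (Over.w φ.hom).trans (Over.w ψ.hom).symm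

lemma frameIso_bijective (T : Cover S d) {Y : Over S} (y : Y ⟶ baseObj S) :
    Function.Bijective (T.frameIso (y := y)) := by
  constructor
  · intro q q' h
    have h₁ : q.1.t.base = q'.1.t.base := by
      rw [← T.frameIso_hom_left_fst q, ← T.frameIso_hom_left_fst q', h]
    exact Subtype.ext (CoverTors.hom_ext (q.2.trans q'.2.symm)
      ((Tors.existsUnique_unitSheaf _ _ _).unique h₁ rfl))
  · intro φ
    obtain ⟨t, ht, -⟩ := Tors.existsUnique_unitSheaf (split (one S) d Y).tors T.obj.tors
      (φ.hom.left ≫ pullback.fst _ _)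
    have h : IsPullback t.base (fold d Y) (Over.mkIdTerminal.from T.1) y :=
      (congrArg (fun m => IsPullback m (fold d Y) (Over.mkIdTerminal.from T.1) y) ht).mpr
        (isPullback_of_overIso _ _ _ φ)
    exact ⟨⟨⟨y, t, h⟩, rfl⟩, T.iso_ext ((T.frameIso_hom_left_fst _).trans ht)⟩

/-- Frames are isomorphisms `Y ⊔ ⋯ ⊔ Y ≅ T ×_S Y` over `Y`. -/
noncomputable def frameEquiv (T : Cover S d) {Y : Over S} (y : Y ⟶ baseObj S) :
    Frame T.obj y ≃
      (Over.mk (fold d Y) ≅ Over.mk (pullback.snd (Over.mkIdTerminal.from T.1) y)) :=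
  Equiv.ofBijective _ (T.frameIso_bijective y)

/-- Restriction of frames corresponds to restriction of isomorphisms. -/
lemma frameEquiv_rs (T : Cover S d) {Y Y' : Over S} {y : Y ⟶ baseObj S} {y' : Y' ⟶ baseObj S}
    (k : Y' ⟶ Y) (h : k ≫ y = y') (q : Frame T.obj y) :
    (T.frameEquiv y' ((frames T.obj).rs k h q)).hom.left ≫ pullback.fst _ _ =
      copiesMap d k ≫ (T.frameEquiv y q).hom.left ≫ pullback.fst _ _ :=
  (T.frameIso_hom_left_fst _).trans (congrArg (copiesMap d k ≫ ·) (T.frameIso_hom_left_fst q).symm)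

/-- The group acts on isomorphisms by permutation of the copies. -/
lemma frameEquiv_ac (T : Cover S d) {Y : Over S} {y : Y ⟶ baseObj S} (q : Frame T.obj y)
    (a : (semidirect (one S) d).obj.obj (op Y)) {Z : Over S} (k : Z ⟶ Y) (τ : Equiv.Perm (Fin d))
    (hk : ConstOn (SemidirectProduct.right a) k τ) (i : Fin d) :
    k ≫ inc d Y i ≫ (T.frameEquiv y ((frames T.obj).ac q a)).hom.left =
      k ≫ inc d Y (τ i) ≫ (T.frameEquiv y q).hom.left := by
  have h₁ : k ≫ inc d Y i ≫ (splitHom a).t.base = k ≫ inc d Y (τ i) :=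
    (splitAut d (one S)).base a k τ hk i
  have h₂ : (T.frameEquiv y ((frames T.obj).ac q a)).hom.left ≫ pullback.fst _ _ =
      (splitHom a).t.base ≫ q.1.t.base := T.frameIso_hom_left_fst _
  have h₃ : (T.frameEquiv y q).hom.left ≫ pullback.fst _ _ = q.1.t.base :=
    T.frameIso_hom_left_fst _
  have h₄ : ∀ φ : Over.mk (fold d Y) ≅ Over.mk (pullback.snd (Over.mkIdTerminal.from T.1) y),
      φ.hom.left ≫ pullback.snd _ _ = fold d Y := fun φ => Over.w φ.hom
  refine pullback.hom_ext ?_ ?_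
  · refine Eq.trans ?_ ((congrArg (· ≫ q.1.t.base) h₁).trans ?_)
    · simp only [Category.assoc]
      exact congrArg (fun m => k ≫ inc d Y i ≫ m) h₂
    · simp only [Category.assoc]
      exact congrArg (fun m => k ≫ inc d Y (τ i) ≫ m) h₃.symm
  · refine Eq.trans (b := k) ?_ (Eq.symm ?_)
    · simp only [Category.assoc]
      refine (congrArg (fun m => k ≫ inc d Y i ≫ m) (h₄ _)).trans ?_
      rw [inc_fold, Category.comp_id]
    · simp only [Category.assoc]
      refine (congrArg (fun m => k ≫ inc d Y (τ i) ≫ m) (h₄ _)).trans ?_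
      rw [inc_fold, Category.comp_id]

/-- The torsors of frames of a cover are the sheaves of isomorphisms `Y ⊔ ⋯ ⊔ Y ≅ T ×_S Y`. -/
lemma isFrames_iff (T : Cover S d) (R : Torsor (permSheaf S d) (baseObj S)) :
    T.IsFrames R ↔ Nonempty (CoverSheaf T R) := by
  constructor
  · rintro ⟨h⟩
    have hb : ∀ {Y : Over S} (y : Y ⟶ baseObj S),
        Function.Bijective (Torsor.on h.inv : (ofPerm R).sec y → (frames T.obj).toTorsor.sec y) :=
      fun y => by
        refine ⟨Torsor.on_injective _, fun s => ⟨Torsor.on h.hom s, ?_⟩⟩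
        exact congrArg (fun α => Torsor.on α s) h.hom_inv_id
    -- sections of `R` are frames, compatibly with restriction and action
    let ρ : ∀ {Y : Over S} (y : Y ⟶ baseObj S), (ofPerm R).sec y ≃ Frame T.obj y := fun y =>
      (Equiv.ofBijective _ (hb y)).trans ((frames T.obj).equiv y).symm
    have hρ : ∀ {Y Y' : Over S} {y : Y ⟶ baseObj S} {y' : Y' ⟶ baseObj S} (k : Y' ⟶ Y)
        (e : k ≫ y = y') (r : (ofPerm R).sec y),
        ρ y' ((ofPerm R).rs k e r) = (frames T.obj).rs k e (ρ y r) := by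
      intro Y Y' y y' k e r
      refine Eq.trans ?_ ((frames T.obj).rs_equiv_symm k e _)
      exact congrArg ((frames T.obj).equiv y').symm (Torsor.on_rs h.inv k e r)
    have hρ' : ∀ {Y : Over S} {y : Y ⟶ baseObj S} (r : (ofPerm R).sec y)
        (a : (semidirect (one S) d).obj.obj (op Y)),
        ρ y ((ofPerm R).ac r a) = (frames T.obj).ac (ρ y r) a := by
      intro Y y r a
      refine Eq.trans ?_ ((frames T.obj).ac_equiv_symm _ a)
      exact congrArg ((frames T.obj).equiv y).symm (Torsor.on_ac h.inv r a)
    refine ⟨⟨fun Y => (ρ Y.hom).trans (T.frameEquiv Y.hom), fun {Y' Y} k r => ?_,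
      fun {Y} r σ Z k τ hk i => ?_⟩⟩
    · exact (congrArg (fun q => (T.frameEquiv Y'.hom q).hom.left ≫ pullback.fst _ _)
        (hρ k.left (Over.w k) r)).trans (T.frameEquiv_rs k.left (Over.w k) _)
    · have h₁ : ρ Y.hom (R.act r σ) =
          (frames T.obj).ac (ρ Y.hom r) (SemidirectProduct.inr σ) := hρ' r (SemidirectProduct.inr σ)
      have h₂ := T.frameEquiv_ac (ρ Y.hom r) (SemidirectProduct.inr σ) k τ hk i
      rw [← h₁] at h₂
      exact h₂
  · rintro ⟨c⟩
    -- frames are sections of `R`, which gives the morphism of torsors `α`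
    obtain ⟨ψ, hψ⟩ : ∃ ψ : ∀ {Y : Over S} {y : Y ⟶ baseObj S}, Frame T.obj y → (ofPerm R).sec y,
        ∀ {Y : Over S} {y : Y ⟶ baseObj S} (q : Frame T.obj y),
          c.equiv (Over.mk y) (ψ q) = T.frameEquiv y q :=
      ⟨fun {Y y} q => (c.equiv (Over.mk y)).symm (T.frameEquiv y q),
        fun q => Equiv.apply_symm_apply _ _⟩
    have hrs : ∀ {Y Y' : Over S} {y : Y ⟶ baseObj S} {y' : Y' ⟶ baseObj S} (k : Y' ⟶ Y)
        (e : k ≫ y = y') (q : Frame T.obj y),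
        ψ ((frames T.obj).rs k e q) = (ofPerm R).rs k e (ψ q) := by
      intro Y Y' y y' k e q
      apply (c.equiv (Over.mk y')).injective
      refine (hψ _).trans (T.iso_ext ?_)
      have h₁ := T.frameEquiv_rs k e q
      rw [← hψ q] at h₁
      exact h₁.trans (c.map (Over.homMk k e : Over.mk y' ⟶ Over.mk y) (ψ q)).symm
    have hac : ∀ {Y : Over S} {y : Y ⟶ baseObj S} (q : Frame T.obj y)
        (a : (semidirect (one S) d).obj.obj (op Y)),
        ψ ((frames T.obj).ac q a) = (ofPerm R).ac (ψ q) a := by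
      intro Y y q a
      apply (c.equiv (Over.mk y)).injective
      refine (hψ _).trans (T.iso_ext (congrArg (· ≫ pullback.fst _ _) ?_))
      refine copies_hom_ext fun i => hom_ext_of_mem
        (constSieve_mem (SemidirectProduct.right a)) fun Z k ⟨τ, hk⟩ => ?_
      have h₁ := T.frameEquiv_ac q a k τ hk i
      rw [← hψ q] at h₁
      exact h₁.trans (c.act (Y := Over.mk y) (ψ q) (SemidirectProduct.right a) k τ hk i).symm
    let α : (frames T.obj).toTorsor ⟶ ofPerm R := Torsor.homMk
      (fun {Y} y s => ψ (((frames T.obj).equiv y).symm s))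
      (fun g y z h s => (congrArg ψ ((frames T.obj).rs_equiv_symm g h s)).trans (hrs g h _))
      (fun y s a => (congrArg ψ ((frames T.obj).ac_equiv_symm s a)).trans (hac _ a))
    exact ⟨@asIso _ _ _ _ α (Torsor.isIso_hom α)⟩

end Cover

end CoverSheaves

end TorsorGerbe

theorem mainTheorem8 (S : Scheme.{u}) (G : Sheaf (Scheme.fppfTopology.over S) GrpCat.{u})
    (d : ℕ) :
    ∃ (_ : IsGerbe (etProj G d) (Scheme.fppfTopology.over S))
      (_ : IsGerbe (Tors.proj (semidirect G d)) (Scheme.fppfTopology.over S))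
      (θ : SplitAut G d) (Φ : IsomFunctor θ),
      IsFiberedEquivalence (etProj G d) (Tors.proj (semidirect G d)) Φ.functor ∧
      ∃ c : CoverClass S d ≃ H1 (permSheaf S d) (baseObj S),
        (∀ (T : Cover S d) (R : Torsor (permSheaf S d) (baseObj S)),
          c (Quot.mk _ T) = H1.mk R ↔ Nonempty (CoverSheaf T R)) ∧
        ∀ T : H1 (permSheaf S d) (baseObj S) → Cover S d, (∀ q, c (Quot.mk _ (T q)) = q) →
          ∃ e : H1 (semidirect G d) (baseObj S) ≃
              Σ q : H1 (permSheaf S d) (baseObj S), H1.Orbits G (T q).1,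
            ∀ q (P : Torsor G (T q).1),
              e (H1.mk (Φ.torsor ((T q).pair P))) = ⟨q, Quot.mk _ (H1.mk P)⟩ := by
  have hE := etProj_isGerbe G d
  obtain ⟨c, hc⟩ := Cover.exists_classEquiv (S := S) (d := d)
  exact ⟨hE, Tors.isGerbe (semidirect G d), splitAut d G, framesFunctor d G,
    framesFunctor_isFiberedEquivalence, c, fun T R => (hc T R).trans (T.isFrames_iff R),
    fun T hT => Cover.exists_orbitsEquiv c T hT⟩
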